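/- Let $\nu$ be a finite measure on a measurable space $E$, let $\gamma(u,s)\ge 0$ be a measurable function on $E\times[0,\infty)$, and let $\lambda(u,s,d,\eta)\ge 0$ be a measurable function of a mark $u\in E$, a time $s\ge 0$, a state $d\in\{0,1\}$ and a configuration $\eta$ (a counting measure on $E\times[0,\infty)$). Let $(\Omega,\mathcal F,Q)$ be a probability space with a filtration $(\mathcal F_t)_{t\ge 0}$, and let $N$ and $C$ be, under $Q$, independent Poisson random measures on $E\times[0,\infty)$, each with mean measure $\nu(du)\,ds$; write $N(A,t)=N(A\times[0,t])$ and $C(A,t)=C(A\times[0,t])$. Let $\eta_t$ and $\eta_{s-}$ be the restrictions of $C$ to $E\times[0,t]$ and $E\times[0,s)$. Let $I_1,I_2,\dots$ be i.i.d. Bernoulli($p$) variables, and let $D$ be a càdlàg $\{0,1\}$-valued process such that $(D_0,(I_k)_{k\ge1})$ is independent of $(N,C)$ and such that for every measurable real function $f$, almost surely for all $t\ge 0$, $$f(D_t,\eta_t)=f(D_0,\eta_0)+\int_{E\times[0,t]}\Big(\mathbf 1_{\{D_{s-}=0\}}\big[f(1,\eta_{s-}+\delta_{(u,s)})-f(0,\eta_{s-})\big]+\mathbf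 1_{\{D_{s-}=1\}}\big[f(1-I_{C(E,s)},\eta_{s-}+\delta_{(u,s)})-f(1,\eta_{s-})\big]\Big)\,C(du\times ds).$$ Assume that $N$, $C$ and $D$ are $(\mathcal F_t)$-adapted and that, for every $t$, the restriction of $N$ to $E\times(t,\infty)$ is independent of $\mathcal F_t$, and likewise for $C$. Let $L_N$ and $L_C$ solve, almost surely for all $t\ge0$ and with absolutely convergent integrals, $$L_N(t)=1+\int_{E\times[0,t]}[\gamma(u,s)-1]\,L_N(s-)\,[N(du\times ds)-\nu(du)\,ds],$$ $$L_C(t)=1+\int_{E\times[0,t]}[\lambda(u,s,D_{s-},\eta_{s-})-1]\,L_C(s-)\,[C(du\times ds)-\nu(du)\,ds],$$ and assume that $L_N$ and $L_C$ are $(\mathcal F_t)$-martingales under $Q$. Put $L=L_NL_C$. Then $L$ is an $(\mathcal F_t)$-martingale under $Q$, and $L(t)\ge 0$ $Q$-almost surely for every $t$. Moreover, let $P$ be any measure on $(\Omega,\mathcal F)$ with $dP|_{\mathcal F_t}=L(t)\,dQ|_{\mathcal F_t}$ for every $t\ge 0$. Then $P$ is a probability measure, and under $P$: (i) for every measurable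 $A\subseteq E$ such that, $P$-almost surely, $\int_0^t\int_A\lambda(u,s,D_s,\eta_s)\,\nu(du)\,ds<\infty$ for all $t$, the process $$C(A,t)-\int_{A\times[0,t]}\lambda(u,s,D_s,\eta_s)\,\nu(du)\,ds$$ is a local $(\mathcal F_t)$-martingale; (ii) $N$ is independent of $C$ and is a Poisson random measure with mean measure $\gamma(u,s)\,\nu(du)\,ds$. -/

import Mathlib

open MeasureTheory ProbabilityTheory Filter Topology Set
open scoped NNReal ENNReal

noncomputable section

namespace ClusterModel

variable {E Ω : Type*} [MeasurableSpace E] {mΩ : MeasurableSpace Ω}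

/-- Lebesgue measure `ds` on `[0, ∞)`. -/
def timeMeasure : Measure ℝ≥0 :=
  (volume : Measure ℝ).comap (fun t : ℝ≥0 => (t : ℝ))

/-- Right-continuous with left limits. -/
def IsCadlag {X : Type*} [TopologicalSpace X] (f : ℝ≥0 → X) : Prop :=
  ∀ t, ContinuousWithinAt f (Ici t) t ∧ ∃ l, Tendsto f (𝓝[<] t) (𝓝 l)

/-- A configuration of marked points on `E × [0, ∞)`: a counting measure, that is a sum of Dirac
masses, with finitely many points (counted with multiplicity) in `E × [0, t]` for every `t`. -/
def IsConfiguration (m : Measure (E × ℝ≥0)) : Prop :=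
  ∀ t : ℝ≥0, ∃ s : Multiset (E × ℝ≥0),
    m.restrict (univ ×ˢ Iic t) = (s.map Measure.dirac).sum

/-- The Poisson law with mean `r ∈ [0, ∞]`, as a law on `[0, ∞]`; it is `δ_∞` if `r = ∞`. -/
def poissonLaw (r : ℝ≥0∞) : Measure ℝ≥0∞ :=
  if r = ∞ then Measure.dirac ∞
  else (poissonMeasure r.toNNReal).map (fun n : ℕ => (n : ℝ≥0∞))

/-- `X` is, under `Q`, a Poisson random measure on `E × [0, ∞)` with mean measure `μ`. -/
structure IsPoissonRandomMeasure (X : Ω → Measure (E × ℝ≥0)) (μ : Measure (E × ℝ≥0))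
    (Q : Measure Ω) : Prop where
  measurable : Measurable X
  isConfiguration : ∀ ω, IsConfiguration (X ω)
  law : ∀ B, MeasurableSet B → Q.map (fun ω => X ω B) = poissonLaw (μ B)
  indep : ∀ (n : ℕ) (B : Fin n → Set (E × ℝ≥0)), (∀ i, MeasurableSet (B i)) →
    Pairwise (fun i j => Disjoint (B i) (B j)) → iIndepFun (fun i ω => X ω (B i)) Q

/-- The random measure `X` is compatible with the filtration `ℱ`: it is adapted, and for every `t`
its points after time `t` are independent of `ℱ t`. -/
structure IsCompatible (ℱ : Filtration ℝ≥0 mΩ) (X : Ω → Measure (E × ℝ≥0)) (Q : Measure Ω) :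
    Prop where
  adapted : ∀ t, Measurable[ℱ t] (fun ω => (X ω).restrict (univ ×ˢ Iic t))
  indep : ∀ t, Indep
    (MeasurableSpace.comap (fun ω => (X ω).restrict (univ ×ˢ Ioi t)) inferInstance) (ℱ t) Q

/-- The configuration `η_t` of the points of `m` up to and including time `t`. -/
def history (m : Measure (E × ℝ≥0)) (t : ℝ≥0) : Measure (E × ℝ≥0) :=
  m.restrict (univ ×ˢ Iic t)

/-- The configuration `η_{t-}` of the points of `m` strictly before time `t`. -/
def historyBefore (m : Measure (E × ℝ≥0)) (t : ℝ≥0) : Measure (E × ℝ≥0) :=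
  m.restrict (univ ×ˢ Iio t)

/-- The number of points of `m` up to and including time `t`. -/
def count (m : Measure (E × ℝ≥0)) (t : ℝ≥0) : ℕ :=
  ⌊(m (univ ×ˢ Iic t)).toReal⌋₊

/-- The stochastic equation for `f (D_t, η_t)`, along one path. `c` is the path of `C`, `coin k` is
the value of the `k`-th coin, `d` is the path of the indicator `D` (`true` means that a cluster is
active), and `1 - x` is `!x`. -/
def SolvesIndicatorEquation (c : Measure (E × ℝ≥0)) (coin : ℕ+ → Bool) (d : ℝ≥0 → Bool)
    (f : Bool × Measure (E × ℝ≥0) → ℝ) : Prop :=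
  ∀ t : ℝ≥0, f (d t, history c t) = f (d 0, history c 0) +
    ∫ x in univ ×ˢ Iic t,
      (if Function.leftLim d x.2 = false then
        f (true, historyBefore c x.2 + Measure.dirac x) - f (false, historyBefore c x.2)
      else
        f (!coin (count c x.2).toPNat', historyBefore c x.2 + Measure.dirac x)
          - f (true, historyBefore c x.2)) ∂c

/-- `L` solves
`L(t) = 1 + ∫_{E × [0,t]} [κ(u,s) - 1] L(s-) [X(du × ds) - ν(du) ds]` for all `t`, almost surely,
all the integrals being absolutely convergent. -/
def SolvesExponentialEquation (Q : Measure Ω) (ν : Measure E) (X : Ω → Measure (E × ℝ≥0))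
    (κ : Ω → E → ℝ≥0 → ℝ≥0) (L : ℝ≥0 → Ω → ℝ) : Prop :=
  ∀ᵐ ω ∂Q, ∀ t : ℝ≥0,
    IntegrableOn (fun x : E × ℝ≥0 =>
      ((κ ω x.1 x.2 : ℝ) - 1) * Function.leftLim (fun s => L s ω) x.2)
      (univ ×ˢ Iic t) (X ω) ∧
    IntegrableOn (fun x : E × ℝ≥0 =>
      ((κ ω x.1 x.2 : ℝ) - 1) * Function.leftLim (fun s => L s ω) x.2)
      (univ ×ˢ Iic t) (ν.prod timeMeasure) ∧
    L t ω = 1 +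
      ((∫ x in univ ×ˢ Iic t,
          ((κ ω x.1 x.2 : ℝ) - 1) * Function.leftLim (fun s => L s ω) x.2 ∂(X ω)) -
        ∫ x in univ ×ˢ Iic t,
          ((κ ω x.1 x.2 : ℝ) - 1) * Function.leftLim (fun s => L s ω) x.2 ∂(ν.prod timeMeasure))

/-- `dP|_{ℱ t} = L(t) dQ|_{ℱ t}` for every `t`. -/
def HasLocalDensity (ℱ : Filtration ℝ≥0 mΩ) (P Q : Measure Ω) (L : ℝ≥0 → Ω → ℝ) : Prop :=
  ∀ t, ∀ B, MeasurableSet[ℱ t] B → P B = ∫⁻ ω in B, ENNReal.ofReal (L t ω) ∂Q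

/-- A local martingale: almost surely càdlàg, and locally a martingale. -/
def IsLocalMartingale (M : ℝ≥0 → Ω → ℝ) (ℱ : Filtration ℝ≥0 mΩ) (P : Measure Ω) : Prop :=
  (∀ᵐ ω ∂P, IsCadlag (fun t => M t ω)) ∧ Locally (fun Y => Martingale Y ℱ P) ℱ M P

end ClusterModel

end

open MeasureTheory ProbabilityTheory Filter Topology Set
open scoped NNReal ENNReal

noncomputable section

namespace ClusterModel

variable {E Ω : Type*} [MeasurableSpace E] {mΩ : MeasurableSpace Ω}

/-! ### The time measure -/

/-! Almost every path of `N` and of `C` is simple (no two points at one time, none at time `0`), and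
almost surely `N` and `C` share no time. Along such a path the equation `dL = (κ - 1) L₋ (dX - ν
ds)` determines `L`: between points it is an ordinary linear equation, and at a point `L` is
multiplied by `κ`. Hence `L(t) = exp(ν(E) t - ∫ κ dν ds) ∏ κ(points)`, with value `0` once the
integral is infinite (`SolvesPath.eq_expFormula`). So `L_N` and `L_C` are nonnegative, and `L_N` is
a functional of `N`. Since `D₋` is a deterministic function of `D_0`, the coins and the number of
earlier points (`SolvesIndicatorEquation.leftLim_eq_indicatorChain`), `L_C` is a functional of `C`,
`D_0` and the coins. These inputs are independent of `N`, so `E L = E L_N · E L_C = 1`.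

Martingale property: without common jumps, the product rule writes `L` as `1` plus integrals of
predictable integrands against `N - ν ds` and `C - ν ds` (`SolvesPath.mul`). Stopped when the
variation of the drift exceeds `n`, these integrals obey the compensation formula, so their
increments have mean `0` on past events. The stopped processes are values of `L` at earlier times,
hence nonnegative; they have mean `1` and converge to `L(t)`, which also has mean `1`. Scheffé's
lemma gives convergence in `L¹`, and the martingale property survives (`IsDriven.martingale`).

Claim (ii): the density factors into a functional of `N` and a functional independent of it, so up
to each time `N` and `C` stay independent under `P`, and `N` is weighted by `L_N` alone. Multiplying
`L_N` by `exp(-∑ tᵢ N(Bᵢ))` only damps `γ` in the product over points, so the Poisson generating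
functional gives the Laplace transform of independent Poisson counts
(`lintegral_laplaceKernel_mul`), and this determines their law.

Claim (i): integrate `L(t) ∫ K dC` by parts. One term is an integral against `L` and has mean `0`.
In the other, `∫ K L dC`, one has `L = λ L₋` at the points of `C`; compensating `C` gives `E_P ∫ K
dC = E_P ∫ K λ dν ds` for predictable `0 ≤ K ≤ 1` (`lintegral_setLIntegral`). Inserting `1_{B ×
(s,t]}` gives martingale increments, and stopping when the integrated intensity reaches `n + 1`
gives the local martingale. Passing from `D_{s-}, η_{s-}` to `D_s, η_s` changes only countably many
times. -/

lemma measurableEmbedding_coe_nnreal : MeasurableEmbedding (fun t : ℝ≥0 => (t : ℝ)) :=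
  MeasurableEmbedding.subtype_coe measurableSet_Ici

lemma timeMeasure_apply (s : Set ℝ≥0) :
    timeMeasure s = volume ((fun t : ℝ≥0 => (t : ℝ)) '' s) :=
  measurableEmbedding_coe_nnreal.comap_apply _ _

lemma timeMeasure_Ioc (a b : ℝ≥0) : timeMeasure (Ioc a b) = (b - a : ℝ≥0) := by
  have h : (fun t : ℝ≥0 => (t : ℝ)) '' Ioc a b = Ioc (a : ℝ) b := by
    ext x
    simp only [mem_image, mem_Ioc]
    constructor
    · rintro ⟨y, hy, rfl⟩
      exact_mod_cast hy
    · rintro ⟨h1, h2⟩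
      exact ⟨⟨x, a.2.trans h1.le⟩, ⟨h1, h2⟩, rfl⟩
  rw [timeMeasure_apply, h, Real.volume_Ioc, ENNReal.ofReal, ← NNReal.sub_def]

instance : NullSingletonClass timeMeasure :=
  ⟨fun x => by rw [timeMeasure_apply]; simp⟩

lemma timeMeasure_Iic (t : ℝ≥0) : timeMeasure (Iic t) = t := by
  have h : (Iic t : Set ℝ≥0) = {0} ∪ Ioc 0 t := by
    ext x
    simp only [mem_Iic, mem_union, mem_singleton_iff, mem_Ioc]
    constructor
    · intro hx
      rcases eq_or_ne x 0 with h0 | h0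
      · exact Or.inl h0
      · exact Or.inr ⟨pos_iff_ne_zero.2 h0, hx⟩
    · rintro (rfl | h)
      · exact zero_le
      · exact h.2
  refine le_antisymm ?_ ?_
  · rw [h]
    refine (measure_union_le _ _).trans ?_
    rw [timeMeasure_Ioc]
    simp
  · refine le_trans ?_ (measure_mono (Ioc_subset_Iic_self (a := 0)))
    rw [timeMeasure_Ioc]
    simp

instance : SigmaFinite timeMeasure := by
  refine ⟨⟨⟨fun n => Iic (n : ℝ≥0), fun _ => trivial, fun n => ?_, ?_⟩⟩⟩
  · rw [timeMeasure_Iic]; simp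
  · refine eq_univ_of_forall fun x => ?_
    obtain ⟨n, hn⟩ := exists_nat_ge x
    exact mem_iUnion.2 ⟨n, hn⟩

section Mean

variable (ν : Measure E)

lemma prod_timeMeasure_Iic (t : ℝ≥0) :
    (ν.prod timeMeasure) (univ ×ˢ Iic t) = ν univ * t := by
  rw [Measure.prod_prod, timeMeasure_Iic]

lemma prod_timeMeasure_Iic_lt_top [IsFiniteMeasure ν] (t : ℝ≥0) :
    (ν.prod timeMeasure) (univ ×ˢ Iic t) < ∞ := by
  rw [prod_timeMeasure_Iic]
  exact ENNReal.mul_lt_top (measure_lt_top _ _) ENNReal.coe_lt_top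

lemma prod_timeMeasure_singleton (t : ℝ≥0) :
    (ν.prod timeMeasure) (univ ×ˢ {t}) = 0 := by
  rw [Measure.prod_prod]; simp

lemma prod_timeMeasure_Ioc (a b : ℝ≥0) :
    (ν.prod timeMeasure) (univ ×ˢ Ioc a b) = ν univ * (b - a : ℝ≥0) := by
  rw [Measure.prod_prod, timeMeasure_Ioc]

/-- Sets of marked points with times in a countable set are null for the mean measure. -/
lemma prod_timeMeasure_countable {J : Set ℝ≥0} (hJ : J.Countable) :
    ∀ᵐ x ∂(ν.prod timeMeasure), x.2 ∉ J := by
  have h : (ν.prod timeMeasure) (univ ×ˢ J) = 0 := by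
    rw [Measure.prod_prod, hJ.measure_zero]; simp
  rw [ae_iff]
  refine measure_mono_null ?_ h
  rintro x hx
  simpa using hx

end Mean

/-! ### Finite sums of Dirac masses -/

/-- A finite sum of Dirac masses. -/
def IsDiracSum {S : Type*} [MeasurableSpace S] (c : Measure S) : Prop :=
  ∃ s : Multiset S, c = (s.map Measure.dirac).sum

namespace IsDiracSum

variable {S : Type*} [MeasurableSpace S] {c c' : Measure S}

lemma zero : IsDiracSum (0 : Measure S) := ⟨0, by simp⟩

lemma dirac (a : S) : IsDiracSum (Measure.dirac a) := ⟨{a}, by simp⟩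

lemma add (hc : IsDiracSum c) (hc' : IsDiracSum c') : IsDiracSum (c + c') := by
  obtain ⟨s, rfl⟩ := hc
  obtain ⟨s', rfl⟩ := hc'
  exact ⟨s + s', by simp⟩

/-- Adding one Dirac mass at a time avoids enumerating atoms; the later facts on counts and products
over points reduce to the empty measure and one more point. -/
lemma induction {p : ∀ c : Measure S, IsDiracSum c → Prop} (h0 : p 0 zero)
    (h : ∀ a μ (hμ : IsDiracSum μ), p μ hμ → p (Measure.dirac a + μ) ((dirac a).add hμ))
    (hc : IsDiracSum c) : p c hc := by
  suffices H : ∀ (s : Multiset S) (h' : IsDiracSum (s.map Measure.dirac).sum), p _ h' by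
    obtain ⟨s, rfl⟩ := hc
    exact H s _
  intro s
  induction s using Multiset.induction_on with
  | empty => intro h'; simpa using h0
  | cons a s ih =>
    rw [Multiset.map_cons, Multiset.sum_cons]
    exact fun _ => h a _ ⟨s, rfl⟩ (ih _)

lemma restrict (hc : IsDiracSum c) {B : Set S} (hB : MeasurableSet B) :
    IsDiracSum (c.restrict B) := by
  classical
  induction hc using IsDiracSum.induction with
  | h0 => simpa using zero
  | h a μ _ ih =>
    rw [Measure.restrict_add, MeasureTheory.restrict_dirac' hB]
    split_ifs
    · exact (dirac a).add ih
    · exact zero.add ih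

lemma exists_natCast (hc : IsDiracSum c) {B : Set S} (hB : MeasurableSet B) :
    ∃ n : ℕ, c B = n := by
  classical
  induction hc using IsDiracSum.induction with
  | h0 => exact ⟨0, by simp⟩
  | h a μ _ ih =>
    obtain ⟨n, hn⟩ := ih
    rw [Measure.add_apply, hn, Measure.dirac_apply' _ hB]
    by_cases h : a ∈ B
    · exact ⟨1 + n, by simp [h]⟩
    · exact ⟨n, by simp [h]⟩

lemma measure_univ_lt_top (hc : IsDiracSum c) : c univ < ∞ := by
  obtain ⟨n, hn⟩ := hc.exists_natCast MeasurableSet.univ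
  rw [hn]; exact ENNReal.natCast_lt_top n

lemma integrable (hc : IsDiracSum c) {g : S → ℝ} (hg : Measurable g) : Integrable g c := by
  induction hc using IsDiracSum.induction with
  | h0 => exact integrable_zero_measure
  | h a μ _ ih =>
    exact (integrable_dirac' hg.stronglyMeasurable (by simp)).add_measure ih

lemma eq_zero_of_lt_one (hc : IsDiracSum c) (h : c univ < 1) : c = 0 := by
  obtain ⟨n, hn⟩ := hc.exists_natCast MeasurableSet.univ
  rw [hn] at h
  have : n = 0 := by
    have : n < 1 := by exact_mod_cast h
    omega
  rw [← Measure.measure_univ_eq_zero, hn, this]; simp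

lemma eq_zero_or_eq_dirac (hc : IsDiracSum c) (h : c univ ≤ 1) :
    c = 0 ∨ ∃ a, c = Measure.dirac a := by
  revert h
  induction hc using IsDiracSum.induction with
  | h0 => exact fun _ => Or.inl rfl
  | h a μ hμ _ =>
    intro h
    right
    refine ⟨a, ?_⟩
    obtain ⟨n, hn⟩ := hμ.exists_natCast MeasurableSet.univ
    rw [Measure.add_apply, hn, measure_univ] at h
    have : n = 0 := by
      have : 1 + n ≤ 1 := by exact_mod_cast h
      omega
    have : μ = 0 := by rw [← Measure.measure_univ_eq_zero, hn, this]; simp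
    rw [this, add_zero]

end IsDiracSum

namespace IsConfiguration

variable {c : Measure (E × ℝ≥0)}

lemma isDiracSum_restrict (hc : IsConfiguration c) {B : Set (E × ℝ≥0)} (hB : MeasurableSet B)
    {t : ℝ≥0} (ht : B ⊆ univ ×ˢ Iic t) : IsDiracSum (c.restrict B) := by
  have h := IsDiracSum.restrict (hc t) hB
  rwa [Measure.restrict_restrict hB, inter_eq_left.2 ht] at h

lemma lt_top (hc : IsConfiguration c) (t : ℝ≥0) : c (univ ×ˢ Iic t) < ∞ := by
  have := (hc.isDiracSum_restrict (MeasurableSet.univ.prod measurableSet_Iic)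
    (t := t) le_rfl).measure_univ_lt_top
  simpa using this

lemma exists_natCast (hc : IsConfiguration c) {B : Set (E × ℝ≥0)} (hB : MeasurableSet B)
    {t : ℝ≥0} (ht : B ⊆ univ ×ˢ Iic t) : ∃ n : ℕ, c B = n := by
  have := (hc.isDiracSum_restrict hB ht).exists_natCast MeasurableSet.univ
  simpa using this

lemma sigmaFinite (hc : IsConfiguration c) : SigmaFinite c := by
  refine ⟨⟨⟨fun n => univ ×ˢ Iic (n : ℝ≥0), fun _ => trivial, fun n => hc.lt_top _, ?_⟩⟩⟩
  refine eq_univ_of_forall fun x => ?_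
  obtain ⟨n, hn⟩ := exists_nat_ge x.2
  exact mem_iUnion.2 ⟨n, trivial, hn⟩

end IsConfiguration

/-! ### Functions of finite variation: product rule, one-sided limits, exponential -/

section FiniteVariation

variable {S S' : Type*} [MeasurableSpace S] [MeasurableSpace S'] {μ : Measure S} {ρ : Measure S'}
  {τ : S → ℝ≥0} {σ : S' → ℝ≥0} {f : S → ℝ} {g : S' → ℝ}

/-- Fubini on the product space, split along `σ y < τ x` and its complement. Strictness on one side
only makes simultaneous times count exactly once; it yields a left limit in one integral and a value
in the other. -/
lemma integral_mul_integral_eq [SFinite μ] [SFinite ρ] (hτ : Measurable τ) (hσ : Measurable σ)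
    (hf : Integrable f μ) (hg : Integrable g ρ) :
    Integrable (fun x => f x * ∫ y in {y | σ y < τ x}, g y ∂ρ) μ ∧
    Integrable (fun y => g y * ∫ x in {x | τ x ≤ σ y}, f x ∂μ) ρ ∧
    (∫ x, f x ∂μ) * ∫ y, g y ∂ρ =
      ∫ x, f x * (∫ y in {y | σ y < τ x}, g y ∂ρ) ∂μ +
        ∫ y, g y * (∫ x in {x | τ x ≤ σ y}, f x ∂μ) ∂ρ := by
  set A : Set (S × S') := {p | σ p.2 < τ p.1} with hA
  have hAm : MeasurableSet A :=
    measurableSet_lt (hσ.comp measurable_snd) (hτ.comp measurable_fst)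
  have hfg : Integrable (fun p : S × S' => f p.1 * g p.2) (μ.prod ρ) := hf.mul_prod hg
  have h1 : Integrable (A.indicator fun p : S × S' => f p.1 * g p.2) (μ.prod ρ) :=
    hfg.indicator hAm
  have h2 : Integrable (Aᶜ.indicator fun p : S × S' => f p.1 * g p.2) (μ.prod ρ) :=
    hfg.indicator hAm.compl
  have e1 : ∀ x, ∫ y, A.indicator (fun p : S × S' => f p.1 * g p.2) (x, y) ∂ρ =
      f x * ∫ y in {y | σ y < τ x}, g y ∂ρ := by
    intro x
    rw [← integral_indicator (measurableSet_lt hσ measurable_const), ← integral_const_mul]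
    refine integral_congr_ae (ae_of_all _ fun y => ?_)
    by_cases h : σ y < τ x <;> simp [indicator, hA, h]
  have e2 : ∀ y, ∫ x, Aᶜ.indicator (fun p : S × S' => f p.1 * g p.2) (x, y) ∂μ =
      g y * ∫ x in {x | τ x ≤ σ y}, f x ∂μ := by
    intro y
    rw [← integral_indicator (measurableSet_le hτ measurable_const), ← integral_const_mul]
    refine integral_congr_ae (ae_of_all _ fun x => ?_)
    by_cases h : τ x ≤ σ y <;> simp [indicator, hA, h, mul_comm]
  refine ⟨?_, ?_, ?_⟩
  · simpa only [e1] using h1.integral_prod_left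
  · simpa only [e2] using h2.integral_prod_right
  · rw [← integral_prod_mul f g, ← integral_add_compl hAm hfg, ← integral_indicator hAm,
      ← integral_indicator hAm.compl, integral_prod _ h1, integral_prod_symm _ h2]
    simp only [e1, e2]

/-- The product rule for functions of finite variation. -/
lemma product_rule [SFinite μ] [SFinite ρ] (hτ : Measurable τ) (hσ : Measurable σ) (a b : ℝ)
    {t : ℝ≥0} (hf : IntegrableOn f {x | τ x ≤ t} μ) (hg : IntegrableOn g {y | σ y ≤ t} ρ) :
    IntegrableOn (fun x => f x * (b + ∫ y in {y | σ y < τ x}, g y ∂ρ)) {x | τ x ≤ t} μ ∧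
    IntegrableOn (fun y => g y * (a + ∫ x in {x | τ x ≤ σ y}, f x ∂μ)) {y | σ y ≤ t} ρ ∧
    (a + ∫ x in {x | τ x ≤ t}, f x ∂μ) * (b + ∫ y in {y | σ y ≤ t}, g y ∂ρ) =
      a * b + (∫ x in {x | τ x ≤ t}, f x * (b + ∫ y in {y | σ y < τ x}, g y ∂ρ) ∂μ) +
        ∫ y in {y | σ y ≤ t}, g y * (a + ∫ x in {x | τ x ≤ σ y}, f x ∂μ) ∂ρ := by
  have hmτ : MeasurableSet {x | τ x ≤ t} := measurableSet_le hτ measurable_const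
  have hmσ : MeasurableSet {y | σ y ≤ t} := measurableSet_le hσ measurable_const
  obtain ⟨h1, h2, h3⟩ := integral_mul_integral_eq hτ hσ hf hg
  -- Restricting both measures to times at most `t` does not affect the inner integrals, whose times
  -- are smaller still.
  have e1 : ∀ x, τ x ≤ t → ∫ y in {y | σ y < τ x}, g y ∂(ρ.restrict {y | σ y ≤ t}) =
      ∫ y in {y | σ y < τ x}, g y ∂ρ := by
    intro x hx
    rw [Measure.restrict_restrict (measurableSet_lt hσ measurable_const), inter_eq_left.2]
    exact fun y hy => (le_of_lt hy).trans hx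
  have e2 : ∀ y, σ y ≤ t → ∫ x in {x | τ x ≤ σ y}, f x ∂(μ.restrict {x | τ x ≤ t}) =
      ∫ x in {x | τ x ≤ σ y}, f x ∂μ := by
    intro y hy
    rw [Measure.restrict_restrict (measurableSet_le hτ measurable_const), inter_eq_left.2]
    exact fun x hx => le_trans hx hy
  have c1 : (fun x => f x * ∫ y in {y | σ y < τ x}, g y ∂(ρ.restrict {y | σ y ≤ t}))
      =ᵐ[μ.restrict {x | τ x ≤ t}] fun x => f x * ∫ y in {y | σ y < τ x}, g y ∂ρ :=
    (ae_restrict_iff' hmτ).2 (ae_of_all _ fun x hx => by simp only [e1 x hx])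
  have c2 : (fun y => g y * ∫ x in {x | τ x ≤ σ y}, f x ∂(μ.restrict {x | τ x ≤ t}))
      =ᵐ[ρ.restrict {y | σ y ≤ t}] fun y => g y * ∫ x in {x | τ x ≤ σ y}, f x ∂μ :=
    (ae_restrict_iff' hmσ).2 (ae_of_all _ fun y hy => by simp only [e2 y hy])
  rw [integral_congr_ae c1, integral_congr_ae c2] at h3
  have i1 := h1.congr c1
  have i2 := h2.congr c2
  simp only [mul_add]
  refine ⟨(hf.mul_const b).add i1, (hg.mul_const a).add i2, ?_⟩
  rw [integral_add (hf.mul_const b) i1, integral_add (hg.mul_const a) i2, integral_mul_const,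
    integral_mul_const, add_mul, add_mul, h3]
  ring

/-- Dominated convergence: as `r ↑ t`, the indicators of `τ ≤ r` converge to that of `τ < t`, and
the integrand up to time `t` dominates. -/
lemma tendsto_setIntegral_left (hτ : Measurable τ) {t : ℝ≥0}
    (hf : IntegrableOn f {x | τ x ≤ t} μ) :
    Tendsto (fun r => ∫ x in {x | τ x ≤ r}, f x ∂μ) (𝓝[<] t)
      (𝓝 (∫ x in {x | τ x < t}, f x ∂μ)) := by
  have hm : ∀ r, MeasurableSet {x | τ x ≤ r} := fun r => measurableSet_le hτ measurable_const
  have hm' : MeasurableSet {x | τ x < t} := measurableSet_lt hτ measurable_const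
  have hi := (integrable_indicator_iff (hm t)).2 hf
  have hev : ∀ᶠ r in 𝓝[<] t, r < t := self_mem_nhdsWithin
  simp_rw [← integral_indicator (hm _)]
  rw [← integral_indicator hm']
  refine tendsto_integral_filter_of_dominated_convergence
    (fun x => ‖{x | τ x ≤ t}.indicator f x‖) ?_ ?_ hi.norm ?_
  · filter_upwards [hev] with r hr
    rw [aestronglyMeasurable_indicator_iff (hm r)]
    exact (hf.mono_set fun x hx => le_trans hx hr.le).aestronglyMeasurable
  · filter_upwards [hev] with r hr
    refine ae_of_all _ fun x => ?_
    by_cases h : τ x ≤ r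
    · simp [indicator, h, h.trans hr.le]
    · simp [indicator, h]
  · refine ae_of_all _ fun x => tendsto_const_nhds.congr' ?_
    by_cases h : τ x < t
    · filter_upwards [mem_nhdsWithin_of_mem_nhds (Ioi_mem_nhds h)] with r hr
      simp [indicator, h, le_of_lt (mem_Ioi.1 hr)]
    · filter_upwards [hev] with r hr
      simp [indicator, h, not_le.2 (hr.trans_le (not_lt.1 h))]

/-- Integrability up to some `t' > t` supplies the dominating function on a right neighbourhood of
`t`. -/
lemma tendsto_setIntegral_right (hτ : Measurable τ) {t t' : ℝ≥0} (htt' : t < t')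
    (hf : IntegrableOn f {x | τ x ≤ t'} μ) :
    Tendsto (fun r => ∫ x in {x | τ x ≤ r}, f x ∂μ) (𝓝[≥] t)
      (𝓝 (∫ x in {x | τ x ≤ t}, f x ∂μ)) := by
  have hm : ∀ r, MeasurableSet {x | τ x ≤ r} := fun r => measurableSet_le hτ measurable_const
  have hi := (integrable_indicator_iff (hm t')).2 hf
  have hev : ∀ᶠ r in 𝓝[≥] t, r < t' := mem_nhdsWithin_of_mem_nhds (Iio_mem_nhds htt')
  have hev' : ∀ᶠ r in 𝓝[≥] t, t ≤ r := self_mem_nhdsWithin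
  simp_rw [← integral_indicator (hm _)]
  refine tendsto_integral_filter_of_dominated_convergence
    (fun x => ‖{x | τ x ≤ t'}.indicator f x‖) ?_ ?_ hi.norm ?_
  · filter_upwards [hev] with r hr
    rw [aestronglyMeasurable_indicator_iff (hm r)]
    exact (hf.mono_set fun x hx => le_trans hx hr.le).aestronglyMeasurable
  · filter_upwards [hev] with r hr
    refine ae_of_all _ fun x => ?_
    by_cases h : τ x ≤ r
    · simp [indicator, h, h.trans hr.le]
    · simp [indicator, h]
  · refine ae_of_all _ fun x => tendsto_const_nhds.congr' ?_
    by_cases h : τ x ≤ t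
    · filter_upwards [hev'] with r hr
      simp [indicator, h, h.trans hr]
    · filter_upwards [mem_nhdsWithin_of_mem_nhds (Iio_mem_nhds (not_le.1 h))] with r hr
      simp [indicator, h, not_le.2 (mem_Iio.1 hr)]

/-- If the times have no atoms, the primitive `F` of `f` satisfies `d(F ^ n) = n F ^ (n - 1) f`. -/
lemma pow_setIntegral_eq [SFinite μ] (hτ : Measurable τ) (h0 : ∀ t, μ {x | τ x = t} = 0)
    {t : ℝ≥0} (hf : IntegrableOn f {x | τ x ≤ t} μ) (n : ℕ) :
    IntegrableOn (fun x => (n + 1 : ℝ) * (∫ y in {y | τ y ≤ τ x}, f y ∂μ) ^ n * f x)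
      {x | τ x ≤ t} μ ∧
    (∫ x in {x | τ x ≤ t}, f x ∂μ) ^ (n + 1) =
      ∫ x in {x | τ x ≤ t}, (n + 1 : ℝ) * (∫ y in {y | τ y ≤ τ x}, f y ∂μ) ^ n * f x ∂μ := by
  -- Without atoms in time, `<` and `≤` give the same integral, so left limits and values in the
  -- product rule coincide.
  have hlt : ∀ s (h : S → ℝ), ∫ y in {y | τ y < s}, h y ∂μ = ∫ y in {y | τ y ≤ s}, h y ∂μ := by
    intro s h
    refine setIntegral_congr_set ?_
    have : {y | τ y ≤ s} = {y | τ y < s} ∪ {y | τ y = s} := by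
      ext y; simp [le_iff_lt_or_eq]
    rw [this]
    exact (union_ae_eq_left_of_ae_eq_empty (ae_eq_empty.2 (h0 s))).symm
  induction n generalizing t with
  | zero => simpa using hf
  | succ n ih =>
    obtain ⟨hi, he⟩ := ih hf
    -- The product rule for `F` and `F ^ (n + 1)` produces `F ^ (n + 1) f` and `(n + 1) F ^ (n + 1)
    -- f`.
    obtain ⟨h1, h2, h3⟩ := product_rule hτ hτ 0 0 hf hi
    simp only [zero_add, mul_zero] at h1 h2 h3
    have key : ∀ x, τ x ≤ t → ∫ y in {y | τ y < τ x},
        (n + 1 : ℝ) * (∫ z in {z | τ z ≤ τ y}, f z ∂μ) ^ n * f y ∂μ =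
        (∫ z in {z | τ z ≤ τ x}, f z ∂μ) ^ (n + 1) := by
      intro x hx
      rw [hlt, ← (ih (hf.mono_set fun y hy => le_trans hy hx)).2]
    have hm : MeasurableSet {x | τ x ≤ t} := measurableSet_le hτ measurable_const
    have c1 : (fun x => f x * ∫ y in {y | τ y < τ x},
        (n + 1 : ℝ) * (∫ z in {z | τ z ≤ τ y}, f z ∂μ) ^ n * f y ∂μ)
        =ᵐ[μ.restrict {x | τ x ≤ t}] fun x => f x * (∫ z in {z | τ z ≤ τ x}, f z ∂μ) ^ (n + 1) :=
      (ae_restrict_iff' hm).2 (ae_of_all _ fun x hx => by simp only [key x hx])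
    have i1 := Integrable.congr h1 c1
    rw [integral_congr_ae c1] at h3
    have hsum : (fun x => ((n + 1 : ℕ) + 1 : ℝ) * (∫ y in {y | τ y ≤ τ x}, f y ∂μ) ^ (n + 1) * f x)
        = fun x => f x * (∫ z in {z | τ z ≤ τ x}, f z ∂μ) ^ (n + 1) +
          (n + 1 : ℝ) * (∫ y in {y | τ y ≤ τ x}, f y ∂μ) ^ n * f x *
            ∫ y in {y | τ y ≤ τ x}, f y ∂μ := by
      funext x; push_cast; ring
    rw [hsum]
    refine ⟨Integrable.add i1 h2, ?_⟩
    rw [integral_add i1 h2, ← h3, ← he]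
    ring

/-- If the times have no atoms, the primitive `F` of `f` satisfies `d(exp F) = exp(F) f`. -/
lemma exp_setIntegral_eq [SFinite μ] (hτ : Measurable τ) (h0 : ∀ t, μ {x | τ x = t} = 0)
    {t : ℝ≥0} (hf : IntegrableOn f {x | τ x ≤ t} μ) :
    IntegrableOn (fun x => Real.exp (∫ y in {y | τ y ≤ τ x}, f y ∂μ) * f x) {x | τ x ≤ t} μ ∧
    Real.exp (∫ x in {x | τ x ≤ t}, f x ∂μ) =
      1 + ∫ x in {x | τ x ≤ t}, Real.exp (∫ y in {y | τ y ≤ τ x}, f y ∂μ) * f x ∂μ := by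
  set F : ℝ≥0 → ℝ := fun s => ∫ x in {x | τ x ≤ s}, f x ∂μ with hF
  have hm : MeasurableSet {x | τ x ≤ t} := measurableSet_le hτ measurable_const
  set M := ∫ x in {x | τ x ≤ t}, ‖f x‖ ∂μ with hM
  have hM0 : 0 ≤ M := integral_nonneg fun _ => norm_nonneg _
  have hFM : ∀ s ≤ t, |F s| ≤ M := by
    intro s hs
    refine (norm_integral_le_integral_norm (μ := μ.restrict {x | τ x ≤ s}) f).trans ?_
    exact setIntegral_mono_set hf.norm (ae_of_all _ fun _ => norm_nonneg _)
      (Eventually.of_forall fun x hx => le_trans hx hs)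
  have hint : ∀ n : ℕ, IntegrableOn (fun x => (n + 1 : ℝ) * F (τ x) ^ n * f x) {x | τ x ≤ t} μ :=
    fun n => (pow_setIntegral_eq hτ h0 hf n).1
  have hint' : ∀ n : ℕ, IntegrableOn (fun x => F (τ x) ^ n / n.factorial * f x)
      {x | τ x ≤ t} μ := by
    intro n
    refine ((hint n).const_mul (((n + 1 : ℝ) * n.factorial)⁻¹)).congr (ae_of_all _ fun x => ?_)
    have : (n + 1 : ℝ) ≠ 0 := by positivity
    have : (n.factorial : ℝ) ≠ 0 := by positivity
    field_simp
  have hexp : ∀ y : ℝ, HasSum (fun n : ℕ => y ^ n / n.factorial) (Real.exp y) := by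
    intro y
    rw [Real.exp_eq_exp_ℝ]
    exact NormedSpace.expSeries_div_hasSum_exp y
  -- The exponential series is integrated term by term; since `|F| ≤ M` up to time `t`, its terms
  -- are dominated by those of `exp M` times `‖f‖`.
  have hs : HasSum (fun n : ℕ => ∫ x in {x | τ x ≤ t}, F (τ x) ^ n / n.factorial * f x ∂μ)
      (∫ x in {x | τ x ≤ t}, Real.exp (F (τ x)) * f x ∂μ) := by
    refine hasSum_integral_of_dominated_convergence
      (fun n x => M ^ n / n.factorial * ‖f x‖) (fun n => (hint' n).aestronglyMeasurable) ?_ ?_ ?_ ?_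
    · intro n
      refine (ae_restrict_iff' hm).2 (ae_of_all _ fun x hx => ?_)
      rw [norm_mul, norm_div, norm_pow, Real.norm_natCast]
      gcongr
      exact hFM _ hx
    · exact ae_of_all _ fun x => (hexp M).summable.mul_right _
    · simp_rw [tsum_mul_right]
      exact hf.norm.const_mul _
    · exact ae_of_all _ fun x => (hexp _).mul_right _
  have hG : IntegrableOn (fun x => Real.exp (F (τ x)) * f x) {x | τ x ≤ t} μ := by
    refine Integrable.mono' (hf.norm.const_mul (Real.exp M)) ?_ ?_
    · have hlim : ∀ x, Tendsto (fun N => ∑ n ∈ Finset.range N, F (τ x) ^ n / n.factorial * f x)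
          atTop (𝓝 (Real.exp (F (τ x)) * f x)) := fun x =>
        ((hexp _).mul_right _).tendsto_sum_nat
      refine aestronglyMeasurable_of_tendsto_ae atTop (fun N => ?_) (ae_of_all _ hlim)
      exact Finset.aestronglyMeasurable_fun_sum _ fun n _ => (hint' n).aestronglyMeasurable
    · refine (ae_restrict_iff' hm).2 (ae_of_all _ fun x hx => ?_)
      rw [norm_mul, Real.norm_eq_abs, abs_of_pos (Real.exp_pos _)]
      gcongr
      exact (le_abs_self _).trans (hFM _ hx)
  refine ⟨hG, ?_⟩
  have hterm : ∀ n : ℕ, ∫ x in {x | τ x ≤ t}, F (τ x) ^ n / n.factorial * f x ∂μ =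
      F t ^ (n + 1) / (n + 1).factorial := by
    intro n
    rw [hF]
    simp only
    rw [(pow_setIntegral_eq hτ h0 hf n).2, ← integral_div]
    refine integral_congr_ae (ae_of_all _ fun x => ?_)
    have : (n + 1 : ℝ) ≠ 0 := by positivity
    have : (n.factorial : ℝ) ≠ 0 := by positivity
    simp only [Nat.factorial_succ, Nat.cast_mul, Nat.cast_add, Nat.cast_one]
    field_simp
  simp_rw [hterm] at hs
  -- The integrated series is the exponential series of `F t` without its constant term.
  have h1 := (hasSum_nat_add_iff' 1).2 (hexp (F t))
  simp only [Finset.range_one, Finset.sum_singleton, pow_zero, Nat.factorial_zero, Nat.cast_one,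
    div_one] at h1
  have := hs.unique h1
  change Real.exp (F t) = 1 + ∫ x in {x | τ x ≤ t}, Real.exp (F (τ x)) * f x ∂μ
  rw [this]
  ring

/-- Solution of a linear equation without atoms. -/
lemma linear_equation_mul_exp [SFinite μ] (hτ : Measurable τ) (h0 : ∀ t, μ {x | τ x = t} = 0)
    {s r : ℝ≥0} (hsr : s ≤ r) (hsupp : ∀ᵐ x ∂μ, τ x ∈ Ioc s r) (hf : Integrable f μ)
    {y : ℝ≥0 → ℝ} (hfy : Integrable (fun x => f x * y (τ x)) μ)
    (hy : ∀ u, s ≤ u → u ≤ r → y u = y s - ∫ x in {x | τ x ≤ u}, f x * y (τ x) ∂μ) :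
    y r * Real.exp (∫ x, f x ∂μ) = y s := by
  have hlt : ∀ t (h : S → ℝ), ∫ x in {x | τ x < t}, h x ∂μ = ∫ x in {x | τ x ≤ t}, h x ∂μ := by
    intro t h
    refine setIntegral_congr_set ?_
    have : {x | τ x ≤ t} = {x | τ x < t} ∪ {x | τ x = t} := by
      ext x; simp [le_iff_lt_or_eq]
    rw [this]
    exact (union_ae_eq_left_of_ae_eq_empty (ae_eq_empty.2 (h0 t))).symm
  have hr : μ.restrict {x | τ x ≤ r} = μ :=
    Measure.restrict_eq_self_of_ae_mem (hsupp.mono fun x hx => hx.2)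
  have hexp : ∀ t, Real.exp (∫ x in {x | τ x ≤ t}, f x ∂μ) = 1 + ∫ x in {x | τ x ≤ t},
      Real.exp (∫ z in {z | τ z ≤ τ x}, f z ∂μ) * f x ∂μ := fun t =>
    (exp_setIntegral_eq hτ h0 hf.integrableOn).2
  -- Product rule for `y` and `exp F`, started at `y s` and `1`: the two integrals are opposite
  -- (`e1`, `e2`), so the product keeps its initial value.
  obtain ⟨-, -, p⟩ := product_rule hτ hτ (y s) 1 (t := r) hfy.neg.integrableOn
    (exp_setIntegral_eq hτ h0 hf.integrableOn).1
  rw [← hexp r, hr] at p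
  simp only [Pi.neg_apply, integral_neg, ← sub_eq_add_neg] at p
  have e0 : y s - ∫ x, f x * y (τ x) ∂μ = y r := by
    rw [hy r hsr le_rfl, hr]
  have e1 : ∫ x, -(f x * y (τ x)) * (1 + ∫ z in {z | τ z < τ x},
      Real.exp (∫ w in {w | τ w ≤ τ z}, f w ∂μ) * f z ∂μ) ∂μ =
      ∫ x, -(f x * y (τ x) * Real.exp (∫ w in {w | τ w ≤ τ x}, f w ∂μ)) ∂μ := by
    refine integral_congr_ae (ae_of_all _ fun x => ?_)
    simp only
    rw [hlt, ← hexp (τ x)]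
    ring
  have e2 : ∫ x, Real.exp (∫ w in {w | τ w ≤ τ x}, f w ∂μ) * f x *
      (y s - ∫ z in {z | τ z ≤ τ x}, f z * y (τ z) ∂μ) ∂μ =
      ∫ x, f x * y (τ x) * Real.exp (∫ w in {w | τ w ≤ τ x}, f w ∂μ) ∂μ := by
    refine integral_congr_ae (hsupp.mono fun x hx => ?_)
    simp only
    rw [← hy (τ x) hx.1.le hx.2]
    ring
  rw [e0, e1, e2, integral_neg] at p
  rw [p]
  ring

end FiniteVariation

/-- Real induction on `[0, ∞)`. -/
lemma nnreal_induction {p : ℝ≥0 → Prop} (h1 : ∀ t, (∀ s < t, p s) → p t)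
    (h2 : ∀ t, (∀ s ≤ t, p s) → ∀ᶠ s in 𝓝[>] t, p s) (t : ℝ≥0) : p t := by
  by_contra ht
  set B : Set ℝ≥0 := {s | ¬ p s} with hB
  have hne : B.Nonempty := ⟨t, ht⟩
  set T := sInf B with hT
  have hlt : ∀ s < T, p s := fun s hs => by
    by_contra h
    exact not_le.2 hs (csInf_le (OrderBot.bddBelow _) h)
  have hle : ∀ s ≤ T, p s := fun s hs => by
    rcases hs.lt_or_eq with h | h
    · exact hlt s h
    · rw [h]; exact h1 T hlt
  obtain ⟨u, hu, hu'⟩ := (mem_nhdsGT_iff_exists_Ioo_subset).1 (h2 T hle)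
  obtain ⟨s, hs, hsu⟩ := exists_lt_of_csInf_lt hne (show sInf B < u from hu)
  rcases le_or_gt s T with h | h
  · exact hs (hle s h)
  · exact hs (hu' ⟨h, hsu⟩)

/-- Discontinuities of a càdlàg function with values in a discrete space are countable. -/
lemma IsCadlag.countable_leftLim_ne {d : ℝ≥0 → Bool} (hd : IsCadlag d) :
    {t | Function.leftLim d t ≠ d t}.Countable := by
  set J := {t | Function.leftLim d t ≠ d t} with hJ
  -- Immediately to the left of `t` the function is constant, so discontinuities do not accumulate
  -- at `t` from the left. A set whose points are all isolated on the left is countable.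
  have h : J ⊆ {x | x ∈ J ∧ 𝓝[J ∩ Iio x] x = ⊥} := by
    intro t ht
    refine ⟨ht, ?_⟩
    obtain ⟨l, hl⟩ := (hd t).2
    have hl' : ∀ᶠ r in 𝓝[<] t, d r = l := by simpa [nhds_discrete, tendsto_pure] using hl
    rcases eq_or_ne t 0 with rfl | h0
    · rw [show Iio (0 : ℝ≥0) = ∅ by ext; simp]; simp
    have hpos : 0 < t := pos_iff_ne_zero.2 h0
    obtain ⟨u, hu, hu'⟩ := (mem_nhdsLT_iff_exists_Ioo_subset' hpos).1 hl'
    rw [← Filter.empty_mem_iff_bot, mem_nhdsWithin]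
    refine ⟨Ioi u, isOpen_Ioi, hu, ?_⟩
    rintro r ⟨hr, hrJ, hrt⟩
    refine hrJ ?_
    have hr0 : 0 < r := lt_of_le_of_lt zero_le hr
    have : (𝓝[<] r).NeBot := nhdsLT_neBot_of_exists_lt ⟨0, hr0⟩
    refine leftLim_eq_of_tendsto ?_
    rw [hu' ⟨hr, hrt⟩]
    refine tendsto_const_nhds.congr' ?_
    filter_upwards [self_mem_nhdsWithin, mem_nhdsWithin_of_mem_nhds (Ioi_mem_nhds hr)] with s hs hs'
    exact (hu' ⟨hs', lt_trans hs hrt⟩).symm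
  exact Set.Countable.mono h countable_setOfPred_isolated_left_within

/-! ### Products over the points of a configuration -/

section PointProd

variable {S : Type*} [MeasurableSpace S] {c c' : Measure S} {g : S → ℝ≥0}

/-- The product of `g` over the points of `c`. -/
def pointProd (g : S → ℝ≥0) (c : Measure S) : ℝ :=
  open Classical in if c {x | g x = 0} = 0 then Real.exp (∫ x, Real.log (g x) ∂c) else 0

lemma pointProd_nonneg (g : S → ℝ≥0) (c : Measure S) : 0 ≤ pointProd g c := by
  unfold pointProd
  split_ifs
  · exact (Real.exp_pos _).le
  · exact le_rfl

lemma pointProd_zero (g : S → ℝ≥0) : pointProd g (0 : Measure S) = 1 := by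
  simp [pointProd]

lemma pointProd_dirac (hg : Measurable g) (a : S) : pointProd g (Measure.dirac a) = g a := by
  have hm : MeasurableSet {x | g x = 0} := hg (measurableSet_singleton 0)
  have hlog : Measurable fun x => Real.log (g x) := Real.measurable_log.comp hg.coe_nnreal_real
  unfold pointProd
  rw [Measure.dirac_apply' _ hm, integral_dirac' _ _ hlog.stronglyMeasurable]
  by_cases h : g a = 0
  · simp [h]
  · have : (0 : ℝ) < g a := by exact_mod_cast pos_iff_ne_zero.2 h
    simp [h, Real.exp_log this]

/-- For finitely many points the logarithm is integrable, so the exponents add; a zero of `g` at a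
point of either part makes both sides vanish. -/
lemma pointProd_add (hg : Measurable g) (hc : IsDiracSum c) (hc' : IsDiracSum c') :
    pointProd g (c + c') = pointProd g c * pointProd g c' := by
  have hlog : Measurable fun x => Real.log (g x) := Real.measurable_log.comp hg.coe_nnreal_real
  unfold pointProd
  rw [Measure.add_apply, integral_add_measure (hc.integrable hlog) (hc'.integrable hlog)]
  by_cases h : c {x | g x = 0} = 0 <;> by_cases h' : c' {x | g x = 0} = 0 <;>
    simp [h, h', Real.exp_add]

end PointProd

/-! ### The exponential of minus an extended number -/

/-- `e^{-r}` for `r ∈ [0, ∞]`, with `e^{-∞} = 0`. -/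
def expNeg (r : ℝ≥0∞) : ℝ := open Classical in if r = ∞ then 0 else Real.exp (-r.toReal)

lemma expNeg_of_ne_top {r : ℝ≥0∞} (h : r ≠ ∞) : expNeg r = Real.exp (-r.toReal) := if_neg h

lemma expNeg_top : expNeg ∞ = 0 := if_pos rfl

lemma expNeg_nonneg (r : ℝ≥0∞) : 0 ≤ expNeg r := by
  unfold expNeg
  split_ifs
  · exact le_rfl
  · exact (Real.exp_pos _).le

lemma expNeg_add (r s : ℝ≥0∞) : expNeg (r + s) = expNeg r * expNeg s := by
  by_cases hr : r = ∞
  · simp [hr, expNeg_top]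
  by_cases hs : s = ∞
  · simp [hs, expNeg_top]
  rw [expNeg_of_ne_top hr, expNeg_of_ne_top hs, expNeg_of_ne_top (ENNReal.add_ne_top.2 ⟨hr, hs⟩),
    ENNReal.toReal_add hr hs, neg_add, Real.exp_add]

/-- Continuity at `∞` lets the explicit solution tend to `0` when the integral of the rate explodes
at a finite time. -/
lemma continuous_expNeg : Continuous expNeg := by
  rw [continuous_iff_continuousAt]
  intro r
  by_cases hr : r = ∞
  · subst hr
    rw [ContinuousAt, expNeg_top, Metric.tendsto_nhds]
    intro ε hε
    have h : ∀ᶠ x : ℝ≥0∞ in 𝓝 ∞, ENNReal.ofReal (-Real.log ε) < x :=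
      lt_mem_nhds ENNReal.ofReal_lt_top
    filter_upwards [h] with x hx
    rw [Real.dist_0_eq_abs, abs_of_nonneg (expNeg_nonneg _)]
    by_cases hx' : x = ∞
    · rw [hx', expNeg_top]; exact hε
    · rw [expNeg_of_ne_top hx', ← Real.lt_log_iff_exp_lt hε]
      have h1 := (ENNReal.toReal_lt_toReal ENNReal.ofReal_ne_top hx').2 hx
      have h2 : -Real.log ε ≤ (ENNReal.ofReal (-Real.log ε)).toReal := by
        rw [ENNReal.toReal_ofReal']; exact le_max_left _ _
      linarith
  · have h : expNeg =ᶠ[𝓝 r] fun x => Real.exp (-x.toReal) := by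
      filter_upwards [isOpen_ne.mem_nhds hr] with x hx
      exact expNeg_of_ne_top hx
    refine ContinuousAt.congr ?_ h.symm
    exact Real.continuous_exp.continuousAt.comp (ENNReal.continuousAt_toReal hr).neg

/-! ### The exponential equation along one path -/

lemma univ_prod_Iic {S : Type*} (t : ℝ≥0) : (univ ×ˢ Iic t : Set (S × ℝ≥0)) = {x | x.2 ≤ t} := by
  ext; simp

lemma univ_prod_Iio {S : Type*} (t : ℝ≥0) : (univ ×ˢ Iio t : Set (S × ℝ≥0)) = {x | x.2 < t} := by
  ext; simp

lemma measurableSet_univ_prod_Iic (t : ℝ≥0) : MeasurableSet (univ ×ˢ Iic t : Set (E × ℝ≥0)) :=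
  MeasurableSet.univ.prod measurableSet_Iic

lemma measurableSet_univ_prod_Iio (t : ℝ≥0) : MeasurableSet (univ ×ˢ Iio t : Set (E × ℝ≥0)) :=
  MeasurableSet.univ.prod measurableSet_Iio

lemma measurableSet_univ_prod_Ioc (s t : ℝ≥0) : MeasurableSet (univ ×ˢ Ioc s t : Set (E × ℝ≥0)) :=
  MeasurableSet.univ.prod measurableSet_Ioc

lemma measurableSet_univ_prod_singleton (t : ℝ≥0) :
    MeasurableSet (univ ×ˢ {t} : Set (E × ℝ≥0)) :=
  MeasurableSet.univ.prod (measurableSet_singleton t)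

lemma restrict_Iic_eq_add_Ioc (c : Measure (E × ℝ≥0)) {s t : ℝ≥0} (h : s ≤ t) :
    c.restrict (univ ×ˢ Iic t) = c.restrict (univ ×ˢ Iic s) + c.restrict (univ ×ˢ Ioc s t) := by
  rw [← Measure.restrict_union _ (measurableSet_univ_prod_Ioc s t), ← prod_union,
    Iic_union_Ioc_eq_Iic h]
  rw [Set.disjoint_prod]
  exact Or.inr (Iic_disjoint_Ioc le_rfl)

lemma restrict_Iic_eq_add_singleton (c : Measure (E × ℝ≥0)) (t : ℝ≥0) :
    c.restrict (univ ×ˢ Iic t) = c.restrict (univ ×ˢ Iio t) + c.restrict (univ ×ˢ {t}) := by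
  rw [← Measure.restrict_union _ (measurableSet_univ_prod_singleton t), ← prod_union,
    Iio_union_right]
  rw [Set.disjoint_prod]
  exact Or.inr (by simp)

/-- A configuration without simultaneous points and without points at time `0`. -/
structure IsSimple (c : Measure (E × ℝ≥0)) : Prop where
  isConfiguration : IsConfiguration c
  le_one : ∀ t, c (univ ×ˢ {t}) ≤ 1
  zero : c (univ ×ˢ {0}) = 0

/-- The exponential equation along one path. -/
def SolvesPath (ν : Measure E) (c : Measure (E × ℝ≥0)) (κ : E × ℝ≥0 → ℝ≥0) (L : ℝ≥0 → ℝ) : Prop :=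
  ∀ t : ℝ≥0,
    IntegrableOn (fun x : E × ℝ≥0 => ((κ x : ℝ) - 1) * Function.leftLim L x.2) (univ ×ˢ Iic t) c ∧
    IntegrableOn (fun x : E × ℝ≥0 => ((κ x : ℝ) - 1) * Function.leftLim L x.2) (univ ×ˢ Iic t)
      (ν.prod timeMeasure) ∧
    L t = 1 + ((∫ x in univ ×ˢ Iic t, ((κ x : ℝ) - 1) * Function.leftLim L x.2 ∂c) -
        ∫ x in univ ×ˢ Iic t, ((κ x : ℝ) - 1) * Function.leftLim L x.2 ∂(ν.prod timeMeasure))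

section Path

variable {c : Measure (E × ℝ≥0)}

/-- The mass of `[0, r]` tends to that of `[0, t)` as `r ↑ t`, so the mass of `(r, t)` drops below
`1`; being an integer, it is `0`. -/
lemma IsConfiguration.eventually_left (hc : IsConfiguration c) (t : ℝ≥0) :
    ∀ᶠ r in 𝓝[<] t, c (univ ×ˢ Ioo r t) = 0 := by
  have h1 : IntegrableOn (fun _ : E × ℝ≥0 => (1 : ℝ)) {x | x.2 ≤ t} c := by
    rw [← univ_prod_Iic]
    exact integrableOn_const (hc.lt_top t).ne
  have h2 := tendsto_setIntegral_left measurable_snd h1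
  have h3 := h2.eventually (lt_mem_nhds (sub_one_lt _))
  filter_upwards [h3, self_mem_nhdsWithin] with r hr hrt
  have hrt' : r < t := hrt
  rw [← univ_prod_Iic, ← univ_prod_Iio] at hr
  have hlt : c (univ ×ˢ Iio t) < ∞ :=
    (measure_mono (prod_mono_right Iio_subset_Iic_self)).trans_lt (hc.lt_top t)
  simp only [setIntegral_const, smul_eq_mul, mul_one] at hr
  have hsub : (univ ×ˢ Ioo r t : Set (E × ℝ≥0)) = univ ×ˢ Iio t \ univ ×ˢ Iic r := by
    ext x; simp [and_comm]
  have hmeas : MeasurableSet (univ ×ˢ Ioo r t : Set (E × ℝ≥0)) :=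
    MeasurableSet.univ.prod measurableSet_Ioo
  have h4 : c.real (univ ×ˢ Ioo r t) = c.real (univ ×ˢ Iio t) - c.real (univ ×ˢ Iic r) := by
    rw [hsub, measureReal_sdiff (prod_mono_right (Iic_subset_Iio.2 hrt'))
      (measurableSet_univ_prod_Iic r) hlt.ne]
  obtain ⟨n, hn⟩ := hc.exists_natCast hmeas (t := t)
    (prod_mono_right (Ioo_subset_Iio_self.trans Iio_subset_Iic_self))
  have h5 : (n : ℝ) < 1 := by
    have : c.real (univ ×ˢ Ioo r t) = n := by simp [Measure.real, hn]
    rw [← this, h4]; linarith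
  have : n = 0 := by
    have : n < 1 := by exact_mod_cast h5
    omega
  rw [hn, this]; simp

lemma IsConfiguration.eventually_right (hc : IsConfiguration c) (t : ℝ≥0) :
    ∀ᶠ r in 𝓝[>] t, c (univ ×ˢ Ioc t r) = 0 := by
  have h1 : IntegrableOn (fun _ : E × ℝ≥0 => (1 : ℝ)) {x | x.2 ≤ t + 1} c := by
    rw [← univ_prod_Iic]
    exact integrableOn_const (hc.lt_top (t + 1)).ne
  have h2 := tendsto_setIntegral_right measurable_snd (lt_add_one t) h1
  have h3 := (h2.mono_left (nhdsWithin_mono _ Ioi_subset_Ici_self)).eventually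
    (gt_mem_nhds (lt_add_one _))
  filter_upwards [h3, self_mem_nhdsWithin] with r hr hrt
  have hrt' : t < r := hrt
  rw [← univ_prod_Iic, ← univ_prod_Iic] at hr
  simp only [setIntegral_const, smul_eq_mul, mul_one] at hr
  have hsub : (univ ×ˢ Ioc t r : Set (E × ℝ≥0)) = univ ×ˢ Iic r \ univ ×ˢ Iic t := by
    ext x; simp [and_comm]
  have h4 : c.real (univ ×ˢ Ioc t r) = c.real (univ ×ˢ Iic r) - c.real (univ ×ˢ Iic t) := by
    rw [hsub, measureReal_sdiff (prod_mono_right (Iic_subset_Iic.2 hrt'.le))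
      (measurableSet_univ_prod_Iic t) (hc.lt_top r).ne]
  obtain ⟨n, hn⟩ := hc.exists_natCast (measurableSet_univ_prod_Ioc t r) (t := r)
    (prod_mono_right Ioc_subset_Iic_self)
  have h5 : (n : ℝ) < 1 := by
    have : c.real (univ ×ˢ Ioc t r) = n := by simp [Measure.real, hn]
    rw [← this, h4]; linarith
  have : n = 0 := by
    have : n < 1 := by exact_mod_cast h5
    omega
  rw [hn, this]; simp

lemma tendsto_measure_prod_Iic_left (μ : Measure (E × ℝ≥0)) {t : ℝ≥0} (ht : 0 < t) :
    Tendsto (fun r => μ (univ ×ˢ Iic r)) (𝓝[<] t) (𝓝 (μ (univ ×ˢ Iio t))) := by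
  have hmono : Monotone fun r : ℝ≥0 => μ (univ ×ˢ Iic r) := fun a b hab =>
    measure_mono (prod_mono_right (Iic_subset_Iic.2 hab))
  obtain ⟨u, hu, hut, hutt⟩ := exists_seq_strictMono_tendsto' ht
  have h1 := hmono.tendsto_nhdsLT t
  have h2 : Tendsto u atTop (𝓝[<] t) :=
    tendsto_nhdsWithin_iff.2 ⟨hutt, Eventually.of_forall fun n => (hut n).2⟩
  have h3 : Tendsto (fun n => μ (univ ×ˢ Iic (u n))) atTop (𝓝 (μ (univ ×ˢ Iio t))) := by
    have : (univ ×ˢ Iio t : Set (E × ℝ≥0)) = ⋃ n, univ ×ˢ Iic (u n) := by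
      ext x
      simp only [mem_prod, mem_univ, true_and, mem_iUnion, mem_Iio, mem_Iic]
      constructor
      · intro hx
        exact ((hutt.eventually (lt_mem_nhds hx)).exists).imp fun n hn => hn.le
      · rintro ⟨n, hn⟩
        exact hn.trans_lt (hut n).2
    rw [this]
    exact tendsto_measure_iUnion_atTop fun a b hab =>
      prod_mono_right (Iic_subset_Iic.2 (hu.monotone hab))
  have := tendsto_nhds_unique (h1.comp h2) h3
  rwa [← this]

end Path

/-! ### Solutions along a simple path: jumps, gaps between points, absorption at zero -/

namespace SolvesPath

variable {ν : Measure E} {c : Measure (E × ℝ≥0)} {κ : E × ℝ≥0 → ℝ≥0}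
  {L : ℝ≥0 → ℝ}

lemma leftLim_eq (hc : IsSimple c) (hL : SolvesPath ν c κ L) (t : ℝ≥0) :
    Function.leftLim L t = 1 +
      ((∫ x in univ ×ˢ Iio t, ((κ x : ℝ) - 1) * Function.leftLim L x.2 ∂c) -
        ∫ x in univ ×ˢ Iio t, ((κ x : ℝ) - 1) * Function.leftLim L x.2 ∂(ν.prod timeMeasure)) := by
  rcases eq_or_ne t 0 with rfl | h0
  -- `Function.leftLim` at `0` is the value at `0`, as nothing lies to the left. Since no point sits
  -- at time `0`, both sides are `1`.
  · have h1 : (Iio (0 : ℝ≥0)) = ∅ := by ext; simp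
    have h2 : (Iic (0 : ℝ≥0)) = {0} := by ext; simp
    rw [leftLim_eq_of_eq_bot _ (by rw [h1]; simp), (hL 0).2.2, h1, h2,
      setIntegral_measure_zero _ hc.zero, setIntegral_measure_zero _ (prod_timeMeasure_singleton ν 0)]
    simp
  · have hpos : 0 < t := pos_iff_ne_zero.2 h0
    have : (𝓝[<] t).NeBot := nhdsLT_neBot_of_exists_lt ⟨0, hpos⟩
    refine leftLim_eq_of_tendsto ?_
    have h := hL t
    rw [univ_prod_Iic] at h
    have h1 := tendsto_setIntegral_left measurable_snd h.1
    have h2 := tendsto_setIntegral_left measurable_snd h.2.1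
    have h3 := (h1.sub h2).const_add 1
    rw [univ_prod_Iio]
    refine h3.congr fun r => ?_
    rw [(hL r).2.2, univ_prod_Iic]

lemma tendsto_left (hc : IsSimple c) (hL : SolvesPath ν c κ L) (t : ℝ≥0) :
    Tendsto L (𝓝[<] t) (𝓝 (Function.leftLim L t)) := by
  have h := hL t
  rw [univ_prod_Iic] at h
  have h1 := tendsto_setIntegral_left measurable_snd h.1
  have h2 := tendsto_setIntegral_left measurable_snd h.2.1
  have h3 := (h1.sub h2).const_add 1
  rw [hL.leftLim_eq hc, univ_prod_Iio]
  refine h3.congr fun r => ?_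
  rw [(hL r).2.2, univ_prod_Iic]

lemma tendsto_right (hL : SolvesPath ν c κ L) (t : ℝ≥0) : Tendsto L (𝓝[≥] t) (𝓝 (L t)) := by
  have h := hL (t + 1)
  rw [univ_prod_Iic] at h
  have h1 := tendsto_setIntegral_right measurable_snd (lt_add_one t) h.1
  have h2 := tendsto_setIntegral_right measurable_snd (lt_add_one t) h.2.1
  have h3 := (h1.sub h2).const_add 1
  rw [(hL t).2.2, univ_prod_Iic]
  refine h3.congr fun r => ?_
  rw [(hL r).2.2, univ_prod_Iic]

lemma eq_add_Ioc (hL : SolvesPath ν c κ L) {s r : ℝ≥0} (h : s ≤ r) :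
    L r = L s + ((∫ x in univ ×ˢ Ioc s r, ((κ x : ℝ) - 1) * Function.leftLim L x.2 ∂c) -
        ∫ x in univ ×ˢ Ioc s r, ((κ x : ℝ) - 1) * Function.leftLim L x.2 ∂(ν.prod timeMeasure)) := by
  have hd : Disjoint (univ ×ˢ Iic s : Set (E × ℝ≥0)) (univ ×ˢ Ioc s r) := by
    rw [Set.disjoint_prod]
    exact Or.inr (Iic_disjoint_Ioc le_rfl)
  have hsub : (univ ×ˢ Ioc s r : Set (E × ℝ≥0)) ⊆ univ ×ˢ Iic r :=
    prod_mono_right Ioc_subset_Iic_self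
  rw [(hL r).2.2, (hL s).2.2, ← Iic_union_Ioc_eq_Iic h, prod_union,
    setIntegral_union hd (measurableSet_univ_prod_Ioc s r) (hL s).1 ((hL r).1.mono_set hsub),
    setIntegral_union hd (measurableSet_univ_prod_Ioc s r) (hL s).2.1 ((hL r).2.1.mono_set hsub)]
  ring

/-- Only a point at `t` can cause a jump, because the mean measure does not charge a single time.
There is at most one such point `a`, and `L₋ + (κ a - 1) L₋ = κ a L₋`. -/
lemma eq_leftLim_mul (hκ : Measurable κ) (hc : IsSimple c) (hL : SolvesPath ν c κ L) (t : ℝ≥0) :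
    L t = Function.leftLim L t * pointProd κ (c.restrict (univ ×ˢ {t})) := by
  have hd : Disjoint (univ ×ˢ Iio t : Set (E × ℝ≥0)) (univ ×ˢ {t}) := by
    rw [Set.disjoint_prod]
    exact Or.inr (by simp)
  have hs1 : (univ ×ˢ Iio t : Set (E × ℝ≥0)) ⊆ univ ×ˢ Iic t := prod_mono_right Iio_subset_Iic_self
  have hs2 : (univ ×ˢ {t} : Set (E × ℝ≥0)) ⊆ univ ×ˢ Iic t :=
    prod_mono_right (by simp)
  have hm := measurableSet_univ_prod_singleton (E := E) t
  have key : L t = Function.leftLim L t +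
      ∫ x in univ ×ˢ {t}, ((κ x : ℝ) - 1) * Function.leftLim L x.2 ∂c := by
    rw [hL.leftLim_eq hc t]
    conv_lhs => rw [(hL t).2.2, ← Iio_union_right, prod_union,
      setIntegral_union hd hm ((hL t).1.mono_set hs1) ((hL t).1.mono_set hs2),
      setIntegral_union hd hm ((hL t).2.1.mono_set hs1) ((hL t).2.1.mono_set hs2),
      setIntegral_measure_zero (s := univ ×ˢ {t}) _ (prod_timeMeasure_singleton ν t)]
    ring
  have h2 : ∫ x in univ ×ˢ {t}, ((κ x : ℝ) - 1) * Function.leftLim L x.2 ∂c =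
      ∫ x in univ ×ˢ {t}, ((κ x : ℝ) - 1) * Function.leftLim L t ∂c := by
    refine setIntegral_congr_fun hm fun x hx => ?_
    have : x.2 = t := by simpa using hx
    simp only [this]
  have hds : IsDiracSum (c.restrict (univ ×ˢ {t})) :=
    hc.isConfiguration.isDiracSum_restrict hm hs2
  have hle : c.restrict (univ ×ˢ {t}) univ ≤ 1 := by simpa using hc.le_one t
  rw [h2] at key
  rcases hds.eq_zero_or_eq_dirac hle with h0 | ⟨a, ha⟩
  · rw [h0] at key ⊢
    rw [pointProd_zero]
    simpa using key
  · rw [ha, integral_dirac' _ _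
      ((hκ.coe_nnreal_real.sub_const 1).mul_const _).stronglyMeasurable] at key
    rw [ha, pointProd_dirac hκ, key]
    ring

lemma leftLim_eq_self (hκ : Measurable κ) (hc : IsSimple c) (hL : SolvesPath ν c κ L) {t : ℝ≥0}
    (h : c (univ ×ˢ {t}) = 0) : Function.leftLim L t = L t := by
  rw [hL.eq_leftLim_mul hκ hc t, Measure.restrict_eq_zero.2 h, pointProd_zero, mul_one]

/-- With no points in `(s, r]`, left limits are values and `L` solves a linear equation with
integrable rate `κ - 1`, whose integral is that of `κ` minus `ν(E) (r - s)`. -/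
lemma eq_mul_exp_of_integrable [IsFiniteMeasure ν] (hκ : Measurable κ) (hc : IsSimple c)
    (hL : SolvesPath ν c κ L) {s r : ℝ≥0} (hsr : s ≤ r) (h0 : c (univ ×ˢ Ioc s r) = 0)
    (hi : ∫⁻ x in univ ×ˢ Ioc s r, κ x ∂(ν.prod timeMeasure) ≠ ∞) :
    L r = L s * (Real.exp (ν.real univ * (r - s)) *
      expNeg (∫⁻ x in univ ×ˢ Ioc s r, κ x ∂(ν.prod timeMeasure))) := by
  set m := (ν.prod timeMeasure).restrict (univ ×ˢ Ioc s r) with hm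
  have hmfin : IsFiniteMeasure m := ⟨by
    rw [hm, Measure.restrict_apply_univ, prod_timeMeasure_Ioc]
    exact ENNReal.mul_lt_top (measure_lt_top _ _) ENNReal.coe_lt_top⟩
  have hJ := measurableSet_univ_prod_Ioc (E := E) s r
  have hκi : Integrable (fun x => (κ x : ℝ)) m :=
    ⟨hκ.coe_nnreal_real.aestronglyMeasurable, by
      simpa [HasFiniteIntegral, enorm_eq_nnnorm] using lt_top_iff_ne_top.2 hi⟩
  have hgi : Integrable (fun x => (κ x : ℝ) - 1) m := hκi.sub (integrable_const 1)
  have hll : ∀ u ∈ Ioc s r, Function.leftLim L u = L u := fun u hu =>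
    hL.leftLim_eq_self hκ hc (measure_mono_null (prod_mono_right (singleton_subset_iff.2 hu)) h0)
  have hfi : Integrable (fun x : E × ℝ≥0 => ((κ x : ℝ) - 1) * L x.2) m := by
    refine Integrable.congr ((hL r).2.1.mono_set (prod_mono_right Ioc_subset_Iic_self))
      ((ae_restrict_iff' hJ).2 (ae_of_all _ fun x hx => ?_))
    simp only [hll x.2 hx.2]
  have hLu : ∀ u, s ≤ u → u ≤ r →
      L u = L s - ∫ x in {x | x.2 ≤ u}, ((κ x : ℝ) - 1) * L x.2 ∂m := by
    intro u hsu hur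
    have hset : {x : E × ℝ≥0 | x.2 ≤ u} ∩ univ ×ˢ Ioc s r = univ ×ˢ Ioc s u := by
      ext x
      simp only [mem_inter_iff, Set.mem_ofPred_eq, mem_prod, mem_univ, true_and, mem_Ioc]
      exact ⟨fun h => ⟨h.2.1, h.1⟩, fun h => ⟨h.2, h.1, h.2.trans hur⟩⟩
    rw [hm, Measure.restrict_restrict (measurableSet_le measurable_snd measurable_const), hset,
      hL.eq_add_Ioc hsu, setIntegral_measure_zero _
        (measure_mono_null (prod_mono_right (Ioc_subset_Ioc_right hur)) h0), zero_sub,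
      ← sub_eq_add_neg]
    congr 1
    refine setIntegral_congr_fun (measurableSet_univ_prod_Ioc s u) fun x hx => ?_
    simp only [hll x.2 ⟨hx.2.1, hx.2.2.trans hur⟩]
  have hnull : ∀ t, m {x | x.2 = t} = 0 := by
    intro t
    refine Measure.absolutelyContinuous_of_le Measure.restrict_le_self ?_
    have : {x : E × ℝ≥0 | x.2 = t} = univ ×ˢ {t} := by ext; simp
    rw [this, prod_timeMeasure_singleton]
  have hsupp : ∀ᵐ x ∂m, x.2 ∈ Ioc s r :=
    (ae_restrict_iff' hJ).2 (ae_of_all _ fun x hx => hx.2)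
  have key := linear_equation_mul_exp measurable_snd hnull hsr hsupp hgi hfi hLu
  have hAr : ∫ x, ((κ x : ℝ) - 1) ∂m = (∫⁻ x, κ x ∂m).toReal - ν.real univ * (r - s) := by
    rw [integral_sub hκi (integrable_const 1), integral_eq_lintegral_of_nonneg_ae
      (ae_of_all _ fun x => NNReal.coe_nonneg _) hκi.aestronglyMeasurable]
    simp [hm, Measure.real, timeMeasure_Ioc, NNReal.coe_sub hsr, -ENNReal.coe_sub]
  rw [hAr] at key
  rw [expNeg_of_ne_top hi, ← Real.exp_add, ← key, mul_assoc, ← Real.exp_add, show ∀ a b : ℝ, a - b + (b + -a) = 0 by intros; ring,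
    Real.exp_zero, mul_one]

/-- On an interval without points where the solution stays away from `0`, the rate is integrable. -/
lemma lintegral_ne_top_of_le [IsFiniteMeasure ν] (hκ : Measurable κ) (hc : IsSimple c)
    (hL : SolvesPath ν c κ L) {s r : ℝ≥0} (h0 : c (univ ×ˢ Ioc s r) = 0) {δ : ℝ} (hδ : 0 < δ)
    (hLδ : ∀ u ∈ Ioc s r, δ ≤ |L u|) :
    ∫⁻ x in univ ×ˢ Ioc s r, κ x ∂(ν.prod timeMeasure) ≠ ∞ := by
  have hJ := measurableSet_univ_prod_Ioc (E := E) s r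
  have hll : ∀ u ∈ Ioc s r, Function.leftLim L u = L u := fun u hu =>
    hL.leftLim_eq_self hκ hc (measure_mono_null (prod_mono_right (singleton_subset_iff.2 hu)) h0)
  -- `|κ - 1| ≤ δ⁻¹ |κ - 1| |L₋|`, and the right side is integrable because `L` is a solution.
  have h1 : IntegrableOn (fun x => (κ x : ℝ) - 1) (univ ×ˢ Ioc s r) (ν.prod timeMeasure) := by
    refine Integrable.mono' ((((hL r).2.1.mono_set
      (prod_mono_right Ioc_subset_Iic_self)).norm).const_mul δ⁻¹)
      (hκ.coe_nnreal_real.sub_const 1).aestronglyMeasurable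
      ((ae_restrict_iff' hJ).2 (ae_of_all _ fun x hx => ?_))
    rw [norm_mul, hll x.2 hx.2, Real.norm_eq_abs, Real.norm_eq_abs]
    have := hLδ x.2 hx.2
    calc |(κ x : ℝ) - 1| = δ⁻¹ * (|(κ x : ℝ) - 1| * δ) := by field_simp
      _ ≤ _ := by gcongr
  have h2 : IntegrableOn (fun _ => (1 : ℝ)) (univ ×ˢ Ioc s r) (ν.prod timeMeasure) :=
    integrableOn_const ((measure_mono (prod_mono_right Ioc_subset_Iic_self)).trans_lt
      (prod_timeMeasure_Iic_lt_top ν r)).ne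
  have h3 := (h1.add h2).hasFiniteIntegral
  simp only [HasFiniteIntegral, enorm_eq_nnnorm] at h3
  simpa using h3.ne

/-- On an interval without points, the solution cannot leave `0`. -/
lemma eq_zero_of_eq_zero [IsFiniteMeasure ν] (hκ : Measurable κ) (hc : IsSimple c)
    (hL : SolvesPath ν c κ L) {s r : ℝ≥0} (hsr : s ≤ r) (h0 : c (univ ×ˢ Ioc s r) = 0)
    (hs : L s = 0) : L r = 0 := by
  by_contra hr
  have hll : ∀ u ∈ Ioc s r, Function.leftLim L u = L u := fun u hu =>
    hL.leftLim_eq_self hκ hc (measure_mono_null (prod_mono_right (singleton_subset_iff.2 hu)) h0)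
  have hcont : ContinuousOn L (Icc s r) := by
    intro u hu
    rcases hu.1.eq_or_lt with rfl | h
    · exact (show ContinuousWithinAt L (Ici s) s from hL.tendsto_right s).mono Icc_subset_Ici_self
    · have h1 : ContinuousWithinAt L (Ici u) u := hL.tendsto_right u
      have h2 : ContinuousWithinAt L (Iio u) u := by
        have := hL.tendsto_left hc u
        rwa [hll u ⟨h, hu.2⟩] at this
      have h3 := h2.union h1
      rw [Iio_union_Ici] at h3
      exact h3.mono (subset_univ _)
  -- Let `z` be the last zero before `r`. As `κ` need not be integrable near `z`, the exponential
  -- formula is used on `[u, r]` with `u > z`, where `|L|` has a positive minimum. The resulting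
  -- bound on `|L r|` has a factor independent of `u`, and `u ↓ z` forces `L r = 0`.
  set Z := Icc s r ∩ L ⁻¹' {0} with hZ
  have hZc : IsCompact Z := by
    refine isCompact_Icc.of_isClosed_subset ?_ inter_subset_left
    exact hcont.preimage_isClosed_of_isClosed isClosed_Icc isClosed_singleton
  obtain ⟨z, hz, hzmax⟩ := hZc.exists_isGreatest ⟨s, ⟨le_rfl, hsr⟩, hs⟩
  have hzr : z < r := lt_of_le_of_ne hz.1.2 fun h => hr (h ▸ hz.2)
  have hbound : ∀ u ∈ Ioc z r, |L r| ≤ |L u| * Real.exp (ν.real univ * r) := by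
    intro u hu
    have hsub : Icc u r ⊆ Icc s r := Icc_subset_Icc_left (hz.1.1.trans hu.1.le)
    obtain ⟨v, hv, hvmin⟩ := isCompact_Icc.exists_isMinOn (nonempty_Icc.2 hu.2)
      (hcont.mono hsub).abs
    have hδ : 0 < |L v| := abs_pos.2 fun h =>
      not_le.2 (hu.1.trans_le hv.1) (hzmax ⟨hsub hv, h⟩)
    have h0' : c (univ ×ˢ Ioc u r) = 0 :=
      measure_mono_null (prod_mono_right (Ioc_subset_Ioc_left (hz.1.1.trans hu.1.le))) h0
    have hfin := hL.lintegral_ne_top_of_le hκ hc h0' hδ fun w hw => hvmin (Ioc_subset_Icc_self hw)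
    rw [hL.eq_mul_exp_of_integrable hκ hc hu.2 h0' hfin, abs_mul, abs_of_nonneg
      (mul_nonneg (Real.exp_pos _).le (expNeg_nonneg _))]
    gcongr
    rw [expNeg_of_ne_top hfin]
    calc _ ≤ Real.exp (ν.real univ * r) * 1 := by
          gcongr
          · exact sub_le_self _ (NNReal.coe_nonneg u)
          · exact Real.exp_le_one_iff.2 (neg_nonpos.2 ENNReal.toReal_nonneg)
      _ = _ := mul_one _
  have hlim : Tendsto (fun u => |L u| * Real.exp (ν.real univ * r)) (𝓝[>] z) (𝓝 0) := by
    have h1 := ((hL.tendsto_right z).mono_left (nhdsWithin_mono _ Ioi_subset_Ici_self)).abs.mul_const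
      (Real.exp (ν.real univ * r))
    have h2 : L z = 0 := hz.2
    rwa [h2, abs_zero, zero_mul] at h1
  have := ge_of_tendsto hlim (by filter_upwards [Ioc_mem_nhdsGT hzr] with u hu using hbound u hu)
  exact hr (abs_eq_zero.1 (le_antisymm this (abs_nonneg _)))

end SolvesPath

/-- The explicit solution of the exponential equation. -/
def expFormula (ν : Measure E) (c : Measure (E × ℝ≥0)) (κ : E × ℝ≥0 → ℝ≥0) (t : ℝ≥0) : ℝ :=
  Real.exp (ν.real univ * t) * expNeg (∫⁻ x in univ ×ˢ Iic t, κ x ∂(ν.prod timeMeasure)) *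
    pointProd κ (c.restrict (univ ×ˢ Iic t))

lemma expFormula_nonneg (ν : Measure E) (c : Measure (E × ℝ≥0)) (κ : E × ℝ≥0 → ℝ≥0) (t : ℝ≥0) :
    0 ≤ expFormula ν c κ t :=
  mul_nonneg (mul_nonneg (Real.exp_pos _).le (expNeg_nonneg _)) (pointProd_nonneg _ _)

section

variable {ν : Measure E} {c : Measure (E × ℝ≥0)} {κ : E × ℝ≥0 → ℝ≥0} {L : ℝ≥0 → ℝ}

lemma expFormula_eq_mul {s r : ℝ≥0} (hsr : s ≤ r) (h0 : c (univ ×ˢ Ioc s r) = 0) :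
    expFormula ν c κ r = expFormula ν c κ s * (Real.exp (ν.real univ * (r - s)) *
      expNeg (∫⁻ x in univ ×ˢ Ioc s r, κ x ∂(ν.prod timeMeasure))) := by
  unfold expFormula
  rw [restrict_Iic_eq_add_Ioc (ν.prod timeMeasure) hsr, lintegral_add_measure, expNeg_add,
    restrict_Iic_eq_add_Ioc c hsr, Measure.restrict_eq_zero.2 h0, add_zero,
    show ν.real univ * (r : ℝ) = ν.real univ * s + ν.real univ * (r - s) by ring, Real.exp_add]
  ring

/-- A solution of the exponential equation along a simple path is the explicit one. -/
theorem SolvesPath.eq_expFormula [IsFiniteMeasure ν] (hκ : Measurable κ) (hc : IsSimple c)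
    (hL : SolvesPath ν c κ L) (t : ℝ≥0) : L t = expFormula ν c κ t := by
  induction t using nnreal_induction with
  -- Reaching `T` from the left: the formula on `[0, T)` passes to the limit, by continuity of
  -- `expNeg` and because some interval `(r, T)` is free of points; a point at `T` multiplies both
  -- sides by the same factor.
  | h1 T ih =>
    rcases eq_or_ne T 0 with rfl | hT
    · have h2 : (Iic (0 : ℝ≥0)) = {0} := by ext; simp
      rw [expFormula, (hL 0).2.2, h2, setIntegral_measure_zero _ hc.zero,
        setIntegral_measure_zero _ (prod_timeMeasure_singleton ν 0),
        setLIntegral_measure_zero _ _ (prod_timeMeasure_singleton ν 0),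
        Measure.restrict_eq_zero.2 hc.zero, pointProd_zero, expNeg_of_ne_top ENNReal.zero_ne_top]
      simp
    have hpos : 0 < T := pos_iff_ne_zero.2 hT
    have : (𝓝[<] T).NeBot := nhdsLT_neBot_of_exists_lt ⟨0, hpos⟩
    have hmI : ∀ B : Set (E × ℝ≥0), MeasurableSet B →
        ((ν.prod timeMeasure).withDensity fun x => (κ x : ℝ≥0∞)) B =
          ∫⁻ x in B, κ x ∂(ν.prod timeMeasure) := fun B hB => withDensity_apply _ hB
    have hΦ := tendsto_measure_prod_Iic_left
      ((ν.prod timeMeasure).withDensity fun x => (κ x : ℝ≥0∞)) hpos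
    simp only [hmI _ (measurableSet_univ_prod_Iic _), hmI _ (measurableSet_univ_prod_Iio _)] at hΦ
    have hexp : Tendsto (fun r : ℝ≥0 => Real.exp (ν.real univ * r)) (𝓝[<] T)
        (𝓝 (Real.exp (ν.real univ * T))) := by
      have : Continuous fun r : ℝ≥0 => Real.exp (ν.real univ * r) := by fun_prop
      exact (this.tendsto T).mono_left nhdsWithin_le_nhds
    have hlim : Tendsto L (𝓝[<] T) (𝓝 (Real.exp (ν.real univ * T) *
        expNeg (∫⁻ x in univ ×ˢ Iio T, κ x ∂(ν.prod timeMeasure)) *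
        pointProd κ (c.restrict (univ ×ˢ Iio T)))) := by
      refine ((hexp.mul ((continuous_expNeg.tendsto _).comp hΦ)).mul_const _).congr' ?_
      filter_upwards [self_mem_nhdsWithin, hc.isConfiguration.eventually_left T] with r hr hr0
      have hrT : r < T := hr
      rw [ih r hrT, expFormula]
      simp only [Function.comp_apply]
      congr 2
      have h1 : (univ ×ˢ Iio T : Set (E × ℝ≥0)) = univ ×ˢ Iic r ∪ univ ×ˢ Ioo r T := by
        rw [← prod_union, Iic_union_Ioo_eq_Iio hrT]
      rw [h1]
      exact Measure.restrict_congr_set (union_ae_eq_left_of_ae_eq_empty (ae_eq_empty.2 hr0))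
    have hℓ := tendsto_nhds_unique (hL.tendsto_left hc T) hlim
    have hmem : (univ ×ˢ Iic T : Set (E × ℝ≥0)) =ᵐ[ν.prod timeMeasure] univ ×ˢ Iio T := by
      rw [← Iio_union_right, prod_union]
      exact union_ae_eq_left_of_ae_eq_empty (ae_eq_empty.2 (prod_timeMeasure_singleton ν T))
    rw [hL.eq_leftLim_mul hκ hc T, hℓ, expFormula, setLIntegral_congr hmem,
      restrict_Iic_eq_add_singleton c T, pointProd_add hκ
      (hc.isConfiguration.isDiracSum_restrict (measurableSet_univ_prod_Iio T)
        (prod_mono_right Iio_subset_Iic_self))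
      (hc.isConfiguration.isDiracSum_restrict (measurableSet_univ_prod_singleton T)
        (t := T) (prod_mono_right (by simp)))]
    ring
  -- Leaving `T` to the right: no point follows at once. Either `L T = 0` and both sides stay `0`,
  -- or `|L|` exceeds `|L T| / 2` for a while, which makes the rate integrable there.
  | h2 T ih =>
    have hT := ih T le_rfl
    have hev := hc.isConfiguration.eventually_right T
    by_cases hz : L T = 0
    · filter_upwards [hev, self_mem_nhdsWithin] with r hr hrT
      have hrT' : T < r := hrT
      rw [hL.eq_zero_of_eq_zero hκ hc hrT'.le hr hz, expFormula_eq_mul hrT'.le hr, ← hT, hz,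
        zero_mul]
    · have hlim : Tendsto (fun r => |L r|) (𝓝[>] T) (𝓝 |L T|) :=
        ((hL.tendsto_right T).mono_left (nhdsWithin_mono _ Ioi_subset_Ici_self)).abs
      have hhalf := hlim.eventually (lt_mem_nhds (half_lt_self (abs_pos.2 hz)))
      obtain ⟨u, hu, hu'⟩ := (mem_nhdsGT_iff_exists_Ioo_subset).1 hhalf
      filter_upwards [hev, self_mem_nhdsWithin, Ioo_mem_nhdsGT (show T < u from hu)] with r hr hrT hru
      have hrT' : T < r := hrT
      have hfin := hL.lintegral_ne_top_of_le hκ hc hr (half_pos (abs_pos.2 hz)) fun w hw =>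
        le_of_lt (hu' ⟨hw.1, hw.2.trans_lt hru.2⟩)
      rw [hL.eq_mul_exp_of_integrable hκ hc hrT'.le hr hfin, expFormula_eq_mul hrT'.le hr, hT]

end

/-! ### Random measures as kernels -/

section Kernel

variable {Ω' S : Type*} [MeasurableSpace Ω'] [MeasurableSpace S]

/-- A random configuration as a kernel. -/
def toKernel (X : Ω' → Measure S) (hX : Measurable X) : Kernel Ω' S := ⟨X, hX⟩

/-- Masses of bounded time sets are finite but not uniformly in `ω`. Cutting time into unit slices,
and `Ω` by the integer part of the mass of each slice, leaves countably many finite kernels.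
S-finiteness is what makes integrals against random measures measurable. -/
lemma isSFiniteKernel_toKernel {X : Ω' → Measure (E × ℝ≥0)} (hX : Measurable X)
    (hfin : ∀ ω t, X ω (univ ×ˢ Iic t) < ∞) : IsSFiniteKernel (toKernel X hX) := by
  classical
  set B : ℕ → Set (E × ℝ≥0) := fun n => {x | ⌊x.2⌋₊ = n} with hB
  have hBm : ∀ n, MeasurableSet (B n) := fun n =>
    (Nat.measurable_floor.comp measurable_snd) (measurableSet_singleton n)
  have hBfin : ∀ ω n, X ω (B n) < ∞ := fun ω n =>
    (measure_mono (show B n ⊆ univ ×ˢ Iic ((n : ℝ≥0) + 1) from fun x hx => by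
      have hx' : ⌊x.2⌋₊ = n := hx
      refine mem_prod.2 ⟨trivial, ?_⟩
      rw [mem_Iic, ← hx']
      exact (Nat.lt_floor_add_one x.2).le)).trans_lt (hfin ω ((n : ℝ≥0) + 1))
  have hXB : ∀ n, Measurable fun ω => X ω (B n) := fun n =>
    (Measure.measurable_coe (hBm n)).comp hX
  set A : ℕ → ℕ → Set Ω' := fun n k => {ω | ⌊(X ω (B n)).toReal⌋₊ = k} with hA
  have hAm : ∀ n k, MeasurableSet (A n k) := fun n k =>
    (Nat.measurable_floor.comp (hXB n).ennreal_toReal) (measurableSet_singleton k)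
  set κ : ℕ × ℕ → Kernel Ω' (E × ℝ≥0) := fun p =>
    Kernel.piecewise (hAm p.1 p.2) ((toKernel X hX).restrict (hBm p.1)) 0 with hκ
  have hκfin : ∀ p, IsFiniteKernel (κ p) := by
    intro p
    refine ⟨⟨ENNReal.ofReal (p.2 + 1), ENNReal.ofReal_lt_top, fun ω => ?_⟩⟩
    rw [hκ]
    simp only [Kernel.piecewise_apply]
    split_ifs with h
    · rw [Kernel.restrict_apply, Measure.restrict_apply_univ]
      change X ω (B p.1) ≤ _
      refine (ENNReal.le_ofReal_iff_toReal_le (hBfin ω p.1).ne (by positivity)).2 ?_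
      have h' : ⌊(X ω (B p.1)).toReal⌋₊ = p.2 := h
      rw [← h']
      exact (Nat.lt_floor_add_one _).le
    · simp
  have hsum : toKernel X hX = Kernel.sum κ := by
    ext ω s hs
    rw [Kernel.sum_apply' _ _ hs, ENNReal.tsum_prod (f := fun n k => κ (n, k) ω s)]
    have h1 : ∀ n, ∑' k, κ (n, k) ω s = X ω (s ∩ B n) := by
      intro n
      rw [tsum_eq_single ⌊(X ω (B n)).toReal⌋₊]
      · rw [hκ]
        simp only
        rw [Kernel.piecewise_apply, if_pos (by simp [hA]), Kernel.restrict_apply,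
          Measure.restrict_apply hs]
        rfl
      · intro k hk
        rw [hκ]
        simp only
        rw [Kernel.piecewise_apply, if_neg (by simpa [hA] using hk.symm)]
        simp
    simp_rw [h1]
    rw [← measure_iUnion _ fun n => hs.inter (hBm n), ← inter_iUnion]
    · congr 1
      rw [inter_eq_left.2]
      intro x _
      exact mem_iUnion.2 ⟨_, rfl⟩
    · intro i j hij
      refine Disjoint.mono inter_subset_right inter_subset_right ?_
      rw [Set.disjoint_left]
      intro x hx hx'
      exact hij ((show ⌊x.2⌋₊ = i from hx).symm.trans hx')
  rw [hsum]
  infer_instance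

lemma measurable_lintegral_toKernel {X : Ω' → Measure (E × ℝ≥0)} (hX : Measurable X)
    (hfin : ∀ ω t, X ω (univ ×ˢ Iic t) < ∞) {f : Ω' × (E × ℝ≥0) → ℝ≥0∞} (hf : Measurable f) :
    Measurable fun ω => ∫⁻ x, f (ω, x) ∂(X ω) := by
  have := isSFiniteKernel_toKernel hX hfin
  exact Measurable.lintegral_kernel_prod_right' (κ := toKernel X hX) hf

lemma stronglyMeasurable_integral_toKernel {X : Ω' → Measure (E × ℝ≥0)} (hX : Measurable X)
    (hfin : ∀ ω t, X ω (univ ×ˢ Iic t) < ∞) {f : Ω' × (E × ℝ≥0) → ℝ} (hf : Measurable f) :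
    StronglyMeasurable fun ω => ∫ x, f (ω, x) ∂(X ω) := by
  have := isSFiniteKernel_toKernel hX hfin
  exact StronglyMeasurable.integral_kernel_prod_right' (κ := toKernel X hX) hf.stronglyMeasurable

end Kernel

/-! ### The mean of a Poisson random measure -/

/-- A shift of the index turns `n e^{-r} rⁿ / n!` into `r` times a Poisson weight. -/
lemma lintegral_natCast_poissonMeasure (r : ℝ≥0) :
    ∫⁻ n, (n : ℝ≥0∞) ∂(poissonMeasure r) = r := by
  have h1 := (hasSum_one_poissonMeasure r).mul_left (r : ℝ)
  have h2 : HasSum (fun n : ℕ => (n : ℝ) * (Real.exp (-r) * r ^ n / n.factorial)) r := by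
    rw [← hasSum_nat_add_iff' 1]
    simp only [Finset.range_one, Finset.sum_singleton, Nat.cast_zero, zero_mul, sub_zero]
    convert! h1 using 2 with n
    · have : (n.factorial : ℝ) ≠ 0 := by positivity
      have : (n + 1 : ℝ) ≠ 0 := by positivity
      simp only [Nat.factorial_succ, Nat.cast_mul, Nat.cast_add, Nat.cast_one, pow_succ]
      field_simp
    · simp
  rw [lintegral_countable']
  have h3 : ∀ n : ℕ, (n : ℝ≥0∞) * poissonMeasure r {n} =
      ENNReal.ofReal ((n : ℝ) * (Real.exp (-r) * r ^ n / n.factorial)) := by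
    intro n
    rw [poissonMeasure_singleton, ENNReal.ofReal_mul (by positivity)]
    simp
  simp_rw [h3]
  rw [← ENNReal.ofReal_tsum_of_nonneg (fun n => by positivity) h2.summable, h2.tsum_eq]
  simp

lemma lintegral_poissonLaw (r : ℝ≥0∞) : ∫⁻ x, x ∂(poissonLaw r) = r := by
  unfold poissonLaw
  split_ifs with h
  · rw [lintegral_dirac, h]
  · rw [lintegral_map measurable_id' (by fun_prop), lintegral_natCast_poissonMeasure,
      ENNReal.coe_toNNReal h]

namespace IsPoissonRandomMeasure

variable {X : Ω → Measure (E × ℝ≥0)} {μ : Measure (E × ℝ≥0)} {Q : Measure Ω}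

lemma measurable_apply (hX : IsPoissonRandomMeasure X μ Q) {B : Set (E × ℝ≥0)}
    (hB : MeasurableSet B) : Measurable fun ω => X ω B :=
  (Measure.measurable_coe hB).comp hX.measurable

lemma lintegral_apply (hX : IsPoissonRandomMeasure X μ Q) {B : Set (E × ℝ≥0)}
    (hB : MeasurableSet B) : ∫⁻ ω, X ω B ∂Q = μ B := by
  rw [← lintegral_poissonLaw (μ B), ← hX.law B hB, lintegral_map measurable_id'
    (hX.measurable_apply hB)]

lemma lt_top (hX : IsPoissonRandomMeasure X μ Q) (ω : Ω) (t : ℝ≥0) : X ω (univ ×ˢ Iic t) < ∞ :=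
  (hX.isConfiguration ω).lt_top t

lemma ae_eq_zero (hX : IsPoissonRandomMeasure X μ Q) {B : Set (E × ℝ≥0)}
    (hB : MeasurableSet B) (h : μ B = 0) : ∀ᵐ ω ∂Q, X ω B = 0 := by
  rw [← hX.lintegral_apply hB, lintegral_eq_zero_iff (hX.measurable_apply hB)] at h
  exact h

end IsPoissonRandomMeasure

/-! ### Predictable processes with marks -/

/-- The sets generating the predictable σ-algebra. -/
def predictableSets (E : Type*) [MeasurableSpace E] (ℱ : Filtration ℝ≥0 mΩ) :
    Set (Set (Ω × (E × ℝ≥0))) :=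
  {S | ∃ (A : Set E) (B : Set Ω), MeasurableSet A ∧ MeasurableSet[ℱ 0] B ∧
    S = B ×ˢ (A ×ˢ {0})} ∪
  {S | ∃ (a b : ℝ≥0) (A : Set E) (B : Set Ω), MeasurableSet A ∧ MeasurableSet[ℱ a] B ∧
    S = B ×ˢ (A ×ˢ Ioc a b)}

/-- The predictable σ-algebra on `Ω × (E × [0, ∞))`. -/
@[reducible]
def predictableMarked (E : Type*) [MeasurableSpace E] (ℱ : Filtration ℝ≥0 mΩ) :
    MeasurableSpace (Ω × (E × ℝ≥0)) :=
  MeasurableSpace.generateFrom (predictableSets E ℱ)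

section Predictable

variable {ℱ : Filtration ℝ≥0 mΩ}

lemma predictableMarked_le : predictableMarked E ℱ ≤ mΩ.prod inferInstance := by
  refine MeasurableSpace.generateFrom_le ?_
  rintro S (⟨A, B, hA, hB, rfl⟩ | ⟨a, b, A, B, hA, hB, rfl⟩)
  · exact (ℱ.le _ _ hB).prod (hA.prod (measurableSet_singleton 0))
  · exact (ℱ.le _ _ hB).prod (hA.prod measurableSet_Ioc)

/-- A slice at time `0` never meets an interval `(a, b]`; for two intervals, the intersected event
is known at the larger left end. -/
lemma isPiSystem_predictableSets : IsPiSystem (predictableSets E ℱ) := by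
  rintro S (⟨A, B, hA, hB, rfl⟩ | ⟨a, b, A, B, hA, hB, rfl⟩) T
    (⟨A', B', hA', hB', rfl⟩ | ⟨a', b', A', B', hA', hB', rfl⟩) -
  · exact Or.inl ⟨A ∩ A', B ∩ B', hA.inter hA', hB.inter hB', by
      rw [prod_inter_prod, prod_inter_prod, inter_self]⟩
  · refine Or.inr ⟨0, 0, ∅, ∅, MeasurableSet.empty, @MeasurableSet.empty _ (ℱ 0), ?_⟩
    rw [prod_inter_prod, prod_inter_prod]
    have : ({0} : Set ℝ≥0) ∩ Ioc a' b' = ∅ := by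
      ext x
      simp only [mem_inter_iff, mem_singleton_iff, mem_Ioc, mem_empty_iff_false, iff_false]
      rintro ⟨rfl, h, -⟩
      exact not_lt_bot h
    simp [this]
  · refine Or.inr ⟨0, 0, ∅, ∅, MeasurableSet.empty, @MeasurableSet.empty _ (ℱ 0), ?_⟩
    rw [prod_inter_prod, prod_inter_prod]
    have : Ioc a b ∩ ({0} : Set ℝ≥0) = ∅ := by
      ext x
      simp only [mem_inter_iff, mem_singleton_iff, mem_Ioc, mem_empty_iff_false, iff_false]
      rintro ⟨⟨h, -⟩, rfl⟩
      exact not_lt_bot h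
    simp [this]
  · refine Or.inr ⟨a ⊔ a', b ⊓ b', A ∩ A', B ∩ B', hA.inter hA',
      (ℱ.mono le_sup_left _ hB).inter (ℱ.mono le_sup_right _ hB'), ?_⟩
    rw [prod_inter_prod, prod_inter_prod, Ioc_inter_Ioc]

/-- A set of marked points, cut at time `0` and at all integer times, is predictable. -/
lemma measurable_mark_predictable :
    Measurable[predictableMarked E ℱ] fun p : Ω × (E × ℝ≥0) => p.2.1 := by
  intro A hA
  have h : (fun p : Ω × (E × ℝ≥0) => p.2.1) ⁻¹' A =
      univ ×ˢ (A ×ˢ {0}) ∪ ⋃ n : ℕ, univ ×ˢ (A ×ˢ Ioc 0 (n : ℝ≥0)) := by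
    ext ⟨ω, u, s⟩
    simp only [mem_preimage, mem_union, mem_prod, mem_univ, true_and, mem_singleton_iff, mem_iUnion,
      mem_Ioc]
    constructor
    · intro h
      rcases eq_or_ne s 0 with h0 | h0
      · exact Or.inl ⟨h, h0⟩
      · obtain ⟨n, hn⟩ := exists_nat_ge s
        exact Or.inr ⟨n, h, pos_iff_ne_zero.2 h0, hn⟩
    · rintro (h | ⟨n, h, -⟩)
      · exact h.1
      · exact h
  rw [h]
  refine @MeasurableSet.union _ (predictableMarked E ℱ) _ _ ?_
    (@MeasurableSet.iUnion _ _ (predictableMarked E ℱ) _ _ fun n => ?_)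
  · exact MeasurableSpace.measurableSet_generateFrom
      (Or.inl ⟨A, univ, hA, MeasurableSet.univ, rfl⟩)
  · exact MeasurableSpace.measurableSet_generateFrom
      (Or.inr ⟨0, n, A, univ, hA, MeasurableSet.univ, rfl⟩)

/-- The last time before `r` in the grid of mesh `1 / (n + 1)`. -/
def gridBefore (n : ℕ) (r : ℝ≥0) : ℝ≥0 := ((⌈r * (n + 1)⌉₊ - 1 : ℕ) : ℝ≥0) / (n + 1)

/-- Truncated subtraction gives `0 - 1 = 0`, in agreement with the value of `Function.leftLim` at
time `0`. -/
lemma gridBefore_zero (n : ℕ) : gridBefore n 0 = 0 := by simp [gridBefore]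

lemma gridBefore_lt (n : ℕ) {r : ℝ≥0} (hr : 0 < r) : gridBefore n r < r := by
  have h1 : (0 : ℝ≥0) < n + 1 := by positivity
  have h2 : 0 < ⌈r * (n + 1)⌉₊ := Nat.ceil_pos.2 (by positivity)
  rw [gridBefore, div_lt_iff₀ h1]
  refine Nat.lt_ceil.1 (by omega)

lemma gridBefore_le (n : ℕ) (r : ℝ≥0) : gridBefore n r ≤ r := by
  rcases eq_or_ne r 0 with rfl | h
  · rw [gridBefore_zero]
  · exact (gridBefore_lt n (pos_iff_ne_zero.2 h)).le

lemma le_gridBefore_add (n : ℕ) (r : ℝ≥0) : r ≤ gridBefore n r + 1 / (n + 1) := by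
  have h1 : (0 : ℝ≥0) < n + 1 := by positivity
  rw [gridBefore, ← add_div, le_div_iff₀ h1]
  refine (Nat.le_ceil _).trans ?_
  have : ⌈r * (n + 1)⌉₊ ≤ ⌈r * (n + 1)⌉₊ - 1 + 1 := by omega
  exact_mod_cast this

lemma tendsto_gridBefore {r : ℝ≥0} (hr : 0 < r) :
    Tendsto (fun n => gridBefore n r) atTop (𝓝[<] r) := by
  refine tendsto_nhdsWithin_iff.2 ⟨?_, Eventually.of_forall fun n => gridBefore_lt n hr⟩
  have h1 : Tendsto (fun n : ℕ => r - 1 / ((n : ℝ≥0) + 1)) atTop (𝓝 (r - 0)) :=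
    tendsto_const_nhds.sub (tendsto_one_div_add_atTop_nhds_zero_nat (𝕜 := ℝ≥0))
  rw [tsub_zero] at h1
  exact tendsto_of_tendsto_of_tendsto_of_le_of_le h1 tendsto_const_nhds
    (fun n => tsub_le_iff_right.2 (le_gridBefore_add n r)) (fun n => gridBefore_le n r)

/-- On the cell `(k/(n+1), (k+1)/(n+1)]` the process is frozen at its value at the left end, which
is known there, so preimages are countable unions of predictable rectangles. Limits in `n` then give
predictability of left limits. -/
lemma measurable_gridBefore_predictable {β : Type*} [MeasurableSpace β] {Y : ℝ≥0 → Ω → β}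
    (hY : ∀ t, Measurable[ℱ t] (Y t)) (n : ℕ) :
    Measurable[predictableMarked E ℱ] fun p : Ω × (E × ℝ≥0) => Y (gridBefore n p.2.2) p.1 := by
  intro B hB
  have h1 : (0 : ℝ≥0) < n + 1 := by positivity
  have h : (fun p : Ω × (E × ℝ≥0) => Y (gridBefore n p.2.2) p.1) ⁻¹' B =
      (Y 0 ⁻¹' B) ×ˢ (univ ×ˢ {0}) ∪ ⋃ k : ℕ, (Y (k / (n + 1)) ⁻¹' B) ×ˢ
        (univ ×ˢ Ioc ((k : ℝ≥0) / (n + 1)) ((k + 1 : ℕ) / (n + 1))) := by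
    ext ⟨ω, u, s⟩
    simp only [mem_preimage, mem_union, mem_prod, mem_univ, true_and, mem_singleton_iff, mem_iUnion,
      mem_Ioc]
    have hk : ∀ k : ℕ, (k : ℝ≥0) / (n + 1) < s → s ≤ (k + 1 : ℕ) / (n + 1) →
        gridBefore n s = k / (n + 1) := by
      intro k h2 h3
      rw [div_lt_iff₀ h1] at h2
      rw [le_div_iff₀ h1] at h3
      have h4 : ⌈s * (n + 1)⌉₊ = k + 1 :=
        le_antisymm (Nat.ceil_le.2 h3) (Nat.lt_ceil.2 h2)
      rw [gridBefore, h4]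
      simp
    constructor
    · intro h
      rcases eq_or_ne s 0 with rfl | h0
      · rw [gridBefore_zero] at h
        exact Or.inl ⟨h, rfl⟩
      · refine Or.inr ⟨⌈s * (n + 1)⌉₊ - 1, h, gridBefore_lt n (pos_iff_ne_zero.2 h0), ?_⟩
        have := le_gridBefore_add n s
        rw [gridBefore, ← add_div] at this
        exact_mod_cast this
    · rintro (⟨h, rfl⟩ | ⟨k, h, h2, h3⟩)
      · rwa [gridBefore_zero]
      · rwa [hk k h2 h3]
  rw [h]
  refine @MeasurableSet.union _ (predictableMarked E ℱ) _ _ ?_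
    (@MeasurableSet.iUnion _ _ (predictableMarked E ℱ) _ _ fun k => ?_)
  · exact MeasurableSpace.measurableSet_generateFrom
      (Or.inl ⟨univ, _, MeasurableSet.univ, hY 0 hB, rfl⟩)
  · exact MeasurableSpace.measurableSet_generateFrom
      (Or.inr ⟨_, _, univ, _, MeasurableSet.univ, hY _ hB, rfl⟩)

lemma measurable_time_predictable :
    Measurable[predictableMarked E ℱ] fun p : Ω × (E × ℝ≥0) => p.2.2 := by
  refine @measurable_of_tendsto_metrizable _ _ (predictableMarked E ℱ) _ _ _ _
    (fun n p => gridBefore n p.2.2) _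
    (fun n => measurable_gridBefore_predictable (Y := fun t _ => t) (fun t => measurable_const) n)
    (tendsto_pi_nhds.2 fun p => ?_)
  rcases eq_or_ne p.2.2 0 with h | h
  · simp only [h, gridBefore_zero]
    exact tendsto_const_nhds
  · exact (tendsto_gridBefore (pos_iff_ne_zero.2 h)).mono_right nhdsWithin_le_nhds

lemma measurable_snd_predictable :
    Measurable[predictableMarked E ℱ] fun p : Ω × (E × ℝ≥0) => p.2 :=
  Measurable.prodMk (f := fun p : Ω × (E × ℝ≥0) => p.2.1) (g := fun p : Ω × (E × ℝ≥0) => p.2.2)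
    measurable_mark_predictable measurable_time_predictable

/-- A predictable set, up to time `t`, is measurable with respect to the events up to time `t`. -/
lemma measurableSet_predictable_inter (t : ℝ≥0) {S : Set (Ω × (E × ℝ≥0))}
    (hS : MeasurableSet[predictableMarked E ℱ] S) :
    MeasurableSet[(ℱ t).prod inferInstance] (S ∩ {p | p.2.2 ≤ t}) := by
  have hT : MeasurableSet[(ℱ t).prod inferInstance] {p : Ω × (E × ℝ≥0) | p.2.2 ≤ t} := by
    let := ℱ t
    exact measurableSet_le (measurable_snd.comp measurable_snd) measurable_const
  induction S, hS using MeasurableSpace.generateFrom_induction with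
  | hC S hS _ =>
    rcases hS with ⟨A, B, hA, hB, rfl⟩ | ⟨a, b, A, B, hA, hB, rfl⟩
    · exact @MeasurableSet.inter _ ((ℱ t).prod inferInstance) _ _
        (@MeasurableSet.prod _ _ (ℱ t) _ _ _ (ℱ.mono zero_le _ hB)
          (hA.prod (measurableSet_singleton 0))) hT
    · rcases le_or_gt a t with h | h
      · exact @MeasurableSet.inter _ ((ℱ t).prod inferInstance) _ _
          (@MeasurableSet.prod _ _ (ℱ t) _ _ _ (ℱ.mono h _ hB) (hA.prod measurableSet_Ioc)) hT
      · have : B ×ˢ (A ×ˢ Ioc a b) ∩ {p : Ω × (E × ℝ≥0) | p.2.2 ≤ t} = ∅ := by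
          ext p
          simp only [mem_inter_iff, mem_prod, mem_Ioc, Set.mem_ofPred_eq, mem_empty_iff_false,
            iff_false]
          rintro ⟨⟨-, -, h1, -⟩, h2⟩
          exact absurd (h.trans h1) (not_lt.2 h2)
        rw [this]
        exact @MeasurableSet.empty _ ((ℱ t).prod inferInstance)
  | empty => rw [empty_inter]; exact @MeasurableSet.empty _ ((ℱ t).prod inferInstance)
  | compl S _ ih =>
    have : Sᶜ ∩ {p : Ω × (E × ℝ≥0) | p.2.2 ≤ t} =
        {p | p.2.2 ≤ t} \ (S ∩ {p | p.2.2 ≤ t}) := by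
      ext p; simp only [mem_inter_iff, mem_compl_iff, Set.mem_sdiff]; tauto
    rw [this]
    exact @MeasurableSet.diff _ ((ℱ t).prod inferInstance) _ _ hT ih
  | iUnion f _ ih =>
    rw [iUnion_inter]
    exact @MeasurableSet.iUnion _ _ ((ℱ t).prod inferInstance) _ _ ih

/-- A predictable process, up to time `t`, is measurable with respect to the events up to
time `t`. -/
lemma measurable_indicator_predictable (t : ℝ≥0) {β : Type*} [MeasurableSpace β] [Zero β]
    {H : Ω × (E × ℝ≥0) → β} (hH : Measurable[predictableMarked E ℱ] H) :
    Measurable[(ℱ t).prod inferInstance]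
      ({p : Ω × (E × ℝ≥0) | p.2.2 ≤ t}.indicator H) := by
  classical
  intro B hB
  have hT : MeasurableSet[(ℱ t).prod inferInstance] {p : Ω × (E × ℝ≥0) | p.2.2 ≤ t} := by
    have := measurableSet_predictable_inter (ℱ := ℱ) (E := E) t (@MeasurableSet.univ _ (predictableMarked E ℱ))
    rwa [univ_inter] at this
  rw [indicator_preimage, Set.ite]
  refine @MeasurableSet.union _ ((ℱ t).prod inferInstance) _ _ (measurableSet_predictable_inter t (hH hB))
    (@MeasurableSet.diff _ ((ℱ t).prod inferInstance) _ _ ?_ hT)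
  by_cases h : (0 : β) ∈ B
  · have : (0 : Ω × (E × ℝ≥0) → β) ⁻¹' B = univ := by ext; simp [h]
    rw [this]; exact @MeasurableSet.univ _ ((ℱ t).prod inferInstance)
  · have : (0 : Ω × (E × ℝ≥0) → β) ⁻¹' B = ∅ := by ext; simp [h]
    rw [this]; exact @MeasurableSet.empty _ ((ℱ t).prod inferInstance)

end Predictable

lemma measurable_measure_restrict {S : Type*} [MeasurableSpace S] {B : Set S}
    (hB : MeasurableSet B) : Measurable fun μ : Measure S => μ.restrict B := by
  refine Measure.measurable_of_measurable_coe _ fun s hs => ?_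
  simp_rw [Measure.restrict_apply hs]
  exact Measure.measurable_coe (hs.inter hB)

section Compensation

variable {ℱ : Filtration ℝ≥0 mΩ} {X : Ω → Measure (E × ℝ≥0)} {Q : Measure Ω} {ν : Measure E}

lemma lintegral_compProd_toKernel [SFinite Q] (hX : Measurable X)
    (hfin : ∀ ω t, X ω (univ ×ˢ Iic t) < ∞) {f : Ω × (E × ℝ≥0) → ℝ≥0∞} (hf : Measurable f) :
    ∫⁻ p, f p ∂(Q ⊗ₘ toKernel X hX) = ∫⁻ ω, ∫⁻ x, f (ω, x) ∂(X ω) ∂Q := by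
  have := isSFiniteKernel_toKernel hX hfin
  exact Measure.lintegral_compProd hf

/-- The points of a compatible Poisson random measure in `(a, b]` are independent of the events up
to time `a`. -/
lemma IsPoissonRandomMeasure.setLIntegral_Ioc
    (hX : IsPoissonRandomMeasure X (ν.prod timeMeasure) Q) (hXℱ : IsCompatible ℱ X Q)
    {a b : ℝ≥0} {A : Set E} (hA : MeasurableSet A) {B : Set Ω} (hB : MeasurableSet[ℱ a] B) :
    ∫⁻ ω in B, X ω (A ×ˢ Ioc a b) ∂Q = Q B * (ν.prod timeMeasure) (A ×ˢ Ioc a b) := by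
  have hAJ : MeasurableSet (A ×ˢ Ioc a b) := hA.prod measurableSet_Ioc
  have hB' := ℱ.le a _ hB
  have h1 : (fun ω => X ω (A ×ˢ Ioc a b)) =
      fun ω => (X ω).restrict (univ ×ˢ Ioi a) (A ×ˢ Ioc a b) := by
    funext ω
    rw [Measure.restrict_apply hAJ, inter_eq_left.2]
    exact prod_mono (subset_univ _) Ioc_subset_Ioi_self
  have hmeas : Measurable[MeasurableSpace.comap
      (fun ω => (X ω).restrict (univ ×ˢ Ioi a)) inferInstance]
      fun ω => X ω (A ×ˢ Ioc a b) := by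
    rw [h1]
    exact (Measure.measurable_coe hAJ).comp (comap_measurable _)
  have hind := hXℱ.indep a
  have hle : MeasurableSpace.comap (fun ω => (X ω).restrict (univ ×ˢ Ioi a)) inferInstance ≤ mΩ :=
    ((measurable_measure_restrict (MeasurableSet.univ.prod measurableSet_Ioi)).comp
      hX.measurable).comap_le
  have h2 := lintegral_mul_eq_lintegral_mul_lintegral_of_independent_measurableSpace hle (ℱ.le a)
    hind hmeas (measurable_const.indicator hB : Measurable[ℱ a] (B.indicator fun _ => (1 : ℝ≥0∞)))
  rw [hX.lintegral_apply hAJ, lintegral_indicator hB'] at h2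
  rw [← lintegral_indicator hB']
  simp only [lintegral_const, one_mul, Measure.restrict_apply_univ] at h2
  rw [mul_comm, ← h2]
  refine lintegral_congr fun ω => ?_
  by_cases h : ω ∈ B <;> simp [h]

/-- The compensation formula: predictable processes have the same mean integral with respect to a
compatible Poisson random measure and to its mean measure. -/
theorem IsPoissonRandomMeasure.lintegral_compensation [IsFiniteMeasure ν] [IsProbabilityMeasure Q]
    (hX : IsPoissonRandomMeasure X (ν.prod timeMeasure) Q) (hXℱ : IsCompatible ℱ X Q)
    {H : Ω × (E × ℝ≥0) → ℝ≥0∞} (hH : Measurable[predictableMarked E ℱ] H) :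
    ∫⁻ ω, ∫⁻ x, H (ω, x) ∂(X ω) ∂Q = ∫⁻ ω, ∫⁻ x, H (ω, x) ∂(ν.prod timeMeasure) ∂Q := by
  have hsf := isSFiniteKernel_toKernel hX.measurable hX.lt_top
  have hH' : Measurable H := hH.mono predictableMarked_le le_rfl
  have hle := predictableMarked_le (E := E) (ℱ := ℱ)
  -- Both sides are integrals against measures on the predictable σ-algebra, so agreement on the
  -- generating rectangles suffices.
  rw [← lintegral_compProd_toKernel hX.measurable hX.lt_top hH', ← lintegral_prod _ hH'.aemeasurable,
    ← lintegral_trim hle hH, ← lintegral_trim hle hH]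
  congr 1
  have hrect : ∀ (A : Set E) (J : Set ℝ≥0) (B : Set Ω), MeasurableSet A → MeasurableSet J →
      MeasurableSet B → (Q ⊗ₘ toKernel X hX.measurable) (B ×ˢ (A ×ˢ J)) =
        ∫⁻ ω in B, X ω (A ×ˢ J) ∂Q := fun A J B hA hJ hB =>
    Measure.compProd_apply_prod hB (hA.prod hJ)
  have key : ∀ S ∈ predictableSets E ℱ, (Q ⊗ₘ toKernel X hX.measurable) S =
      (Q.prod (ν.prod timeMeasure)) S := by
    rintro S (⟨A, B, hA, hB, rfl⟩ | ⟨a, b, A, B, hA, hB, rfl⟩)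
    · have h0 : (ν.prod timeMeasure) (A ×ˢ ({0} : Set ℝ≥0)) = 0 := by
        rw [Measure.prod_prod]; simp
      have hm : MeasurableSet (A ×ˢ ({0} : Set ℝ≥0)) := hA.prod (measurableSet_singleton 0)
      rw [hrect A _ B hA (measurableSet_singleton 0) (ℱ.le _ _ hB), Measure.prod_prod, h0, mul_zero]
      refine le_antisymm ((setLIntegral_le_lintegral _ _).trans ?_) zero_le
      rw [hX.lintegral_apply hm, h0]
    · rw [hrect A _ B hA measurableSet_Ioc (ℱ.le _ _ hB), Measure.prod_prod,
        hX.setLIntegral_Ioc hXℱ hA hB]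
  have hms : ∀ S ∈ predictableSets E ℱ, MeasurableSet[predictableMarked E ℱ] S := fun S hS =>
    MeasurableSpace.measurableSet_generateFrom hS
  -- The countable cover of finite mass consists of time `0` and the intervals `(n, n + 1]`.
  refine @Measure.ext_of_generateFrom_of_cover_subset _ (predictableMarked E ℱ) _ _
    (predictableSets E ℱ) ({univ ×ˢ (univ ×ˢ {0})} ∪
      range fun n : ℕ => univ ×ˢ (univ ×ˢ Ioc (n : ℝ≥0) ((n + 1 : ℕ) : ℝ≥0))) rfl
    isPiSystem_predictableSets ?_ ?_ ?_ ?_ ?_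
  · rintro S (rfl | ⟨n, rfl⟩)
    · exact Or.inl ⟨univ, univ, MeasurableSet.univ, @MeasurableSet.univ _ (ℱ 0), rfl⟩
    · exact Or.inr ⟨_, _, univ, univ, MeasurableSet.univ, @MeasurableSet.univ _ (ℱ _), rfl⟩
  · exact (countable_singleton _).union (countable_range _)
  · refine eq_univ_of_forall fun p => ?_
    rcases eq_or_ne p.2.2 0 with h | h
    · exact ⟨_, Or.inl rfl, by simp [h]⟩
    · have hpos : 0 < p.2.2 := pos_iff_ne_zero.2 h
      have hc : 0 < ⌈p.2.2⌉₊ := Nat.ceil_pos.2 hpos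
      refine ⟨_, Or.inr ⟨⌈p.2.2⌉₊ - 1, rfl⟩, trivial, trivial, ?_, ?_⟩
      · exact Nat.lt_ceil.1 (by omega)
      · refine (Nat.le_ceil _).trans ?_
        rw [Nat.sub_add_cancel hc]
  · intro S hS
    have hS' : S ∈ predictableSets E ℱ := by
      rcases hS with rfl | ⟨n, rfl⟩
      · exact Or.inl ⟨univ, univ, MeasurableSet.univ, @MeasurableSet.univ _ (ℱ 0), rfl⟩
      · exact Or.inr ⟨_, _, univ, univ, MeasurableSet.univ, @MeasurableSet.univ _ (ℱ _), rfl⟩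
    rw [trim_measurableSet_eq hle (hms S hS'), key S hS']
    rcases hS with rfl | ⟨n, rfl⟩
    · rw [Measure.prod_prod, prod_timeMeasure_singleton, mul_zero]; simp
    · rw [Measure.prod_prod, prod_timeMeasure_Ioc]
      exact ENNReal.mul_ne_top (measure_ne_top _ _)
        (ENNReal.mul_ne_top (measure_ne_top _ _) ENNReal.coe_ne_top)
  · intro S hS
    rw [trim_measurableSet_eq hle (hms S hS), trim_measurableSet_eq hle (hms S hS), key S hS]

/-- Compensated integrals of integrable predictable processes have mean `0`. -/
theorem IsPoissonRandomMeasure.integral_compensation [IsFiniteMeasure ν] [IsProbabilityMeasure Q]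
    (hX : IsPoissonRandomMeasure X (ν.prod timeMeasure) Q) (hXℱ : IsCompatible ℱ X Q)
    {H : Ω × (E × ℝ≥0) → ℝ} (hH : Measurable[predictableMarked E ℱ] H)
    (hint : ∫⁻ ω, ∫⁻ x, ‖H (ω, x)‖ₑ ∂(ν.prod timeMeasure) ∂Q ≠ ∞) :
    Integrable (fun ω => ∫ x, H (ω, x) ∂(X ω)) Q ∧
    Integrable (fun ω => ∫ x, H (ω, x) ∂(ν.prod timeMeasure)) Q ∧
    ∫ ω, ∫ x, H (ω, x) ∂(X ω) ∂Q = ∫ ω, ∫ x, H (ω, x) ∂(ν.prod timeMeasure) ∂Q := by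
  have hsf := isSFiniteKernel_toKernel hX.measurable hX.lt_top
  have hH' : Measurable H := hH.mono predictableMarked_le le_rfl
  have hcomp : ∀ φ : ℝ → ℝ≥0∞, Measurable φ →
      ∫⁻ p, φ (H p) ∂(Q ⊗ₘ toKernel X hX.measurable) =
        ∫⁻ p, φ (H p) ∂(Q.prod (ν.prod timeMeasure)) := by
    intro φ hφ
    have hφH : Measurable fun p => φ (H p) := hφ.comp hH'
    rw [lintegral_compProd_toKernel hX.measurable hX.lt_top hφH,
      lintegral_prod _ hφH.aemeasurable]
    exact hX.lintegral_compensation hXℱ (hφ.comp hH)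
  have h1 : Integrable H (Q.prod (ν.prod timeMeasure)) := by
    refine ⟨hH'.aestronglyMeasurable, ?_⟩
    rw [HasFiniteIntegral, lintegral_prod _ hH'.enorm.aemeasurable]
    exact lt_top_iff_ne_top.2 hint
  have h2 : Integrable H (Q ⊗ₘ toKernel X hX.measurable) := by
    refine ⟨hH'.aestronglyMeasurable, ?_⟩
    rw [HasFiniteIntegral, hcomp _ measurable_enorm]
    exact h1.2
  have h2' : Integrable H ((Kernel.const Unit Q ⊗ₖ
      Kernel.prodMkLeft Unit (toKernel X hX.measurable)) ()) := h2
  refine ⟨h2'.integral_compProd, h1.integral_prod_left, ?_⟩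
  rw [← integral_prod _ h1]
  refine (Measure.integral_compProd h2).symm.trans ?_
  -- The nonnegative formula applies to the positive and the negative part separately.
  rw [integral_eq_lintegral_pos_part_sub_lintegral_neg_part h1,
    integral_eq_lintegral_pos_part_sub_lintegral_neg_part h2,
    hcomp (fun y => ENNReal.ofReal y) ENNReal.measurable_ofReal,
    hcomp (fun y => ENNReal.ofReal (-y)) (ENNReal.measurable_ofReal.comp measurable_neg)]

end Compensation

/-! ### Simultaneous points -/

/-- The probability is `1 - e^{-r} (1 + r) ≤ 1 - (1 - r)(1 + r) = r²`. -/
lemma poissonMeasure_two_le (r : ℝ≥0) : poissonMeasure r {n | 2 ≤ n} ≤ (r : ℝ≥0∞) ^ 2 := by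
  have h1 : ({n : ℕ | 2 ≤ n})ᶜ = {0} ∪ {1} := by
    ext n; simp only [mem_compl_iff, Set.mem_ofPred_eq, mem_union, mem_singleton_iff]; omega
  have h2 : (poissonMeasure r).real {n | 2 ≤ n}ᶜ = Real.exp (-r) * (1 + r) := by
    rw [h1, measureReal_union (by simp) (measurableSet_singleton 1), poissonMeasure_real_singleton,
      poissonMeasure_real_singleton]
    simp only [pow_zero, pow_one, Nat.factorial, Nat.cast_one]
    ring
  have h3 : (poissonMeasure r).real {n | 2 ≤ n} = 1 - Real.exp (-r) * (1 + r) := by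
    rw [← h2, probReal_compl_eq_one_sub (by measurability)]
    ring
  have h4 : (poissonMeasure r).real {n | 2 ≤ n} ≤ (r : ℝ) ^ 2 := by
    rw [h3]
    have := Real.add_one_le_exp (-(r : ℝ))
    have hr : (0 : ℝ) ≤ r := r.2
    nlinarith
  rw [← ENNReal.ofReal_toReal (measure_ne_top (poissonMeasure r) {n | 2 ≤ n})]
  refine (ENNReal.ofReal_le_ofReal h4).trans ?_
  rw [ENNReal.ofReal_pow (NNReal.coe_nonneg r), ENNReal.ofReal_coe_nnreal]

lemma lintegral_comp_poissonLaw {φ : ℝ≥0∞ → ℝ≥0∞} (hφ : Measurable φ) {r : ℝ≥0∞} (hr : r ≠ ∞) :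
    ∫⁻ x, φ x ∂(poissonLaw r) = ∫⁻ n : ℕ, φ n ∂(poissonMeasure r.toNNReal) := by
  rw [poissonLaw, if_neg hr, lintegral_map hφ (by fun_prop)]

lemma IsPoissonRandomMeasure.measure_two_le {X : Ω → Measure (E × ℝ≥0)} {μ : Measure (E × ℝ≥0)}
    {Q : Measure Ω} (hX : IsPoissonRandomMeasure X μ Q) {B : Set (E × ℝ≥0)} (hB : MeasurableSet B)
    (hμ : μ B ≠ ∞) : Q {ω | 2 ≤ X ω B} ≤ μ B ^ 2 := by
  have h1 : Q {ω | 2 ≤ X ω B} = poissonLaw (μ B) (Ici 2) := by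
    rw [← hX.law B hB, Measure.map_apply (hX.measurable_apply hB) measurableSet_Ici]
    rfl
  rw [h1, poissonLaw, if_neg hμ, Measure.map_apply (by fun_prop) measurableSet_Ici]
  have h2 : (fun n : ℕ => (n : ℝ≥0∞)) ⁻¹' Ici 2 = {n | 2 ≤ n} := by
    ext n
    simp only [mem_preimage, mem_Ici, Set.mem_ofPred_eq]
    exact_mod_cast Iff.rfl
  rw [h2]
  refine (poissonMeasure_two_le _).trans ?_
  rw [ENNReal.coe_toNNReal hμ]

/-- The `k`-th cell of the grid of mesh `1 / (n + 1)`. -/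
def gridCell (n k : ℕ) : Set ℝ≥0 := Ioc ((k : ℝ≥0) / (n + 1)) ((k + 1 : ℕ) / (n + 1))

lemma exists_mem_gridCell (n T : ℕ) {s : ℝ≥0} (h0 : 0 < s) (hs : s ≤ T) :
    ∃ k < T * (n + 1), s ∈ gridCell n k := by
  have h1 : (0 : ℝ≥0) < n + 1 := by positivity
  have h2 : 0 < ⌈s * (n + 1)⌉₊ := Nat.ceil_pos.2 (by positivity)
  have h3 : ⌈s * (n + 1)⌉₊ ≤ T * (n + 1) := by
    refine Nat.ceil_le.2 ?_
    push_cast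
    gcongr
  refine ⟨⌈s * (n + 1)⌉₊ - 1, by omega, gridBefore_lt n h0, ?_⟩
  have := le_gridBefore_add n s
  rw [gridBefore, ← add_div] at this
  exact_mod_cast this

lemma measurableSet_univ_prod_gridCell (n k : ℕ) :
    MeasurableSet (univ ×ˢ gridCell n k : Set (E × ℝ≥0)) := measurableSet_univ_prod_Ioc _ _

lemma prod_timeMeasure_gridCell (ν : Measure E) (n k : ℕ) :
    (ν.prod timeMeasure) (univ ×ˢ gridCell n k) = ν univ / (n + 1) := by
  have h : (((k + 1 : ℕ) : ℝ≥0) / (n + 1) - (k : ℝ≥0) / (n + 1)) = 1 / (n + 1) := by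
    push_cast
    rw [add_div, add_tsub_cancel_left]
  rw [gridCell, prod_timeMeasure_Ioc, h, ENNReal.div_eq_inv_mul, mul_comm]
  congr 1
  rw [one_div, ENNReal.coe_inv (by positivity)]
  simp

/-- An event is null if on each grid it forces an event of order `mesh ^ 2` in some cell. -/
lemma measure_eq_zero_of_grid {Q : Measure Ω} {a : ℝ≥0∞} (ha : a ≠ ∞) (T : ℕ) {S : Set Ω}
    (A : ℕ → ℕ → Set Ω) (hA : ∀ n k, Q (A n k) ≤ (a / (n + 1)) ^ 2)
    (hS : ∀ n, S ⊆ ⋃ k ∈ Finset.range (T * (n + 1)), A n k) : Q S = 0 := by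
  -- There are `T (n + 1)` cells, each contributing at most `a² / (n + 1)²`; the total `T a² / (n +
  -- 1)` tends to `0`.
  have h1 : ∀ n : ℕ, Q S ≤ T * a ^ 2 * (1 / ((n : ℝ≥0∞) + 1)) := by
    intro n
    have h0 : ((n : ℝ≥0∞) + 1) ≠ 0 := by positivity
    have h0' : ((n : ℝ≥0∞) + 1) ≠ ∞ := by finiteness
    calc Q S ≤ ∑ k ∈ Finset.range (T * (n + 1)), Q (A n k) :=
          (measure_mono (hS n)).trans (measure_biUnion_finset_le _ _)
      _ ≤ ∑ k ∈ Finset.range (T * (n + 1)), (a / (n + 1)) ^ 2 := Finset.sum_le_sum fun k _ => hA n k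
      _ = T * a ^ 2 * (1 / ((n : ℝ≥0∞) + 1)) := by
        rw [Finset.sum_const, Finset.card_range, nsmul_eq_mul, Nat.cast_mul, Nat.cast_add,
          Nat.cast_one, one_div, ENNReal.div_eq_inv_mul, mul_pow, sq (((n : ℝ≥0∞) + 1)⁻¹)]
        calc (T : ℝ≥0∞) * (n + 1) * ((n + 1 : ℝ≥0∞)⁻¹ * (n + 1 : ℝ≥0∞)⁻¹ * a ^ 2)
            = T * a ^ 2 * (((n + 1) * (n + 1 : ℝ≥0∞)⁻¹) * (n + 1 : ℝ≥0∞)⁻¹) := by ring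
          _ = _ := by rw [ENNReal.mul_inv_cancel h0 h0', one_mul]
  have h2 : Tendsto (fun n : ℕ => T * a ^ 2 * (1 / ((n : ℝ≥0∞) + 1))) atTop (𝓝 (T * a ^ 2 * 0)) := by
    refine ENNReal.Tendsto.const_mul ?_ (Or.inr (by finiteness))
    have := ENNReal.tendsto_inv_nat_nhds_zero.comp (tendsto_add_atTop_nat 1)
    refine this.congr fun n => ?_
    simp [one_div]
  rw [mul_zero] at h2
  exact le_antisymm (ge_of_tendsto' h2 h1) zero_le

section Poisson

variable {X Y : Ω → Measure (E × ℝ≥0)} {Q : Measure Ω} {ν : Measure E} [IsFiniteMeasure ν]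

/-- Two points at one time fall into one grid cell, which has probability at most the square of the
mean of the cell. -/
lemma IsPoissonRandomMeasure.ae_isSimple (hX : IsPoissonRandomMeasure X (ν.prod timeMeasure) Q) :
    ∀ᵐ ω ∂Q, IsSimple (X ω) := by
  have h0 := hX.ae_eq_zero (measurableSet_univ_prod_singleton 0) (prod_timeMeasure_singleton ν 0)
  have h1 : ∀ T : ℕ, ∀ᵐ ω ∂Q, ¬ ∃ s, 0 < s ∧ s ≤ (T : ℝ≥0) ∧ 1 < X ω (univ ×ˢ {s}) := by
    intro T
    rw [ae_iff]
    refine measure_eq_zero_of_grid (measure_ne_top ν univ) T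
      (fun n k => {ω | 2 ≤ X ω (univ ×ˢ gridCell n k)}) (fun n k => ?_) (fun n ω hω => ?_)
    · rw [← prod_timeMeasure_gridCell ν n k]
      refine hX.measure_two_le (measurableSet_univ_prod_gridCell n k) ?_
      rw [gridCell, prod_timeMeasure_Ioc]
      exact ENNReal.mul_ne_top (measure_ne_top _ _) ENNReal.coe_ne_top
    · simp only [Set.mem_ofPred_eq, not_not] at hω
      obtain ⟨s, hs0, hsT, hs⟩ := hω
      obtain ⟨k, hk, hsk⟩ := exists_mem_gridCell n T hs0 hsT
      refine mem_biUnion (Finset.mem_coe.2 (Finset.mem_range.2 hk)) ?_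
      have hle : X ω (univ ×ˢ {s}) ≤ X ω (univ ×ˢ gridCell n k) :=
        measure_mono (prod_mono_right (singleton_subset_iff.2 hsk))
      obtain ⟨j, hj⟩ := (hX.isConfiguration ω).exists_natCast
        (measurableSet_univ_prod_singleton s) (t := s) (prod_mono_right (by simp))
      rw [hj] at hs hle
      refine le_trans ?_ hle
      have : 1 < j := by exact_mod_cast hs
      exact_mod_cast this
  filter_upwards [h0, ae_all_iff.2 h1] with ω h0 h1
  refine ⟨hX.isConfiguration ω, fun t => ?_, h0⟩
  rcases eq_or_ne t 0 with rfl | ht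
  · rw [h0]; exact zero_le
  · obtain ⟨T, hT⟩ := exists_nat_ge t
    by_contra h
    exact h1 T ⟨t, pos_iff_ne_zero.2 ht, hT, not_le.1 h⟩

/-- A common time puts a point of each measure into one cell; by independence and Markov's
inequality this has probability at most the square of the mean of the cell. -/
lemma IsPoissonRandomMeasure.ae_no_common (hX : IsPoissonRandomMeasure X (ν.prod timeMeasure) Q)
    (hY : IsPoissonRandomMeasure Y (ν.prod timeMeasure) Q) (hXY : IndepFun X Y Q) :
    ∀ᵐ ω ∂Q, ∀ s, X ω (univ ×ˢ {s}) = 0 ∨ Y ω (univ ×ˢ {s}) = 0 := by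
  have h0 := hX.ae_eq_zero (measurableSet_univ_prod_singleton 0) (prod_timeMeasure_singleton ν 0)
  have hone : ∀ (Z : Ω → Measure (E × ℝ≥0)), IsPoissonRandomMeasure Z (ν.prod timeMeasure) Q →
      ∀ n k, Q (Z ⁻¹' {μ | 1 ≤ μ (univ ×ˢ gridCell n k)}) ≤ ν univ / (n + 1) := by
    intro Z hZ n k
    have hm := measurableSet_univ_prod_gridCell (E := E) n k
    rw [← prod_timeMeasure_gridCell ν n k, ← hZ.lintegral_apply hm]
    have := mul_meas_ge_le_lintegral (μ := Q) (hZ.measurable_apply hm) 1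
    rwa [one_mul] at this
  have hcell : ∀ n k, MeasurableSet {μ : Measure (E × ℝ≥0) | 1 ≤ μ (univ ×ˢ gridCell n k)} :=
    fun n k => Measure.measurable_coe (measurableSet_univ_prod_gridCell n k) measurableSet_Ici
  have h1 : ∀ T : ℕ, ∀ᵐ ω ∂Q, ¬ ∃ s, 0 < s ∧ s ≤ (T : ℝ≥0) ∧ X ω (univ ×ˢ {s}) ≠ 0 ∧
      Y ω (univ ×ˢ {s}) ≠ 0 := by
    intro T
    rw [ae_iff]
    refine measure_eq_zero_of_grid (measure_ne_top ν univ) T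
      (fun n k => X ⁻¹' {μ | 1 ≤ μ (univ ×ˢ gridCell n k)} ∩
        Y ⁻¹' {μ | 1 ≤ μ (univ ×ˢ gridCell n k)}) (fun n k => ?_) (fun n ω hω => ?_)
    · rw [hXY.measure_inter_preimage_eq_mul _ _ (hcell n k) (hcell n k), sq]
      exact mul_le_mul' (hone X hX n k) (hone Y hY n k)
    · simp only [Set.mem_ofPred_eq, not_not] at hω
      obtain ⟨s, hs0, hsT, hs⟩ := hω
      obtain ⟨k, hk, hsk⟩ := exists_mem_gridCell n T hs0 hsT
      refine mem_biUnion (Finset.mem_coe.2 (Finset.mem_range.2 hk)) ?_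
      have hle : ∀ c : Measure (E × ℝ≥0), IsConfiguration c → c (univ ×ˢ {s}) ≠ 0 →
          1 ≤ c (univ ×ˢ gridCell n k) := by
        intro c hc h
        obtain ⟨j, hj⟩ := hc.exists_natCast
          (measurableSet_univ_prod_singleton s) (t := s) (prod_mono_right (by simp))
        refine le_trans ?_ (measure_mono (prod_mono_right (singleton_subset_iff.2 hsk)))
        rw [hj] at h ⊢
        have : 1 ≤ j := Nat.one_le_iff_ne_zero.2 (by exact_mod_cast h)
        exact_mod_cast this
      exact ⟨hle _ (hX.isConfiguration ω) hs.1, hle _ (hY.isConfiguration ω) hs.2⟩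
  filter_upwards [h0, ae_all_iff.2 h1] with ω h0 h1
  intro s
  rcases eq_or_ne s 0 with rfl | hs
  · exact Or.inl h0
  · obtain ⟨T, hT⟩ := exists_nat_ge s
    by_contra! h
    exact h1 T ⟨s, pos_iff_ne_zero.2 hs, hT, h⟩

end Poisson

/-! ### Measurability of the explicit solution -/

section Measurability

variable {Ω' : Type*} [MeasurableSpace Ω'] {X : Ω' → Measure (E × ℝ≥0)}
  {κ : Ω' × (E × ℝ≥0) → ℝ≥0}

lemma measurable_pointProd (hX : Measurable X) (hfin : ∀ ω t, X ω (univ ×ˢ Iic t) < ∞)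
    (hκ : Measurable κ) (t : ℝ≥0) :
    Measurable fun ω => pointProd (fun x => κ (ω, x)) ((X ω).restrict (univ ×ˢ Iic t)) := by
  have hJ := measurableSet_univ_prod_Iic (E := E) t
  have hJ' : MeasurableSet {p : Ω' × (E × ℝ≥0) | p.2 ∈ (univ ×ˢ Iic t : Set (E × ℝ≥0))} :=
    measurable_snd hJ
  have hZ : MeasurableSet {p : Ω' × (E × ℝ≥0) | κ p = 0} := hκ (measurableSet_singleton 0)
  unfold pointProd
  refine Measurable.ite ?_ ?_ measurable_const
  · have h1 : (fun ω => (X ω).restrict (univ ×ˢ Iic t) {x | κ (ω, x) = 0}) = fun ω =>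
        ∫⁻ x, ({p : Ω' × (E × ℝ≥0) | κ p = 0} ∩ {p | p.2 ∈ (univ ×ˢ Iic t : Set (E × ℝ≥0))}).indicator
          (fun _ => (1 : ℝ≥0∞)) (ω, x) ∂(X ω) := by
      funext ω
      have hm : MeasurableSet {x | κ (ω, x) = 0} := (hκ.comp measurable_prodMk_left)
        (measurableSet_singleton 0)
      rw [Measure.restrict_apply hm, ← lintegral_indicator_one (hm.inter hJ)]
      rfl
    have h2 := measurable_lintegral_toKernel hX hfin
      ((measurable_const (a := (1 : ℝ≥0∞))).indicator (hZ.inter hJ'))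
    have h3 : Measurable fun ω => (X ω).restrict (univ ×ˢ Iic t) {x | κ (ω, x) = 0} := by
      rw [h1]; exact h2
    exact h3 (measurableSet_singleton 0)
  · refine Real.measurable_exp.comp ?_
    have h1 := stronglyMeasurable_integral_toKernel hX hfin
      ((Real.measurable_log.comp hκ.coe_nnreal_real).indicator hJ')
    have h2 : (fun ω => ∫ x in univ ×ˢ Iic t, Real.log (κ (ω, x)) ∂(X ω)) = fun ω =>
        ∫ x, {p : Ω' × (E × ℝ≥0) | p.2 ∈ (univ ×ˢ Iic t : Set (E × ℝ≥0))}.indicator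
          (Real.log ∘ fun p => (κ p : ℝ)) (ω, x) ∂(X ω) := by
      funext ω
      rw [← integral_indicator hJ]
      rfl
    rw [h2]
    exact h1.measurable

lemma measurable_expFormula (ν : Measure E) [SFinite ν] (hX : Measurable X)
    (hfin : ∀ ω t, X ω (univ ×ˢ Iic t) < ∞) (hκ : Measurable κ) (t : ℝ≥0) :
    Measurable fun ω => expFormula ν (X ω) (fun x => κ (ω, x)) t := by
  unfold expFormula
  refine (measurable_const.mul (continuous_expNeg.measurable.comp ?_)).mul
    (measurable_pointProd hX hfin hκ t)
  exact Measurable.lintegral_prod_right' (f := fun p : Ω' × (E × ℝ≥0) => (κ p : ℝ≥0∞))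
    hκ.coe_nnreal_ennreal

end Measurability

/-! ### The generating functional of a Poisson random measure -/

/-- Weighting Poisson(`r`) by `zⁿ` gives Poisson(`r z`) times the constant `exp(r z - r)`. -/
lemma lintegral_pow_poissonMeasure (r z : ℝ≥0) :
    ∫⁻ n, (z : ℝ≥0∞) ^ n ∂(poissonMeasure r) = ENNReal.ofReal (Real.exp (r * z - r)) := by
  have h1 := (hasSum_one_poissonMeasure (r * z)).mul_left (Real.exp (r * z - r))
  rw [lintegral_countable']
  have h3 : ∀ n : ℕ, (z : ℝ≥0∞) ^ n * poissonMeasure r {n} =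
      ENNReal.ofReal (Real.exp (r * z - r) *
        (Real.exp (-(r * z : ℝ≥0)) * (r * z : ℝ≥0) ^ n / n.factorial)) := by
    intro n
    have h4 : Real.exp (r * z - r) * (Real.exp (-(r * z : ℝ≥0)) * (r * z : ℝ≥0) ^ n / n.factorial) =
        z ^ n * (Real.exp (-r) * r ^ n / n.factorial) := by
      have : Real.exp (-(r : ℝ)) = Real.exp (r * z - r) * Real.exp (-(r * z : ℝ≥0)) := by
        rw [← Real.exp_add]; congr 1; push_cast; ring
      rw [this]; push_cast; ring
    rw [poissonMeasure_singleton, h4, ENNReal.ofReal_mul (by positivity),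
      ENNReal.ofReal_pow (NNReal.coe_nonneg z), ENNReal.ofReal_coe_nnreal]
  simp_rw [h3]
  rw [← ENNReal.ofReal_tsum_of_nonneg (fun n => by positivity) h1.summable, h1.tsum_eq, mul_one]

lemma IsPoissonRandomMeasure.iIndepFun_fintype {X : Ω → Measure (E × ℝ≥0)}
    {μ : Measure (E × ℝ≥0)} {Q : Measure Ω} (hX : IsPoissonRandomMeasure X μ Q)
    {ι : Type*} [Fintype ι] {B : ι → Set (E × ℝ≥0)} (hB : ∀ i, MeasurableSet (B i))
    (hd : Pairwise fun i j => Disjoint (B i) (B j)) : iIndepFun (fun i ω => X ω (B i)) Q := by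
  let e := Fintype.equivFin ι
  have h := hX.indep (Fintype.card ι) (fun k => B (e.symm k)) (fun k => hB _)
    (fun i j hij => hd (e.symm.injective.ne hij))
  have h2 := h.precomp e.injective
  simpa using h2

/-! ### Algebra and limits of products over points -/

section PointProd

variable {S : Type*} [MeasurableSpace S] {c : Measure S}

lemma pointProd_mul (hc : IsDiracSum c) {f g : S → ℝ≥0} (hf : Measurable f) (hg : Measurable g) :
    pointProd (fun x => f x * g x) c = pointProd f c * pointProd g c := by
  induction hc using IsDiracSum.induction with
  | h0 => simp [pointProd_zero]
  | h a μ hμ ih =>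
    have hfg : Measurable fun x => f x * g x := hf.mul hg
    rw [pointProd_add hfg (.dirac a) hμ, pointProd_add hf (.dirac a) hμ,
      pointProd_add hg (.dirac a) hμ, ih, pointProd_dirac hfg, pointProd_dirac hf,
      pointProd_dirac hg]
    push_cast
    ring

lemma pointProd_mono (hc : IsDiracSum c) {f g : S → ℝ≥0} (hf : Measurable f) (hg : Measurable g)
    (h : ∀ x, f x ≤ g x) : pointProd f c ≤ pointProd g c := by
  induction hc using IsDiracSum.induction with
  | h0 => simp [pointProd_zero]
  | h a μ hμ ih =>
    rw [pointProd_add hf (.dirac a) hμ, pointProd_add hg (.dirac a) hμ, pointProd_dirac hf,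
      pointProd_dirac hg]
    exact mul_le_mul (by exact_mod_cast h a) ih (pointProd_nonneg _ _) (NNReal.coe_nonneg _)

lemma tendsto_pointProd (hc : IsDiracSum c) {f : ℕ → S → ℝ≥0} {g : S → ℝ≥0}
    (hf : ∀ n, Measurable (f n)) (hg : Measurable g)
    (h : ∀ x, Tendsto (fun n => f n x) atTop (𝓝 (g x))) :
    Tendsto (fun n => pointProd (f n) c) atTop (𝓝 (pointProd g c)) := by
  induction hc using IsDiracSum.induction with
  | h0 => simp [pointProd_zero]
  | h a μ hμ ih =>
    simp_rw [pointProd_add (hf _) (.dirac a) hμ, pointProd_add hg (.dirac a) hμ,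
      pointProd_dirac (hf _), pointProd_dirac hg]
    exact (NNReal.tendsto_coe.2 (h a)).mul ih

/-- The points are grouped by the value of `φ`; the floor reads off the integer number of points in
a fibre. -/
lemma ofReal_pointProd_simpleFunc (hc : IsDiracSum c) (φ : SimpleFunc S ℝ≥0) :
    ENNReal.ofReal (pointProd φ c) =
      ∏ z ∈ φ.range, (z : ℝ≥0∞) ^ ⌊(c (φ ⁻¹' {z})).toReal⌋₊ := by
  induction hc using IsDiracSum.induction with
  | h0 => simp [pointProd_zero]
  | h a μ hμ ih =>
    rw [pointProd_add φ.measurable (.dirac a) hμ, pointProd_dirac φ.measurable,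
      ENNReal.ofReal_mul (NNReal.coe_nonneg _), ih, ENNReal.ofReal_coe_nnreal]
    have h1 : ((φ a : ℝ≥0) : ℝ≥0∞) = ∏ z ∈ φ.range, if φ a = z then (z : ℝ≥0∞) else 1 := by
      rw [Finset.prod_ite_eq, if_pos (SimpleFunc.mem_range_self φ a)]
    rw [h1, ← Finset.prod_mul_distrib]
    refine Finset.prod_congr rfl fun z _ => ?_
    obtain ⟨n, hn⟩ := hμ.exists_natCast (φ.measurableSet_fiber z)
    rw [Measure.add_apply, Measure.dirac_apply' _ (φ.measurableSet_fiber z), hn]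
    by_cases h : φ a = z
    · have h2 : (φ ⁻¹' {z}).indicator (1 : S → ℝ≥0∞) a = 1 := by
        rw [indicator_of_mem (by simpa using h)]; rfl
      have h3 : (1 + (n : ℝ≥0∞)) = ((n + 1 : ℕ) : ℝ≥0∞) := by push_cast; ring
      rw [h2, h3, if_pos h]
      simp only [ENNReal.toReal_natCast, Nat.floor_natCast]
      rw [pow_succ, mul_comm]
    · have h2 : (φ ⁻¹' {z}).indicator (1 : S → ℝ≥0∞) a = 0 := by
        rw [indicator_of_notMem (by simpa using h)]
      rw [h2, if_neg h, zero_add, one_mul]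

end PointProd

section Functional

variable {X : Ω → Measure (E × ℝ≥0)} {μ : Measure (E × ℝ≥0)} {Q : Measure Ω}

/-- The fibres of `φ` are disjoint, so their counts are independent Poisson variables and the
expectation splits into factors `exp(z μ(B) - μ(B))`. -/
lemma IsPoissonRandomMeasure.lintegral_pointProd_simpleFunc (hX : IsPoissonRandomMeasure X μ Q)
    {t : ℝ≥0} (ht : μ (univ ×ˢ Iic t) ≠ ∞) (φ : SimpleFunc (E × ℝ≥0) ℝ≥0) :
    ∫⁻ ω, ENNReal.ofReal (pointProd φ ((X ω).restrict (univ ×ˢ Iic t))) ∂Q =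
      ENNReal.ofReal (Real.exp ((∫⁻ x in univ ×ˢ Iic t, φ x ∂μ).toReal -
        (μ (univ ×ˢ Iic t)).toReal)) := by
  have hJ := measurableSet_univ_prod_Iic (E := E) t
  have hB : ∀ z : φ.range, MeasurableSet (φ ⁻¹' {(z : ℝ≥0)} ∩ univ ×ˢ Iic t) := fun z =>
    (φ.measurableSet_fiber z).inter hJ
  have hfin : ∀ z : ℝ≥0, μ (φ ⁻¹' {z} ∩ univ ×ˢ Iic t) ≠ ∞ := fun z =>
    ((measure_mono inter_subset_right).trans_lt (lt_top_iff_ne_top.2 ht)).ne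
  have hind := hX.iIndepFun_fintype hB (fun z w hzw => by
    refine Disjoint.mono inter_subset_left inter_subset_left ?_
    refine Disjoint.preimage _ ?_
    simpa using fun h => hzw (Subtype.ext h))
  have hmeas : ∀ z : φ.range, Measurable fun x : ℝ≥0∞ => ((z : ℝ≥0) : ℝ≥0∞) ^ ⌊x.toReal⌋₊ := by
    intro z
    have : Measurable fun n : ℕ => ((z : ℝ≥0) : ℝ≥0∞) ^ n := measurable_from_nat
    exact this.comp (Nat.measurable_floor.comp ENNReal.measurable_toReal)
  have h2 := lintegral_prod_eq_prod_lintegral_of_indepFun Finset.univ _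
    (hind.comp (fun (z : φ.range) (x : ℝ≥0∞) => ((z : ℝ≥0) : ℝ≥0∞) ^ ⌊x.toReal⌋₊) hmeas)
    (fun z => (hmeas z).comp (hX.measurable_apply (hB z)))
  have h1 : ∀ ω, ENNReal.ofReal (pointProd φ ((X ω).restrict (univ ×ˢ Iic t))) =
      ∏ z : φ.range, ((z : ℝ≥0) : ℝ≥0∞) ^ ⌊(X ω (φ ⁻¹' {(z : ℝ≥0)} ∩ univ ×ˢ Iic t)).toReal⌋₊ := by
    intro ω
    rw [ofReal_pointProd_simpleFunc ((hX.isConfiguration ω).isDiracSum_restrict hJ subset_rfl),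
      ← Finset.prod_coe_sort]
    refine Finset.prod_congr rfl fun z _ => ?_
    rw [Measure.restrict_apply (φ.measurableSet_fiber z)]
  simp_rw [h1]
  refine h2.trans ?_
  have h3 : ∀ z : φ.range, ∫⁻ ω, (((fun (x : ℝ≥0∞) => ((z : ℝ≥0) : ℝ≥0∞) ^ ⌊x.toReal⌋₊) ∘
      fun ω => X ω (φ ⁻¹' {(z : ℝ≥0)} ∩ univ ×ˢ Iic t)) ω) ∂Q =
      ENNReal.ofReal (Real.exp ((z : ℝ) * (μ (φ ⁻¹' {(z : ℝ≥0)} ∩ univ ×ˢ Iic t)).toReal -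
        (μ (φ ⁻¹' {(z : ℝ≥0)} ∩ univ ×ˢ Iic t)).toReal)) := by
    intro z
    have := lintegral_map (μ := Q) (hmeas z) (hX.measurable_apply (hB z))
    rw [hX.law _ (hB z), lintegral_comp_poissonLaw (hmeas z) (hfin z)] at this
    refine this.symm.trans ?_
    simp only [ENNReal.toReal_natCast, Nat.floor_natCast]
    rw [lintegral_pow_poissonMeasure, mul_comm]
    rfl
  refine (Finset.prod_congr rfl fun z _ => h3 z).trans ?_
  rw [← ENNReal.ofReal_prod_of_nonneg (fun _ _ => (Real.exp_pos _).le), ← Real.exp_sum,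
    Finset.sum_sub_distrib]
  have h4 : (∫⁻ x in univ ×ˢ Iic t, φ x ∂μ) =
      ∑ z : φ.range, ((z : ℝ≥0) : ℝ≥0∞) * μ (φ ⁻¹' {(z : ℝ≥0)} ∩ univ ×ˢ Iic t) := by
    have := SimpleFunc.map_lintegral (μ := μ.restrict (univ ×ˢ Iic t)) (fun z : ℝ≥0 => (z : ℝ≥0∞)) φ
    rw [← SimpleFunc.lintegral_eq_lintegral] at this
    refine this.trans ?_
    rw [← Finset.sum_coe_sort]
    refine Finset.sum_congr rfl fun z _ => ?_
    rw [Measure.restrict_apply (φ.measurableSet_fiber z)]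
  have h5 : μ (univ ×ˢ Iic t) = ∑ z : φ.range, μ (φ ⁻¹' {(z : ℝ≥0)} ∩ univ ×ˢ Iic t) := by
    have := SimpleFunc.map_lintegral (μ := μ.restrict (univ ×ˢ Iic t)) (fun z : ℝ≥0 => (1 : ℝ≥0∞)) φ
    rw [← SimpleFunc.lintegral_eq_lintegral] at this
    have h6 : ∫⁻ x, (SimpleFunc.map (fun z : ℝ≥0 => (1 : ℝ≥0∞)) φ) x ∂(μ.restrict (univ ×ˢ Iic t)) =
        μ (univ ×ˢ Iic t) := by simp
    rw [← h6]
    refine this.trans ?_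
    rw [← Finset.sum_coe_sort]
    refine Finset.sum_congr rfl fun z _ => ?_
    rw [Measure.restrict_apply (φ.measurableSet_fiber z), one_mul]
  have h6 := ENNReal.toReal_sum (s := Finset.univ)
    (f := fun z : φ.range => ((z : ℝ≥0) : ℝ≥0∞) * μ (φ ⁻¹' {(z : ℝ≥0)} ∩ univ ×ˢ Iic t))
    (fun z _ => ENNReal.mul_ne_top ENNReal.coe_ne_top (hfin z))
  rw [h4, h6]
  have h7 := ENNReal.toReal_sum (s := Finset.univ)
    (f := fun z : φ.range => μ (φ ⁻¹' {(z : ℝ≥0)} ∩ univ ×ˢ Iic t)) (fun z _ => hfin z)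
  conv_rhs => rw [h5, h7]
  simp [ENNReal.toReal_mul]

/-- Simple functions increasing to `g` make both the products over points and the integrals increase
to their limits, so monotone convergence extends the simple case. -/
theorem IsPoissonRandomMeasure.lintegral_pointProd (hX : IsPoissonRandomMeasure X μ Q)
    {t : ℝ≥0} (ht : μ (univ ×ˢ Iic t) ≠ ∞) {g : E × ℝ≥0 → ℝ≥0} (hg : Measurable g)
    (hfin : ∫⁻ x in univ ×ˢ Iic t, g x ∂μ ≠ ∞) :
    ∫⁻ ω, ENNReal.ofReal (pointProd g ((X ω).restrict (univ ×ˢ Iic t))) ∂Q =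
      ENNReal.ofReal (Real.exp ((∫⁻ x in univ ×ˢ Iic t, g x ∂μ).toReal -
        (μ (univ ×ˢ Iic t)).toReal)) := by
  have hJ := measurableSet_univ_prod_Iic (E := E) t
  let φ : ℕ → SimpleFunc (E × ℝ≥0) ℝ≥0 := fun n =>
    (SimpleFunc.eapprox (fun x => (g x : ℝ≥0∞)) n).map ENNReal.toNNReal
  have hφ : ∀ n x, ((φ n x : ℝ≥0) : ℝ≥0∞) = SimpleFunc.eapprox (fun x => (g x : ℝ≥0∞)) n x :=
    fun n x => ENNReal.coe_toNNReal (SimpleFunc.eapprox_lt_top _ n x).ne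
  have hmono : ∀ x, Monotone fun n => φ n x := by
    intro x a b hab
    have := SimpleFunc.monotone_eapprox (fun x => (g x : ℝ≥0∞)) hab x
    rw [← hφ, ← hφ] at this
    exact ENNReal.coe_le_coe.1 this
  have htend : ∀ x, Tendsto (fun n => φ n x) atTop (𝓝 (g x)) := by
    intro x
    have h1 := tendsto_atTop_iSup (f := fun n => ((φ n x : ℝ≥0) : ℝ≥0∞))
      (fun a b hab => ENNReal.coe_le_coe.2 (hmono x hab))
    simp_rw [hφ] at h1
    rw [SimpleFunc.iSup_eapprox_apply hg.coe_nnreal_ennreal] at h1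
    simp_rw [← hφ] at h1
    exact ENNReal.tendsto_coe.1 h1
  have hD : ∀ ω, IsDiracSum ((X ω).restrict (univ ×ˢ Iic t)) := fun ω =>
    (hX.isConfiguration ω).isDiracSum_restrict hJ subset_rfl
  have hlt := hX.lt_top
  have hm : ∀ f : E × ℝ≥0 → ℝ≥0, Measurable f →
      Measurable fun ω => ENNReal.ofReal (pointProd f ((X ω).restrict (univ ×ˢ Iic t))) := by
    intro f hf
    exact ENNReal.measurable_ofReal.comp
      (measurable_pointProd hX.measurable hlt (κ := fun p => f p.2) (hf.comp measurable_snd) t)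
  have hl := lintegral_tendsto_of_tendsto_of_monotone (μ := Q)
    (f := fun n ω => ENNReal.ofReal (pointProd (φ n) ((X ω).restrict (univ ×ˢ Iic t))))
    (F := fun ω => ENNReal.ofReal (pointProd g ((X ω).restrict (univ ×ˢ Iic t))))
    (fun n => (hm _ (φ n).measurable).aemeasurable)
    (ae_of_all _ fun ω a b hab => ENNReal.ofReal_le_ofReal
      (pointProd_mono (hD ω) (φ a).measurable (φ b).measurable fun x => hmono x hab))
    (ae_of_all _ fun ω => (ENNReal.continuous_ofReal.tendsto _).comp
      (tendsto_pointProd (hD ω) (fun n => (φ n).measurable) hg htend))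
  have hi := lintegral_tendsto_of_tendsto_of_monotone (μ := μ.restrict (univ ×ˢ Iic t))
    (f := fun n x => ((φ n x : ℝ≥0) : ℝ≥0∞)) (F := fun x => (g x : ℝ≥0∞))
    (fun n => (φ n).measurable.coe_nnreal_ennreal.aemeasurable)
    (ae_of_all _ fun x a b hab => ENNReal.coe_le_coe.2 (hmono x hab))
    (ae_of_all _ fun x => ENNReal.tendsto_coe.2 (htend x))
  simp_rw [hX.lintegral_pointProd_simpleFunc ht] at hl
  refine tendsto_nhds_unique hl ?_
  refine (ENNReal.continuous_ofReal.tendsto _).comp ((Real.continuous_exp.tendsto _).comp ?_)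
  exact ((ENNReal.tendsto_toReal hfin).comp hi).sub_const _

end Functional

/-! ### The cluster indicator as a function of the points and the coins -/

/-- The state of the indicator after `k` points, started at `b`. -/
def indicatorChain (b : Bool) (coin : ℕ+ → Bool) : ℕ → Bool
  | 0 => b
  | k + 1 => if indicatorChain b coin k = false then true else !coin (k + 1).toPNat'

/-- No measurability of `g` is required: against each Dirac mass `g ∘ τ` is almost surely constant.
The integrands to come depend on left limits of a path of `D` of which no measurability in time is
known. -/
lemma IsDiracSum.integrable_comp_time {S : Type*} [MeasurableSpace S] {c : Measure S}
    (hc : IsDiracSum c) {τ : S → ℝ≥0} (hτ : Measurable τ) (g : ℝ≥0 → ℝ) :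
    Integrable (fun x => g (τ x)) c := by
  induction hc using IsDiracSum.induction with
  | h0 => exact integrable_zero_measure
  | h a μ hμ ih =>
    refine Integrable.add_measure ?_ ih
    have hm : MeasurableSet {x | τ x = τ a} := hτ (measurableSet_singleton _)
    have h1 : ∀ᵐ x ∂(Measure.dirac a), τ x = τ a := by
      rw [ae_iff, Measure.dirac_apply' _ (by exact hm.compl)]
      simp
    refine (integrable_const (g (τ a))).congr ?_
    filter_upwards [h1] with x hx
    rw [hx]

section

variable {c : Measure (E × ℝ≥0)}

/-- The number of points of `m` strictly before time `t`. -/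
def countBefore (m : Measure (E × ℝ≥0)) (t : ℝ≥0) : ℕ := ⌊(m (univ ×ˢ Iio t)).toReal⌋₊

lemma IsConfiguration.count_eq_add (hc : IsConfiguration c) {t : ℝ≥0} {J K : Set ℝ≥0} (hK : MeasurableSet K) (hd : Disjoint J K)
    (h : Iic t = J ∪ K) {n : ℕ} (hn : c (univ ×ˢ K) = n) :
    count c t = ⌊(c (univ ×ˢ J)).toReal⌋₊ + n := by
  have h1 : c (univ ×ˢ Iic t) = c (univ ×ˢ J) + n := by
    rw [h, prod_union, measure_union _ (MeasurableSet.univ.prod hK), hn]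
    rw [Set.disjoint_prod]
    exact Or.inr hd
  have h2 : c (univ ×ˢ J) ≠ ∞ := by
    intro h3
    have := (hc.lt_top t).ne
    rw [h1, h3] at this
    simp at this
  rw [count, h1, ENNReal.toReal_add h2 (ENNReal.natCast_ne_top n), ENNReal.toReal_natCast,
    Nat.floor_add_natCast ENNReal.toReal_nonneg]

lemma IsConfiguration.count_eq_of_Ioc (hc : IsConfiguration c) {s t : ℝ≥0} (hst : s ≤ t)
    (h : c (univ ×ˢ Ioc s t) = 0) : count c t = count c s :=
  hc.count_eq_add measurableSet_Ioc (Iic_disjoint_Ioc le_rfl)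
    (Iic_union_Ioc_eq_Iic hst).symm (n := 0) (by simpa using h)

variable {coin : ℕ+ → Bool} {d : ℝ≥0 → Bool}

/-- The jump of the indicator at time `s`. -/
def indicatorJump (c : Measure (E × ℝ≥0)) (coin : ℕ+ → Bool) (d : ℝ≥0 → Bool) (s : ℝ≥0) : ℝ :=
  if Function.leftLim d s = false then 1
    else (if (!coin (count c s).toPNat') = true then 1 else 0) - 1

/-- For the test function `1_{d = 1}` the histories drop out and the equation closes on the path of
the indicator; this is the only test function needed. -/
lemma SolvesIndicatorEquation.eq_add (hc : IsConfiguration c)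
    (hd : SolvesIndicatorEquation c coin d (fun p => if p.1 = true then 1 else 0)) {s t : ℝ≥0}
    (hst : s ≤ t) :
    (if d t = true then (1 : ℝ) else 0) = (if d s = true then 1 else 0) +
      ∫ x in univ ×ˢ Ioc s t, indicatorJump c coin d x.2 ∂c := by
  have h1 : ∀ t, (if d t = true then (1 : ℝ) else 0) = (if d 0 = true then 1 else 0) +
      ∫ x in univ ×ˢ Iic t, indicatorJump c coin d x.2 ∂c := by
    intro t
    have := hd t
    simp only [if_true, Bool.false_eq_true, if_false, sub_zero] at this
    exact this
  have h2 : IntegrableOn (fun x => indicatorJump c coin d x.2) (univ ×ˢ Iic t) c :=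
    (hc.isDiracSum_restrict (measurableSet_univ_prod_Iic t) subset_rfl).integrable_comp_time
      measurable_snd _
  have hdis : Disjoint (univ ×ˢ Iic s : Set (E × ℝ≥0)) (univ ×ˢ Ioc s t) := by
    rw [Set.disjoint_prod]
    exact Or.inr (Iic_disjoint_Ioc le_rfl)
  rw [h1 t, h1 s, ← Iic_union_Ioc_eq_Iic hst, prod_union,
    setIntegral_union hdis (measurableSet_univ_prod_Ioc s t)
      (h2.mono_set (prod_mono_right (Iic_subset_Iic.2 hst)))
      (h2.mono_set (prod_mono_right Ioc_subset_Iic_self)), add_assoc]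

lemma SolvesIndicatorEquation.eq_of_Ioc (hc : IsConfiguration c)
    (hd : SolvesIndicatorEquation c coin d (fun p => if p.1 = true then 1 else 0)) {s t : ℝ≥0}
    (hst : s ≤ t) (h : c (univ ×ˢ Ioc s t) = 0) : d t = d s := by
  have := hd.eq_add hc hst
  rw [setIntegral_measure_zero _ h, add_zero] at this
  cases h1 : d t <;> cases h2 : d s <;> simp_all

lemma Ioc_eq_Ioo_union {s t : ℝ≥0} (h : s < t) : Ioc s t = Ioo s t ∪ {t} :=
  (Ioo_union_right h).symm

/-- Between points `d` is constant. At a point it moves by `indicatorJump`, which is one transition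
of the chain; the coin used is numbered by the points so far, the present one included. Simplicity
excludes two transitions at once. -/
theorem SolvesIndicatorEquation.eq_indicatorChain (hc : IsSimple c)
    (hd : SolvesIndicatorEquation c coin d (fun p => if p.1 = true then 1 else 0)) (t : ℝ≥0) :
    d t = indicatorChain (d 0) coin (count c t) := by
  have hcc := hc.isConfiguration
  induction t using nnreal_induction with
  | h1 t ih =>
    rcases eq_or_ne t 0 with rfl | ht
    · have h2 : (Iic (0 : ℝ≥0)) = {0} := by ext; simp
      rw [count, h2, hc.zero]
      simp [indicatorChain]
    have hpos : 0 < t := pos_iff_ne_zero.2 ht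
    have : (𝓝[<] t).NeBot := nhdsLT_neBot_of_exists_lt ⟨0, hpos⟩
    obtain ⟨r, hr, hrt⟩ := ((hcc.eventually_left t).and self_mem_nhdsWithin).exists
    have hrt' : r < t := hrt
    have hleft : Function.leftLim d t = d r := by
      refine leftLim_eq_of_tendsto ?_
      refine tendsto_const_nhds.congr' ?_
      filter_upwards [Ioo_mem_nhdsLT hrt'] with s hs
      exact (hd.eq_of_Ioc hcc hs.1.le (measure_mono_null
        (prod_mono_right (Ioc_subset_Ioo_right hs.2)) hr)).symm
    obtain ⟨n, hn⟩ := hcc.exists_natCast (measurableSet_univ_prod_singleton t)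
      (t := t) (prod_mono_right (by simp))
    have hn1 : n ≤ 1 := by
      have := hc.le_one t
      rw [hn] at this
      exact_mod_cast this
    have hIoc : c (univ ×ˢ Ioc r t) = n := by
      rw [Ioc_eq_Ioo_union hrt', prod_union, measure_union _ (measurableSet_univ_prod_singleton t),
        hr, hn, zero_add]
      rw [Set.disjoint_prod]
      exact Or.inr (by simp)
    have hcount : count c t = count c r + n := hcc.count_eq_add
      measurableSet_Ioc (Iic_disjoint_Ioc le_rfl) (Iic_union_Ioc_eq_Iic hrt'.le).symm hIoc
    interval_cases n
    · rw [hd.eq_of_Ioc hcc hrt'.le (by simpa using hIoc), hcount, add_zero]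
      exact ih r hrt'
    · have h1 := hd.eq_add hcc hrt'.le
      have h2 : ∫ x in univ ×ˢ Ioc r t, indicatorJump c coin d x.2 ∂c = indicatorJump c coin d t := by
        have h3 : ∫ x in univ ×ˢ Ioc r t, indicatorJump c coin d x.2 ∂c =
            ∫ x in univ ×ˢ Ioc r t, indicatorJump c coin d t ∂c := by
          refine integral_congr_ae ?_
          rw [EventuallyEq, ae_restrict_iff' (measurableSet_univ_prod_Ioc r t)]
          have : ∀ᵐ x ∂c, x ∉ (univ ×ˢ Ioo r t : Set (E × ℝ≥0)) := measure_eq_zero_iff_ae_notMem.1 hr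
          filter_upwards [this] with x hx hx'
          have : x.2 = t := by
            by_contra hne
            exact hx ⟨mem_univ _, hx'.2.1, lt_of_le_of_ne hx'.2.2 hne⟩
          rw [this]
        rw [h3, setIntegral_const, Measure.real, hIoc]
        simp
      rw [h2, indicatorJump, hleft] at h1
      rw [hcount, indicatorChain, ← ih r hrt']
      rw [hcount] at h1
      revert h1
      generalize d t = a
      generalize d r = b
      generalize coin (count c r + 1).toPNat' = e
      cases a <;> cases b <;> cases e <;> norm_num
  | h2 t ih =>
    filter_upwards [hcc.eventually_right t, self_mem_nhdsWithin] with s hs hts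
    have hts' : t < s := hts
    rw [hd.eq_of_Ioc hcc hts'.le hs, hcc.count_eq_of_Ioc hts'.le hs]
    exact ih t le_rfl

theorem SolvesIndicatorEquation.leftLim_eq_indicatorChain (hc : IsSimple c)
    (hd : SolvesIndicatorEquation c coin d (fun p => if p.1 = true then 1 else 0)) (t : ℝ≥0) :
    Function.leftLim d t = indicatorChain (d 0) coin (countBefore c t) := by
  have hcc := hc.isConfiguration
  rcases eq_or_ne t 0 with rfl | ht
  · have h1 : (Iio (0 : ℝ≥0)) = ∅ := by ext; simp
    rw [leftLim_eq_of_eq_bot _ (by rw [h1]; simp), countBefore, h1]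
    simp [indicatorChain]
  have hpos : 0 < t := pos_iff_ne_zero.2 ht
  have : (𝓝[<] t).NeBot := nhdsLT_neBot_of_exists_lt ⟨0, hpos⟩
  obtain ⟨r, hr, hrt⟩ := ((hcc.eventually_left t).and self_mem_nhdsWithin).exists
  have hrt' : r < t := hrt
  have hleft : Function.leftLim d t = d r := by
    refine leftLim_eq_of_tendsto ?_
    refine tendsto_const_nhds.congr' ?_
    filter_upwards [Ioo_mem_nhdsLT hrt'] with s hs
    exact (hd.eq_of_Ioc hcc hs.1.le (measure_mono_null
      (prod_mono_right (Ioc_subset_Ioo_right hs.2)) hr)).symm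
  rw [hleft, hd.eq_indicatorChain hc, count, countBefore, ← Iic_union_Ioo_eq_Iio hrt', prod_union]
  congr 3
  refine le_antisymm (measure_mono subset_union_left) ((measure_union_le _ _).trans ?_)
  rw [hr, add_zero]

end

/-! ### Joint measurability of histories, counts and the chain -/

section Measurability

variable {Ω' : Type*} [MeasurableSpace Ω'] {X : Ω' → Measure (E × ℝ≥0)}

lemma measurable_historyBefore (hX : Measurable X) (hfin : ∀ ω t, X ω (univ ×ˢ Iic t) < ∞) :
    Measurable fun p : Ω' × (E × ℝ≥0) => historyBefore (X p.1) p.2.2 := by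
  refine Measure.measurable_of_measurable_coe _ fun B hB => ?_
  have hm : MeasurableSet {q : (Ω' × (E × ℝ≥0)) × (E × ℝ≥0) | q.2 ∈ B ∧ q.2.2 < q.1.2.2} :=
    (measurable_snd hB).inter (measurableSet_lt (by fun_prop) (by fun_prop))
  have h1 := measurable_lintegral_toKernel (X := fun p : Ω' × (E × ℝ≥0) => X p.1)
    (hX.comp measurable_fst) (fun p => hfin p.1) ((measurable_const (a := (1 : ℝ≥0∞))).indicator hm)
  convert h1 using 2 with p
  rw [historyBefore, Measure.restrict_apply hB, ← lintegral_indicator_one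
    (hB.inter (measurableSet_univ_prod_Iio _))]
  congr 1 with x
  by_cases h : x ∈ B ∧ x.2 < p.2.2
  · rw [indicator_of_mem (show x ∈ B ∩ univ ×ˢ Iio p.2.2 from ⟨h.1, mem_univ _, h.2⟩),
      indicator_of_mem (by exact h)]
    rfl
  · rw [indicator_of_notMem (fun h' => h ⟨h'.1, h'.2.2⟩), indicator_of_notMem (by exact h)]

lemma measurable_countBefore (hX : Measurable X) (hfin : ∀ ω t, X ω (univ ×ˢ Iic t) < ∞) :
    Measurable fun p : Ω' × (E × ℝ≥0) => countBefore (X p.1) p.2.2 := by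
  have h := (Measure.measurable_coe MeasurableSet.univ).comp (measurable_historyBefore hX hfin)
  have h2 : (fun p : Ω' × (E × ℝ≥0) => countBefore (X p.1) p.2.2) =
      fun p => ⌊(historyBefore (X p.1) p.2.2 univ).toReal⌋₊ := by
    funext p
    rw [countBefore, historyBefore, Measure.restrict_apply_univ]
  rw [h2]
  exact Nat.measurable_floor.comp (ENNReal.measurable_toReal.comp h)

lemma measurable_indicatorChain {b : Ω' → Bool} (hb : Measurable b) {coin : ℕ+ → Ω' → Bool}
    (hcoin : ∀ k, Measurable (coin k)) (n : ℕ) :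
    Measurable fun ω => indicatorChain (b ω) (fun k => coin k ω) n := by
  induction n with
  | zero => exact hb
  | succ n ih =>
    have h : Measurable fun q : Bool × Bool => if q.1 = false then true else !q.2 :=
      measurable_of_finite _
    exact h.comp (ih.prodMk (hcoin _))

lemma measurable_indicatorChain_countBefore (hX : Measurable X)
    (hfin : ∀ ω t, X ω (univ ×ˢ Iic t) < ∞) {b : Ω' → Bool} (hb : Measurable b)
    {coin : ℕ+ → Ω' → Bool} (hcoin : ∀ k, Measurable (coin k)) :
    Measurable fun p : Ω' × (E × ℝ≥0) =>
      indicatorChain (b p.1) (fun k => coin k p.1) (countBefore (X p.1) p.2.2) := by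
  have h : Measurable fun q : (Ω' × (E × ℝ≥0)) × ℕ =>
      indicatorChain (b q.1.1) (fun k => coin k q.1.1) q.2 :=
    measurable_from_prod_countable_left fun n =>
      (measurable_indicatorChain hb hcoin n).comp measurable_fst
  exact h.comp (measurable_id.prodMk (measurable_countBefore hX hfin))

end Measurability

/-! ### Integrals against several measures -/

section SumMeasure

variable {S S' : Type*} [MeasurableSpace S] [MeasurableSpace S']

/-- The measure on a disjoint union with the given restrictions to both parts. -/
def sumMeasure (μ : Measure S) (ρ : Measure S') : Measure (S ⊕ S') :=
  μ.map Sum.inl + ρ.map Sum.inr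

variable {μ : Measure S} {ρ : Measure S'}

instance [SFinite μ] [SFinite ρ] : SFinite (sumMeasure μ ρ) := by
  unfold sumMeasure; infer_instance

lemma measurableEmbedding_sum_inl : MeasurableEmbedding (Sum.inl : S → S ⊕ S') where
  injective := Sum.inl_injective
  measurable := measurable_inl
  measurableSet_image' := fun _ hs => measurableSet_inl_image.2 hs

lemma measurableEmbedding_sum_inr : MeasurableEmbedding (Sum.inr : S' → S ⊕ S') where
  injective := Sum.inr_injective
  measurable := measurable_inr
  measurableSet_image' := fun _ hs => measurableSet_inr_image.2 hs

lemma integrableOn_sumMeasure {f : S ⊕ S' → ℝ} {A : Set (S ⊕ S')} :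
    IntegrableOn f A (sumMeasure μ ρ) ↔
      IntegrableOn (f ∘ Sum.inl) (Sum.inl ⁻¹' A) μ ∧ IntegrableOn (f ∘ Sum.inr) (Sum.inr ⁻¹' A) ρ := by
  rw [sumMeasure, integrableOn_add_measure, measurableEmbedding_sum_inl.integrableOn_map_iff,
    measurableEmbedding_sum_inr.integrableOn_map_iff]

lemma setIntegral_sumMeasure {f : S ⊕ S' → ℝ} {A : Set (S ⊕ S')}
    (hf : IntegrableOn f A (sumMeasure μ ρ)) :
    ∫ x in A, f x ∂(sumMeasure μ ρ) =
      ∫ x in Sum.inl ⁻¹' A, f (Sum.inl x) ∂μ + ∫ x in Sum.inr ⁻¹' A, f (Sum.inr x) ∂ρ := by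
  have hf' := hf
  rw [sumMeasure, integrableOn_add_measure] at hf'
  rw [sumMeasure, Measure.restrict_add, integral_add_measure hf'.1 hf'.2,
    measurableEmbedding_sum_inl.setIntegral_map, measurableEmbedding_sum_inr.setIntegral_map]

end SumMeasure

/-- A Dirac mass charges the time of its own point. For two configurations without common times,
this shows that the other one does not jump at almost every point of the first. -/
lemma IsDiracSum.ae_fiber_ne_zero {S : Type*} [MeasurableSpace S] {c : Measure S}
    (hc : IsDiracSum c) {τ : S → ℝ≥0} (hτ : Measurable τ) : ∀ᵐ y ∂c, c {x | τ x = τ y} ≠ 0 := by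
  induction hc using IsDiracSum.induction with
  | h0 => simp
  | h a μ hμ ih =>
    have hm : MeasurableSet {x | τ x = τ a} := hτ (measurableSet_singleton _)
    rw [ae_add_measure_iff]
    constructor
    · have h1 : ∀ᵐ x ∂(Measure.dirac a), τ x = τ a := by
        rw [ae_iff, Measure.dirac_apply' _ (by exact hm.compl)]
        simp
      filter_upwards [h1] with x hx
      rw [hx, Measure.add_apply, Measure.dirac_apply' _ hm]
      simp
    · filter_upwards [ih] with x hx
      rw [Measure.add_apply]
      exact fun h => hx (add_eq_zero.1 h).2

lemma IsConfiguration.ae_ne_zero {c : Measure (E × ℝ≥0)} (hc : IsConfiguration c) (t : ℝ≥0) :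
    ∀ᵐ y ∂(c.restrict (univ ×ˢ Iic t)), c (univ ×ˢ {y.2}) ≠ 0 := by
  have h := (hc.isDiracSum_restrict (measurableSet_univ_prod_Iic t) subset_rfl).ae_fiber_ne_zero
    measurable_snd
  filter_upwards [h] with y hy h0
  refine hy (le_antisymm ((Measure.restrict_apply_le _ _).trans ?_) zero_le)
  rw [← h0]
  refine measure_mono fun x hx => ⟨mem_univ _, hx⟩

lemma countable_times (c : Measure (E × ℝ≥0)) [SFinite c] :
    {s : ℝ≥0 | c (univ ×ˢ {s}) ≠ 0}.Countable := by
  have h := Measure.countable_meas_pos_of_disjoint_iUnion (μ := c)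
    (As := fun s : ℝ≥0 => (univ ×ˢ {s} : Set (E × ℝ≥0)))
    (fun s => measurableSet_univ_prod_singleton s) (fun s t hst => by
      rw [Function.onFun, Set.disjoint_prod]
      exact Or.inr (by simpa using hst))
  simpa [pos_iff_ne_zero] using h

section Compensated

variable {c m : Measure (E × ℝ≥0)} {h : E × ℝ≥0 → ℝ}

/-- The time of a point in a disjoint union of two copies of the marked half-line. -/
def sumTime : (E × ℝ≥0) ⊕ (E × ℝ≥0) → ℝ≥0 := Sum.elim Prod.snd Prod.snd

lemma measurable_sumTime : Measurable (sumTime (E := E)) :=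
  measurable_snd.sumElim measurable_snd

/-- The signed measure `c - m` is replaced by a positive measure on two copies of the space, the
sign moving into the integrand, so that the product rule applies to compensated integrals. -/
lemma integrableOn_compensated {J : Set ℝ≥0} :
    IntegrableOn (Sum.elim h (-h)) (sumTime ⁻¹' J) (sumMeasure c m) ↔
      IntegrableOn h (univ ×ˢ J) c ∧ IntegrableOn h (univ ×ˢ J) m := by
  have h1 : (Prod.snd ⁻¹' J : Set (E × ℝ≥0)) = univ ×ˢ J := by ext; simp
  rw [integrableOn_sumMeasure]
  have h2 : Sum.inl ⁻¹' (sumTime ⁻¹' J) = (univ ×ˢ J : Set (E × ℝ≥0)) := h1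
  have h3 : Sum.inr ⁻¹' (sumTime ⁻¹' J) = (univ ×ˢ J : Set (E × ℝ≥0)) := h1
  rw [h2, h3, Sum.elim_comp_inl, Sum.elim_comp_inr, integrableOn_neg_iff]

lemma setIntegral_compensated {J : Set ℝ≥0} (h1 : IntegrableOn h (univ ×ˢ J) c)
    (h2 : IntegrableOn h (univ ×ˢ J) m) :
    ∫ x in sumTime ⁻¹' J, Sum.elim h (-h) x ∂(sumMeasure c m) =
      ∫ x in univ ×ˢ J, h x ∂c - ∫ x in univ ×ˢ J, h x ∂m := by
  have h0 : (Prod.snd ⁻¹' J : Set (E × ℝ≥0)) = univ ×ˢ J := by ext; simp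
  rw [setIntegral_sumMeasure (integrableOn_compensated.2 ⟨h1, h2⟩)]
  have h3 : Sum.inl ⁻¹' (sumTime ⁻¹' J) = (univ ×ˢ J : Set (E × ℝ≥0)) := h0
  have h4 : Sum.inr ⁻¹' (sumTime ⁻¹' J) = (univ ×ˢ J : Set (E × ℝ≥0)) := h0
  rw [h3, h4]
  simp only [Sum.elim_inl, Sum.elim_inr, Pi.neg_apply, integral_neg, ← sub_eq_add_neg]

end Compensated

/-- The product rule for two solutions without common jumps. -/
theorem SolvesPath.mul {ν : Measure E} [IsFiniteMeasure ν]
    {c₁ c₂ : Measure (E × ℝ≥0)} {κ₁ κ₂ : E × ℝ≥0 → ℝ≥0} {L₁ L₂ : ℝ≥0 → ℝ}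
    (hκ₁ : Measurable κ₁) (hc₁ : IsSimple c₁) (hc₂ : IsSimple c₂)
    (hcc : ∀ s, c₁ (univ ×ˢ {s}) = 0 ∨ c₂ (univ ×ˢ {s}) = 0)
    (h₁ : SolvesPath ν c₁ κ₁ L₁) (h₂ : SolvesPath ν c₂ κ₂ L₂) (t : ℝ≥0) :
    (IntegrableOn (fun x => ((κ₁ x : ℝ) - 1) * Function.leftLim L₁ x.2 * Function.leftLim L₂ x.2)
      (univ ×ˢ Iic t) c₁ ∧
    IntegrableOn (fun x => ((κ₁ x : ℝ) - 1) * Function.leftLim L₁ x.2 * Function.leftLim L₂ x.2)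
      (univ ×ˢ Iic t) (ν.prod timeMeasure)) ∧
    (IntegrableOn (fun x => ((κ₂ x : ℝ) - 1) * Function.leftLim L₂ x.2 * Function.leftLim L₁ x.2)
      (univ ×ˢ Iic t) c₂ ∧
    IntegrableOn (fun x => ((κ₂ x : ℝ) - 1) * Function.leftLim L₂ x.2 * Function.leftLim L₁ x.2)
      (univ ×ˢ Iic t) (ν.prod timeMeasure)) ∧
    L₁ t * L₂ t = 1 +
      (((∫ x in univ ×ˢ Iic t,
          ((κ₁ x : ℝ) - 1) * Function.leftLim L₁ x.2 * Function.leftLim L₂ x.2 ∂c₁) -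
        ∫ x in univ ×ˢ Iic t,
          ((κ₁ x : ℝ) - 1) * Function.leftLim L₁ x.2 * Function.leftLim L₂ x.2 ∂(ν.prod timeMeasure)) +
      ((∫ x in univ ×ˢ Iic t,
          ((κ₂ x : ℝ) - 1) * Function.leftLim L₂ x.2 * Function.leftLim L₁ x.2 ∂c₂) -
        ∫ x in univ ×ˢ Iic t,
          ((κ₂ x : ℝ) - 1) * Function.leftLim L₂ x.2 * Function.leftLim L₁ x.2
            ∂(ν.prod timeMeasure))) := by
  have := hc₁.isConfiguration.sigmaFinite
  have := hc₂.isConfiguration.sigmaFinite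
  set m := ν.prod timeMeasure with hm
  set f₁ : E × ℝ≥0 → ℝ := fun x => ((κ₁ x : ℝ) - 1) * Function.leftLim L₁ x.2 with hf₁
  set f₂ : E × ℝ≥0 → ℝ := fun x => ((κ₂ x : ℝ) - 1) * Function.leftLim L₂ x.2 with hf₂
  have hL₁ : ∀ r, L₁ r = 1 + ∫ x in {x | sumTime x ≤ r}, Sum.elim f₁ (-f₁) x ∂(sumMeasure c₁ m) := by
    intro r
    rw [(h₁ r).2.2]
    exact congrArg _ (setIntegral_compensated (h₁ r).1 (h₁ r).2.1).symm
  have hL₂ : ∀ r, L₂ r = 1 + ∫ x in {x | sumTime x ≤ r}, Sum.elim f₂ (-f₂) x ∂(sumMeasure c₂ m) := by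
    intro r
    rw [(h₂ r).2.2]
    exact congrArg _ (setIntegral_compensated (h₂ r).1 (h₂ r).2.1).symm
  have hL₂' : ∀ r, Function.leftLim L₂ r =
      1 + ∫ x in {x | sumTime x < r}, Sum.elim f₂ (-f₂) x ∂(sumMeasure c₂ m) := by
    intro r
    rw [h₂.leftLim_eq hc₂]
    exact congrArg _ (setIntegral_compensated
      ((h₂ r).1.mono_set (prod_mono_right Iio_subset_Iic_self))
      ((h₂ r).2.1.mono_set (prod_mono_right Iio_subset_Iic_self))).symm
  -- The product rule is asymmetric: it leaves `L₂(s-)` in one integral and `L₁(s)` in the other.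
  obtain ⟨p1, p2, p3⟩ := product_rule (μ := sumMeasure c₁ m) (ρ := sumMeasure c₂ m)
    (measurable_sumTime (E := E)) (measurable_sumTime (E := E)) 1 1 (t := t)
    (f := Sum.elim f₁ (-f₁)) (g := Sum.elim f₂ (-f₂))
    (integrableOn_compensated.2 ⟨(h₁ t).1, (h₁ t).2.1⟩)
    (integrableOn_compensated.2 ⟨(h₂ t).1, (h₂ t).2.1⟩)
  rw [← hL₁, ← hL₂] at p3
  simp_rw [← hL₂'] at p1 p3
  simp_rw [← hL₁] at p2 p3
  have e1 : (fun x => Sum.elim f₁ (-f₁) x * Function.leftLim L₂ (sumTime x)) =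
      Sum.elim (fun x => f₁ x * Function.leftLim L₂ x.2) (-fun x => f₁ x * Function.leftLim L₂ x.2) := by
    funext x
    rcases x with x | x <;> simp [sumTime]
  have e2 : (fun x => Sum.elim f₂ (-f₂) x * L₁ (sumTime x)) =
      Sum.elim (fun x => f₂ x * L₁ x.2) (-fun x => f₂ x * L₁ x.2) := by
    funext x
    rcases x with x | x <;> simp [sumTime]
  rw [e1] at p1
  rw [e2] at p2
  have q1 := integrableOn_compensated (J := Iic t).1 p1
  have q2 := integrableOn_compensated (J := Iic t).1 p2
  have r1 : (∫ x in {x | sumTime x ≤ t}, Sum.elim f₁ (-f₁) x * Function.leftLim L₂ (sumTime x)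
      ∂(sumMeasure c₁ m)) = _ := (congrArg (fun F : (E × ℝ≥0) ⊕ (E × ℝ≥0) → ℝ =>
        ∫ x in {x | sumTime x ≤ t}, F x ∂(sumMeasure c₁ m)) e1).trans
      (setIntegral_compensated q1.1 q1.2)
  have r2 : (∫ x in {x | sumTime x ≤ t}, Sum.elim f₂ (-f₂) x * L₁ (sumTime x)
      ∂(sumMeasure c₂ m)) = _ := (congrArg (fun F : (E × ℝ≥0) ⊕ (E × ℝ≥0) → ℝ =>
        ∫ x in {x | sumTime x ≤ t}, F x ∂(sumMeasure c₂ m)) e2).trans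
      (setIntegral_compensated q2.1 q2.2)
  rw [r1, r2] at p3
  -- `L₁(s)` may be replaced by `L₁(s-)`: at points of `c₂` because `c₁` has none at that time, and
  -- under the mean measure because `c₁` has only countably many times (`a2`).
  have a1 : (fun x => f₂ x * L₁ x.2) =ᵐ[c₂.restrict (univ ×ˢ Iic t)]
      fun x => f₂ x * Function.leftLim L₁ x.2 := by
    filter_upwards [hc₂.isConfiguration.ae_ne_zero t] with x hx
    rw [h₁.leftLim_eq_self hκ₁ hc₁ ((hcc x.2).resolve_right hx)]
  have a2 : (fun x => f₂ x * L₁ x.2) =ᵐ[m.restrict (univ ×ˢ Iic t)]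
      fun x => f₂ x * Function.leftLim L₁ x.2 := by
    filter_upwards [ae_restrict_of_ae (prod_timeMeasure_countable ν (countable_times c₁))] with x hx
    rw [h₁.leftLim_eq_self hκ₁ hc₁ (not_not.1 hx)]
  refine ⟨q1, ⟨q2.1.congr_fun_ae a1, q2.2.congr_fun_ae a2⟩, ?_⟩
  rw [p3, integral_congr_ae a1, integral_congr_ae a2]
  ring

/-! ### Level sets of running integrals, and passage to the limit -/

section Truncation

variable {m : Measure (E × ℝ≥0)} {V : E × ℝ≥0 → ℝ≥0∞}

/-- Where a continuous increasing integral stays below a level is an initial interval. -/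
lemma exists_Iic_eq_lintegral_le (hm : m (univ ×ˢ {0}) = 0)
    (hm' : ∀ t, m (univ ×ˢ {t}) = 0) (t : ℝ≥0) (a : ℝ≥0∞) :
    ∃ T ≤ t, {r | r ≤ t ∧ ∫⁻ x in univ ×ˢ Iic r, V x ∂m ≤ a} = Iic T := by
  set G : ℝ≥0 → ℝ≥0∞ := fun r => ∫⁻ x in univ ×ˢ Iic r, V x ∂m with hG
  have hGm : ∀ r, G r = (m.withDensity V) (univ ×ˢ Iic r) := fun r =>
    (withDensity_apply _ (measurableSet_univ_prod_Iic r)).symm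
  have hmono : Monotone G := fun r s hrs =>
    lintegral_mono_set (prod_mono_right (Iic_subset_Iic.2 hrs))
  set A := {r | r ≤ t ∧ G r ≤ a} with hA
  have h0 : (0 : ℝ≥0) ∈ A := by
    refine ⟨zero_le, ?_⟩
    have h2 : (Iic (0 : ℝ≥0)) = {0} := by ext; simp
    rw [hG]
    simp only
    rw [h2, setLIntegral_measure_zero _ _ hm]
    exact zero_le
  have hbdd : BddAbove A := ⟨t, fun r hr => hr.1⟩
  have hT : sSup A ≤ t := csSup_le ⟨0, h0⟩ fun r hr => hr.1
  have hlt : ∀ r < sSup A, G r ≤ a := by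
    intro r hr
    obtain ⟨s, hs, hrs⟩ := exists_lt_of_lt_csSup ⟨0, h0⟩ hr
    exact (hmono hrs.le).trans hs.2
  -- The bound passes to the supremum by left-continuity, as single times carry no mass.
  -- Right-continuity is not used, so a jump of the integral from a finite value to `∞` is harmless.
  have hTa : G (sSup A) ≤ a := by
    rcases eq_or_ne (sSup A) 0 with h | h
    · rw [h]; exact h0.2
    · have hpos : 0 < sSup A := pos_iff_ne_zero.2 h
      have : (𝓝[<] (sSup A)).NeBot := nhdsLT_neBot_of_exists_lt ⟨0, hpos⟩
      have h1 := tendsto_measure_prod_Iic_left (m.withDensity V) hpos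
      have h2 : (m.withDensity V) (univ ×ˢ Iio (sSup A)) = G (sSup A) := by
        rw [hGm, ← Iio_union_right, prod_union]
        refine le_antisymm (measure_mono subset_union_left) ((measure_union_le _ _).trans ?_)
        rw [withDensity_absolutelyContinuous m V (hm' (sSup A)), add_zero]
      rw [h2] at h1
      refine le_of_tendsto h1 ?_
      filter_upwards [self_mem_nhdsWithin] with r hr
      rw [← hGm]
      exact hlt r hr
  refine ⟨sSup A, hT, ?_⟩
  ext r
  constructor
  · exact fun hr => le_csSup hbdd hr
  · exact fun hr => ⟨le_trans hr hT, (hmono hr).trans hTa⟩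

end Truncation

/-- Scheffé's lemma. -/
lemma tendsto_integral_mul_of_scheffe {Q : Measure Ω} {f : ℕ → Ω → ℝ} {g : Ω → ℝ}
    {Z : ℕ → Ω → ℝ} {Y : Ω → ℝ} {a : ℝ}
    (hf : ∀ n, Integrable (f n) Q) (hf0 : ∀ n, ∀ᵐ ω ∂Q, 0 ≤ f n ω) (hg : Integrable g Q)
    (hg0 : ∀ᵐ ω ∂Q, 0 ≤ g ω) (hfg : ∀ᵐ ω ∂Q, Tendsto (fun n => f n ω) atTop (𝓝 (g ω)))
    (hint : ∀ n, ∫ ω, f n ω ∂Q = ∫ ω, g ω ∂Q) (hZ : ∀ n, AEStronglyMeasurable (Z n) Q)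
    (hZa : ∀ n, ∀ᵐ ω ∂Q, |Z n ω| ≤ a)
    (hZY : ∀ᵐ ω ∂Q, Tendsto (fun n => Z n ω) atTop (𝓝 (Y ω))) :
    Tendsto (fun n => ∫ ω, f n ω * Z n ω ∂Q) atTop (𝓝 (∫ ω, g ω * Y ω ∂Q)) := by
  have hpos : Tendsto (fun n => ∫ ω, max (g ω - f n ω) 0 ∂Q) atTop (𝓝 0) := by
    have := tendsto_integral_of_dominated_convergence (μ := Q)
      (F := fun n ω => max (g ω - f n ω) 0) (f := fun _ => (0 : ℝ)) g
      (fun n => ((hg.sub (hf n)).pos_part).aestronglyMeasurable) hg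
      (fun n => by
        filter_upwards [hf0 n, hg0] with ω h1 h2
        rw [Real.norm_eq_abs, abs_of_nonneg (le_max_right _ _)]
        exact max_le (by linarith) h2)
      (by
        filter_upwards [hfg] with ω h
        have := ((h.const_sub (g ω)).max (tendsto_const_nhds (x := (0 : ℝ))))
        simpa using this)
    simpa using this
  have habs : Tendsto (fun n => ∫ ω, |f n ω - g ω| ∂Q) atTop (𝓝 0) := by
    -- Equal means cancel `∫ (f n - g)`, so only the positive part of `g - f n` is left, and this is
    -- dominated by `g`.
    have h1 : ∀ n, ∫ ω, |f n ω - g ω| ∂Q = 2 * ∫ ω, max (g ω - f n ω) 0 ∂Q := by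
      intro n
      have h2 : ∀ ω, |f n ω - g ω| = (f n ω - g ω) + 2 * max (g ω - f n ω) 0 := by
        intro ω
        rcases le_total (f n ω) (g ω) with h | h
        · rw [abs_of_nonpos (by linarith), max_eq_left (by linarith)]; ring
        · rw [abs_of_nonneg (by linarith), max_eq_right (by linarith)]; ring
      simp_rw [h2]
      have h3 : Integrable (fun ω => f n ω - g ω) Q := (hf n).sub hg
      have h4 : Integrable (fun ω => 2 * max (g ω - f n ω) 0) Q :=
        ((hg.sub (hf n)).pos_part).const_mul 2
      rw [integral_add h3 h4, integral_sub (hf n) hg, hint, sub_self, zero_add, integral_const_mul]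
    simp_rw [h1]
    simpa using hpos.const_mul 2
  have hfZ : ∀ n, Integrable (fun ω => f n ω * Z n ω) Q := fun n =>
    (hf n).mul_bdd (c := a) (hZ n) (hZa n)
  have hgZ : ∀ n, Integrable (fun ω => g ω * Z n ω) Q := fun n => hg.mul_bdd (c := a) (hZ n) (hZa n)
  have h1 : Tendsto (fun n => ∫ ω, g ω * Z n ω ∂Q) atTop (𝓝 (∫ ω, g ω * Y ω ∂Q)) := by
    refine tendsto_integral_of_dominated_convergence (fun ω => a * |g ω|)
      (fun n => (hgZ n).aestronglyMeasurable) (hg.abs.const_mul a) (fun n => ?_) ?_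
    · filter_upwards [hZa n] with ω h
      rw [norm_mul, mul_comm, Real.norm_eq_abs, Real.norm_eq_abs]
      exact mul_le_mul_of_nonneg_right h (abs_nonneg _)
    · filter_upwards [hZY] with ω h
      exact h.const_mul _
  have h2 : Tendsto (fun n => ∫ ω, f n ω * Z n ω ∂Q - ∫ ω, g ω * Z n ω ∂Q) atTop (𝓝 0) := by
    refine squeeze_zero_norm (a := fun n => a * ∫ ω, |f n ω - g ω| ∂Q) (fun n => ?_)
      (by simpa using habs.const_mul a)
    rw [← integral_sub (hfZ n) (hgZ n), ← integral_const_mul]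
    refine norm_integral_le_of_norm_le (((hf n).sub hg).abs.const_mul a) ?_
    filter_upwards [hZa n] with ω h
    rw [← sub_mul, norm_mul, mul_comm, Real.norm_eq_abs, Real.norm_eq_abs]
    exact mul_le_mul_of_nonneg_right h (abs_nonneg _)
  simpa using h2.add h1

/-! ### Predictable versions of left limits -/

section Predictable

variable {ℱ : Filtration ℝ≥0 mΩ}

/-- `limUnder` is measurable whether or not the limit exists, so this version is predictable
everywhere although the densities have left limits only almost surely. -/
lemma exists_predictable_leftLim {Y : ℝ≥0 → Ω → ℝ} (hY : ∀ t, Measurable[ℱ t] (Y t)) :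
    ∃ H : Ω × (E × ℝ≥0) → ℝ, Measurable[predictableMarked E ℱ] H ∧
      ∀ ω, (∀ t, Tendsto (fun s => Y s ω) (𝓝[<] t) (𝓝 (Function.leftLim (fun s => Y s ω) t))) →
        ∀ x, H (ω, x) = Function.leftLim (fun s => Y s ω) x.2 := by
  refine ⟨fun p => limUnder atTop fun n => Y (gridBefore n p.2.2) p.1, ?_, fun ω h x => ?_⟩
  · have h1 := @StronglyMeasurable.limUnder ℕ (Ω × (E × ℝ≥0)) ℝ (predictableMarked E ℱ) _ _ atTop _
      (fun n p => Y (gridBefore n p.2.2) p.1) _ _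
      (fun n => (measurable_gridBefore_predictable hY n).stronglyMeasurable)
    exact h1.measurable
  · rcases eq_or_ne x.2 0 with h0 | h0
    · have h1 : (Iio (0 : ℝ≥0)) = ∅ := by ext; simp
      simp only [h0, gridBefore_zero]
      rw [tendsto_const_nhds.limUnder_eq, leftLim_eq_of_eq_bot _ (by rw [h1]; simp)]
    · exact ((h x.2).comp (tendsto_gridBefore (pos_iff_ne_zero.2 h0))).limUnder_eq

lemma measurable_leftLim_predictable {D : ℝ≥0 → Ω → Bool} (hD : ∀ t, Measurable[ℱ t] (D t))
    (hc : ∀ ω, IsCadlag fun t => D t ω) :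
    Measurable[predictableMarked E ℱ] fun p : Ω × (E × ℝ≥0) =>
      Function.leftLim (fun s => D s p.1) p.2.2 := by
  refine @measurable_of_tendsto_metrizable _ _ (predictableMarked E ℱ) _ _ _ _
    (fun n p => D (gridBefore n p.2.2) p.1) _
    (fun n => measurable_gridBefore_predictable hD n) (tendsto_pi_nhds.2 fun p => ?_)
  rcases eq_or_ne p.2.2 0 with h0 | h0
  · have h1 : (Iio (0 : ℝ≥0)) = ∅ := by ext; simp
    simp only [h0, gridBefore_zero]
    rw [leftLim_eq_of_eq_bot _ (by rw [h1]; simp)]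
    exact tendsto_const_nhds
  · have hpos := pos_iff_ne_zero.2 h0
    have : (𝓝[<] p.2.2).NeBot := nhdsLT_neBot_of_exists_lt ⟨0, hpos⟩
    obtain ⟨l, hl⟩ := (hc p.1 p.2.2).2
    rw [leftLim_eq_of_tendsto hl]
    exact hl.comp (tendsto_gridBefore hpos)

/-- A left-continuous adapted extended process, null at time zero, is predictable. -/
lemma measurable_predictable_of_left {Y : ℝ≥0 → Ω → ℝ≥0∞} (hY : ∀ t, Measurable[ℱ t] (Y t))
    {Z : ℝ≥0 → Ω → ℝ≥0∞} (hZ0 : ∀ ω, Z 0 ω = 0)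
    (hZ : ∀ ω t, 0 < t → Tendsto (fun s => Y s ω) (𝓝[<] t) (𝓝 (Z t ω))) :
    Measurable[predictableMarked E ℱ] fun p : Ω × (E × ℝ≥0) => Z p.2.2 p.1 := by
  have hS : MeasurableSet[predictableMarked E ℱ] {p : Ω × (E × ℝ≥0) | p.2.2 ∈ ({0}ᶜ : Set ℝ≥0)} :=
    measurable_time_predictable (measurableSet_singleton (0 : ℝ≥0)).compl
  refine @measurable_of_tendsto_metrizable _ _ (predictableMarked E ℱ) _ _ _ _
    (fun n => {p : Ω × (E × ℝ≥0) | p.2.2 ∈ ({0}ᶜ : Set ℝ≥0)}.indicator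
      fun p => Y (gridBefore n p.2.2) p.1) _
    (fun n => Measurable.indicator (measurable_gridBefore_predictable hY n) hS)
    (tendsto_pi_nhds.2 fun p => ?_)
  rcases eq_or_ne p.2.2 0 with h0 | h0
  · have : p ∉ {p : Ω × (E × ℝ≥0) | p.2.2 ∈ ({0}ᶜ : Set ℝ≥0)} := by simpa using h0
    simp only [indicator_of_notMem this, h0, hZ0]
    exact tendsto_const_nhds
  · have : p ∈ {p : Ω × (E × ℝ≥0) | p.2.2 ∈ ({0}ᶜ : Set ℝ≥0)} := by simpa using h0
    simp only [indicator_of_mem this]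
    exact (hZ _ _ (pos_iff_ne_zero.2 h0)).comp (tendsto_gridBefore (pos_iff_ne_zero.2 h0))

lemma measurable_historyBefore_predictable {C : Ω → Measure (E × ℝ≥0)} {Q : Measure Ω}
    (hC : IsCompatible ℱ C Q) :
    Measurable[predictableMarked E ℱ] fun p : Ω × (E × ℝ≥0) => historyBefore (C p.1) p.2.2 := by
  refine Measure.measurable_of_measurable_coe _ fun B hB => ?_
  refine measurable_predictable_of_left (Y := fun t ω => (C ω).restrict (univ ×ˢ Iic t) B)
    (Z := fun t ω => historyBefore (C ω) t B)
    (fun t => (Measure.measurable_coe hB).comp (hC.adapted t)) (fun ω => ?_) (fun ω t ht => ?_)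
  · simp [historyBefore]
  · have := tendsto_measure_prod_Iic_left ((C ω).restrict B) ht
    rw [Measure.restrict_apply (measurableSet_univ_prod_Iio t)] at this
    simp_rw [Measure.restrict_apply (measurableSet_univ_prod_Iic _)] at this
    rw [historyBefore, Measure.restrict_apply hB, inter_comm]
    simp_rw [Measure.restrict_apply hB, inter_comm B]
    exact this

/-- Integrals of predictable functions up to time `t` are known at time `t`. -/
lemma measurable_setLIntegral_predictable {ρ : Measure (E × ℝ≥0)} [SFinite ρ]
    {H : Ω × (E × ℝ≥0) → ℝ≥0∞} (hH : Measurable[predictableMarked E ℱ] H) (t : ℝ≥0) :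
    Measurable[ℱ t] fun ω => ∫⁻ x in univ ×ˢ Iic t, H (ω, x) ∂ρ := by
  have h := measurable_indicator_predictable t hH
  have h2 : (fun ω => ∫⁻ x in univ ×ˢ Iic t, H (ω, x) ∂ρ) = fun ω =>
      ∫⁻ x, {p : Ω × (E × ℝ≥0) | p.2.2 ≤ t}.indicator H (ω, x) ∂ρ := by
    funext ω
    rw [← lintegral_indicator (measurableSet_univ_prod_Iic t), univ_prod_Iic]
    rfl
  rw [h2]
  exact @Measurable.lintegral_prod_right' _ _ (ℱ t) _ _ _ _ h

lemma setLIntegral_Iic_eq_Iio (ν : Measure E) [SFinite ν] (f : E × ℝ≥0 → ℝ≥0∞) (t : ℝ≥0) :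
    ∫⁻ x in univ ×ˢ Iic t, f x ∂(ν.prod timeMeasure) =
      ∫⁻ x in univ ×ˢ Iio t, f x ∂(ν.prod timeMeasure) := by
  rw [restrict_Iic_eq_add_singleton, lintegral_add_measure,
    setLIntegral_measure_zero _ _ (prod_timeMeasure_singleton ν t), add_zero]

/-- The running integral of a nonnegative predictable function against `ν(du) ds` is predictable. -/
lemma measurable_running_predictable {ν : Measure E} [SFinite ν]
    {H : Ω × (E × ℝ≥0) → ℝ≥0∞} (hH : Measurable[predictableMarked E ℱ] H) :
    Measurable[predictableMarked E ℱ] fun p : Ω × (E × ℝ≥0) =>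
      ∫⁻ x in univ ×ˢ Iic p.2.2, H (p.1, x) ∂(ν.prod timeMeasure) := by
  refine measurable_predictable_of_left
    (Y := fun t ω => ∫⁻ x in univ ×ˢ Iic t, H (ω, x) ∂(ν.prod timeMeasure))
    (Z := fun t ω => ∫⁻ x in univ ×ˢ Iic t, H (ω, x) ∂(ν.prod timeMeasure))
    (fun t => measurable_setLIntegral_predictable hH t) (fun ω => ?_) (fun ω t ht => ?_)
  · have h2 : (Iic (0 : ℝ≥0)) = {0} := by ext; simp
    rw [h2, setLIntegral_measure_zero _ _ (prod_timeMeasure_singleton ν 0)]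
  · have := tendsto_measure_prod_Iic_left ((ν.prod timeMeasure).withDensity fun x => H (ω, x)) ht
    rw [withDensity_apply _ (measurableSet_univ_prod_Iio t)] at this
    simp_rw [withDensity_apply _ (measurableSet_univ_prod_Iic _)] at this
    rwa [← setLIntegral_Iic_eq_Iio ν] at this

end Predictable

/-! ### Processes driven by two compensated random measures -/

section Driven

variable {ℱ : Filtration ℝ≥0 mΩ} {Q : Measure Ω} {ν : Measure E} {X Y : Ω → Measure (E × ℝ≥0)}
  {h k f g : Ω × (E × ℝ≥0) → ℝ} {U : ℝ≥0 → Ω → ℝ}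

/-- The integral of `f` against the compensated random measure `X - ν(du) ds`. -/
def compInt (ν : Measure E) (X : Ω → Measure (E × ℝ≥0)) (f : Ω × (E × ℝ≥0) → ℝ) (t : ℝ≥0)
    (ω : Ω) : ℝ :=
  ∫ x in univ ×ˢ Iic t, f (ω, x) ∂(X ω) - ∫ x in univ ×ˢ Iic t, f (ω, x) ∂(ν.prod timeMeasure)

/-- `f` is integrable up to time `t` against `X` and against `ν(du) ds`. -/
def CompIntegrable (ν : Measure E) (X : Ω → Measure (E × ℝ≥0)) (f : Ω × (E × ℝ≥0) → ℝ) (t : ℝ≥0)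
    (ω : Ω) : Prop :=
  IntegrableOn (fun x => f (ω, x)) (univ ×ˢ Iic t) (X ω) ∧
    IntegrableOn (fun x => f (ω, x)) (univ ×ˢ Iic t) (ν.prod timeMeasure)

/-- `U = 1 + ∫ h d(X - ν ds) + ∫ k d(Y - ν ds)`. -/
def IsDriven (Q : Measure Ω) (ν : Measure E) (X Y : Ω → Measure (E × ℝ≥0))
    (h k : Ω × (E × ℝ≥0) → ℝ) (U : ℝ≥0 → Ω → ℝ) : Prop :=
  ∀ᵐ ω ∂Q, ∀ t, CompIntegrable ν X h t ω ∧ CompIntegrable ν Y k t ω ∧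
    U t ω = 1 + (compInt ν X h t ω + compInt ν Y k t ω)

/-- The variation of the absolutely continuous part of a driven process. -/
def driftVariation (ν : Measure E) (h k : Ω × (E × ℝ≥0) → ℝ) (ω : Ω) (r : ℝ≥0) : ℝ≥0∞ :=
  ∫⁻ x in univ ×ˢ Iic r, (‖h (ω, x)‖ₑ + ‖k (ω, x)‖ₑ) ∂(ν.prod timeMeasure)

/-- The predictable set where the drift variation is at most `n`. -/
def driftBelow (ν : Measure E) (h k : Ω × (E × ℝ≥0) → ℝ) (n : ℕ) : Set (Ω × (E × ℝ≥0)) :=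
  {p | driftVariation ν h k p.1 p.2.2 ≤ n}

/-- The driven process, stopped when the drift variation exceeds `n`. -/
def truncated (ν : Measure E) (X Y : Ω → Measure (E × ℝ≥0)) (h k : Ω × (E × ℝ≥0) → ℝ) (n : ℕ)
    (t : ℝ≥0) (ω : Ω) : ℝ :=
  1 + (compInt ν X ((driftBelow ν h k n).indicator h) t ω +
    compInt ν Y ((driftBelow ν h k n).indicator k) t ω)

lemma measurable_of_predictable {β : Type*} [MeasurableSpace β] {H : Ω × (E × ℝ≥0) → β}
    (hH : Measurable[predictableMarked E ℱ] H) : Measurable H :=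
  hH.mono predictableMarked_le le_rfl

lemma measurable_section_of_predictable {β : Type*} [MeasurableSpace β] {H : Ω × (E × ℝ≥0) → β}
    (hH : Measurable[predictableMarked E ℱ] H) (ω : Ω) : Measurable fun x => H (ω, x) :=
  (measurable_of_predictable hH).comp measurable_prodMk_left

lemma measurableSet_driftBelow [SFinite ν] (hh : Measurable[predictableMarked E ℱ] h)
    (hk : Measurable[predictableMarked E ℱ] k) (n : ℕ) :
    MeasurableSet[predictableMarked E ℱ] (driftBelow ν h k n) := by
  have h1 : Measurable[predictableMarked E ℱ] fun p : Ω × (E × ℝ≥0) => ‖h p‖ₑ + ‖k p‖ₑ :=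
    (measurable_enorm.comp hh).add (measurable_enorm.comp hk)
  exact measurable_running_predictable (ν := ν) h1 measurableSet_Iic

/-- Because the drift variation is increasing and left-continuous, cutting with `driftBelow` amounts
to stopping at a time `T`, and `T = t` while the level is not exceeded. -/
lemma driftBelow_section [SFinite ν] (n : ℕ) (t : ℝ≥0) (ω : Ω) :
    ∃ T ≤ t, (univ ×ˢ Iic t) ∩ {x | (ω, x) ∈ driftBelow ν h k n} = univ ×ˢ Iic T ∧
      driftVariation ν h k ω T ≤ n ∧ (driftVariation ν h k ω t ≤ n → T = t) := by
  obtain ⟨T, hT, he⟩ := exists_Iic_eq_lintegral_le (m := ν.prod timeMeasure)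
    (V := fun x => ‖h (ω, x)‖ₑ + ‖k (ω, x)‖ₑ) (prod_timeMeasure_singleton ν 0)
    (prod_timeMeasure_singleton ν) t n
  refine ⟨T, hT, ?_, ?_, fun h1 => le_antisymm hT ?_⟩
  · ext x
    have := Set.ext_iff.1 he x.2
    simp only [mem_inter_iff, mem_prod, mem_univ, true_and]
    exact this
  · have : T ∈ Iic T := le_refl T
    rw [← he] at this
    exact this.2
  · have : t ∈ {r | r ≤ t ∧ ∫⁻ x in univ ×ˢ Iic r, (‖h (ω, x)‖ₑ + ‖k (ω, x)‖ₑ)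
        ∂(ν.prod timeMeasure) ≤ n} := ⟨le_rfl, h1⟩
    rw [he] at this
    exact this

section

lemma compInt_mean_zero [IsFiniteMeasure ν] [IsProbabilityMeasure Q]
    (hX : IsPoissonRandomMeasure X (ν.prod timeMeasure) Q)
    (hXℱ : IsCompatible ℱ X Q) (hf : Measurable[predictableMarked E ℱ] f) {t : ℝ≥0}
    (hint : ∫⁻ ω, ∫⁻ x in univ ×ˢ Iic t, ‖f (ω, x)‖ₑ ∂(ν.prod timeMeasure) ∂Q ≠ ∞) :
    Integrable (compInt ν X f t) Q ∧ ∫ ω, compInt ν X f t ω ∂Q = 0 := by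
  have hJ := measurableSet_univ_prod_Iic (E := E) t
  have hS : MeasurableSet[predictableMarked E ℱ]
      {p : Ω × (E × ℝ≥0) | p.2 ∈ (univ ×ˢ Iic t : Set (E × ℝ≥0))} := measurable_snd_predictable hJ
  have hH : Measurable[predictableMarked E ℱ]
      ({p : Ω × (E × ℝ≥0) | p.2 ∈ (univ ×ˢ Iic t : Set (E × ℝ≥0))}.indicator f) := hf.indicator hS
  have e : ∀ (ω : Ω) (ρ : Measure (E × ℝ≥0)),
      ∫ x, {p : Ω × (E × ℝ≥0) | p.2 ∈ (univ ×ˢ Iic t : Set (E × ℝ≥0))}.indicator f (ω, x) ∂ρ =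
        ∫ x in univ ×ˢ Iic t, f (ω, x) ∂ρ := by
    intro ω ρ
    rw [← integral_indicator hJ]
    rfl
  obtain ⟨h1, h2, h3⟩ := hX.integral_compensation hXℱ hH (by
    refine (congrArg (· ≠ ∞) (lintegral_congr fun ω => ?_)).mpr hint
    rw [← lintegral_indicator hJ]
    congr 1 with x
    by_cases hx : x ∈ (univ ×ˢ Iic t : Set (E × ℝ≥0))
    · rw [indicator_of_mem hx, indicator_of_mem (by exact hx)]
    · rw [indicator_of_notMem hx, indicator_of_notMem (by exact hx), enorm_zero])
  simp_rw [e] at h1 h2 h3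
  refine ⟨h1.sub h2, ?_⟩
  unfold compInt
  rw [integral_sub h1 h2, h3, sub_self]

/-- The bound holds for every `ω`, so the truncated integrands satisfy the integrability condition
of the compensation formula. -/
lemma lintegral_driftBelow_le [SFinite ν] (hh : Measurable[predictableMarked E ℱ] h)
    (hk : Measurable[predictableMarked E ℱ] k) (n : ℕ) (t : ℝ≥0) (ω : Ω) :
    ∫⁻ x in univ ×ˢ Iic t, ‖(driftBelow ν h k n).indicator h (ω, x)‖ₑ ∂(ν.prod timeMeasure) ≤ n ∧
    ∫⁻ x in univ ×ˢ Iic t, ‖(driftBelow ν h k n).indicator k (ω, x)‖ₑ ∂(ν.prod timeMeasure) ≤ n := by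
  obtain ⟨T, hT, he, hv, -⟩ := driftBelow_section (ν := ν) (h := h) (k := k) n t ω
  have hm : MeasurableSet {x | (ω, x) ∈ driftBelow ν h k n} :=
    measurable_prodMk_left (predictableMarked_le _ (measurableSet_driftBelow hh hk n))
  have key : ∀ f : Ω × (E × ℝ≥0) → ℝ, (∀ x, ‖f (ω, x)‖ₑ ≤ ‖h (ω, x)‖ₑ + ‖k (ω, x)‖ₑ) →
      ∫⁻ x in univ ×ˢ Iic t, ‖(driftBelow ν h k n).indicator f (ω, x)‖ₑ ∂(ν.prod timeMeasure)
        ≤ n := by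
    intro f hf
    have h1 : ∀ x, ‖(driftBelow ν h k n).indicator f (ω, x)‖ₑ =
        {x | (ω, x) ∈ driftBelow ν h k n}.indicator (fun x => ‖f (ω, x)‖ₑ) x := by
      intro x
      by_cases hx : (ω, x) ∈ driftBelow ν h k n
      · rw [indicator_of_mem hx, indicator_of_mem (by exact hx)]
      · rw [indicator_of_notMem hx, indicator_of_notMem (by exact hx), enorm_zero]
    simp_rw [h1]
    rw [setLIntegral_indicator hm, inter_comm, he]
    exact (lintegral_mono fun x => hf x).trans hv
  exact ⟨key h fun x => le_self_add, key k fun x => le_add_self⟩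

lemma setIntegral_driftBelow [SFinite ν] (hh : Measurable[predictableMarked E ℱ] h)
    (hk : Measurable[predictableMarked E ℱ] k) {n : ℕ} {t T : ℝ≥0} {ω : Ω}
    (he : (univ ×ˢ Iic t) ∩ {x | (ω, x) ∈ driftBelow ν h k n} = univ ×ˢ Iic T)
    (ρ : Measure (E × ℝ≥0)) (f : Ω × (E × ℝ≥0) → ℝ) :
    ∫ x in univ ×ˢ Iic t, (driftBelow ν h k n).indicator f (ω, x) ∂ρ =
      ∫ x in univ ×ˢ Iic T, f (ω, x) ∂ρ := by
  have hm : MeasurableSet {x | (ω, x) ∈ driftBelow ν h k n} :=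
    measurable_prodMk_left (predictableMarked_le _ (measurableSet_driftBelow hh hk n))
  rw [← he, ← setIntegral_indicator hm]
  rfl

/-- The truncated process is the driven process at an earlier time. -/
lemma exists_truncated_eq [SFinite ν] (hh : Measurable[predictableMarked E ℱ] h)
    (hk : Measurable[predictableMarked E ℱ] k) (n : ℕ) (t : ℝ≥0) (ω : Ω) :
    ∃ T ≤ t, truncated ν X Y h k n t ω = 1 + (compInt ν X h T ω + compInt ν Y k T ω) ∧
      (univ ×ˢ Iic t) ∩ {x | (ω, x) ∈ driftBelow ν h k n} = univ ×ˢ Iic T ∧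
      (driftVariation ν h k ω t ≤ n → T = t) := by
  obtain ⟨T, hT, he, -, hv⟩ := driftBelow_section (ν := ν) (h := h) (k := k) n t ω
  refine ⟨T, hT, ?_, he, hv⟩
  unfold truncated compInt
  simp_rw [setIntegral_driftBelow hh hk he]

lemma CompIntegrable.driftBelow [SFinite ν] (hh : Measurable[predictableMarked E ℱ] h)
    (hk : Measurable[predictableMarked E ℱ] k) (n : ℕ) {t : ℝ≥0} {ω : Ω}
    (hi : CompIntegrable ν X f t ω) :
    CompIntegrable ν X ((ClusterModel.driftBelow ν h k n).indicator f) t ω := by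
  have hm : MeasurableSet {x | (ω, x) ∈ ClusterModel.driftBelow ν h k n} :=
    measurable_prodMk_left (predictableMarked_le _ (measurableSet_driftBelow hh hk n))
  exact ⟨hi.1.indicator hm, hi.2.indicator hm⟩

/-- Bounded predictable integrands against the truncated process have mean zero. -/
lemma truncated_mean_zero [IsFiniteMeasure ν] [IsProbabilityMeasure Q]
    (hX : IsPoissonRandomMeasure X (ν.prod timeMeasure) Q)
    (hXℱ : IsCompatible ℱ X Q) (hY : IsPoissonRandomMeasure Y (ν.prod timeMeasure) Q)
    (hYℱ : IsCompatible ℱ Y Q) (hh : Measurable[predictableMarked E ℱ] h)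
    (hk : Measurable[predictableMarked E ℱ] k) (hg : Measurable[predictableMarked E ℱ] g)
    {a : ℝ} (hga : ∀ p, |g p| ≤ a) (n : ℕ) (t : ℝ≥0) :
    Integrable (fun ω => compInt ν X (fun p => g p * (driftBelow ν h k n).indicator h p) t ω +
      compInt ν Y (fun p => g p * (driftBelow ν h k n).indicator k p) t ω) Q ∧
    ∫ ω, (compInt ν X (fun p => g p * (driftBelow ν h k n).indicator h p) t ω +
      compInt ν Y (fun p => g p * (driftBelow ν h k n).indicator k p) t ω) ∂Q = 0 := by
  have hR := measurableSet_driftBelow (ν := ν) hh hk n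
  have bound : ∀ f : Ω × (E × ℝ≥0) → ℝ,
      (∀ ω, ∫⁻ x in univ ×ˢ Iic t, ‖f (ω, x)‖ₑ ∂(ν.prod timeMeasure) ≤ n) →
      ∫⁻ ω, ∫⁻ x in univ ×ˢ Iic t, ‖g (ω, x) * f (ω, x)‖ₑ ∂(ν.prod timeMeasure) ∂Q ≠ ∞ := by
    intro f hf
    have h1 : ∀ ω, ∫⁻ x in univ ×ˢ Iic t, ‖g (ω, x) * f (ω, x)‖ₑ ∂(ν.prod timeMeasure) ≤
        ENNReal.ofReal a * n := by
      intro ω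
      refine le_trans ?_ (mul_le_mul_right (hf ω) (ENNReal.ofReal a))
      rw [← lintegral_const_mul' _ _ ENNReal.ofReal_ne_top]
      refine lintegral_mono fun x => ?_
      rw [enorm_mul]
      refine mul_le_mul_left ?_ _
      rw [Real.enorm_eq_ofReal_abs]
      exact ENNReal.ofReal_le_ofReal (hga _)
    refine ((lintegral_mono h1).trans_lt ?_).ne
    rw [lintegral_const, measure_univ, mul_one]
    exact ENNReal.mul_lt_top ENNReal.ofReal_lt_top (ENNReal.natCast_lt_top n)
  obtain ⟨h1, h2⟩ := compInt_mean_zero hX hXℱ (hg.mul (hh.indicator hR)) (t := t)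
    (bound _ fun ω => (lintegral_driftBelow_le hh hk n t ω).1)
  obtain ⟨h3, h4⟩ := compInt_mean_zero hY hYℱ (hg.mul (hk.indicator hR)) (t := t)
    (bound _ fun ω => (lintegral_driftBelow_le hh hk n t ω).2)
  refine ⟨h1.add h3, ?_⟩
  have h5 := integral_add h1 h3
  rw [h2, h4, add_zero] at h5
  exact h5

lemma truncated_integrable [IsFiniteMeasure ν] [IsProbabilityMeasure Q]
    (hX : IsPoissonRandomMeasure X (ν.prod timeMeasure) Q)
    (hXℱ : IsCompatible ℱ X Q) (hY : IsPoissonRandomMeasure Y (ν.prod timeMeasure) Q)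
    (hYℱ : IsCompatible ℱ Y Q) (hh : Measurable[predictableMarked E ℱ] h)
    (hk : Measurable[predictableMarked E ℱ] k) (n : ℕ) (t : ℝ≥0) :
    Integrable (truncated ν X Y h k n t) Q ∧ ∫ ω, truncated ν X Y h k n t ω ∂Q = 1 := by
  obtain ⟨h1, h2⟩ := truncated_mean_zero hX hXℱ hY hYℱ hh hk (g := fun _ => 1)
    (@measurable_const _ _ _ (predictableMarked E ℱ) _) (a := 1) (by simp) n t
  simp only [one_mul] at h1 h2
  refine ⟨(integrable_const 1).add h1, ?_⟩
  have h3 := integral_add (integrable_const (1 : ℝ)) h1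
  rw [h2, integral_const, probReal_univ, one_smul, add_zero] at h3
  exact h3

lemma IsDriven.driftVariation_ne_top (hdr : IsDriven Q ν X Y h k U) :
    ∀ᵐ ω ∂Q, ∀ t, driftVariation ν h k ω t ≠ ∞ := by
  filter_upwards [hdr] with ω hω t
  have h1 := (hω t).1.2
  have h2 := (hω t).2.1.2
  unfold driftVariation
  rw [lintegral_add_left' h1.1.enorm]
  exact ENNReal.add_ne_top.2 ⟨h1.2.ne, h2.2.ne⟩

/-- The truncated process is `U` at an earlier time, hence nonnegative. As the drift variation up to
`t` is finite, the truncation has no effect for large `n`. -/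
lemma IsDriven.truncated_facts [SFinite ν] (hdr : IsDriven Q ν X Y h k U)
    (hh : Measurable[predictableMarked E ℱ] h) (hk : Measurable[predictableMarked E ℱ] k)
    (hU0 : ∀ᵐ ω ∂Q, ∀ t, 0 ≤ U t ω) :
    ∀ᵐ ω ∂Q, ∀ t, (∀ n, 0 ≤ truncated ν X Y h k n t ω) ∧
      ∀ᶠ n : ℕ in atTop, truncated ν X Y h k n t ω = U t ω := by
  filter_upwards [hdr, hU0, hdr.driftVariation_ne_top] with ω hω h0 hV t
  refine ⟨fun n => ?_, ?_⟩
  · obtain ⟨T, -, he, -⟩ := exists_truncated_eq (X := X) (Y := Y) (ν := ν) hh hk n t ω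
    rw [he, ← (hω T).2.2]
    exact h0 T
  · obtain ⟨n₀, hn₀⟩ := ENNReal.exists_nat_gt (hV t)
    filter_upwards [eventually_ge_atTop n₀] with n hn
    obtain ⟨T, -, he, -, hT⟩ := exists_truncated_eq (X := X) (Y := Y) (ν := ν) hh hk n t ω
    rw [he, ← (hω T).2.2, hT (hn₀.le.trans (by exact_mod_cast hn))]

lemma martingale_of_setIntegral_eq [IsFiniteMeasure Q] {M : ℝ≥0 → Ω → ℝ}
    (hM : ∀ t, Measurable[ℱ t] (M t)) (hi : ∀ t, Integrable (M t) Q)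
    (heq : ∀ s t, s ≤ t → ∀ B, MeasurableSet[ℱ s] B → ∫ ω in B, M t ω ∂Q = ∫ ω in B, M s ω ∂Q) :
    Martingale M ℱ Q := by
  refine ⟨fun t => (hM t).stronglyMeasurable, fun s t hst => ?_⟩
  exact (ae_eq_condExp_of_forall_setIntegral_eq (ℱ.le s) (hi t)
    (fun B _ _ => (hi s).integrableOn) (fun B hB _ => (heq s t hst B hB).symm)
    (hM s).stronglyMeasurable.aestronglyMeasurable).symm

lemma measurableSet_predictable_rectangle {s t : ℝ≥0} {A : Set E} (hA : MeasurableSet A)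
    {B : Set Ω} (hB : MeasurableSet[ℱ s] B) :
    MeasurableSet[predictableMarked E ℱ] (B ×ˢ (A ×ˢ Ioc s t)) :=
  MeasurableSpace.measurableSet_generateFrom (Or.inr ⟨_, _, _, _, hA, hB, rfl⟩)

/-- A predictable rectangle extracts the increment over `(s, t]` on the event `B`; this turns mean
zero for predictable integrands into the martingale property. -/
lemma compInt_rectangle {s t : ℝ≥0} (hst : s ≤ t) {B : Set Ω} {ω : Ω}
    (hi : CompIntegrable ν X f t ω) :
    compInt ν X (fun p => (B ×ˢ (univ ×ˢ Ioc s t)).indicator (fun _ => (1 : ℝ)) p * f p) t ω =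
      B.indicator (fun ω => compInt ν X f t ω - compInt ν X f s ω) ω := by
  have hJ := measurableSet_univ_prod_Ioc (E := E) s t
  have hd : Disjoint (univ ×ˢ Iic s : Set (E × ℝ≥0)) (univ ×ˢ Ioc s t) := by
    rw [Set.disjoint_prod]
    exact Or.inr (Iic_disjoint_Ioc le_rfl)
  by_cases hω : ω ∈ B
  · have key : ∀ ρ : Measure (E × ℝ≥0), IntegrableOn (fun x => f (ω, x)) (univ ×ˢ Iic t) ρ →
        ∫ x in univ ×ˢ Iic t, (B ×ˢ (univ ×ˢ Ioc s t)).indicator (fun _ => (1 : ℝ)) (ω, x) * f (ω, x) ∂ρ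
          = ∫ x in univ ×ˢ Iic t, f (ω, x) ∂ρ - ∫ x in univ ×ˢ Iic s, f (ω, x) ∂ρ := by
      intro ρ hρ
      have h1 : ∀ x, (B ×ˢ (univ ×ˢ Ioc s t)).indicator (fun _ => (1 : ℝ)) (ω, x) * f (ω, x) =
          (univ ×ˢ Ioc s t : Set (E × ℝ≥0)).indicator (fun x => f (ω, x)) x := by
        intro x
        by_cases hx : x ∈ (univ ×ˢ Ioc s t : Set (E × ℝ≥0))
        · rw [indicator_of_mem hx, indicator_of_mem (by exact ⟨hω, hx⟩), one_mul]
        · rw [indicator_of_notMem hx, indicator_of_notMem (fun h' => hx h'.2), zero_mul]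
      simp_rw [h1]
      rw [setIntegral_indicator hJ, inter_eq_self_of_subset_right
        (prod_mono_right Ioc_subset_Iic_self), eq_sub_iff_add_eq']
      rw [← Iic_union_Ioc_eq_Iic hst, prod_union]
      exact (setIntegral_union hd hJ (hρ.mono_set (prod_mono_right (Iic_subset_Iic.2 hst)))
        (hρ.mono_set (prod_mono_right Ioc_subset_Iic_self))).symm
    rw [indicator_of_mem hω]
    unfold compInt
    rw [key _ hi.1, key _ hi.2]
    ring
  · rw [indicator_of_notMem hω]
    unfold compInt
    have h1 : ∀ x, (B ×ˢ (univ ×ˢ Ioc s t)).indicator (fun _ => (1 : ℝ)) (ω, x) * f (ω, x) = 0 := by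
      intro x
      rw [indicator_of_notMem (fun h' => hω h'.1), zero_mul]
    simp [h1]

lemma IsDriven.setIntegral_truncated_eq [IsFiniteMeasure ν] [IsProbabilityMeasure Q]
    (hX : IsPoissonRandomMeasure X (ν.prod timeMeasure) Q)
    (hXℱ : IsCompatible ℱ X Q) (hY : IsPoissonRandomMeasure Y (ν.prod timeMeasure) Q)
    (hYℱ : IsCompatible ℱ Y Q) (hh : Measurable[predictableMarked E ℱ] h)
    (hk : Measurable[predictableMarked E ℱ] k) (hdr : IsDriven Q ν X Y h k U) (n : ℕ)
    {s t : ℝ≥0} (hst : s ≤ t) {B : Set Ω} (hB : MeasurableSet[ℱ s] B) :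
    ∫ ω in B, truncated ν X Y h k n t ω ∂Q = ∫ ω in B, truncated ν X Y h k n s ω ∂Q := by
  have hG : Measurable[predictableMarked E ℱ]
      ((B ×ˢ (univ ×ˢ Ioc s t) : Set (Ω × (E × ℝ≥0))).indicator fun _ => (1 : ℝ)) :=
    Measurable.indicator (@measurable_const _ _ _ (predictableMarked E ℱ) _)
      (measurableSet_predictable_rectangle MeasurableSet.univ hB)
  obtain ⟨-, h2⟩ := truncated_mean_zero hX hXℱ hY hYℱ hh hk hG (a := 1)
    (fun p => by unfold indicator; split_ifs <;> simp) n t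
  have h3 : ∀ᵐ ω ∂Q, (compInt ν X (fun p => (B ×ˢ (univ ×ˢ Ioc s t)).indicator (fun _ => (1 : ℝ)) p *
        (driftBelow ν h k n).indicator h p) t ω +
      compInt ν Y (fun p => (B ×ˢ (univ ×ˢ Ioc s t)).indicator (fun _ => (1 : ℝ)) p *
        (driftBelow ν h k n).indicator k p) t ω) =
      B.indicator (fun ω => truncated ν X Y h k n t ω - truncated ν X Y h k n s ω) ω := by
    filter_upwards [hdr] with ω hω
    rw [compInt_rectangle hst ((hω t).1.driftBelow hh hk n),
      compInt_rectangle hst ((hω t).2.1.driftBelow hh hk n)]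
    unfold truncated
    by_cases hωB : ω ∈ B
    · simp only [indicator_of_mem hωB]
      ring
    · simp only [indicator_of_notMem hωB, add_zero]
  rw [integral_congr_ae h3, integral_indicator (ℱ.le s _ hB),
    integral_sub (truncated_integrable hX hXℱ hY hYℱ hh hk n t).1.integrableOn
      (truncated_integrable hX hXℱ hY hYℱ hh hk n s).1.integrableOn] at h2
  linarith

/-- A nonnegative driven process of constant mean is a martingale. -/
theorem IsDriven.martingale [IsFiniteMeasure ν] [IsProbabilityMeasure Q]
    (hX : IsPoissonRandomMeasure X (ν.prod timeMeasure) Q)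
    (hXℱ : IsCompatible ℱ X Q) (hY : IsPoissonRandomMeasure Y (ν.prod timeMeasure) Q)
    (hYℱ : IsCompatible ℱ Y Q) (hh : Measurable[predictableMarked E ℱ] h)
    (hk : Measurable[predictableMarked E ℱ] k) (hdr : IsDriven Q ν X Y h k U)
    (hU : ∀ t, Measurable[ℱ t] (U t)) (hU0 : ∀ᵐ ω ∂Q, ∀ t, 0 ≤ U t ω)
    (hUi : ∀ t, Integrable (U t) Q) (hU1 : ∀ t, ∫ ω, U t ω ∂Q = 1) : Martingale U ℱ Q := by
  have hfacts := hdr.truncated_facts hh hk hU0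
  have hlim : ∀ t, ∀ B, MeasurableSet B →
      Tendsto (fun n => ∫ ω in B, truncated ν X Y h k n t ω ∂Q) atTop (𝓝 (∫ ω in B, U t ω ∂Q)) := by
    intro t B hB
    -- The truncated processes and their limit are nonnegative with the same mean `1`; the
    -- multiplier is the fixed indicator of `B`.
    have := tendsto_integral_mul_of_scheffe (Q := Q) (f := fun n => truncated ν X Y h k n t) (g := U t)
      (Z := fun _ => B.indicator fun _ => (1 : ℝ)) (Y := B.indicator fun _ => (1 : ℝ)) (a := 1)
      (fun n => (truncated_integrable hX hXℱ hY hYℱ hh hk n t).1)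
      (fun n => by filter_upwards [hfacts] with ω hω using (hω t).1 n) (hUi t)
      (by filter_upwards [hU0] with ω hω using hω t)
      (by filter_upwards [hfacts] with ω hω using tendsto_nhds_of_eventually_eq (hω t).2)
      (fun n => by rw [(truncated_integrable hX hXℱ hY hYℱ hh hk n t).2, hU1])
      (fun _ => (measurable_const.indicator hB).aestronglyMeasurable)
      (fun _ => ae_of_all _ fun ω => by unfold indicator; split_ifs <;> simp)
      (ae_of_all _ fun ω => tendsto_const_nhds)
    have e : ∀ F : Ω → ℝ, ∫ ω, F ω * B.indicator (fun _ => (1 : ℝ)) ω ∂Q = ∫ ω in B, F ω ∂Q := by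
      intro F
      rw [← integral_indicator hB]
      congr 1 with ω
      by_cases hω : ω ∈ B <;> simp [hω]
    simpa only [e] using this
  refine martingale_of_setIntegral_eq hU hUi fun s t hst B hB => ?_
  refine tendsto_nhds_unique (hlim t B (ℱ.le s _ hB)) ((hlim s B (ℱ.le s _ hB)).congr fun n => ?_)
  exact (hdr.setIntegral_truncated_eq hX hXℱ hY hYℱ hh hk n hst hB).symm

end

end Driven

/-! ### The cluster model -/

/-- The two hypotheses make the three variables jointly independent: the law of the triple is a
product measure, however it is bracketed. -/
lemma indepFun_prodMk_of_indepFun {Q : Measure Ω} [IsProbabilityMeasure Q] {α β δ : Type*}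
    [MeasurableSpace α] [MeasurableSpace β] [MeasurableSpace δ] {X : Ω → α} {Y : Ω → β} {Z : Ω → δ}
    (hX : Measurable X) (hY : Measurable Y) (hZ : Measurable Z) (hXY : IndepFun X Y Q)
    (h : IndepFun Z (fun ω => (X ω, Y ω)) Q) : IndepFun X (fun ω => (Y ω, Z ω)) Q := by
  have hYZ : IndepFun Y Z Q := (h.comp measurable_id measurable_snd).symm
  have := Measure.isProbabilityMeasure_map (μ := Q) hX.aemeasurable
  have := Measure.isProbabilityMeasure_map (μ := Q) hY.aemeasurable
  have := Measure.isProbabilityMeasure_map (μ := Q) hZ.aemeasurable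
  rw [indepFun_iff_map_prod_eq_prod_map_map hX.aemeasurable (hY.prodMk hZ).aemeasurable,
    (indepFun_iff_map_prod_eq_prod_map_map hY.aemeasurable hZ.aemeasurable).1 hYZ,
    ← Measure.prodAssoc_prod,
    ← (indepFun_iff_map_prod_eq_prod_map_map hX.aemeasurable hY.aemeasurable).1 hXY,
    ← (indepFun_iff_map_prod_eq_prod_map_map (hX.prodMk hY).aemeasurable hZ.aemeasurable).1 h.symm,
    Measure.map_map (MeasurableEquiv.measurable _) ((hX.prodMk hY).prodMk hZ)]
  rfl

/-- The intensity of `C`, computed from the initial state, the coins and the points. -/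
lemma measurable_chainRate {Ω' : Type*} [MeasurableSpace Ω']
    {lam : E → ℝ≥0 → Bool → Measure (E × ℝ≥0) → ℝ≥0}
    (hlam : Measurable fun x : E × ℝ≥0 × Bool × Measure (E × ℝ≥0) =>
      lam x.1 x.2.1 x.2.2.1 x.2.2.2) {X : Ω' → Measure (E × ℝ≥0)} (hX : Measurable X)
    (hfin : ∀ ω t, X ω (univ ×ˢ Iic t) < ∞) {b : Ω' → Bool} (hb : Measurable b)
    {coin : ℕ+ → Ω' → Bool} (hcoin : ∀ k, Measurable (coin k)) :
    Measurable fun p : Ω' × (E × ℝ≥0) => lam p.2.1 p.2.2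
      (indicatorChain (b p.1) (fun k => coin k p.1) (countBefore (X p.1) p.2.2))
      (historyBefore (X p.1) p.2.2) :=
  hlam.comp (Measurable.prodMk (by fun_prop) (Measurable.prodMk (by fun_prop)
    (Measurable.prodMk (measurable_indicatorChain_countBefore hX hfin hb hcoin)
      (measurable_historyBefore hX hfin))))

/-- The standing assumptions of the model. -/
structure IsClusterModel (Q : Measure Ω) (ℱ : Filtration ℝ≥0 mΩ) (ν : Measure E)
    (γ : E → ℝ≥0 → ℝ≥0) (lam : E → ℝ≥0 → Bool → Measure (E × ℝ≥0) → ℝ≥0)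
    (N C : Ω → Measure (E × ℝ≥0)) (I : ℕ+ → Ω → Bool) (D : ℝ≥0 → Ω → Bool)
    (LN LC : ℝ≥0 → Ω → ℝ) : Prop where
  measurable_gamma : Measurable fun x : E × ℝ≥0 => γ x.1 x.2
  measurable_lam : Measurable fun x : E × ℝ≥0 × Bool × Measure (E × ℝ≥0) =>
    lam x.1 x.2.1 x.2.2.1 x.2.2.2
  poisson_N : IsPoissonRandomMeasure N (ν.prod timeMeasure) Q
  poisson_C : IsPoissonRandomMeasure C (ν.prod timeMeasure) Q
  indep : IndepFun N C Q
  measurable_I : ∀ k, Measurable (I k)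
  cadlag : ∀ ω, IsCadlag fun t => D t ω
  indep_D : IndepFun (fun ω => (D 0 ω, fun k => I k ω)) (fun ω => (N ω, C ω)) Q
  solves_D : ∀ f : Bool × Measure (E × ℝ≥0) → ℝ, Measurable f →
    ∀ᵐ ω ∂Q, SolvesIndicatorEquation (C ω) (fun k => I k ω) (fun t => D t ω) f
  compatible_N : IsCompatible ℱ N Q
  compatible_C : IsCompatible ℱ C Q
  adapted_D : ∀ t, Measurable[ℱ t] (D t)
  solves_N : SolvesExponentialEquation Q ν N (fun _ u s => γ u s) LN
  solves_C : SolvesExponentialEquation Q ν C (fun ω u s => lam u s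
    (Function.leftLim (fun r => D r ω) s) (historyBefore (C ω) s)) LC
  martingale_N : Martingale LN ℱ Q
  martingale_C : Martingale LC ℱ Q

/-- The intensity `λ(u, s, D_{s-}, η_{s-})`. -/
def rateBefore (lam : E → ℝ≥0 → Bool → Measure (E × ℝ≥0) → ℝ≥0) (C : Ω → Measure (E × ℝ≥0))
    (D : ℝ≥0 → Ω → Bool) (p : Ω × (E × ℝ≥0)) : ℝ≥0 :=
  lam p.2.1 p.2.2 (Function.leftLim (fun r => D r p.1) p.2.2) (historyBefore (C p.1) p.2.2)

namespace IsClusterModel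

variable {Q : Measure Ω} {ℱ : Filtration ℝ≥0 mΩ} {ν : Measure E} {γ : E → ℝ≥0 → ℝ≥0}
  {lam : E → ℝ≥0 → Bool → Measure (E × ℝ≥0) → ℝ≥0} {N C : Ω → Measure (E × ℝ≥0)}
  {I : ℕ+ → Ω → Bool} {D : ℝ≥0 → Ω → Bool} {LN LC : ℝ≥0 → Ω → ℝ}

lemma measurable_rateBefore (hM : IsClusterModel Q ℱ ν γ lam N C I D LN LC) :
    Measurable[predictableMarked E ℱ] (rateBefore lam C D) :=
  hM.measurable_lam.comp (Measurable.prodMk (f := fun p : Ω × (E × ℝ≥0) => p.2.1)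
    measurable_mark_predictable (Measurable.prodMk (f := fun p : Ω × (E × ℝ≥0) => p.2.2)
      measurable_time_predictable
      (Measurable.prodMk (measurable_leftLim_predictable hM.adapted_D hM.cadlag)
        (measurable_historyBefore_predictable hM.compatible_C))))

/-- The properties of a typical path. -/
structure GoodPath (ν : Measure E) (γ : E → ℝ≥0 → ℝ≥0)
    (lam : E → ℝ≥0 → Bool → Measure (E × ℝ≥0) → ℝ≥0) (N C : Ω → Measure (E × ℝ≥0))
    (I : ℕ+ → Ω → Bool) (D : ℝ≥0 → Ω → Bool) (LN LC : ℝ≥0 → Ω → ℝ) (ω : Ω) : Prop where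
  simple_N : IsSimple (N ω)
  simple_C : IsSimple (C ω)
  no_common : ∀ s, N ω (univ ×ˢ {s}) = 0 ∨ C ω (univ ×ˢ {s}) = 0
  solves_N : SolvesPath ν (N ω) (fun x => γ x.1 x.2) fun t => LN t ω
  solves_C : SolvesPath ν (C ω) (fun x => rateBefore lam C D (ω, x)) fun t => LC t ω
  leftLim_D : ∀ s, Function.leftLim (fun r => D r ω) s =
    indicatorChain (D 0 ω) (fun k => I k ω) (countBefore (C ω) s)

/-- The events generated by the points of `C`, the initial state and the coins. -/
@[reducible]
def sigmaC (C : Ω → Measure (E × ℝ≥0)) (I : ℕ+ → Ω → Bool) (D : ℝ≥0 → Ω → Bool) :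
    MeasurableSpace Ω :=
  MeasurableSpace.comap (fun ω => (C ω, (D 0 ω, fun k => I k ω))) inferInstance

lemma measurable_initial (hM : IsClusterModel Q ℱ ν γ lam N C I D LN LC) :
    Measurable fun ω => (D 0 ω, fun k => I k ω) :=
  ((hM.adapted_D 0).mono (ℱ.le 0) le_rfl).prodMk (measurable_pi_lambda _ hM.measurable_I)

lemma expFormula_zero {c : Measure (E × ℝ≥0)} (hc : IsSimple c) (κ : E × ℝ≥0 → ℝ≥0) :
    expFormula ν c κ 0 = 1 := by
  have h2 : (Iic (0 : ℝ≥0)) = {0} := by ext; simp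
  rw [expFormula, h2, setLIntegral_measure_zero _ _ (prod_timeMeasure_singleton ν 0),
    Measure.restrict_eq_zero.2 hc.zero, pointProd_zero, expNeg_of_ne_top ENNReal.zero_ne_top]
  simp

lemma measurable_LN (hM : IsClusterModel Q ℱ ν γ lam N C I D LN LC) (t : ℝ≥0) :
    Measurable[ℱ t] (LN t) := (hM.martingale_N.1 t).measurable

lemma measurable_LC (hM : IsClusterModel Q ℱ ν γ lam N C I D LN LC) (t : ℝ≥0) :
    Measurable[ℱ t] (LC t) := (hM.martingale_C.1 t).measurable

lemma measurable_mul (hM : IsClusterModel Q ℱ ν γ lam N C I D LN LC) (t : ℝ≥0) :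
    Measurable[ℱ t] (fun ω => LN t ω * LC t ω) := (hM.measurable_LN t).mul (hM.measurable_LC t)

lemma sigmaC_le (hM : IsClusterModel Q ℱ ν γ lam N C I D LN LC) : sigmaC C I D ≤ mΩ :=
  (hM.poisson_C.measurable.prodMk hM.measurable_initial).comap_le

lemma indep_sigmaC [IsProbabilityMeasure Q] (hM : IsClusterModel Q ℱ ν γ lam N C I D LN LC) :
    Indep (MeasurableSpace.comap N inferInstance) (sigmaC C I D) Q :=
  indepFun_prodMk_of_indepFun hM.poisson_N.measurable hM.poisson_C.measurable hM.measurable_initial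
    hM.indep hM.indep_D

variable [IsFiniteMeasure ν]

lemma ae_goodPath (hM : IsClusterModel Q ℱ ν γ lam N C I D LN LC) :
    ∀ᵐ ω ∂Q, GoodPath ν γ lam N C I D LN LC ω := by
  have hf : Measurable fun p : Bool × Measure (E × ℝ≥0) => if p.1 = true then (1 : ℝ) else 0 :=
    Measurable.ite (measurable_fst (measurableSet_singleton true)) measurable_const measurable_const
  filter_upwards [hM.poisson_N.ae_isSimple, hM.poisson_C.ae_isSimple,
    hM.poisson_N.ae_no_common hM.poisson_C hM.indep, hM.solves_N, hM.solves_C, hM.solves_D _ hf]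
    with ω h1 h2 h3 h4 h5 h6
  exact ⟨h1, h2, h3, h4, h5, h6.leftLim_eq_indicatorChain h2⟩

/-- The version of `L_N` that is a function of the points of `N`. -/
def densityN (ν : Measure E) (γ : E → ℝ≥0 → ℝ≥0) (N : Ω → Measure (E × ℝ≥0)) (t : ℝ≥0) (ω : Ω) : ℝ :=
  expFormula ν (N ω) (fun x => γ x.1 x.2) t

/-- The version of `L_C` that is a function of the points of `C`, the initial state and the
coins. -/
def densityC (ν : Measure E) (lam : E → ℝ≥0 → Bool → Measure (E × ℝ≥0) → ℝ≥0)
    (C : Ω → Measure (E × ℝ≥0)) (I : ℕ+ → Ω → Bool) (D : ℝ≥0 → Ω → Bool) (t : ℝ≥0) (ω : Ω) : ℝ :=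
  expFormula ν (C ω) (fun x => lam x.1 x.2
    (indicatorChain (D 0 ω) (fun k => I k ω) (countBefore (C ω) x.2)) (historyBefore (C ω) x.2)) t

lemma measurable_densityN (hM : IsClusterModel Q ℱ ν γ lam N C I D LN LC) (t : ℝ≥0) :
    Measurable[MeasurableSpace.comap N inferInstance] (densityN ν γ N t) := by
  let := MeasurableSpace.comap N inferInstance
  exact measurable_expFormula ν (comap_measurable N) hM.poisson_N.lt_top
    (κ := fun p => γ p.2.1 p.2.2) (hM.measurable_gamma.comp measurable_snd) t

lemma measurable_densityC (hM : IsClusterModel Q ℱ ν γ lam N C I D LN LC) (t : ℝ≥0) :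
    Measurable[sigmaC C I D] (densityC ν lam C I D t) := by
  have h0 : Measurable[sigmaC C I D] fun ω => (C ω, (D 0 ω, fun k => I k ω)) := comap_measurable _
  let := sigmaC C I D
  have h1 : Measurable C := measurable_fst.comp h0
  have h2 : Measurable (D 0) := (measurable_fst.comp measurable_snd).comp h0
  have h3 : ∀ k, Measurable (I k) := fun k =>
    ((measurable_pi_apply k).comp (measurable_snd.comp measurable_snd)).comp h0
  exact measurable_expFormula ν h1 hM.poisson_C.lt_top
    (measurable_chainRate hM.measurable_lam h1 hM.poisson_C.lt_top h2 h3) t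

/-- Uniqueness for the exponential equation, with `D₋` rewritten as the chain, exhibits both
densities as functionals of independent inputs. -/
lemma ae_eq_density (hM : IsClusterModel Q ℱ ν γ lam N C I D LN LC) :
    ∀ᵐ ω ∂Q, ∀ t, LN t ω = densityN ν γ N t ω ∧ LC t ω = densityC ν lam C I D t ω := by
  filter_upwards [hM.ae_goodPath] with ω hω t
  refine ⟨hω.solves_N.eq_expFormula hM.measurable_gamma hω.simple_N t, ?_⟩
  have h := hω.solves_C.eq_expFormula
    (measurable_section_of_predictable hM.measurable_rateBefore ω) hω.simple_C t
  refine h.trans ?_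
  unfold rateBefore densityC
  simp_rw [hω.leftLim_D]

lemma ae_nonneg (hM : IsClusterModel Q ℱ ν γ lam N C I D LN LC) :
    ∀ᵐ ω ∂Q, ∀ t, 0 ≤ LN t ω ∧ 0 ≤ LC t ω := by
  filter_upwards [hM.ae_eq_density] with ω hω t
  rw [(hω t).1, (hω t).2]
  exact ⟨expFormula_nonneg _ _ _ _, expFormula_nonneg _ _ _ _⟩

/-- The density process is driven by `N` and `C`, with predictable integrands. -/
lemma exists_driven (hM : IsClusterModel Q ℱ ν γ lam N C I D LN LC) :
    ∃ G : Ω × (E × ℝ≥0) → ℝ, Measurable[predictableMarked E ℱ] G ∧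
      (∀ᵐ ω ∂Q, ∀ x, G (ω, x) = Function.leftLim (fun t => LN t ω) x.2 *
        Function.leftLim (fun t => LC t ω) x.2) ∧
      IsDriven Q ν N C (fun p => ((γ p.2.1 p.2.2 : ℝ) - 1) * G p)
        (fun p => ((rateBefore lam C D p : ℝ) - 1) * G p) fun t ω => LN t ω * LC t ω := by
  obtain ⟨G₁, hG₁, hG₁'⟩ := exists_predictable_leftLim (E := E) hM.measurable_LN
  obtain ⟨G₂, hG₂, hG₂'⟩ := exists_predictable_leftLim (E := E) hM.measurable_LC
  have hG : ∀ᵐ ω ∂Q, ∀ x, G₁ (ω, x) * G₂ (ω, x) = Function.leftLim (fun t => LN t ω) x.2 *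
      Function.leftLim (fun t => LC t ω) x.2 := by
    filter_upwards [hM.ae_goodPath] with ω hω x
    rw [hG₁' ω (hω.solves_N.tendsto_left hω.simple_N), hG₂' ω (hω.solves_C.tendsto_left hω.simple_C)]
  refine ⟨fun p => G₁ p * G₂ p, hG₁.mul hG₂, hG, ?_⟩
  filter_upwards [hM.ae_goodPath, hG] with ω hω hGω t
  have h := SolvesPath.mul hM.measurable_gamma hω.simple_N hω.simple_C hω.no_common hω.solves_N
    hω.solves_C t
  have e1 : (fun x : E × ℝ≥0 => ((γ x.1 x.2 : ℝ) - 1) * (G₁ (ω, x) * G₂ (ω, x))) = fun x =>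
      ((γ x.1 x.2 : ℝ) - 1) * Function.leftLim (fun t => LN t ω) x.2 *
        Function.leftLim (fun t => LC t ω) x.2 := by
    funext x
    rw [hGω]
    ring
  have e2 : (fun x : E × ℝ≥0 => ((rateBefore lam C D (ω, x) : ℝ) - 1) * (G₁ (ω, x) * G₂ (ω, x))) =
      fun x => ((rateBefore lam C D (ω, x) : ℝ) - 1) * Function.leftLim (fun t => LC t ω) x.2 *
        Function.leftLim (fun t => LN t ω) x.2 := by
    funext x
    rw [hGω]
    ring
  unfold CompIntegrable compInt
  simp only [e1, e2]
  exact h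

variable [IsProbabilityMeasure Q]

lemma integral_eq_one (hM : IsClusterModel Q ℱ ν γ lam N C I D LN LC) (t : ℝ≥0) :
    ∫ ω, LN t ω ∂Q = 1 ∧ ∫ ω, LC t ω ∂Q = 1 := by
  have h1 : ∀ L : ℝ≥0 → Ω → ℝ, Martingale L ℱ Q → (∀ᵐ ω ∂Q, L 0 ω = 1) → ∫ ω, L t ω ∂Q = 1 := by
    intro L hL h0
    have := hL.setIntegral_eq (zero_le : (0 : ℝ≥0) ≤ t) MeasurableSet.univ
    rw [setIntegral_univ, setIntegral_univ] at this
    rw [← this, integral_congr_ae h0]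
    simp
  constructor
  · refine h1 _ hM.martingale_N ?_
    filter_upwards [hM.ae_eq_density, hM.ae_goodPath] with ω h2 h3
    rw [(h2 0).1]
    exact expFormula_zero h3.simple_N _
  · refine h1 _ hM.martingale_C ?_
    filter_upwards [hM.ae_eq_density, hM.ae_goodPath] with ω h2 h3
    rw [(h2 0).2]
    exact expFormula_zero h3.simple_C _

lemma lintegral_eq_one (hM : IsClusterModel Q ℱ ν γ lam N C I D LN LC) (t : ℝ≥0) :
    ∫⁻ ω, ENNReal.ofReal (LN t ω) ∂Q = 1 ∧ ∫⁻ ω, ENNReal.ofReal (LC t ω) ∂Q = 1 := by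
  have h := hM.integral_eq_one t
  constructor
  · rw [← ofReal_integral_eq_lintegral_ofReal (hM.martingale_N.integrable t), h.1, ENNReal.ofReal_one]
    filter_upwards [hM.ae_nonneg] with ω hω using (hω t).1
  · rw [← ofReal_integral_eq_lintegral_ofReal (hM.martingale_C.integrable t), h.2, ENNReal.ofReal_one]
    filter_upwards [hM.ae_nonneg] with ω hω using (hω t).2

/-- Functionals of `N`, and of `C` with the initial state and the coins, decouple. -/
lemma lintegral_mul_density (hM : IsClusterModel Q ℱ ν γ lam N C I D LN LC) (t : ℝ≥0)
    {φ ψ : Ω → ℝ≥0∞} (hφ : Measurable[MeasurableSpace.comap N inferInstance] φ)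
    (hψ : Measurable[sigmaC C I D] ψ) :
    ∫⁻ ω, (φ ω * ψ ω) * ENNReal.ofReal (LN t ω * LC t ω) ∂Q =
      (∫⁻ ω, φ ω * ENNReal.ofReal (LN t ω) ∂Q) * ∫⁻ ω, ψ ω * ENNReal.ofReal (LC t ω) ∂Q := by
  have h := lintegral_mul_eq_lintegral_mul_lintegral_of_independent_measurableSpace
    hM.poisson_N.measurable.comap_le hM.sigmaC_le hM.indep_sigmaC
    (hφ.mul (ENNReal.measurable_ofReal.comp (hM.measurable_densityN t)))
    (hψ.mul (ENNReal.measurable_ofReal.comp (hM.measurable_densityC t)))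
  have e1 : ∫⁻ ω, (φ ω * ψ ω) * ENNReal.ofReal (LN t ω * LC t ω) ∂Q =
      ∫⁻ ω, (φ ω * ENNReal.ofReal (densityN ν γ N t ω)) *
        (ψ ω * ENNReal.ofReal (densityC ν lam C I D t ω)) ∂Q := by
    refine lintegral_congr_ae ?_
    filter_upwards [hM.ae_eq_density, hM.ae_nonneg] with ω h1 h2
    rw [ENNReal.ofReal_mul (h2 t).1, (h1 t).1, (h1 t).2]
    ring
  have e2 : ∫⁻ ω, φ ω * ENNReal.ofReal (LN t ω) ∂Q =
      ∫⁻ ω, φ ω * ENNReal.ofReal (densityN ν γ N t ω) ∂Q := by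
    refine lintegral_congr_ae ?_
    filter_upwards [hM.ae_eq_density] with ω h1
    rw [(h1 t).1]
  have e3 : ∫⁻ ω, ψ ω * ENNReal.ofReal (LC t ω) ∂Q =
      ∫⁻ ω, ψ ω * ENNReal.ofReal (densityC ν lam C I D t ω) ∂Q := by
    refine lintegral_congr_ae ?_
    filter_upwards [hM.ae_eq_density] with ω h1
    rw [(h1 t).2]
  rw [e1, e2, e3]
  exact h

lemma lintegral_mul_eq_one (hM : IsClusterModel Q ℱ ν γ lam N C I D LN LC) (t : ℝ≥0) :
    ∫⁻ ω, ENNReal.ofReal (LN t ω * LC t ω) ∂Q = 1 := by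
  have h := hM.lintegral_mul_density t (φ := fun _ => 1) (ψ := fun _ => 1)
    (@measurable_const _ _ _ (_) _) (@measurable_const _ _ _ (_) _)
  simpa [(hM.lintegral_eq_one t).1, (hM.lintegral_eq_one t).2] using h

lemma integrable_mul (hM : IsClusterModel Q ℱ ν γ lam N C I D LN LC) (t : ℝ≥0) :
    Integrable (fun ω => LN t ω * LC t ω) Q := by
  refine ⟨((hM.measurable_mul t).mono (ℱ.le t) le_rfl).aestronglyMeasurable, ?_⟩
  rw [hasFiniteIntegral_iff_ofReal, hM.lintegral_mul_eq_one]
  · exact ENNReal.one_lt_top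
  · filter_upwards [hM.ae_nonneg] with ω hω using mul_nonneg (hω t).1 (hω t).2

lemma integral_mul_eq_one (hM : IsClusterModel Q ℱ ν γ lam N C I D LN LC) (t : ℝ≥0) :
    ∫ ω, LN t ω * LC t ω ∂Q = 1 := by
  rw [integral_eq_lintegral_of_nonneg_ae, hM.lintegral_mul_eq_one, ENNReal.toReal_one]
  · filter_upwards [hM.ae_nonneg] with ω hω using mul_nonneg (hω t).1 (hω t).2
  · exact (hM.integrable_mul t).1

lemma martingale_mul (hM : IsClusterModel Q ℱ ν γ lam N C I D LN LC) :
    Martingale (fun t ω => LN t ω * LC t ω) ℱ Q := by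
  obtain ⟨G, hG, -, hd⟩ := hM.exists_driven
  have hγ : Measurable[predictableMarked E ℱ] fun p : Ω × (E × ℝ≥0) => ((γ p.2.1 p.2.2 : ℝ) - 1) :=
    ((hM.measurable_gamma.comp measurable_snd_predictable).coe_nnreal_real).sub_const 1
  have hr : Measurable[predictableMarked E ℱ] fun p => ((rateBefore lam C D p : ℝ) - 1) :=
    hM.measurable_rateBefore.coe_nnreal_real.sub_const 1
  refine hd.martingale hM.poisson_N hM.compatible_N hM.poisson_C hM.compatible_C (hγ.mul hG)
    (hr.mul hG) hM.measurable_mul ?_ hM.integrable_mul hM.integral_mul_eq_one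
  filter_upwards [hM.ae_nonneg] with ω hω t using mul_nonneg (hω t).1 (hω t).2

end IsClusterModel

/-! ### Laplace transforms of laws on `[0, ∞]ⁿ` -/

lemma expNeg_injective : Function.Injective expNeg := by
  intro a b h
  unfold expNeg at h
  split_ifs at h with h1 h2 h2
  · rw [h1, h2]
  · exact absurd h.symm (Real.exp_pos _).ne'
  · exact absurd h (Real.exp_pos _).ne'
  · exact (ENNReal.toReal_eq_toReal_iff' h1 h2).1 (neg_injective (Real.exp_injective h))

lemma expNeg_zero : expNeg 0 = 1 := by
  rw [expNeg_of_ne_top ENNReal.zero_ne_top]; simp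

lemma expNeg_le_one (r : ℝ≥0∞) : expNeg r ≤ 1 := by
  unfold expNeg
  split_ifs
  · exact zero_le_one
  · exact Real.exp_le_one_iff.2 (neg_nonpos.2 ENNReal.toReal_nonneg)

section Laplace

variable {ι : Type*} [Fintype ι]

/-- The function `x ↦ exp (- ∑ tᵢ xᵢ)`. -/
def laplaceKernel (t : ι → ℕ) (x : ι → ℝ≥0∞) : ℝ := ∏ i, expNeg (t i * x i)

lemma continuous_laplaceKernel (t : ι → ℕ) : Continuous (laplaceKernel t) := by
  unfold laplaceKernel
  refine continuous_finsetProd _ fun i _ => continuous_expNeg.comp ?_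
  exact (ENNReal.continuous_const_mul (ENNReal.natCast_ne_top _)).comp (continuous_apply i)

lemma laplaceKernel_nonneg (t : ι → ℕ) (x : ι → ℝ≥0∞) : 0 ≤ laplaceKernel t x :=
  Finset.prod_nonneg fun _ _ => expNeg_nonneg _

/-- The Laplace kernel as a bounded continuous function. -/
def laplaceKernelBCF (t : ι → ℕ) : BoundedContinuousFunction (ι → ℝ≥0∞) ℝ :=
  BoundedContinuousFunction.mkOfCompact ⟨laplaceKernel t, continuous_laplaceKernel t⟩

lemma laplaceKernelBCF_mul (s t : ι → ℕ) :
    laplaceKernelBCF s * laplaceKernelBCF t = laplaceKernelBCF (s + t) := by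
  ext x
  change (∏ i, expNeg (s i * x i)) * (∏ i, expNeg (t i * x i)) = ∏ i, expNeg ((s + t) i * x i)
  rw [← Finset.prod_mul_distrib]
  refine Finset.prod_congr rfl fun i _ => ?_
  rw [← expNeg_add, Pi.add_apply, Nat.cast_add, add_mul]

lemma laplaceKernelBCF_zero : laplaceKernelBCF (0 : ι → ℕ) = 1 := by
  ext x
  change (∏ i, expNeg ((0 : ι → ℕ) i * x i)) = 1
  simp [expNeg_zero]

/-- The Laplace kernels as a multiplicative submonoid. -/
def laplaceSubmonoid (ι : Type*) [Fintype ι] :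
    Submonoid (BoundedContinuousFunction (ι → ℝ≥0∞) ℝ) where
  carrier := range laplaceKernelBCF
  mul_mem' := by
    rintro _ _ ⟨s, rfl⟩ ⟨t, rfl⟩
    exact ⟨s + t, (laplaceKernelBCF_mul s t).symm⟩
  one_mem' := ⟨0, laplaceKernelBCF_zero⟩

/-- The algebra generated by the Laplace kernels. -/
def laplaceAlgebra (ι : Type*) [Fintype ι] :
    StarSubalgebra ℝ (BoundedContinuousFunction (ι → ℝ≥0∞) ℝ) where
  toSubalgebra := Algebra.adjoin ℝ (laplaceSubmonoid ι : Set _)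
  star_mem' := by
    intro f hf
    have : star f = f := by
      ext x
      simp
    rwa [this]

/-- Finite measures on `[0, ∞]ⁿ` are determined by their Laplace transforms. -/
theorem ext_of_lintegral_laplaceKernel_eq {μ ρ : Measure (ι → ℝ≥0∞)} [IsFiniteMeasure μ]
    [IsFiniteMeasure ρ] (h : ∀ t : ι → ℕ, ∫⁻ x, ENNReal.ofReal (laplaceKernel t x) ∂μ =
      ∫⁻ x, ENNReal.ofReal (laplaceKernel t x) ∂ρ) : μ = ρ := by
  -- The Laplace kernels are closed under products and separate points, `∞` included, because
  -- `expNeg` is injective. Their linear span is thus a separating algebra, on which the two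
  -- integrals agree by linearity.
  refine ext_of_forall_mem_subalgebra_integral_eq_of_polish (𝕜 := ℝ) (A := laplaceAlgebra ι) ?_ ?_
  · intro x y hxy
    obtain ⟨i, hi⟩ := Function.ne_iff.1 hxy
    classical
    refine ⟨laplaceKernel (Pi.single i 1), ?_, ?_⟩
    · refine ⟨_, ⟨laplaceKernelBCF (Pi.single i 1), ?_, rfl⟩, rfl⟩
      exact Algebra.subset_adjoin ⟨_, rfl⟩
    · have : ∀ z : ι → ℝ≥0∞, laplaceKernel (Pi.single i 1) z = expNeg (z i) := by
        intro z
        unfold laplaceKernel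
        rw [Finset.prod_eq_single i]
        · simp
        · intro j _ hj
          simp [Pi.single_eq_of_ne hj, expNeg_zero]
        · simp
      rw [this, this]
      exact fun h' => hi (expNeg_injective h')
  · intro g hg
    have hg' : g ∈ Algebra.adjoin ℝ (laplaceSubmonoid ι : Set _) := hg
    rw [← Subalgebra.mem_toSubmodule, Algebra.adjoin_eq_span, Submonoid.closure_eq] at hg'
    induction hg' using Submodule.span_induction with
    | mem f hf =>
      obtain ⟨t, rfl⟩ := hf
      change ∫ x, laplaceKernel t x ∂μ = ∫ x, laplaceKernel t x ∂ρ
      rw [integral_eq_lintegral_of_nonneg_ae (ae_of_all _ (laplaceKernel_nonneg t))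
          (continuous_laplaceKernel t).aestronglyMeasurable,
        integral_eq_lintegral_of_nonneg_ae (ae_of_all _ (laplaceKernel_nonneg t))
          (continuous_laplaceKernel t).aestronglyMeasurable, h t]
    | zero => simp
    | add f f' hf hf' h1 h2 =>
      have e1 := h1 (by
        change f ∈ Algebra.adjoin ℝ _
        rw [← Subalgebra.mem_toSubmodule, Algebra.adjoin_eq_span, Submonoid.closure_eq]; exact hf)
      have e2 := h2 (by
        change f' ∈ Algebra.adjoin ℝ _
        rw [← Subalgebra.mem_toSubmodule, Algebra.adjoin_eq_span, Submonoid.closure_eq]; exact hf')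
      simp only [BoundedContinuousFunction.coe_add, Pi.add_apply]
      rw [integral_add (f.integrable μ) (f'.integrable μ),
        integral_add (f.integrable ρ) (f'.integrable ρ), e1, e2]
    | smul a f hf h1 =>
      have e1 := h1 (by
        change f ∈ Algebra.adjoin ℝ _
        rw [← Subalgebra.mem_toSubmodule, Algebra.adjoin_eq_span, Submonoid.closure_eq]; exact hf)
      simp only [BoundedContinuousFunction.coe_smul, smul_eq_mul]
      rw [integral_const_mul, integral_const_mul, e1]

lemma lintegral_expNeg_poissonLaw (t : ℕ) (r : ℝ≥0∞) :
    ∫⁻ x, ENNReal.ofReal (expNeg (t * x)) ∂(poissonLaw r) =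
      ENNReal.ofReal (expNeg (ENNReal.ofReal (1 - Real.exp (-t)) * r)) := by
  have hm : Measurable fun x : ℝ≥0∞ => ENNReal.ofReal (expNeg (t * x)) :=
    ENNReal.measurable_ofReal.comp (continuous_expNeg.measurable.comp (measurable_const.mul measurable_id))
  by_cases hr : r = ∞
  -- For infinite mean the law is `δ_∞`; both sides are `0`, or both are `1` when `t = 0`, since `0
  -- * ∞ = 0`.
  · rw [poissonLaw, if_pos hr, lintegral_dirac' _ hm, hr]
    rcases Nat.eq_zero_or_pos t with rfl | ht
    · simp
    · have h1 : ENNReal.ofReal (1 - Real.exp (-t)) ≠ 0 := by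
        rw [ENNReal.ofReal_ne_zero_iff, sub_pos, Real.exp_lt_one_iff]
        simpa using ht
      have h2 : (t : ℝ≥0∞) ≠ 0 := by exact_mod_cast ht.ne'
      rw [ENNReal.mul_top h1, ENNReal.mul_top h2]
  · rw [lintegral_comp_poissonLaw hm hr]
    have h1 : ∀ n : ℕ, ENNReal.ofReal (expNeg (t * (n : ℝ≥0∞))) =
        ((Real.exp (-t)).toNNReal : ℝ≥0∞) ^ n := by
      intro n
      rw [expNeg_of_ne_top (ENNReal.mul_ne_top (ENNReal.natCast_ne_top _) (ENNReal.natCast_ne_top _)),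
        ENNReal.toReal_mul, ENNReal.toReal_natCast, ENNReal.toReal_natCast]
      change _ = (ENNReal.ofReal (Real.exp (-t))) ^ n
      rw [← ENNReal.ofReal_pow (Real.exp_pos _).le, ← Real.exp_nat_mul]
      congr 2
      ring
    simp_rw [h1]
    rw [lintegral_pow_poissonMeasure, expNeg_of_ne_top (ENNReal.mul_ne_top ENNReal.ofReal_ne_top hr),
      ENNReal.toReal_mul, ENNReal.toReal_ofReal (by simp), Real.coe_toNNReal _ (Real.exp_pos _).le]
    congr 2
    rw [show ((r.toNNReal : ℝ≥0) : ℝ) = r.toReal from rfl]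
    ring

lemma isProbabilityMeasure_poissonLaw (r : ℝ≥0∞) : IsProbabilityMeasure (poissonLaw r) := by
  unfold poissonLaw
  split_ifs
  · infer_instance
  · exact Measure.isProbabilityMeasure_map (by fun_prop)

lemma lintegral_laplaceKernel_pi (t : ι → ℕ) (r : ι → ℝ≥0∞) :
    ∫⁻ x, ENNReal.ofReal (laplaceKernel t x) ∂(Measure.pi fun i => poissonLaw (r i)) =
      ∏ i, ENNReal.ofReal (expNeg (ENNReal.ofReal (1 - Real.exp (-t i)) * r i)) := by
  have := fun i => isProbabilityMeasure_poissonLaw (r i)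
  unfold laplaceKernel
  simp_rw [ENNReal.ofReal_prod_of_nonneg fun _ _ => expNeg_nonneg _]
  have hm : ∀ i, Measurable fun x : ℝ≥0∞ => ENNReal.ofReal (expNeg (t i * x)) := fun i =>
    ENNReal.measurable_ofReal.comp (continuous_expNeg.measurable.comp (measurable_const.mul measurable_id))
  have hind := iIndepFun_pi (μ := fun i => poissonLaw (r i))
    (X := fun i x => ENNReal.ofReal (expNeg (t i * x))) (fun i => (hm i).aemeasurable)
  rw [lintegral_prod_eq_prod_lintegral_of_indepFun Finset.univ _ hind
    (fun i => (hm i).comp (measurable_pi_apply i))]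
  refine Finset.prod_congr rfl fun i _ => ?_
  rw [← lintegral_expNeg_poissonLaw]
  exact (measurePreserving_eval (fun i => poissonLaw (r i)) i).lintegral_comp (hm i)

end Laplace

/-! ### The law of `N` under the new measure -/

section LaplaceFunctional

variable {X : Ω → Measure (E × ℝ≥0)} {μ : Measure (E × ℝ≥0)} {P : Measure Ω}

/-- The Laplace transform identifies the joint law of the counts as a product of Poisson laws. The
case of a single set gives the marginals, and the product form then gives independence. -/
lemma isPoissonRandomMeasure_of_laplace [IsProbabilityMeasure P] (hX : Measurable X)
    (hc : ∀ ω, IsConfiguration (X ω))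
    (h : ∀ (n : ℕ) (B : Fin n → Set (E × ℝ≥0)), (∀ i, MeasurableSet (B i)) →
      Pairwise (fun i j => Disjoint (B i) (B j)) → ∀ t : Fin n → ℕ,
      ∫⁻ ω, ENNReal.ofReal (laplaceKernel t fun i => X ω (B i)) ∂P =
        ∏ i, ENNReal.ofReal (expNeg (ENNReal.ofReal (1 - Real.exp (-t i)) * μ (B i)))) :
    IsPoissonRandomMeasure X μ P := by
  have hm : ∀ B, MeasurableSet B → Measurable fun ω => X ω B := fun B hB =>
    (Measure.measurable_coe hB).comp hX
  have hjoint : ∀ (n : ℕ) (B : Fin n → Set (E × ℝ≥0)), (∀ i, MeasurableSet (B i)) →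
      Pairwise (fun i j => Disjoint (B i) (B j)) →
      P.map (fun ω i => X ω (B i)) = Measure.pi fun i => poissonLaw (μ (B i)) := by
    intro n B hB hd
    have h1 : Measurable fun ω i => X ω (B i) := measurable_pi_lambda _ fun i => hm _ (hB i)
    have := fun i => isProbabilityMeasure_poissonLaw (μ (B i))
    have := Measure.isProbabilityMeasure_map (μ := P) h1.aemeasurable
    refine ext_of_lintegral_laplaceKernel_eq fun t => ?_
    rw [lintegral_laplaceKernel_pi]
    exact (lintegral_map (ENNReal.measurable_ofReal.comp (continuous_laplaceKernel t).measurable)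
      h1).trans (h n B hB hd t)
  have hlaw : ∀ B, MeasurableSet B → P.map (fun ω => X ω B) = poissonLaw (μ B) := by
    intro B hB
    have := isProbabilityMeasure_poissonLaw (μ B)
    have h1 := hjoint 1 (fun _ => B) (fun _ => hB) (fun i j hij => absurd (Subsingleton.elim i j) hij)
    have h2 := (measurePreserving_eval (fun _ : Fin 1 => poissonLaw (μ B)) 0).map_eq
    rw [← h1, Measure.map_map (measurable_pi_apply 0)
      (measurable_pi_lambda _ fun _ => hm _ hB)] at h2
    exact h2
  refine ⟨hX, hc, hlaw, fun n B hB hd => ?_⟩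
  rw [iIndepFun_iff_map_fun_eq_pi_map fun i => (hm _ (hB i)).aemeasurable, hjoint n B hB hd]
  congr 1
  funext i
  rw [hlaw _ (hB i)]

lemma tendsto_measure_inter_Iic (c : Measure (E × ℝ≥0)) (B : Set (E × ℝ≥0)) :
    Tendsto (fun n : ℕ => c (B ∩ univ ×ˢ Iic (n : ℝ≥0))) atTop (𝓝 (c B)) := by
  have h1 : B = ⋃ n : ℕ, B ∩ univ ×ˢ Iic (n : ℝ≥0) := by
    ext x
    simp only [mem_iUnion, mem_inter_iff, mem_prod, mem_univ, true_and, mem_Iic]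
    exact ⟨fun hx => (exists_nat_ge x.2).imp fun n hn => ⟨hx, hn⟩, fun ⟨n, hn⟩ => hn.1⟩
  conv_rhs => rw [h1]
  refine tendsto_measure_iUnion_atTop fun a b hab => inter_subset_inter_right _
    (prod_mono_right (Iic_subset_Iic.2 (by exact_mod_cast hab)))

/-- The density is available only up to finite times, so sets are cut at `T` and `T → ∞`. The kernel
is bounded by `1` and continuous on `[0, ∞]ⁿ`, so infinite counts and infinite means are covered. -/
lemma lintegral_laplaceKernel_of_bounded [IsProbabilityMeasure P] (hX : Measurable X) {n : ℕ}
    {B : Fin n → Set (E × ℝ≥0)} (hB : ∀ i, MeasurableSet (B i)) {t : Fin n → ℕ}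
    (h : ∀ T : ℕ, ∫⁻ ω, ENNReal.ofReal (laplaceKernel t fun i => X ω (B i ∩ univ ×ˢ Iic (T : ℝ≥0))) ∂P =
        ∏ i, ENNReal.ofReal (expNeg (ENNReal.ofReal (1 - Real.exp (-t i)) *
          μ (B i ∩ univ ×ˢ Iic (T : ℝ≥0))))) :
    ∫⁻ ω, ENNReal.ofReal (laplaceKernel t fun i => X ω (B i)) ∂P =
        ∏ i, ENNReal.ofReal (expNeg (ENNReal.ofReal (1 - Real.exp (-t i)) * μ (B i))) := by
  have hm : ∀ T : ℕ, Measurable fun ω =>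
      ENNReal.ofReal (laplaceKernel t fun i => X ω (B i ∩ univ ×ˢ Iic (T : ℝ≥0))) := fun T =>
    ENNReal.measurable_ofReal.comp ((continuous_laplaceKernel t).measurable.comp
      (measurable_pi_lambda _ fun i => (Measure.measurable_coe
        ((hB i).inter (measurableSet_univ_prod_Iic _))).comp hX))
  have hl := tendsto_lintegral_of_dominated_convergence (μ := P) (fun _ => 1) hm
    (f := fun ω => ENNReal.ofReal (laplaceKernel t fun i => X ω (B i)))
    (fun T => ae_of_all _ fun ω => by
      rw [← ENNReal.ofReal_one]
      exact ENNReal.ofReal_le_ofReal (Finset.prod_le_one (fun _ _ => expNeg_nonneg _)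
        fun _ _ => expNeg_le_one _))
    (by simp)
    (ae_of_all _ fun ω => (ENNReal.continuous_ofReal.tendsto _).comp
      (((continuous_laplaceKernel t).tendsto _).comp (tendsto_pi_nhds.2 fun i =>
        tendsto_measure_inter_Iic (X ω) (B i))))
  simp_rw [h] at hl
  refine tendsto_nhds_unique hl ?_
  simp_rw [← ENNReal.ofReal_prod_of_nonneg fun _ _ => expNeg_nonneg _]
  refine (ENNReal.continuous_ofReal.tendsto _).comp (tendsto_finsetProd _ fun i _ => ?_)
  refine (continuous_expNeg.tendsto _).comp ?_
  exact ((ENNReal.continuous_const_mul ENNReal.ofReal_ne_top).tendsto _).comp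
    (tendsto_measure_inter_Iic μ (B i))

section Damping

variable {S : Type*} [MeasurableSpace S] {n : ℕ} {B : Fin n → Set S} {t : Fin n → ℕ}

/-- The factor `exp (- ∑ tᵢ 1_{Bᵢ})`. -/
def damping (B : Fin n → Set S) (t : Fin n → ℕ) (x : S) : ℝ≥0 :=
  open Classical in ∏ i, if x ∈ B i then (Real.exp (-t i)).toNNReal else 1

lemma measurable_damping (hB : ∀ i, MeasurableSet (B i)) : Measurable (damping B t) := by
  unfold damping
  exact Finset.measurable_prod _ fun i _ => Measurable.ite (hB i) measurable_const measurable_const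

/-- Written as a product over points, the Laplace kernel of the counts can be absorbed into the
product that occurs in the density. -/
lemma pointProd_damping (hB : ∀ i, MeasurableSet (B i)) {c : Measure S} (hc : IsDiracSum c) :
    pointProd (damping B t) c = laplaceKernel t fun i => c (B i) := by
  induction hc using IsDiracSum.induction with
  | h0 => simp [pointProd_zero, laplaceKernel, expNeg_zero]
  | h a μ hμ ih =>
    rw [pointProd_add (measurable_damping hB) (.dirac a) hμ, ih, pointProd_dirac (measurable_damping hB)]
    unfold laplaceKernel damping
    rw [NNReal.coe_prod, ← Finset.prod_mul_distrib]
    refine Finset.prod_congr rfl fun i _ => ?_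
    simp only
    rw [Measure.add_apply, mul_add, expNeg_add, Measure.dirac_apply' _ (hB i)]
    congr 1
    by_cases h : a ∈ B i
    · rw [if_pos h, indicator_of_mem h, Pi.one_apply, mul_one,
        expNeg_of_ne_top (ENNReal.natCast_ne_top _), Real.coe_toNNReal _ (Real.exp_pos _).le]
      simp
    · rw [if_neg h, indicator_of_notMem h, mul_zero, expNeg_zero]
      simp

/-- By disjointness at most one factor of the damping differs from `1`, so the damping equals `1 - ∑
(1 - e^{-tᵢ}) 1_{Bᵢ}`. -/
lemma one_eq_damping_add {S : Type*} {n : ℕ} {B : Fin n → Set S} {t : Fin n → ℕ}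
    (hd : Pairwise fun i j => Disjoint (B i) (B j)) (x : S) :
    (1 : ℝ≥0∞) = damping B t x +
      ∑ i, (B i).indicator (fun _ => ENNReal.ofReal (1 - Real.exp (-t i))) x := by
  unfold damping
  by_cases h : ∃ j, x ∈ B j
  · obtain ⟨j, hj⟩ := h
    have hne : ∀ i, i ≠ j → x ∉ B i := fun i hij hi => (disjoint_left.1 (hd hij)) hi hj
    rw [Finset.prod_eq_single j (fun i _ hij => if_neg (hne i hij)) (by simp), if_pos hj,
      Finset.sum_eq_single j (fun i _ hij => indicator_of_notMem (hne i hij) _) (by simp),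
      indicator_of_mem hj]
    change 1 = ENNReal.ofReal (Real.exp (-t j)) + _
    rw [← ENNReal.ofReal_add (Real.exp_pos _).le (by simp)]
    simp
  · push Not at h
    simp [h]

lemma lintegral_eq_damping_add (hB : ∀ i, MeasurableSet (B i))
    (hd : Pairwise fun i j => Disjoint (B i) (B j)) (ρ : Measure S) {g : S → ℝ≥0}
    (hg : Measurable g) :
    ∫⁻ x, g x ∂ρ = ∫⁻ x, (g x * damping B t x : ℝ≥0) ∂ρ +
      ∑ i, ENNReal.ofReal (1 - Real.exp (-t i)) * ∫⁻ x in B i, g x ∂ρ := by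
  have h1 : ∀ x, (g x : ℝ≥0∞) = (g x * damping B t x : ℝ≥0) +
      ∑ i, (B i).indicator (fun x => ENNReal.ofReal (1 - Real.exp (-t i)) * g x) x := by
    intro x
    conv_lhs => rw [← mul_one (g x : ℝ≥0∞), one_eq_damping_add (t := t) hd x, mul_add, Finset.mul_sum]
    rw [ENNReal.coe_mul]
    congr 1
    refine Finset.sum_congr rfl fun i _ => ?_
    by_cases h : x ∈ B i
    · rw [indicator_of_mem h, indicator_of_mem h, mul_comm]
    · rw [indicator_of_notMem h, indicator_of_notMem h, mul_zero]
  have h2 : Measurable fun x => g x * damping B t x := hg.mul (measurable_damping hB)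
  rw [lintegral_congr h1, lintegral_add_left h2.coe_nnreal_ennreal,
    lintegral_finsetSum _ fun i _ => (hg.coe_nnreal_ennreal.const_mul _).indicator (hB i)]
  congr 1
  refine Finset.sum_congr rfl fun i _ => ?_
  rw [lintegral_indicator (hB i), lintegral_const_mul _ hg.coe_nnreal_ennreal]

end Damping

lemma expFormula_eq_zero {ν : Measure E} {c : Measure (E × ℝ≥0)} {κ : E × ℝ≥0 → ℝ≥0} {t : ℝ≥0}
    (h : ∫⁻ x in univ ×ˢ Iic t, κ x ∂(ν.prod timeMeasure) = ∞) : expFormula ν c κ t = 0 := by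
  rw [expFormula, h, expNeg_top]
  simp

end LaplaceFunctional

namespace IsClusterModel

variable {Q : Measure Ω} {ℱ : Filtration ℝ≥0 mΩ} {ν : Measure E} {γ : E → ℝ≥0 → ℝ≥0}
  {lam : E → ℝ≥0 → Bool → Measure (E × ℝ≥0) → ℝ≥0} {N C : Ω → Measure (E × ℝ≥0)}
  {I : ℕ+ → Ω → Bool} {D : ℝ≥0 → Ω → Bool} {LN LC : ℝ≥0 → Ω → ℝ} {P : Measure Ω}

/-- Expectations of functionals known at time `t`, under the new measure. -/
lemma lintegral_eq (hM : IsClusterModel Q ℱ ν γ lam N C I D LN LC)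
    (hP : HasLocalDensity ℱ P Q fun t ω => LN t ω * LC t ω) {t : ℝ≥0} {φ : Ω → ℝ≥0∞}
    (hφ : Measurable[ℱ t] φ) :
    ∫⁻ ω, φ ω ∂P = ∫⁻ ω, φ ω * ENNReal.ofReal (LN t ω * LC t ω) ∂Q := by
  have hU : Measurable fun ω => ENNReal.ofReal (LN t ω * LC t ω) :=
    ENNReal.measurable_ofReal.comp ((hM.measurable_mul t).mono (ℱ.le t) le_rfl)
  have h1 : P.trim (ℱ.le t) =
      (Q.withDensity fun ω => ENNReal.ofReal (LN t ω * LC t ω)).trim (ℱ.le t) := by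
    refine @Measure.ext _ (ℱ t) _ _ fun B hB => ?_
    rw [trim_measurableSet_eq _ hB, trim_measurableSet_eq _ hB,
      withDensity_apply _ (ℱ.le t _ hB), hP t B hB]
  rw [← lintegral_trim (ℱ.le t) hφ, h1, lintegral_trim (ℱ.le t) hφ,
    lintegral_withDensity_eq_lintegral_mul _ hU (hφ.mono (ℱ.le t) le_rfl)]
  refine lintegral_congr fun ω => ?_
  rw [Pi.mul_apply, mul_comm]

variable [IsFiniteMeasure ν] [IsProbabilityMeasure Q]

/-- Otherwise the explicit density would vanish almost surely, contrary to its mean `1`. -/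
lemma lintegral_gamma_ne_top (hM : IsClusterModel Q ℱ ν γ lam N C I D LN LC) (t : ℝ≥0) :
    ∫⁻ x in univ ×ˢ Iic t, γ x.1 x.2 ∂(ν.prod timeMeasure) ≠ ∞ := by
  intro h
  have h1 : ∫⁻ ω, ENNReal.ofReal (LN t ω) ∂Q = 0 := by
    rw [← lintegral_zero (μ := Q)]
    refine lintegral_congr_ae ?_
    filter_upwards [hM.ae_eq_density] with ω hω
    rw [(hω t).1, densityN, expFormula_eq_zero (κ := fun x : E × ℝ≥0 => γ x.1 x.2) h,
      ENNReal.ofReal_zero]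
  rw [(hM.lintegral_eq_one t).1] at h1
  exact one_ne_zero h1

/-- The damping multiplies `γ` in the product over points while the exponential prefactor keeps the
undamped `γ`. In the exponent, `ν(E) T - ∫ γ + ∫ γ · damping - ν(E) T` reduces to `-∑ (1 - e^{-tᵢ})
∫_{Bᵢ} γ`. -/
lemma lintegral_laplaceKernel_mul (hM : IsClusterModel Q ℱ ν γ lam N C I D LN LC) (T : ℝ≥0) {n : ℕ}
    {B : Fin n → Set (E × ℝ≥0)} (hB : ∀ i, MeasurableSet (B i))
    (hd : Pairwise fun i j => Disjoint (B i) (B j)) (t : Fin n → ℕ) :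
    ∫⁻ ω, ENNReal.ofReal (laplaceKernel t fun i => N ω (B i ∩ univ ×ˢ Iic T)) *
        ENNReal.ofReal (LN T ω) ∂Q =
      ∏ i, ENNReal.ofReal (expNeg (ENNReal.ofReal (1 - Real.exp (-t i)) *
        ((ν.prod timeMeasure).withDensity fun x => (γ x.1 x.2 : ℝ≥0∞)) (B i ∩ univ ×ˢ Iic T))) := by
  set m := ν.prod timeMeasure with hm
  set g : E × ℝ≥0 → ℝ≥0 := fun x => γ x.1 x.2 with hg
  have hgm : Measurable g := hM.measurable_gamma
  have hdm : Measurable (damping B t) := measurable_damping hB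
  have hgd : Measurable fun x => g x * damping B t x := hgm.mul hdm
  have hJ := measurableSet_univ_prod_Iic (E := E) T
  have ha : ∫⁻ x in univ ×ˢ Iic T, g x ∂m ≠ ∞ := hM.lintegral_gamma_ne_top T
  have hmJ : m (univ ×ˢ Iic T) ≠ ∞ := (prod_timeMeasure_Iic_lt_top ν T).ne
  have hsplit := lintegral_eq_damping_add (t := t) hB hd (m.restrict (univ ×ˢ Iic T)) hgm
  have hb : ∫⁻ x in univ ×ˢ Iic T, (g x * damping B t x : ℝ≥0) ∂m ≠ ∞ := by
    rw [hsplit] at ha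
    exact (ENNReal.add_ne_top.1 ha).1
  have hs : ∑ i, ENNReal.ofReal (1 - Real.exp (-t i)) *
      ∫⁻ x in B i, g x ∂(m.restrict (univ ×ˢ Iic T)) ≠ ∞ := by
    rw [hsplit] at ha
    exact (ENNReal.add_ne_top.1 ha).2
  have e1 : ∀ᵐ ω ∂Q, ENNReal.ofReal (laplaceKernel t fun i => N ω (B i ∩ univ ×ˢ Iic T)) *
        ENNReal.ofReal (LN T ω) =
      ENNReal.ofReal (Real.exp (ν.real univ * T) * expNeg (∫⁻ x in univ ×ˢ Iic T, g x ∂m)) *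
        ENNReal.ofReal (pointProd (fun x => g x * damping B t x) ((N ω).restrict (univ ×ˢ Iic T))) := by
    filter_upwards [hM.ae_eq_density] with ω hω
    have hD := (hM.poisson_N.isConfiguration ω).isDiracSum_restrict hJ subset_rfl
    have h1 : (laplaceKernel t fun i => N ω (B i ∩ univ ×ˢ Iic T)) =
        pointProd (damping B t) ((N ω).restrict (univ ×ˢ Iic T)) := by
      rw [pointProd_damping hB hD]
      simp_rw [Measure.restrict_apply (hB _)]
    rw [(hω T).1, densityN, expFormula, pointProd_mul hD hgm hdm, h1,
      ← ENNReal.ofReal_mul (pointProd_nonneg _ _), ← ENNReal.ofReal_mul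
        (mul_nonneg (Real.exp_pos _).le (expNeg_nonneg _))]
    congr 1
    ring
  rw [lintegral_congr_ae e1, lintegral_const_mul' _ _ ENNReal.ofReal_ne_top,
    hM.poisson_N.lintegral_pointProd hmJ hgd hb,
    ← ENNReal.ofReal_mul (mul_nonneg (Real.exp_pos _).le (expNeg_nonneg _)),
    ← ENNReal.ofReal_prod_of_nonneg (fun _ _ => expNeg_nonneg _)]
  congr 1
  have h2 : ∀ i, ((m.withDensity fun x => (γ x.1 x.2 : ℝ≥0∞)) (B i ∩ univ ×ˢ Iic T)) =
      ∫⁻ x in B i, g x ∂(m.restrict (univ ×ˢ Iic T)) := by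
    intro i
    rw [withDensity_apply _ ((hB i).inter hJ), Measure.restrict_restrict (hB i)]
  have h3 : ∀ i, ENNReal.ofReal (1 - Real.exp (-t i)) *
      ∫⁻ x in B i, g x ∂(m.restrict (univ ×ˢ Iic T)) ≠ ∞ := fun i =>
    (ENNReal.sum_ne_top.1 hs) i (Finset.mem_univ i)
  simp_rw [h2, expNeg_of_ne_top (h3 _)]
  rw [← Real.exp_sum, expNeg_of_ne_top ha, ← Real.exp_add, ← Real.exp_add, hsplit,
    ENNReal.toReal_add hb hs, ENNReal.toReal_sum fun i _ => h3 i, Finset.sum_neg_distrib]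
  congr 1
  have h4 : (m (univ ×ˢ Iic T)).toReal = ν.real univ * T := by
    rw [hm, prod_timeMeasure_Iic, ENNReal.toReal_mul]
    rfl
  rw [h4]
  ring

lemma isProbabilityMeasure (hM : IsClusterModel Q ℱ ν γ lam N C I D LN LC)
    (hP : HasLocalDensity ℱ P Q fun t ω => LN t ω * LC t ω) : IsProbabilityMeasure P := by
  refine ⟨?_⟩
  rw [hP 0 univ MeasurableSet.univ, setLIntegral_univ]
  exact hM.lintegral_mul_eq_one 0

lemma measurable_restrict_comap (X : Ω → Measure (E × ℝ≥0)) (t : ℝ≥0) :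
    MeasurableSpace.comap (fun ω => (X ω).restrict (univ ×ˢ Iic t)) inferInstance ≤
      MeasurableSpace.comap X inferInstance := by
  rw [← measurable_iff_comap_le]
  exact (measurable_measure_restrict (measurableSet_univ_prod_Iic t)).comp (comap_measurable X)

lemma lintegral_mul_eq (hM : IsClusterModel Q ℱ ν γ lam N C I D LN LC)
    (hP : HasLocalDensity ℱ P Q fun t ω => LN t ω * LC t ω) {t : ℝ≥0} {φ ψ : Ω → ℝ≥0∞}
    (hφ : Measurable[MeasurableSpace.comap (fun ω => (N ω).restrict (univ ×ˢ Iic t)) inferInstance] φ)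
    (hψ : Measurable[MeasurableSpace.comap (fun ω => (C ω).restrict (univ ×ˢ Iic t)) inferInstance] ψ) :
    ∫⁻ ω, φ ω * ψ ω ∂P =
      (∫⁻ ω, φ ω * ENNReal.ofReal (LN t ω) ∂Q) * ∫⁻ ω, ψ ω * ENNReal.ofReal (LC t ω) ∂Q := by
  have h1 : Measurable[ℱ t] φ := hφ.mono (hM.compatible_N.adapted t).comap_le le_rfl
  have h2 : Measurable[ℱ t] ψ := hψ.mono (hM.compatible_C.adapted t).comap_le le_rfl
  have h3 : MeasurableSpace.comap C inferInstance ≤ sigmaC C I D := by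
    rw [← measurable_iff_comap_le]
    have h0 : Measurable[sigmaC C I D] fun ω => (C ω, (D 0 ω, fun k => I k ω)) := comap_measurable _
    exact measurable_fst.comp h0
  refine (hM.lintegral_eq hP (h1.mul h2)).trans ?_
  exact hM.lintegral_mul_density t (hφ.mono (measurable_restrict_comap N t) le_rfl)
    (hψ.mono ((measurable_restrict_comap C t).trans h3) le_rfl)

lemma lintegral_of_N (hM : IsClusterModel Q ℱ ν γ lam N C I D LN LC)
    (hP : HasLocalDensity ℱ P Q fun t ω => LN t ω * LC t ω) {t : ℝ≥0} {φ : Ω → ℝ≥0∞}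
    (hφ : Measurable[MeasurableSpace.comap (fun ω => (N ω).restrict (univ ×ˢ Iic t)) inferInstance] φ) :
    ∫⁻ ω, φ ω ∂P = ∫⁻ ω, φ ω * ENNReal.ofReal (LN t ω) ∂Q := by
  have h := hM.lintegral_mul_eq hP hφ (ψ := fun _ => 1) (@measurable_const _ _ _ (_) _)
  simpa [(hM.lintegral_eq_one t).2] using h

lemma lintegral_of_C (hM : IsClusterModel Q ℱ ν γ lam N C I D LN LC)
    (hP : HasLocalDensity ℱ P Q fun t ω => LN t ω * LC t ω) {t : ℝ≥0} {ψ : Ω → ℝ≥0∞}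
    (hψ : Measurable[MeasurableSpace.comap (fun ω => (C ω).restrict (univ ×ˢ Iic t)) inferInstance] ψ) :
    ∫⁻ ω, ψ ω ∂P = ∫⁻ ω, ψ ω * ENNReal.ofReal (LC t ω) ∂Q := by
  have h := hM.lintegral_mul_eq hP (φ := fun _ => 1) (@measurable_const _ _ _ (_) _) hψ
  simpa [(hM.lintegral_eq_one t).1] using h

lemma measurable_apply_inter (X : Ω → Measure (E × ℝ≥0)) {B : Set (E × ℝ≥0)}
    (hB : MeasurableSet B) (t : ℝ≥0) :
    Measurable[MeasurableSpace.comap (fun ω => (X ω).restrict (univ ×ˢ Iic t)) inferInstance]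
      fun ω => X ω (B ∩ univ ×ˢ Iic t) := by
  have h1 : (fun ω => X ω (B ∩ univ ×ˢ Iic t)) = fun ω => (X ω).restrict (univ ×ˢ Iic t) B := by
    funext ω
    rw [Measure.restrict_apply hB]
  rw [h1]
  exact (Measure.measurable_coe hB).comp (comap_measurable fun ω => (X ω).restrict (univ ×ˢ Iic t))

lemma isPoissonRandomMeasure (hM : IsClusterModel Q ℱ ν γ lam N C I D LN LC)
    (hP : HasLocalDensity ℱ P Q fun t ω => LN t ω * LC t ω) :
    IsPoissonRandomMeasure N
      ((ν.prod timeMeasure).withDensity fun x => (γ x.1 x.2 : ℝ≥0∞)) P := by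
  have := hM.isProbabilityMeasure hP
  refine isPoissonRandomMeasure_of_laplace hM.poisson_N.measurable hM.poisson_N.isConfiguration
    fun n B hB hd t => ?_
  refine lintegral_laplaceKernel_of_bounded hM.poisson_N.measurable hB fun T => ?_
  rw [← hM.lintegral_laplaceKernel_mul T hB hd t]
  refine hM.lintegral_of_N hP (t := T) ?_
  exact ENNReal.measurable_ofReal.comp ((continuous_laplaceKernel t).measurable.comp
    (@measurable_pi_lambda _ _ _ (_) _ _ fun i => measurable_apply_inter N (hB i) T))

lemma comap_le_iSup (X : Ω → Measure (E × ℝ≥0)) :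
    MeasurableSpace.comap X inferInstance ≤ ⨆ n : ℕ,
      MeasurableSpace.comap (fun ω => (X ω).restrict (univ ×ˢ Iic (n : ℝ≥0))) inferInstance := by
  rw [← measurable_iff_comap_le]
  refine @Measure.measurable_of_measurable_coe _ _ _ (_) _ fun B hB => ?_
  refine @measurable_of_tendsto_metrizable _ _ (_) _ _ _ _
    (fun (n : ℕ) ω => X ω (B ∩ univ ×ˢ Iic (n : ℝ≥0))) _ (fun n => ?_)
    (tendsto_pi_nhds.2 fun ω => tendsto_measure_inter_Iic (X ω) B)
  refine Measurable.mono (measurable_apply_inter X hB n) ?_ le_rfl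
  exact le_iSup (fun n : ℕ => MeasurableSpace.comap
    (fun ω => (X ω).restrict (univ ×ˢ Iic (n : ℝ≥0))) inferInstance) n

lemma comap_restrict_mono (X : Ω → Measure (E × ℝ≥0)) : Monotone fun n : ℕ =>
    MeasurableSpace.comap (fun ω => (X ω).restrict (univ ×ˢ Iic (n : ℝ≥0))) inferInstance := by
  intro a b hab
  simp only
  rw [← measurable_iff_comap_le]
  have h1 : (fun ω => (X ω).restrict (univ ×ˢ Iic (a : ℝ≥0))) =
      fun ω => ((X ω).restrict (univ ×ˢ Iic (b : ℝ≥0))).restrict (univ ×ˢ Iic (a : ℝ≥0)) := by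
    funext ω
    rw [Measure.restrict_restrict_of_subset
      (prod_mono_right (Iic_subset_Iic.2 (by exact_mod_cast hab)))]
  rw [h1]
  exact (measurable_measure_restrict (measurableSet_univ_prod_Iic _)).comp
    (comap_measurable fun ω => (X ω).restrict (univ ×ˢ Iic (b : ℝ≥0)))

/-- Up to each integer time the density factors and probabilities multiply. The σ-algebras of the
restrictions increase to ones containing those of `N` and `C`. -/
lemma indepFun (hM : IsClusterModel Q ℱ ν γ lam N C I D LN LC)
    (hP : HasLocalDensity ℱ P Q fun t ω => LN t ω * LC t ω) : IndepFun N C P := by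
  have := hM.isProbabilityMeasure hP
  have hN : ∀ n : ℕ, MeasurableSpace.comap (fun ω => (N ω).restrict (univ ×ˢ Iic (n : ℝ≥0)))
      inferInstance ≤ mΩ := fun n =>
    (measurable_restrict_comap N n).trans hM.poisson_N.measurable.comap_le
  have hC : ∀ n : ℕ, MeasurableSpace.comap (fun ω => (C ω).restrict (univ ×ˢ Iic (n : ℝ≥0)))
      inferInstance ≤ mΩ := fun n =>
    (measurable_restrict_comap C n).trans hM.poisson_C.measurable.comap_le
  have h0 : ∀ n : ℕ, Indep
      (MeasurableSpace.comap (fun ω => (N ω).restrict (univ ×ˢ Iic (n : ℝ≥0))) inferInstance)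
      (MeasurableSpace.comap (fun ω => (C ω).restrict (univ ×ˢ Iic (n : ℝ≥0))) inferInstance) P := by
    intro n
    rw [Indep_iff]
    intro A B hA hB
    have hA' : Measurable[MeasurableSpace.comap
        (fun ω => (N ω).restrict (univ ×ˢ Iic (n : ℝ≥0))) inferInstance]
        (A.indicator fun _ => (1 : ℝ≥0∞)) :=
      Measurable.indicator (@measurable_const _ _ _ (_) _) hA
    have hB' : Measurable[MeasurableSpace.comap
        (fun ω => (C ω).restrict (univ ×ˢ Iic (n : ℝ≥0))) inferInstance]
        (B.indicator fun _ => (1 : ℝ≥0∞)) :=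
      Measurable.indicator (@measurable_const _ _ _ (_) _) hB
    have h1 := hM.lintegral_mul_eq hP hA' hB'
    rw [← hM.lintegral_of_N hP hA', ← hM.lintegral_of_C hP hB'] at h1
    have h2 : ∀ ω, A.indicator (fun _ => (1 : ℝ≥0∞)) ω * B.indicator (fun _ => (1 : ℝ≥0∞)) ω =
        (A ∩ B).indicator (fun _ => (1 : ℝ≥0∞)) ω := by
      intro ω
      by_cases hωA : ω ∈ A <;> by_cases hωB : ω ∈ B <;> simp [hωA, hωB]
    simp_rw [h2] at h1
    have h3 : ∀ S, MeasurableSet S → ∫⁻ ω, S.indicator (fun _ => (1 : ℝ≥0∞)) ω ∂P = P S :=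
      fun S hS => lintegral_indicator_one hS
    rwa [h3 _ ((hN n _ hA).inter (hC n _ hB)), h3 _ (hN n _ hA), h3 _ (hC n _ hB)] at h1
  have h1 : Indep (⨆ n : ℕ, MeasurableSpace.comap
      (fun ω => (N ω).restrict (univ ×ˢ Iic (n : ℝ≥0))) inferInstance)
      (⨆ n : ℕ, MeasurableSpace.comap
      (fun ω => (C ω).restrict (univ ×ˢ Iic (n : ℝ≥0))) inferInstance) P := by
    refine indep_iSup_of_monotone (fun n => ?_) hN (iSup_le hC) (comap_restrict_mono N)
    refine (indep_iSup_of_monotone (fun k => ?_) hC (hN n) (comap_restrict_mono C)).symm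
    refine (indep_of_indep_of_le_left (indep_of_indep_of_le_right (h0 (max n k)) ?_) ?_).symm
    · exact comap_restrict_mono C (le_max_right n k)
    · exact comap_restrict_mono N (le_max_left n k)
  exact indep_of_indep_of_le_left (indep_of_indep_of_le_right h1 (comap_le_iSup C)) (comap_le_iSup N)

end IsClusterModel

/-! ### The jumps of the density process -/

/-- With at most one point at each time, the product over the points that share the time of `y` has
the single factor `κ y`. -/
lemma IsDiracSum.ae_pointProd_fiber {S : Type*} [MeasurableSpace S] {c : Measure S}
    (hc : IsDiracSum c) {τ : S → ℝ≥0} (hτ : Measurable τ) {κ : S → ℝ≥0} (hκ : Measurable κ)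
    (h1 : ∀ s, c {x | τ x = s} ≤ 1) :
    ∀ᵐ y ∂c, pointProd κ (c.restrict {x | τ x = τ y}) = κ y := by
  induction hc using IsDiracSum.induction with
  | h0 => simp
  | h a μ hμ ih =>
    have hm : ∀ s, MeasurableSet {x | τ x = s} := fun s => hτ (measurableSet_singleton s)
    have hμ1 : ∀ s, μ {x | τ x = s} ≤ 1 := fun s => le_trans (by
      rw [Measure.add_apply]; exact le_add_self) (h1 s)
    have hμ0 : μ {x | τ x = τ a} = 0 := by
      have h2 := h1 (τ a)
      rw [Measure.add_apply, Measure.dirac_apply' _ (hm _), indicator_of_mem (by exact rfl),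
        Pi.one_apply] at h2
      obtain ⟨n, hn⟩ := hμ.exists_natCast (hm (τ a))
      rw [hn] at h2 ⊢
      have h3 : 1 + n ≤ 1 := by exact_mod_cast h2
      have : n = 0 := by omega
      simp [this]
    rw [ae_add_measure_iff]
    constructor
    · have h2 : ∀ᵐ x ∂(Measure.dirac a), τ x = τ a ∧ κ x = κ a := by
        have hm2 : MeasurableSet {x | τ x = τ a ∧ κ x = κ a} :=
          (hm _).inter (hκ (measurableSet_singleton _))
        rw [ae_iff, Measure.dirac_apply' _ (by exact hm2.compl)]
        simp
      filter_upwards [h2] with y hy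
      rw [hy.1, hy.2, Measure.restrict_add, Measure.restrict_eq_zero.2 hμ0, add_zero,
        restrict_dirac' (hm _), if_pos (by exact rfl), pointProd_dirac hκ]
    · filter_upwards [ih hμ1, measure_eq_zero_iff_ae_notMem.1 hμ0] with y hy hya
      have h2 : a ∉ {x | τ x = τ y} := fun h => hya (by exact (show τ a = τ y from h).symm)
      rw [Measure.restrict_add, restrict_dirac' (hm _), if_neg h2, zero_add, hy]

/-- The jump relation is restated at almost every point of `c`, the form needed to replace `L` by `κ
L₋` under an integral against `c`. -/
lemma SolvesPath.ae_eq_leftLim_mul {ν : Measure E} {c : Measure (E × ℝ≥0)} {κ : E × ℝ≥0 → ℝ≥0}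
    {L : ℝ≥0 → ℝ} (hκ : Measurable κ) (hc : IsSimple c) (hL : SolvesPath ν c κ L) (t : ℝ≥0) :
    ∀ᵐ y ∂(c.restrict (univ ×ˢ Iic t)), L y.2 = Function.leftLim L y.2 * κ y := by
  have hJ := measurableSet_univ_prod_Iic (E := E) t
  have h := (hc.isConfiguration.isDiracSum_restrict hJ subset_rfl).ae_pointProd_fiber
    measurable_snd hκ (fun s => (Measure.restrict_apply_le _ _).trans (by
      refine le_trans (measure_mono fun x hx => ?_) (hc.le_one s)
      exact ⟨mem_univ _, hx⟩))
  filter_upwards [h, ae_restrict_mem hJ] with y hy hyt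
  have h2 : ({x : E × ℝ≥0 | x.2 = y.2}) = univ ×ˢ {y.2} := by ext; simp
  rw [h2, Measure.restrict_restrict_of_subset
    (prod_mono_right (singleton_subset_iff.2 hyt.2))] at hy
  rw [hL.eq_leftLim_mul hκ hc, hy]

/-- The times in question lie in an initial interval with at most `j` points before its end and, by
simplicity, at most one at the end. -/
lemma IsSimple.measure_countBefore_le {c : Measure (E × ℝ≥0)} (hc : IsSimple c) (t : ℝ≥0) (j : ℕ) :
    c (univ ×ˢ {s | s ≤ t ∧ c (univ ×ˢ Iio s) ≤ j}) ≤ j + 1 := by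
  set A := {s | s ≤ t ∧ c (univ ×ˢ Iio s) ≤ j} with hA
  have h0 : (0 : ℝ≥0) ∈ A := by
    refine ⟨zero_le, ?_⟩
    simp
  have hbdd : BddAbove A := ⟨t, fun r hr => hr.1⟩
  have hT : c (univ ×ˢ Iio (sSup A)) ≤ j := by
    rcases eq_or_ne (sSup A) 0 with h | h
    · rw [h]; exact h0.2
    · have hpos : 0 < sSup A := pos_iff_ne_zero.2 h
      have : (𝓝[<] (sSup A)).NeBot := nhdsLT_neBot_of_exists_lt ⟨0, hpos⟩
      refine le_of_tendsto (tendsto_measure_prod_Iic_left c hpos) ?_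
      filter_upwards [self_mem_nhdsWithin] with r hr
      obtain ⟨s, hs, hrs⟩ := exists_lt_of_lt_csSup ⟨0, h0⟩ hr
      exact (measure_mono (prod_mono_right (Iic_subset_Iio.2 hrs))).trans hs.2
  have hsub : (univ ×ˢ A : Set (E × ℝ≥0)) ⊆ univ ×ˢ Iio (sSup A) ∪ univ ×ˢ {sSup A} := by
    rw [← prod_union, Iio_union_right]
    exact prod_mono_right fun s hs => le_csSup hbdd hs
  exact (measure_mono hsub).trans ((measure_union_le _ _).trans (add_le_add hT (hc.le_one _)))

/-- The product of a driven process and a pure jump process. -/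
lemma driven_mul_setIntegral {ν : Measure E} [SFinite ν] {X Y : Ω → Measure (E × ℝ≥0)}
    {f g k : Ω × (E × ℝ≥0) → ℝ} {ω : Ω} [SFinite (X ω)] [SFinite (Y ω)]
    (hf : ∀ t, CompIntegrable ν X f t ω) (hg : ∀ t, CompIntegrable ν Y g t ω)
    {t : ℝ≥0} (hk : IntegrableOn (fun x => k (ω, x)) (univ ×ˢ Iic t) (Y ω)) :
    (1 + (compInt ν X f t ω + compInt ν Y g t ω)) * ∫ x in univ ×ˢ Iic t, k (ω, x) ∂(Y ω) =
      (compInt ν X (fun p => (∫ y in univ ×ˢ Iio p.2.2, k (p.1, y) ∂(Y p.1)) * f p) t ω +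
        compInt ν Y (fun p => (∫ y in univ ×ˢ Iio p.2.2, k (p.1, y) ∂(Y p.1)) * g p) t ω) +
      ∫ y in univ ×ˢ Iic t, k (ω, y) * (1 + (compInt ν X f y.2 ω + compInt ν Y g y.2 ω)) ∂(Y ω) := by
  set m := ν.prod timeMeasure with hm
  -- `X`, `Y` and their two compensators live on four disjoint copies, so the driven process is `1`
  -- plus a single integral and the product rule applies.
  set M := sumMeasure (sumMeasure (X ω) m) (sumMeasure (Y ω) m) with hMdef
  set f' : E × ℝ≥0 → ℝ := fun x => f (ω, x) with hf'
  set g' : E × ℝ≥0 → ℝ := fun x => g (ω, x) with hg'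
  set τ : ((E × ℝ≥0) ⊕ (E × ℝ≥0)) ⊕ ((E × ℝ≥0) ⊕ (E × ℝ≥0)) → ℝ≥0 :=
    Sum.elim sumTime sumTime with hτ
  have hτm : Measurable τ := measurable_sumTime.sumElim measurable_sumTime
  have int : ∀ f₁ g₁ : E × ℝ≥0 → ℝ, ∀ r, IntegrableOn (Sum.elim (Sum.elim f₁ (-f₁))
        (Sum.elim g₁ (-g₁))) {x | τ x ≤ r} M ↔
      (IntegrableOn f₁ (univ ×ˢ Iic r) (X ω) ∧ IntegrableOn f₁ (univ ×ˢ Iic r) m) ∧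
      (IntegrableOn g₁ (univ ×ˢ Iic r) (Y ω) ∧ IntegrableOn g₁ (univ ×ˢ Iic r) m) := by
    intro f₁ g₁ r
    rw [hMdef, integrableOn_sumMeasure, Sum.elim_comp_inl, Sum.elim_comp_inr]
    exact and_congr (integrableOn_compensated (J := Iic r)) (integrableOn_compensated (J := Iic r))
  have val : ∀ f₁ g₁ : E × ℝ≥0 → ℝ, ∀ r, IntegrableOn (Sum.elim (Sum.elim f₁ (-f₁))
        (Sum.elim g₁ (-g₁))) {x | τ x ≤ r} M →
      ∫ x in {x | τ x ≤ r}, Sum.elim (Sum.elim f₁ (-f₁)) (Sum.elim g₁ (-g₁)) x ∂M =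
      (∫ x in univ ×ˢ Iic r, f₁ x ∂(X ω) - ∫ x in univ ×ˢ Iic r, f₁ x ∂m) +
      (∫ x in univ ×ˢ Iic r, g₁ x ∂(Y ω) - ∫ x in univ ×ˢ Iic r, g₁ x ∂m) := by
    intro f₁ g₁ r hr
    have hr' := (int f₁ g₁ r).1 hr
    rw [hMdef] at hr ⊢
    rw [setIntegral_sumMeasure hr, ← setIntegral_compensated hr'.1.1 hr'.1.2,
      ← setIntegral_compensated hr'.2.1 hr'.2.2]
    rfl
  have hW : ∀ r, compInt ν X f r ω + compInt ν Y g r ω =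
      ∫ x in {x | τ x ≤ r}, Sum.elim (Sum.elim f' (-f')) (Sum.elim g' (-g')) x ∂M := fun r =>
    (val f' g' r ((int f' g' r).2 ⟨hf r, hg r⟩)).symm
  obtain ⟨p1, -, p3⟩ := product_rule (μ := M) (ρ := Y ω) hτm measurable_snd 1 0 (t := t)
    (f := Sum.elim (Sum.elim f' (-f')) (Sum.elim g' (-g'))) (g := fun x => k (ω, x))
    ((int f' g' t).2 ⟨hf t, hg t⟩) (by rwa [← univ_prod_Iic])
  simp_rw [← hW] at p3
  simp_rw [← univ_prod_Iic (S := E), ← univ_prod_Iio (S := E), zero_add, mul_zero] at p1 p3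
  have e1 : (fun x => Sum.elim (Sum.elim f' (-f')) (Sum.elim g' (-g')) x *
        ∫ y in univ ×ˢ Iio (τ x), k (ω, y) ∂(Y ω)) =
      Sum.elim (Sum.elim (fun x => (∫ y in univ ×ˢ Iio x.2, k (ω, y) ∂(Y ω)) * f' x)
          (-fun x => (∫ y in univ ×ˢ Iio x.2, k (ω, y) ∂(Y ω)) * f' x))
        (Sum.elim (fun x => (∫ y in univ ×ˢ Iio x.2, k (ω, y) ∂(Y ω)) * g' x)
          (-fun x => (∫ y in univ ×ˢ Iio x.2, k (ω, y) ∂(Y ω)) * g' x)) := by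
    funext x
    rcases x with (x | x) | (x | x) <;> simp [hτ, sumTime, mul_comm]
  rw [e1] at p1
  rw [p3]
  congr 1
  rw [zero_add]
  have e2 := val _ _ t p1
  rw [← e1] at e2
  exact e2

/-! ### Compensation under the new measure -/

section Compensation

variable {ℱ : Filtration ℝ≥0 mΩ} {Q : Measure Ω} {ν : Measure E} {X Y : Ω → Measure (E × ℝ≥0)}
  {h k V : Ω × (E × ℝ≥0) → ℝ} {U : ℝ≥0 → Ω → ℝ} {K : Ω × (E × ℝ≥0) → ℝ≥0}

/-- Integrals of predictable functions up to time `t` against an adapted random measure are known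
at time `t`. -/
lemma measurable_setLIntegral_toKernel (hXℱ : IsCompatible ℱ X Q)
    (hXc : ∀ ω t, X ω (univ ×ˢ Iic t) < ∞) {H : Ω × (E × ℝ≥0) → ℝ≥0∞}
    (hH : Measurable[predictableMarked E ℱ] H) (t : ℝ≥0) :
    Measurable[ℱ t] fun ω => ∫⁻ x in univ ×ˢ Iic t, H (ω, x) ∂(X ω) := by
  have h := measurable_indicator_predictable t hH
  have e : ∀ ω, ∫⁻ x in univ ×ˢ Iic t, H (ω, x) ∂(X ω) =
      ∫⁻ x, {p : Ω × (E × ℝ≥0) | p.2.2 ≤ t}.indicator H (ω, x) ∂((X ω).restrict (univ ×ˢ Iic t)) := by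
    intro ω
    refine setLIntegral_congr_fun (measurableSet_univ_prod_Iic t) fun x hx => ?_
    exact (indicator_of_mem (s := {p : Ω × (E × ℝ≥0) | p.2.2 ≤ t}) (a := (ω, x))
      (show x.2 ≤ t from hx.2) H).symm
  simp_rw [e]
  exact @measurable_lintegral_toKernel E _ Ω (ℱ t)
      (fun ω => (X ω).restrict (univ ×ˢ Iic t)) (hXℱ.adapted t)
      (fun ω s => (Measure.restrict_apply_le _ _).trans_lt (hXc ω s)) _ h

lemma measurable_lintegral_Iio_predictable (hXℱ : IsCompatible ℱ X Q)
    (hXc : ∀ ω t, X ω (univ ×ˢ Iic t) < ∞) {H : Ω × (E × ℝ≥0) → ℝ≥0∞}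
    (hH : Measurable[predictableMarked E ℱ] H) :
    Measurable[predictableMarked E ℱ] fun p : Ω × (E × ℝ≥0) =>
      ∫⁻ x in univ ×ˢ Iio p.2.2, H (p.1, x) ∂(X p.1) := by
  refine measurable_predictable_of_left
    (Y := fun t ω => ∫⁻ x in univ ×ˢ Iic t, H (ω, x) ∂(X ω))
    (Z := fun t ω => ∫⁻ x in univ ×ˢ Iio t, H (ω, x) ∂(X ω))
    (fun t => measurable_setLIntegral_toKernel hXℱ hXc hH t) (fun ω => ?_) (fun ω t ht => ?_)
  · simp
  · have := tendsto_measure_prod_Iic_left ((X ω).withDensity fun x => H (ω, x)) ht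
    rw [withDensity_apply _ (measurableSet_univ_prod_Iio t)] at this
    simp_rw [withDensity_apply _ (measurableSet_univ_prod_Iic _)] at this
    exact this

lemma IsConfiguration.integrableOn {c : Measure (E × ℝ≥0)} (hc : IsConfiguration c) {g : E × ℝ≥0 → ℝ}
    (hg : Measurable g) (t : ℝ≥0) : IntegrableOn g (univ ×ˢ Iic t) c :=
  (hc.isDiracSum_restrict (measurableSet_univ_prod_Iic t) subset_rfl).integrable hg

lemma integral_coe_nnreal {c : Measure (E × ℝ≥0)} {g : E × ℝ≥0 → ℝ≥0} (hg : Measurable g) :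
    ∫ x, (g x : ℝ) ∂c = (∫⁻ x, g x ∂c).toReal := by
  rw [integral_eq_lintegral_of_nonneg_ae (ae_of_all _ fun x => (g x).coe_nonneg)
    hg.coe_nnreal_real.aestronglyMeasurable]
  simp

variable [IsFiniteMeasure ν] [IsProbabilityMeasure Q]

/-- Integration by parts of the truncated density with `A = ∫ K dY`, cut at the same level. The term
`∫ A₋ dU` has mean zero because `A₋` is bounded; in `∫ K U dY` the density is replaced by the
predictable `V`, and `Y` is compensated. -/
lemma IsDriven.lintegral_truncated_mul (hX : IsPoissonRandomMeasure X (ν.prod timeMeasure) Q)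
    (hXℱ : IsCompatible ℱ X Q) (hY : IsPoissonRandomMeasure Y (ν.prod timeMeasure) Q)
    (hYℱ : IsCompatible ℱ Y Q) (hh : Measurable[predictableMarked E ℱ] h)
    (hk : Measurable[predictableMarked E ℱ] k) (hdr : IsDriven Q ν X Y h k U)
    (hU0 : ∀ᵐ ω ∂Q, ∀ t, 0 ≤ U t ω) (hV : Measurable[predictableMarked E ℱ] V)
    (hUV : ∀ᵐ ω ∂Q, ∀ t, ∀ᵐ y ∂((Y ω).restrict (univ ×ˢ Iic t)), U y.2 ω = V (ω, y))
    (hK : Measurable[predictableMarked E ℱ] K) {a : ℝ≥0}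
    (hKa : ∀ᵐ ω ∂Q, ∀ t, ∫⁻ x in univ ×ˢ Iic t, K (ω, x) ∂(Y ω) ≤ a) (n : ℕ) (t : ℝ≥0) :
    ENNReal.ofReal (∫ ω, truncated ν X Y h k n t ω *
        ∫ x in univ ×ˢ Iic t, (((driftBelow ν h k n).indicator K (ω, x) : ℝ≥0) : ℝ) ∂(Y ω) ∂Q) =
      ∫⁻ ω, ∫⁻ x in univ ×ˢ Iic t, ((driftBelow ν h k n).indicator K (ω, x) : ℝ≥0) *
        ENNReal.ofReal (V (ω, x)) ∂(ν.prod timeMeasure) ∂Q := by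
  have hR := measurableSet_driftBelow (ν := ν) hh hk n
  set κ : Ω × (E × ℝ≥0) → ℝ≥0 := (driftBelow ν h k n).indicator K with hκ
  have hκm : Measurable[predictableMarked E ℱ] κ := hK.indicator hR
  have hκs : ∀ ω, Measurable fun x => κ (ω, x) := measurable_section_of_predictable hκm
  have hκK : ∀ p, κ p ≤ K p := indicator_le_self _ _
  set Z : Ω × (E × ℝ≥0) → ℝ≥0∞ := fun p =>
    ∫⁻ x in univ ×ˢ Iio p.2.2, κ (p.1, x) ∂(Y p.1) with hZ
  have hZm : Measurable[predictableMarked E ℱ] Z :=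
    measurable_lintegral_Iio_predictable hYℱ hY.lt_top (H := fun p => (κ p : ℝ≥0∞))
      hκm.coe_nnreal_ennreal
  -- `Z` is at most `a` only almost surely; the minimum makes the integrand bounded everywhere and
  -- changes nothing on those paths.
  set g : Ω × (E × ℝ≥0) → ℝ := fun p => (min (Z p) a).toReal with hg
  have hgm : Measurable[predictableMarked E ℱ] g := (hZm.min (@measurable_const _ _ _ (_) _)).ennreal_toReal
  have hga : ∀ p, |g p| ≤ a := fun p => by
    rw [abs_of_nonneg ENNReal.toReal_nonneg]
    exact ENNReal.toReal_le_coe_of_le_coe (min_le_right _ _)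
  obtain ⟨z1, z2⟩ := truncated_mean_zero hX hXℱ hY hYℱ hh hk hgm hga n t
  have hS : MeasurableSet[predictableMarked E ℱ]
      {p : Ω × (E × ℝ≥0) | p.2 ∈ (univ ×ˢ Iic t : Set (E × ℝ≥0))} :=
    measurable_snd_predictable (measurableSet_univ_prod_Iic t)
  have hcomp := hY.lintegral_compensation hYℱ (H :=
    {p : Ω × (E × ℝ≥0) | p.2 ∈ (univ ×ˢ Iic t : Set (E × ℝ≥0))}.indicator fun p =>
      κ p * ENNReal.ofReal (V p))
    ((hκm.coe_nnreal_ennreal.mul (ENNReal.measurable_ofReal.comp hV)).indicator hS)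
  have e : ∀ (ω : Ω) (ρ : Measure (E × ℝ≥0)),
      ∫⁻ x, {p : Ω × (E × ℝ≥0) | p.2 ∈ (univ ×ˢ Iic t : Set (E × ℝ≥0))}.indicator
        (fun p => κ p * ENNReal.ofReal (V p)) (ω, x) ∂ρ =
        ∫⁻ x in univ ×ˢ Iic t, κ (ω, x) * ENNReal.ofReal (V (ω, x)) ∂ρ := by
    intro ω ρ
    rw [← lintegral_indicator (measurableSet_univ_prod_Iic t)]
    rfl
  simp_rw [e] at hcomp
  rw [← hcomp]
  have hbd : ∀ᵐ ω ∂Q, ∀ t, ∫⁻ x in univ ×ˢ Iic t, κ (ω, x) ∂(Y ω) ≤ a := by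
    filter_upwards [hKa] with ω hω t
    exact (lintegral_mono fun x => ENNReal.coe_le_coe.2 (hκK _)).trans (hω t)
  have hid : ∀ᵐ ω ∂Q, truncated ν X Y h k n t ω * ∫ x in univ ×ˢ Iic t, (κ (ω, x) : ℝ) ∂(Y ω) =
      (compInt ν X (fun p => g p * (driftBelow ν h k n).indicator h p) t ω +
        compInt ν Y (fun p => g p * (driftBelow ν h k n).indicator k p) t ω) +
      ∫ y in univ ×ˢ Iic t, κ (ω, y) * V (ω, y) ∂(Y ω) ∧
      0 ≤ ∫ y in univ ×ˢ Iic t, κ (ω, y) * V (ω, y) ∂(Y ω) ∧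
      ENNReal.ofReal (∫ y in univ ×ˢ Iic t, κ (ω, y) * V (ω, y) ∂(Y ω)) =
        ∫⁻ y in univ ×ˢ Iic t, κ (ω, y) * ENNReal.ofReal (V (ω, y)) ∂(Y ω) := by
    filter_upwards [hdr, hbd, hUV, hU0] with ω hω hb hUVω hU0ω
    have := (hX.isConfiguration ω).sigmaFinite
    have := (hY.isConfiguration ω).sigmaFinite
    have hint := (hY.isConfiguration ω).integrableOn (hκs ω).coe_nnreal_real t
    have hd := driven_mul_setIntegral (k := fun p => (κ p : ℝ))
      (fun t => (hω t).1.driftBelow hh hk n) (fun t => (hω t).2.1.driftBelow hh hk n) hint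
    have hgZ : ∀ x, ∫ y in univ ×ˢ Iio x.2, (κ (ω, y) : ℝ) ∂(Y ω) = g (ω, x) := by
      intro x
      rw [integral_coe_nnreal (hκs ω), hg]
      simp only
      rw [min_eq_left]
      exact (lintegral_mono_set (prod_mono_right Iio_subset_Iic_self)).trans (hb x.2)
    have hlast : ∫ y in univ ×ˢ Iic t, (κ (ω, y) : ℝ) *
        (1 + (compInt ν X ((driftBelow ν h k n).indicator h) y.2 ω +
          compInt ν Y ((driftBelow ν h k n).indicator k) y.2 ω)) ∂(Y ω) =
        ∫ y in univ ×ˢ Iic t, κ (ω, y) * V (ω, y) ∂(Y ω) := by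
      refine integral_congr_ae ?_
      filter_upwards [hUVω t] with y hy
      -- At a point below the level the truncated process has not been stopped and equals `U`;
      -- beyond the level the cut-off `K` vanishes.
      by_cases hyR : (ω, y) ∈ driftBelow ν h k n
      · obtain ⟨T, -, he, -, hT⟩ := exists_truncated_eq (X := X) (Y := Y) (ν := ν) hh hk n y.2 ω
        unfold truncated at he
        rw [he, hT hyR, ← (hω y.2).2.2, hy]
      · simp [hκ, indicator_of_notMem hyR]
    refine ⟨?_, ?_, ?_⟩
    · rw [hlast] at hd
      refine hd.trans ?_
      unfold compInt
      simp_rw [hgZ]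
    · refine integral_nonneg_of_ae ?_
      filter_upwards [hUVω t] with y hy
      rw [← hy]
      exact mul_nonneg (κ _).coe_nonneg (hU0ω _)
    · rw [ofReal_integral_eq_lintegral_ofReal]
      · refine lintegral_congr fun y => ?_
        rw [ENNReal.ofReal_mul (κ _).coe_nonneg, ENNReal.ofReal_coe_nnreal]
      · exact (hY.isConfiguration ω).integrableOn
          ((hκs ω).coe_nnreal_real.mul (measurable_section_of_predictable hV ω)) t
      · filter_upwards [hUVω t] with y hy
        rw [← hy]
        exact mul_nonneg (κ _).coe_nonneg (hU0ω _)
  have hKr : Measurable fun ω => ∫ x in univ ×ˢ Iic t, (κ (ω, x) : ℝ) ∂(Y ω) := by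
    simp_rw [integral_coe_nnreal (hκs _)]
    exact ((measurable_setLIntegral_toKernel hYℱ hY.lt_top (H := fun p => (κ p : ℝ≥0∞))
      hκm.coe_nnreal_ennreal t).ennreal_toReal).mono (ℱ.le t) le_rfl
  have hiL : Integrable (fun ω => truncated ν X Y h k n t ω *
      ∫ x in univ ×ˢ Iic t, (κ (ω, x) : ℝ) ∂(Y ω)) Q := by
    refine (truncated_integrable hX hXℱ hY hYℱ hh hk n t).1.mul_bdd (c := a)
      hKr.aestronglyMeasurable ?_
    filter_upwards [hbd] with ω hω
    rw [integral_coe_nnreal (hκs _), Real.norm_eq_abs, abs_of_nonneg ENNReal.toReal_nonneg]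
    exact ENNReal.toReal_le_coe_of_le_coe (hω t)
  have hiR : Integrable (fun ω => ∫ y in univ ×ˢ Iic t, κ (ω, y) * V (ω, y) ∂(Y ω)) Q := by
    refine (hiL.sub z1).congr ?_
    filter_upwards [hid] with ω hω
    rw [Pi.sub_apply, hω.1]
    ring
  have e2 : ∫ ω, truncated ν X Y h k n t ω * ∫ x in univ ×ˢ Iic t, (κ (ω, x) : ℝ) ∂(Y ω) ∂Q =
      ∫ ω, ∫ y in univ ×ˢ Iic t, κ (ω, y) * V (ω, y) ∂(Y ω) ∂Q := by
    rw [integral_congr_ae (hid.mono fun ω hω => hω.1), integral_add z1 hiR, z2, zero_add]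
  rw [e2, ofReal_integral_eq_lintegral_ofReal hiR (hid.mono fun ω hω => hω.2.1)]
  exact lintegral_congr_ae (hid.mono fun ω hω => hω.2.2)

/-- Compensation of bounded functionals with respect to a driven density. -/
theorem IsDriven.lintegral_mul_setLIntegral (hX : IsPoissonRandomMeasure X (ν.prod timeMeasure) Q)
    (hXℱ : IsCompatible ℱ X Q) (hY : IsPoissonRandomMeasure Y (ν.prod timeMeasure) Q)
    (hYℱ : IsCompatible ℱ Y Q) (hh : Measurable[predictableMarked E ℱ] h)
    (hk : Measurable[predictableMarked E ℱ] k) (hdr : IsDriven Q ν X Y h k U)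
    (hU0 : ∀ᵐ ω ∂Q, ∀ t, 0 ≤ U t ω) (hUi : ∀ t, Integrable (U t) Q)
    (hU1 : ∀ t, ∫ ω, U t ω ∂Q = 1) (hV : Measurable[predictableMarked E ℱ] V)
    (hUV : ∀ᵐ ω ∂Q, ∀ t, ∀ᵐ y ∂((Y ω).restrict (univ ×ˢ Iic t)), U y.2 ω = V (ω, y))
    (hK : Measurable[predictableMarked E ℱ] K) {a : ℝ≥0}
    (hKa : ∀ᵐ ω ∂Q, ∀ t, ∫⁻ x in univ ×ˢ Iic t, K (ω, x) ∂(Y ω) ≤ a) (t : ℝ≥0) :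
    ∫⁻ ω, (∫⁻ x in univ ×ˢ Iic t, K (ω, x) ∂(Y ω)) * ENNReal.ofReal (U t ω) ∂Q =
      ∫⁻ ω, ∫⁻ x in univ ×ˢ Iic t, K (ω, x) * ENNReal.ofReal (V (ω, x)) ∂(ν.prod timeMeasure) ∂Q := by
  have hfacts := hdr.truncated_facts hh hk hU0
  have hR := fun n => measurableSet_driftBelow (ν := ν) hh hk n
  have hKn : ∀ n, Measurable[predictableMarked E ℱ] ((driftBelow ν h k n).indicator K) := fun n =>
    hK.indicator (hR n)
  have hKns : ∀ n ω, Measurable fun x => (driftBelow ν h k n).indicator K (ω, x) := fun n ω =>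
    measurable_section_of_predictable (hKn n) ω
  have hKs : ∀ ω, Measurable fun x => K (ω, x) := measurable_section_of_predictable hK
  have hev : ∀ᵐ ω ∂Q, ∀ᶠ n : ℕ in atTop, ∀ x ∈ (univ ×ˢ Iic t : Set (E × ℝ≥0)),
      (driftBelow ν h k n).indicator K (ω, x) = K (ω, x) := by
    filter_upwards [hdr.driftVariation_ne_top] with ω hω
    obtain ⟨n₀, hn₀⟩ := ENNReal.exists_nat_gt (hω t)
    filter_upwards [eventually_ge_atTop n₀] with n hn x hx
    refine indicator_of_mem ?_ _
    refine le_trans (lintegral_mono_set (prod_mono_right (Iic_subset_Iic.2 hx.2))) ?_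
    exact hn₀.le.trans (by exact_mod_cast hn)
  -- The left side converges by Scheffé's lemma, the multipliers being bounded by `a`; the right
  -- side (`hr`) by monotone convergence, as the cut-offs increase with `n`.
  have hl := tendsto_integral_mul_of_scheffe (Q := Q) (f := fun n => truncated ν X Y h k n t)
    (g := U t)
    (Z := fun n ω => ∫ x in univ ×ˢ Iic t, (((driftBelow ν h k n).indicator K (ω, x) : ℝ≥0) : ℝ) ∂(Y ω))
    (Y := fun ω => ∫ x in univ ×ˢ Iic t, (K (ω, x) : ℝ) ∂(Y ω)) (a := a)
    (fun n => (truncated_integrable hX hXℱ hY hYℱ hh hk n t).1)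
    (fun n => by filter_upwards [hfacts] with ω hω using (hω t).1 n) (hUi t)
    (by filter_upwards [hU0] with ω hω using hω t)
    (by filter_upwards [hfacts] with ω hω using tendsto_nhds_of_eventually_eq (hω t).2)
    (fun n => by rw [(truncated_integrable hX hXℱ hY hYℱ hh hk n t).2, hU1])
    (fun n => by
      simp_rw [fun ω => integral_coe_nnreal (c := (Y ω).restrict (univ ×ˢ Iic t)) (hKns n ω)]
      exact (((measurable_setLIntegral_toKernel hYℱ hY.lt_top
        (H := fun p => (((driftBelow ν h k n).indicator K p : ℝ≥0) : ℝ≥0∞))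
        (hKn n).coe_nnreal_ennreal t).ennreal_toReal).mono (ℱ.le t) le_rfl).aestronglyMeasurable)
    (fun n => by
      filter_upwards [hKa] with ω hω
      rw [integral_coe_nnreal (hKns n _), abs_of_nonneg ENNReal.toReal_nonneg]
      refine ENNReal.toReal_le_coe_of_le_coe (le_trans (lintegral_mono fun x => ?_) (hω t))
      exact ENNReal.coe_le_coe.2 (indicator_le_self _ _ _))
    (by
      filter_upwards [hev] with ω hω
      refine tendsto_nhds_of_eventually_eq ?_
      filter_upwards [hω] with n hn
      refine setIntegral_congr_fun (measurableSet_univ_prod_Iic t) fun x hx => ?_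
      rw [hn x hx])
  have hl2 := (ENNReal.continuous_ofReal.tendsto _).comp hl
  simp only [Function.comp_def] at hl2
  simp_rw [hdr.lintegral_truncated_mul hX hXℱ hY hYℱ hh hk hU0 hV hUV hK hKa _ t] at hl2
  have hm : Measurable fun p : Ω × (E × ℝ≥0) => (K p : ℝ≥0∞) * ENNReal.ofReal (V p) :=
    (measurable_of_predictable hK).coe_nnreal_ennreal.mul
      (ENNReal.measurable_ofReal.comp (measurable_of_predictable hV))
  have hr : Tendsto (fun n => ∫⁻ ω, ∫⁻ x in univ ×ˢ Iic t, ((driftBelow ν h k n).indicator K (ω, x) : ℝ≥0) *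
        ENNReal.ofReal (V (ω, x)) ∂(ν.prod timeMeasure) ∂Q) atTop
      (𝓝 (∫⁻ ω, ∫⁻ x in univ ×ˢ Iic t, K (ω, x) * ENNReal.ofReal (V (ω, x))
        ∂(ν.prod timeMeasure) ∂Q)) := by
    refine lintegral_tendsto_of_tendsto_of_monotone (fun n => ?_) (ae_of_all _ fun ω => ?_) ?_
    · have : Measurable fun p : Ω × (E × ℝ≥0) => (((driftBelow ν h k n).indicator K p : ℝ≥0) : ℝ≥0∞) *
          ENNReal.ofReal (V p) := (measurable_of_predictable (hKn n)).coe_nnreal_ennreal.mul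
            (ENNReal.measurable_ofReal.comp (measurable_of_predictable hV))
      exact this.lintegral_prod_right'.aemeasurable
    · intro n n' hnn
      refine lintegral_mono fun x => mul_le_mul_left (ENNReal.coe_le_coe.2 ?_) _
      refine indicator_le_indicator_of_subset (fun p hp => ?_) (fun _ => zero_le) _
      exact le_trans (show driftVariation ν h k p.1 p.2.2 ≤ n from hp) (by exact_mod_cast hnn)
    · filter_upwards [hev] with ω hω
      refine tendsto_nhds_of_eventually_eq ?_
      filter_upwards [hω] with n hn
      refine setLIntegral_congr_fun (measurableSet_univ_prod_Iic t) fun x hx => ?_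
      rw [hn x hx]
  rw [← tendsto_nhds_unique hl2 hr, ofReal_integral_eq_lintegral_ofReal]
  · refine lintegral_congr_ae ?_
    filter_upwards [hKa, hU0] with ω hω h0
    rw [ENNReal.ofReal_mul (h0 t), integral_coe_nnreal (hKs ω), mul_comm, ENNReal.ofReal_toReal]
    exact ((hω t).trans_lt ENNReal.coe_lt_top).ne
  · refine (hUi t).mul_bdd (c := a) ?_ ?_
    · simp_rw [fun ω => integral_coe_nnreal (c := (Y ω).restrict (univ ×ˢ Iic t)) (hKs ω)]
      exact (((measurable_setLIntegral_toKernel hYℱ hY.lt_top (H := fun p => (K p : ℝ≥0∞))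
        hK.coe_nnreal_ennreal t).ennreal_toReal).mono (ℱ.le t) le_rfl).aestronglyMeasurable
    · filter_upwards [hKa] with ω hω
      rw [integral_coe_nnreal (hKs _), Real.norm_eq_abs, abs_of_nonneg ENNReal.toReal_nonneg]
      exact ENNReal.toReal_le_coe_of_le_coe (hω t)
  · filter_upwards [hU0] with ω h0
    exact mul_nonneg (h0 t) (integral_nonneg fun x => (K _).coe_nonneg)

end Compensation

/-! ### The intensity of `C` under the new measure -/

lemma measurable_section_predictable {ℱ : Filtration ℝ≥0 mΩ} {β : Type*} [MeasurableSpace β] [Zero β]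
    {H : Ω × (E × ℝ≥0) → β} (hH : Measurable[predictableMarked E ℱ] H) (x : E × ℝ≥0) :
    Measurable[ℱ x.2] fun ω => H (ω, x) := by
  have h1 : Measurable[ℱ x.2] fun ω => {p : Ω × (E × ℝ≥0) | p.2.2 ≤ x.2}.indicator H (ω, x) :=
    (measurable_indicator_predictable x.2 hH).comp (@measurable_prodMk_right _ _ (ℱ x.2) _ x)
  have h2 : (fun ω => {p : Ω × (E × ℝ≥0) | p.2.2 ≤ x.2}.indicator H (ω, x)) = fun ω => H (ω, x) := by
    funext ω
    exact indicator_of_mem (s := {p : Ω × (E × ℝ≥0) | p.2.2 ≤ x.2}) (le_refl x.2) H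
  rwa [h2] at h1

namespace IsClusterModel

variable {P Q : Measure Ω} {ℱ : Filtration ℝ≥0 mΩ} {ν : Measure E} {γ : E → ℝ≥0 → ℝ≥0}
  {lam : E → ℝ≥0 → Bool → Measure (E × ℝ≥0) → ℝ≥0} {N C : Ω → Measure (E × ℝ≥0)}
  {I : ℕ+ → Ω → Bool} {D : ℝ≥0 → Ω → Bool} {LN LC : ℝ≥0 → Ω → ℝ} {K : Ω × (E × ℝ≥0) → ℝ≥0}

variable [IsFiniteMeasure ν] [IsProbabilityMeasure Q]

/-- Here the intensity appears: at a point of `C`, `L_N` does not jump and `L_C` is multiplied by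
`λ`, so `L = λ L₋`. After compensation, Tonelli's theorem fixes a time `s`; almost surely no point
falls there, so `L₋(s) = L(s)` and the integral is again an expectation under `P`. -/
lemma lintegral_setLIntegral_of_le (hM : IsClusterModel Q ℱ ν γ lam N C I D LN LC)
    (hP : HasLocalDensity ℱ P Q fun t ω => LN t ω * LC t ω)
    (hK : Measurable[predictableMarked E ℱ] K) {a : ℝ≥0}
    (hKa : ∀ᵐ ω ∂Q, ∀ t, ∫⁻ x in univ ×ˢ Iic t, K (ω, x) ∂(C ω) ≤ a) (t : ℝ≥0) :
    ∫⁻ ω, ∫⁻ x in univ ×ˢ Iic t, K (ω, x) ∂(C ω) ∂P =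
      ∫⁻ ω, ∫⁻ x in univ ×ˢ Iic t, (K (ω, x) * rateBefore lam C D (ω, x) : ℝ≥0)
        ∂(ν.prod timeMeasure) ∂P := by
  have := hM.isProbabilityMeasure hP
  obtain ⟨G, hG, hGU, hd⟩ := hM.exists_driven
  have hγ : Measurable[predictableMarked E ℱ] fun p : Ω × (E × ℝ≥0) => ((γ p.2.1 p.2.2 : ℝ) - 1) :=
    ((hM.measurable_gamma.comp measurable_snd_predictable).coe_nnreal_real).sub_const 1
  have hr : Measurable[predictableMarked E ℱ] fun p => ((rateBefore lam C D p : ℝ) - 1) :=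
    hM.measurable_rateBefore.coe_nnreal_real.sub_const 1
  have hUV : ∀ᵐ ω ∂Q, ∀ t, ∀ᵐ y ∂((C ω).restrict (univ ×ˢ Iic t)),
      LN y.2 ω * LC y.2 ω = rateBefore lam C D (ω, y) * G (ω, y) := by
    filter_upwards [hM.ae_goodPath, hGU] with ω hω hGω t
    have hκ := measurable_section_of_predictable hM.measurable_rateBefore ω
    filter_upwards [hω.solves_C.ae_eq_leftLim_mul hκ hω.simple_C t,
      hω.simple_C.isConfiguration.ae_ne_zero t] with y h1 h2
    rw [h1, hGω, hω.solves_N.leftLim_eq_self hM.measurable_gamma hω.simple_N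
      ((hω.no_common y.2).resolve_right h2)]
    ring
  have hmain := hd.lintegral_mul_setLIntegral hM.poisson_N hM.compatible_N hM.poisson_C
    hM.compatible_C (hγ.mul hG) (hr.mul hG)
    (by filter_upwards [hM.ae_nonneg] with ω hω t using mul_nonneg (hω t).1 (hω t).2)
    hM.integrable_mul hM.integral_mul_eq_one (hM.measurable_rateBefore.coe_nnreal_real.mul hG)
    hUV hK hKa t
  rw [hM.lintegral_eq hP (measurable_setLIntegral_toKernel hM.compatible_C hM.poisson_C.lt_top
    (H := fun p => (K p : ℝ≥0∞)) hK.coe_nnreal_ennreal t)]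
  refine hmain.trans ?_
  have hKr : Measurable[predictableMarked E ℱ] fun p =>
      ((K p * rateBefore lam C D p : ℝ≥0) : ℝ≥0∞) :=
    (hK.mul hM.measurable_rateBefore).coe_nnreal_ennreal
  have e1 : ∀ ω x, (K (ω, x) : ℝ≥0∞) * ENNReal.ofReal (rateBefore lam C D (ω, x) * G (ω, x)) =
      (K (ω, x) * rateBefore lam C D (ω, x) : ℝ≥0) * ENNReal.ofReal (G (ω, x)) := by
    intro ω x
    rw [ENNReal.ofReal_mul (NNReal.coe_nonneg _), ENNReal.ofReal_coe_nnreal, ENNReal.coe_mul, mul_assoc]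
  refine (lintegral_congr fun ω => lintegral_congr fun x => e1 ω x).trans ?_
  refine (lintegral_lintegral_swap ((measurable_of_predictable hKr).mul
    (ENNReal.measurable_ofReal.comp (measurable_of_predictable hG))).aemeasurable).trans ?_
  refine Eq.trans ?_ (lintegral_lintegral_swap (measurable_of_predictable hKr).aemeasurable).symm
  refine lintegral_congr fun x => ?_
  rw [hM.lintegral_eq hP (t := x.2) (measurable_section_predictable hKr x)]
  refine lintegral_congr_ae ?_
  have hm := fun s : ℝ≥0 => measurableSet_univ_prod_singleton (E := E) s
  filter_upwards [hM.ae_goodPath, hGU,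
    hM.poisson_N.ae_eq_zero (hm x.2) (prod_timeMeasure_singleton ν x.2),
    hM.poisson_C.ae_eq_zero (hm x.2) (prod_timeMeasure_singleton ν x.2)] with ω hω hGω h1 h2
  rw [hGω, hω.solves_N.leftLim_eq_self hM.measurable_gamma hω.simple_N h1,
    hω.solves_C.leftLim_eq_self
      (measurable_section_of_predictable hM.measurable_rateBefore ω) hω.simple_C h2]

/-- Under `P` the random measure `C` has intensity `λ(u, s, D_{s-}, η_{s-}) ν(du) ds`. -/
theorem lintegral_setLIntegral (hM : IsClusterModel Q ℱ ν γ lam N C I D LN LC)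
    (hP : HasLocalDensity ℱ P Q fun t ω => LN t ω * LC t ω)
    (hK : Measurable[predictableMarked E ℱ] K) (hK1 : ∀ p, K p ≤ 1) (t : ℝ≥0) :
    ∫⁻ ω, ∫⁻ x in univ ×ˢ Iic t, K (ω, x) ∂(C ω) ∂P =
      ∫⁻ ω, ∫⁻ x in univ ×ˢ Iic t, (K (ω, x) * rateBefore lam C D (ω, x) : ℝ≥0)
        ∂(ν.prod timeMeasure) ∂P := by
  -- Keeping only the times with at most `j` earlier points bounds the integral against `C` by `j +
  -- 1`; the bound is removed by letting `j` increase.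
  set J : ℕ → Set (Ω × (E × ℝ≥0)) := fun j => {p | historyBefore (C p.1) p.2.2 univ ≤ j} with hJ
  have hJm : ∀ j, MeasurableSet[predictableMarked E ℱ] (J j) := fun j =>
    ((Measure.measurable_coe MeasurableSet.univ).comp
      (measurable_historyBefore_predictable hM.compatible_C)) measurableSet_Iic
  have hJK : ∀ j, Measurable[predictableMarked E ℱ] ((J j).indicator K) := fun j =>
    hK.indicator (hJm j)
  have hJmono : ∀ p, Monotone fun j => (J j).indicator K p := fun p i j hij =>
    indicator_le_indicator_of_subset (fun q hq => le_trans (show historyBefore (C q.1) q.2.2 univ ≤ i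
      from hq) (by exact_mod_cast hij)) (fun _ => zero_le) p
  have hb : ∀ j : ℕ, ∀ᵐ ω ∂Q, ∀ t, ∫⁻ x in univ ×ˢ Iic t, ((J j).indicator K (ω, x) : ℝ≥0) ∂(C ω) ≤
      ((j + 1 : ℕ) : ℝ≥0) := by
    intro j
    filter_upwards [hM.ae_goodPath] with ω hω t
    have hms : MeasurableSet {x : E × ℝ≥0 | (ω, x) ∈ J j} :=
      measurable_prodMk_left (predictableMarked_le _ (hJm j))
    have h1 : ∀ x, (((J j).indicator K (ω, x) : ℝ≥0) : ℝ≥0∞) ≤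
        {x : E × ℝ≥0 | (ω, x) ∈ J j}.indicator (fun _ => 1) x := by
      intro x
      by_cases hx : (ω, x) ∈ J j
      · rw [indicator_of_mem hx, indicator_of_mem (by exact hx)]
        exact_mod_cast hK1 _
      · rw [indicator_of_notMem hx, indicator_of_notMem (by exact hx)]
        simp
    refine (lintegral_mono h1).trans ?_
    rw [lintegral_indicator_const hms, one_mul, Measure.restrict_apply hms]
    refine le_trans (measure_mono fun x hx => ?_) ((hω.simple_C.measure_countBefore_le t j).trans
      (by push_cast; exact le_rfl))
    refine ⟨mem_univ _, hx.2.2, ?_⟩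
    have := hx.1
    simpa [hJ, historyBefore] using this
  have hev : ∀ ω, ∀ᶠ j : ℕ in atTop, ∀ x ∈ (univ ×ˢ Iic t : Set (E × ℝ≥0)),
      (J j).indicator K (ω, x) = K (ω, x) := by
    intro ω
    obtain ⟨n₀, hn₀⟩ := ENNReal.exists_nat_gt (hM.poisson_C.lt_top ω t).ne
    filter_upwards [eventually_ge_atTop n₀] with n hn x hx
    refine indicator_of_mem ?_ _
    have h2 : historyBefore (C ω) x.2 univ ≤ C ω (univ ×ˢ Iic t) := by
      rw [historyBefore, Measure.restrict_apply_univ]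
      exact measure_mono (prod_mono_right (Iio_subset_Iic_self.trans (Iic_subset_Iic.2 hx.2)))
    exact h2.trans (hn₀.le.trans (by exact_mod_cast hn))
  have hr := measurable_of_predictable hM.measurable_rateBefore
  have hl1 : Tendsto (fun j => ∫⁻ ω, ∫⁻ x in univ ×ˢ Iic t, ((J j).indicator K (ω, x) : ℝ≥0) ∂(C ω) ∂P)
      atTop (𝓝 (∫⁻ ω, ∫⁻ x in univ ×ˢ Iic t, K (ω, x) ∂(C ω) ∂P)) := by
    refine lintegral_tendsto_of_tendsto_of_monotone (fun j => ?_) (ae_of_all _ fun ω => ?_)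
      (ae_of_all _ fun ω => ?_)
    · exact ((measurable_setLIntegral_toKernel hM.compatible_C hM.poisson_C.lt_top
        (H := fun p => (((J j).indicator K p : ℝ≥0) : ℝ≥0∞))
        (hJK j).coe_nnreal_ennreal t).mono (ℱ.le t) le_rfl).aemeasurable
    · exact fun i j hij => lintegral_mono fun x => ENNReal.coe_le_coe.2 (hJmono _ hij)
    · refine tendsto_nhds_of_eventually_eq ?_
      filter_upwards [hev ω] with n hn
      refine setLIntegral_congr_fun (measurableSet_univ_prod_Iic t) fun x hx => ?_
      rw [hn x hx]
  have hl2 : Tendsto (fun j => ∫⁻ ω, ∫⁻ x in univ ×ˢ Iic t,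
        ((J j).indicator K (ω, x) * rateBefore lam C D (ω, x) : ℝ≥0) ∂(ν.prod timeMeasure) ∂P)
      atTop (𝓝 (∫⁻ ω, ∫⁻ x in univ ×ˢ Iic t,
        (K (ω, x) * rateBefore lam C D (ω, x) : ℝ≥0) ∂(ν.prod timeMeasure) ∂P)) := by
    refine lintegral_tendsto_of_tendsto_of_monotone (fun j => ?_) (ae_of_all _ fun ω => ?_)
      (ae_of_all _ fun ω => ?_)
    · exact ((measurable_of_predictable (hJK j)).mul
        hr).coe_nnreal_ennreal.lintegral_prod_right'.aemeasurable
    · exact fun i j hij => lintegral_mono fun x => ENNReal.coe_le_coe.2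
        (mul_le_mul_left (hJmono _ hij) _)
    · refine tendsto_nhds_of_eventually_eq ?_
      filter_upwards [hev ω] with n hn
      refine setLIntegral_congr_fun (measurableSet_univ_prod_Iic t) fun x hx => ?_
      rw [hn x hx]
  refine tendsto_nhds_unique hl1 (hl2.congr fun j => ?_)
  exact (hM.lintegral_setLIntegral_of_le hP (hJK j) (hb j) t).symm

end IsClusterModel

/-! ### Compensated integrals are martingales under the new measure -/

lemma indicator_setLIntegral_eq_add {X : Ω → Measure (E × ℝ≥0)} {s t : ℝ≥0} (hst : s ≤ t) (B : Set Ω)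
    (F : Ω × (E × ℝ≥0) → ℝ≥0∞) (ω : Ω) :
    B.indicator (fun ω => ∫⁻ x in univ ×ˢ Iic t, F (ω, x) ∂(X ω)) ω =
      B.indicator (fun ω => ∫⁻ x in univ ×ˢ Iic s, F (ω, x) ∂(X ω)) ω +
      ∫⁻ x in univ ×ˢ Iic t, (B ×ˢ (univ ×ˢ Ioc s t)).indicator F (ω, x) ∂(X ω) := by
  by_cases hω : ω ∈ B
  · have h1 : ∀ x, (B ×ˢ (univ ×ˢ Ioc s t)).indicator F (ω, x) =
        (univ ×ˢ Ioc s t : Set (E × ℝ≥0)).indicator (fun x => F (ω, x)) x := by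
      intro x
      by_cases hx : x ∈ (univ ×ˢ Ioc s t : Set (E × ℝ≥0))
      · rw [indicator_of_mem hx, indicator_of_mem (by exact ⟨hω, hx⟩)]
      · rw [indicator_of_notMem hx, indicator_of_notMem (fun h' => hx h'.2)]
    simp_rw [h1]
    rw [setLIntegral_indicator (measurableSet_univ_prod_Ioc s t), inter_eq_self_of_subset_left
      (prod_mono_right Ioc_subset_Iic_self), indicator_of_mem hω, indicator_of_mem hω,
      restrict_Iic_eq_add_Ioc (X ω) hst, lintegral_add_measure]
  · have h1 : ∀ x, (B ×ˢ (univ ×ˢ Ioc s t)).indicator F (ω, x) = 0 := fun x =>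
      indicator_of_notMem (fun h' => hω h'.1) _
    simp [indicator_of_notMem hω, h1]

namespace IsClusterModel

variable {P Q : Measure Ω} {ℱ : Filtration ℝ≥0 mΩ} {ν : Measure E} {γ : E → ℝ≥0 → ℝ≥0}
  {lam : E → ℝ≥0 → Bool → Measure (E × ℝ≥0) → ℝ≥0} {N C : Ω → Measure (E × ℝ≥0)}
  {I : ℕ+ → Ω → Bool} {D : ℝ≥0 → Ω → Bool} {LN LC : ℝ≥0 → Ω → ℝ} {K : Ω × (E × ℝ≥0) → ℝ≥0}

variable [IsFiniteMeasure ν] [IsProbabilityMeasure Q]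

/-- The compensation formula for `K 1_{B × (s,t]}` says that, on a past event `B`, both integrals
gain the same mean `δ` between `s` and `t`. -/
theorem martingale_compensated (hM : IsClusterModel Q ℱ ν γ lam N C I D LN LC)
    (hP : HasLocalDensity ℱ P Q fun t ω => LN t ω * LC t ω)
    (hK : Measurable[predictableMarked E ℱ] K) (hK1 : ∀ p, K p ≤ 1)
    (hfin : ∀ t, ∫⁻ ω, ∫⁻ x in univ ×ˢ Iic t, (K (ω, x) * rateBefore lam C D (ω, x) : ℝ≥0)
        ∂(ν.prod timeMeasure) ∂P ≠ ∞) :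
    Martingale (fun t ω => (∫⁻ x in univ ×ˢ Iic t, K (ω, x) ∂(C ω)).toReal -
      (∫⁻ x in univ ×ˢ Iic t, (K (ω, x) * rateBefore lam C D (ω, x) : ℝ≥0)
        ∂(ν.prod timeMeasure)).toReal) ℱ P := by
  have := hM.isProbabilityMeasure hP
  set a : ℝ≥0 → Ω → ℝ≥0∞ := fun t ω => ∫⁻ x in univ ×ˢ Iic t, K (ω, x) ∂(C ω) with ha
  set b : ℝ≥0 → Ω → ℝ≥0∞ := fun t ω => ∫⁻ x in univ ×ˢ Iic t,
    (K (ω, x) * rateBefore lam C D (ω, x) : ℝ≥0) ∂(ν.prod timeMeasure) with hb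
  have ham : ∀ t, Measurable[ℱ t] (a t) := fun t =>
    measurable_setLIntegral_toKernel hM.compatible_C hM.poisson_C.lt_top
      (H := fun p => (K p : ℝ≥0∞)) hK.coe_nnreal_ennreal t
  have hbm : ∀ t, Measurable[ℱ t] (b t) := fun t =>
    measurable_setLIntegral_predictable
      (H := fun p => ((K p * rateBefore lam C D p : ℝ≥0) : ℝ≥0∞))
      (hK.mul hM.measurable_rateBefore).coe_nnreal_ennreal t
  have ham' := fun t => (ham t).mono (ℱ.le t) le_rfl
  have hbm' := fun t => (hbm t).mono (ℱ.le t) le_rfl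
  have hafin : ∀ t, ∫⁻ ω, a t ω ∂P ≠ ∞ := fun t => by
    rw [hM.lintegral_setLIntegral hP hK hK1 t]
    exact hfin t
  have hai := fun t => integrable_toReal_of_lintegral_ne_top (ham' t).aemeasurable (hafin t)
  have hbi := fun t => integrable_toReal_of_lintegral_ne_top (hbm' t).aemeasurable (hfin t)
  have hset : ∀ f : Ω → ℝ≥0∞, Measurable f → ∫⁻ ω, f ω ∂P ≠ ∞ → ∀ B : Set Ω,
      ∫ ω in B, (f ω).toReal ∂P = (∫⁻ ω in B, f ω ∂P).toReal := fun f hf hf' B =>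
    integral_toReal hf.aemeasurable (ae_restrict_of_ae (ae_lt_top hf hf'))
  have hsetfin : ∀ f : Ω → ℝ≥0∞, ∫⁻ ω, f ω ∂P ≠ ∞ → ∀ B : Set Ω, ∫⁻ ω in B, f ω ∂P ≠ ∞ :=
    fun f hf B => ((setLIntegral_le_lintegral _ _).trans_lt hf.lt_top).ne
  refine martingale_of_setIntegral_eq (fun t => (ham t).ennreal_toReal.sub (hbm t).ennreal_toReal)
    (fun t => (hai t).sub (hbi t)) fun s t hst B hB => ?_
  have hBm := ℱ.le s B hB
  set R : Set (Ω × (E × ℝ≥0)) := B ×ˢ (univ ×ˢ Ioc s t) with hR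
  have hRm : MeasurableSet[predictableMarked E ℱ] R :=
    measurableSet_predictable_rectangle MeasurableSet.univ hB
  have hcomp := hM.lintegral_setLIntegral hP (hK.indicator hRm)
    (fun p => (indicator_le_self _ _ _).trans (hK1 p)) t
  set δ := ∫⁻ ω, ∫⁻ x in univ ×ˢ Iic t, (R.indicator K (ω, x) : ℝ≥0) ∂(C ω) ∂P with hδ
  have hA : ∫⁻ ω in B, a t ω ∂P = ∫⁻ ω in B, a s ω ∂P + δ := by
    rw [← lintegral_indicator hBm, ← lintegral_indicator hBm, hδ,
      ← lintegral_add_left ((ham' s).indicator hBm)]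
    refine lintegral_congr fun ω => ?_
    refine (indicator_setLIntegral_eq_add (X := C) hst B (fun p => (K p : ℝ≥0∞)) ω).trans ?_
    congr 1
    refine lintegral_congr fun x => ?_
    by_cases h : (ω, x) ∈ R
    · rw [indicator_of_mem h, indicator_of_mem h]
    · rw [indicator_of_notMem h, indicator_of_notMem h, ENNReal.coe_zero]
  have hB' : ∫⁻ ω in B, b t ω ∂P = ∫⁻ ω in B, b s ω ∂P + δ := by
    rw [← lintegral_indicator hBm, ← lintegral_indicator hBm, hcomp,
      ← lintegral_add_left ((hbm' s).indicator hBm)]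
    refine lintegral_congr fun ω => ?_
    refine (indicator_setLIntegral_eq_add (X := fun _ => ν.prod timeMeasure) hst B
      (fun p => ((K p * rateBefore lam C D p : ℝ≥0) : ℝ≥0∞)) ω).trans ?_
    congr 1
    refine lintegral_congr fun x => ?_
    by_cases h : (ω, x) ∈ R
    · rw [indicator_of_mem h, indicator_of_mem h]
    · rw [indicator_of_notMem h, indicator_of_notMem h, zero_mul, ENNReal.coe_zero]
  have hδfin : δ ≠ ∞ := fun h => hsetfin _ (hafin t) B (by rw [hA, h, add_top])
  rw [integral_sub (hai t).integrableOn (hbi t).integrableOn,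
    integral_sub (hai s).integrableOn (hbi s).integrableOn, hset _ (ham' t) (hafin t),
    hset _ (hbm' t) (hfin t), hset _ (ham' s) (hafin s), hset _ (hbm' s) (hfin s), hA, hB',
    ENNReal.toReal_add (hsetfin _ (hafin s) B) hδfin, ENNReal.toReal_add (hsetfin _ (hfin s) B) hδfin]
  ring

end IsClusterModel

/-! ### Localizing times -/

/-- `τ` is the first time `f` reaches `c`. Right-continuity makes the level attained at `τ`, so `τ ≤
t` is decided by `f t` alone. -/
lemma exists_le_iff_of_rightContinuous {f : ℝ≥0 → ℝ≥0∞} (hf : Monotone f) (c : ℝ≥0∞)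
    (hc : ∀ t, (∀ s, t < s → c ≤ f s) → c ≤ f t) :
    ∃ τ : WithTop ℝ≥0, ∀ t : ℝ≥0, τ ≤ t ↔ c ≤ f t := by
  by_cases h : ∃ t, c ≤ f t
  · refine ⟨(sInf {t | c ≤ f t} : ℝ≥0), fun t => ?_⟩
    rw [WithTop.coe_le_coe]
    refine ⟨fun ht => ?_, fun ht => csInf_le (OrderBot.bddBelow _) ht⟩
    refine (hc _ fun s hs => ?_).trans (hf ht)
    obtain ⟨r, hr, hrs⟩ := exists_lt_of_csInf_lt h hs
    exact (show c ≤ f r from hr).trans (hf hrs.le)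
  · push Not at h
    exact ⟨⊤, fun t => iff_of_false (not_le.2 (WithTop.coe_lt_top t)) (not_le.2 (h t))⟩

lemma le_measure_prod_Iic_of_forall_lt {μ : Measure (E × ℝ≥0)} (hμ : ∀ t, μ (univ ×ˢ Iic t) ≠ ∞)
    {c : ℝ≥0∞} {t : ℝ≥0} (h : ∀ s, t < s → c ≤ μ (univ ×ˢ Iic s)) : c ≤ μ (univ ×ˢ Iic t) := by
  have h1 : (univ ×ˢ Iic t : Set (E × ℝ≥0)) = ⋂ n : ℕ, univ ×ˢ Iic (t + 1 / (n + 1)) := by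
    ext x
    simp only [mem_prod, mem_univ, true_and, mem_Iic, mem_iInter]
    refine ⟨fun hx n => hx.trans le_self_add, fun hx => ?_⟩
    refine ge_of_tendsto' (f := fun n : ℕ => t + 1 / ((n : ℝ≥0) + 1)) (b := x.2) (x := atTop) ?_ hx
    simpa using tendsto_const_nhds.add (tendsto_one_div_add_atTop_nhds_zero_nat (𝕜 := ℝ≥0))
  have h2 := tendsto_measure_iInter_atTop (μ := μ)
    (s := fun n : ℕ => (univ ×ˢ Iic (t + 1 / ((n : ℝ≥0) + 1)) : Set (E × ℝ≥0)))
    (fun n => (measurableSet_univ_prod_Iic _).nullMeasurableSet)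
    (fun n n' hnn => prod_mono_right (Iic_subset_Iic.2 (by gcongr)))
    ⟨0, hμ _⟩
  rw [← h1] at h2
  refine ge_of_tendsto' h2 fun n => h _ ?_
  exact lt_add_of_pos_right _ (by positivity)

/-- Up to a stopping time, in the predictable sense. -/
lemma measurableSet_le_stoppingTime {ℱ : Filtration ℝ≥0 mΩ} {τ : Ω → WithTop ℝ≥0}
    (hτ : IsStoppingTime ℱ τ) :
    MeasurableSet[predictableMarked E ℱ] {p : Ω × (E × ℝ≥0) | (p.2.2 : WithTop ℝ≥0) ≤ τ p.1} := by
  -- The complement `τ < s` is, as a process in `s`, the left limit of the adapted process `1_{τ ≤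
  -- s}`.
  have h := measurable_predictable_of_left (E := E)
    (Y := fun t => {ω | τ ω ≤ t}.indicator fun _ => 1)
    (Z := fun t => {ω | τ ω < t}.indicator fun _ => 1)
    (fun t => Measurable.indicator (@measurable_const _ _ _ (ℱ t) _) (hτ t)) (fun ω => by simp)
    (fun ω t ht => by
      refine tendsto_nhds_of_eventually_eq ?_
      by_cases h : τ ω < t
      · obtain ⟨r, hr⟩ := WithTop.ne_top_iff_exists.1 (ne_top_of_lt h)
        rw [← hr, WithTop.coe_lt_coe] at h
        filter_upwards [Ioo_mem_nhdsLT h] with s hs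
        have h1 : ω ∈ {ω | τ ω < t} := show τ ω < t by rw [← hr]; exact_mod_cast h
        have h2 : ω ∈ {ω | τ ω ≤ s} := show τ ω ≤ s by rw [← hr]; exact_mod_cast hs.1.le
        rw [indicator_of_mem h1, indicator_of_mem h2]
      · filter_upwards [self_mem_nhdsWithin] with s hs
        have h1 : ω ∉ {ω | τ ω < t} := h
        have h2 : ω ∉ {ω | τ ω ≤ s} := fun h' =>
          h (lt_of_le_of_lt (show τ ω ≤ s from h') (WithTop.coe_lt_coe.2 hs))
        rw [indicator_of_notMem h1, indicator_of_notMem h2])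
  have h2 := h (measurableSet_singleton (0 : ℝ≥0∞))
  convert h2 using 1
  ext p
  simp only [mem_preimage, mem_singleton_iff, indicator_apply_eq_zero, one_ne_zero, imp_false]
  exact (not_lt (a := τ p.1) (b := (p.2.2 : WithTop ℝ≥0))).symm

section LocalizingTime

variable {m : Measure (E × ℝ≥0)} {H : Ω × (E × ℝ≥0) → ℝ≥0∞} {ℱ : Filtration ℝ≥0 mΩ}

/-- The running integral of `H`, up to the level `c`. -/
def cappedIntegral (m : Measure (E × ℝ≥0)) (H : Ω × (E × ℝ≥0) → ℝ≥0∞) (c : ℝ≥0∞) (t : ℝ≥0)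
    (ω : Ω) : ℝ≥0∞ :=
  ∫⁻ x in univ ×ˢ Iic t, {p : Ω × (E × ℝ≥0) | ∫⁻ y in univ ×ˢ Iic p.2.2, H (p.1, y) ∂m ≤ c}.indicator
    H (ω, x) ∂m

lemma cappedIntegral_mono (c : ℝ≥0∞) (ω : Ω) : Monotone fun t => cappedIntegral m H c t ω :=
  fun _ _ hst => lintegral_mono_set (prod_mono_right (Iic_subset_Iic.2 hst))

lemma cappedIntegral_le_self (c : ℝ≥0∞) (t : ℝ≥0) (ω : Ω) :
    cappedIntegral m H c t ω ≤ ∫⁻ x in univ ×ˢ Iic t, H (ω, x) ∂m :=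
  lintegral_mono fun _ => indicator_le_self _ _ _

end LocalizingTime

section LocalizingTime

variable {ν : Measure E} [SFinite ν] {H : Ω × (E × ℝ≥0) → ℝ≥0∞} {ℱ : Filtration ℝ≥0 mΩ}

lemma measurableSet_running_le (hH : Measurable[predictableMarked E ℱ] H) (c : ℝ≥0∞) :
    MeasurableSet[predictableMarked E ℱ] {p : Ω × (E × ℝ≥0) |
      ∫⁻ y in univ ×ˢ Iic p.2.2, H (p.1, y) ∂(ν.prod timeMeasure) ≤ c} :=
  measurable_running_predictable hH measurableSet_Iic

lemma cappedIntegral_eq (hH : Measurable[predictableMarked E ℱ] H) (c : ℝ≥0∞) (t : ℝ≥0) (ω : Ω) :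
    ∃ T ≤ t, {r | r ≤ t ∧ ∫⁻ x in univ ×ˢ Iic r, H (ω, x) ∂(ν.prod timeMeasure) ≤ c} = Iic T ∧
      cappedIntegral (ν.prod timeMeasure) H c t ω =
        ∫⁻ x in univ ×ˢ Iic T, H (ω, x) ∂(ν.prod timeMeasure) := by
  obtain ⟨T, hT, he⟩ := exists_Iic_eq_lintegral_le (m := ν.prod timeMeasure)
    (V := fun x => H (ω, x)) (prod_timeMeasure_singleton ν 0) (prod_timeMeasure_singleton ν) t c
  refine ⟨T, hT, he, ?_⟩
  have hm := predictableMarked_le _ (measurableSet_running_le (ν := ν) hH c)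
  have hm' : MeasurableSet {x : E × ℝ≥0 |
      ∫⁻ y in univ ×ˢ Iic x.2, H (ω, y) ∂(ν.prod timeMeasure) ≤ c} := measurable_prodMk_left hm
  have h2 : ({x : E × ℝ≥0 | ∫⁻ y in univ ×ˢ Iic x.2, H (ω, y) ∂(ν.prod timeMeasure) ≤ c} ∩
      univ ×ˢ Iic t) = univ ×ˢ Iic T := by
    rw [← he]
    ext x
    simp [and_comm]
  rw [← h2, ← setLIntegral_indicator hm']
  rfl

lemma cappedIntegral_le (hH : Measurable[predictableMarked E ℱ] H) (c : ℝ≥0∞) (t : ℝ≥0) (ω : Ω) :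
    cappedIntegral (ν.prod timeMeasure) H c t ω ≤ c := by
  obtain ⟨T, -, he, h⟩ := cappedIntegral_eq (ν := ν) hH c t ω
  rw [h]
  have h1 : T ∈ Iic T := le_refl T
  rw [← he] at h1
  exact h1.2

/-- The cap is attained once the running integral is above it and finite. -/
lemma le_cappedIntegral (hH : Measurable[predictableMarked E ℱ] H) {c : ℝ≥0∞} {t : ℝ≥0} {ω : Ω}
    (hfin : ∫⁻ x in univ ×ˢ Iic t, H (ω, x) ∂(ν.prod timeMeasure) ≠ ∞)
    (hc : c ≤ ∫⁻ x in univ ×ˢ Iic t, H (ω, x) ∂(ν.prod timeMeasure)) :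
    c ≤ cappedIntegral (ν.prod timeMeasure) H c t ω := by
  obtain ⟨T, hT, he, h⟩ := cappedIntegral_eq (ν := ν) hH c t ω
  rw [h]
  rcases hT.eq_or_lt with rfl | hTt
  · exact hc
  have hm := fun s : ℝ≥0 => measurableSet_univ_prod_Iic (E := E) s
  have h1 : ∀ r, ((ν.prod timeMeasure).restrict (univ ×ˢ Iic t)).withDensity (fun x => H (ω, x))
      (univ ×ˢ Iic r) = ∫⁻ x in univ ×ˢ Iic (min r t), H (ω, x) ∂(ν.prod timeMeasure) := by
    intro r
    rw [withDensity_apply _ (hm r), Measure.restrict_restrict (hm r), prod_inter_prod, univ_inter,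
      Iic_inter_Iic]
  have h2 := le_measure_prod_Iic_of_forall_lt (μ :=
    ((ν.prod timeMeasure).restrict (univ ×ˢ Iic t)).withDensity (fun x => H (ω, x)))
    (c := c) (t := T) (fun r => by
      rw [h1]
      exact ((lintegral_mono_set (prod_mono_right (Iic_subset_Iic.2 (min_le_right _ _)))).trans_lt
        hfin.lt_top).ne)
    (fun s hs => by
      rw [h1]
      by_contra hlt
      have : min s t ∈ Iic T := by
        rw [← he]
        exact ⟨min_le_right _ _, (not_le.1 hlt).le⟩
      exact absurd this (not_le.2 (lt_min hs hTt)))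
  rwa [h1, min_eq_left hT] at h2

/-- The running integral can jump from a finite value to `∞` and then fails to be right-continuous.
The capped one is at most `c` for every `ω`, hence right-continuous, so its first passage to `c` is
a stopping time without completing the filtration or making it right-continuous. -/
lemma exists_stoppingTime (hH : Measurable[predictableMarked E ℱ] H) {c : ℝ≥0∞} (hc : c ≠ ∞) :
    ∃ τ : Ω → WithTop ℝ≥0, IsStoppingTime ℱ τ ∧
      ∀ ω (t : ℝ≥0), τ ω ≤ t ↔ c ≤ cappedIntegral (ν.prod timeMeasure) H c t ω := by
  have h : ∀ ω, ∃ τ : WithTop ℝ≥0, ∀ t : ℝ≥0,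
      τ ≤ t ↔ c ≤ cappedIntegral (ν.prod timeMeasure) H c t ω := by
    intro ω
    refine exists_le_iff_of_rightContinuous (cappedIntegral_mono c ω) c fun t ht => ?_
    have h1 : ∀ r, cappedIntegral (ν.prod timeMeasure) H c r ω =
        (ν.prod timeMeasure).withDensity (fun x => {p : Ω × (E × ℝ≥0) |
          ∫⁻ y in univ ×ˢ Iic p.2.2, H (p.1, y) ∂(ν.prod timeMeasure) ≤ c}.indicator H (ω, x))
          (univ ×ˢ Iic r) := fun r =>
      (withDensity_apply _ (measurableSet_univ_prod_Iic r)).symm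
    simp_rw [h1] at ht ⊢
    refine le_measure_prod_Iic_of_forall_lt (fun r => ?_) ht
    rw [← h1]
    exact ((cappedIntegral_le hH c r ω).trans_lt hc.lt_top).ne
  choose τ hτ using h
  refine ⟨τ, fun t => ?_, hτ⟩
  simp_rw [hτ]
  exact measurable_setLIntegral_predictable (hH.indicator (measurableSet_running_le hH c)) t
    measurableSet_Ici

end LocalizingTime

/-! ### The compensator of `C` under the new measure -/

lemma isCadlag_setIntegral {μ : Measure (E × ℝ≥0)} {f : E × ℝ≥0 → ℝ}
    (hf : ∀ t, IntegrableOn f (univ ×ˢ Iic t) μ) :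
    IsCadlag fun t => ∫ x in univ ×ˢ Iic t, f x ∂μ := by
  simp_rw [univ_prod_Iic] at hf ⊢
  refine fun t => ⟨?_, _, tendsto_setIntegral_left measurable_snd (hf t)⟩
  exact tendsto_setIntegral_right measurable_snd (lt_add_one t) (hf (t + 1))

lemma IsCadlag.sub {f g : ℝ≥0 → ℝ} (hf : IsCadlag f) (hg : IsCadlag g) :
    IsCadlag fun t => f t - g t := fun t => by
  obtain ⟨l, hl⟩ := (hf t).2
  obtain ⟨l', hl'⟩ := (hg t).2
  exact ⟨(hf t).1.sub (hg t).1, l - l', hl.sub hl'⟩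

lemma exists_inter_eq_Iic {S : Type*} (t : ℝ≥0) (τ : WithTop ℝ≥0) :
    ∃ T ≤ t, (min (t : WithTop ℝ≥0) τ).untopA = T ∧ (T : WithTop ℝ≥0) ≤ τ ∧
      ({x : S × ℝ≥0 | (x.2 : WithTop ℝ≥0) ≤ τ} ∩ univ ×ˢ Iic t) = univ ×ˢ Iic T := by
  obtain ⟨T, h⟩ := WithTop.ne_top_iff_exists.1
    (ne_top_of_le_ne_top WithTop.coe_ne_top (min_le_left (t : WithTop ℝ≥0) τ))
  refine ⟨T, WithTop.coe_le_coe.1 (h.trans_le (min_le_left _ _)), ?_,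
    h.trans_le (min_le_right _ _), ?_⟩
  · rw [← h]
    rfl
  ext x
  have h1 : x.2 ≤ T ↔ x.2 ≤ t ∧ (x.2 : WithTop ℝ≥0) ≤ τ :=
    WithTop.coe_le_coe.symm.trans (by rw [h, le_min_iff, WithTop.coe_le_coe])
  simp only [mem_inter_iff, mem_prod, mem_univ, true_and, mem_Iic, Set.mem_ofPred_eq]
  rw [h1, and_comm]

lemma tendsto_withTop_of_forall {τ : ℕ → WithTop ℝ≥0} (h : ∀ t : ℝ≥0, ∀ᶠ n in atTop, ¬ τ n ≤ t) :
    Tendsto τ atTop (𝓝 ⊤) := by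
  refine tendsto_order.2 ⟨fun a ha => ?_, fun a ha => absurd ha not_top_lt⟩
  obtain ⟨t, rfl⟩ := WithTop.ne_top_iff_exists.1 ha.ne
  filter_upwards [h t] with n hn using not_le.1 hn

namespace IsClusterModel

variable {P Q : Measure Ω} {ℱ : Filtration ℝ≥0 mΩ} {ν : Measure E} {γ : E → ℝ≥0 → ℝ≥0}
  {lam : E → ℝ≥0 → Bool → Measure (E × ℝ≥0) → ℝ≥0} {N C : Ω → Measure (E × ℝ≥0)}
  {I : ℕ+ → Ω → Bool} {D : ℝ≥0 → Ω → Bool} {LN LC : ℝ≥0 → Ω → ℝ} {K : Ω × (E × ℝ≥0) → ℝ≥0}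

/-- A càdlàg path of `D` jumps at countably many times, and `C` charges countably many; `ds` gives
these times no mass. -/
lemma ae_rateBefore_eq [SFinite ν] (hM : IsClusterModel Q ℱ ν γ lam N C I D LN LC) (ω : Ω) :
    ∀ᵐ x ∂(ν.prod timeMeasure),
      rateBefore lam C D (ω, x) = lam x.1 x.2 (D x.2 ω) (history (C ω) x.2) := by
  have := (hM.poisson_C.isConfiguration ω).sigmaFinite
  filter_upwards [prod_timeMeasure_countable ν (hM.cadlag ω).countable_leftLim_ne,
    prod_timeMeasure_countable ν (countable_times (C ω))] with x h1 h2
  have h3 : Function.leftLim (fun r => D r ω) x.2 = D x.2 ω := by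
    by_contra h
    exact h1 h
  have h4 : C ω (univ ×ˢ {x.2}) = 0 := by
    by_contra h
    exact h2 h
  rw [rateBefore, h3, history, restrict_Iic_eq_add_singleton, Measure.restrict_eq_zero.2 h4, add_zero]
  rfl

variable [IsFiniteMeasure ν] [IsProbabilityMeasure Q]

theorem isLocalMartingale_compensated (hM : IsClusterModel Q ℱ ν γ lam N C I D LN LC)
    (hP : HasLocalDensity ℱ P Q fun t ω => LN t ω * LC t ω)
    (hK : Measurable[predictableMarked E ℱ] K) (hK1 : ∀ p, K p ≤ 1)
    (hfin : ∀ᵐ ω ∂P, ∀ t, ∫⁻ x in univ ×ˢ Iic t, (K (ω, x) * rateBefore lam C D (ω, x) : ℝ≥0)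
        ∂(ν.prod timeMeasure) < ∞) :
    IsLocalMartingale (fun t ω => (∫⁻ x in univ ×ˢ Iic t, K (ω, x) ∂(C ω)).toReal -
      (∫⁻ x in univ ×ˢ Iic t, (K (ω, x) * rateBefore lam C D (ω, x) : ℝ≥0)
        ∂(ν.prod timeMeasure)).toReal) ℱ P := by
  have := hM.isProbabilityMeasure hP
  set H : Ω × (E × ℝ≥0) → ℝ≥0∞ := fun p => ((K p * rateBefore lam C D p : ℝ≥0) : ℝ≥0∞) with hHdef
  have hKr := hK.mul hM.measurable_rateBefore
  have hH : Measurable[predictableMarked E ℱ] H := hKr.coe_nnreal_ennreal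
  -- The levels start at `1` rather than `0`, so that every localizing time is positive and the
  -- indicator of `⊥ < τ` in the localization is trivial.
  have hc : ∀ n : ℕ, ((n + 1 : ℕ) : ℝ≥0∞) ≠ ∞ := fun n => ENNReal.natCast_ne_top _
  choose τ hτs hτ using fun n => exists_stoppingTime (ν := ν) hH (hc n)
  have hτ0 : ∀ n ω, ⊥ < τ n ω := by
    intro n ω
    refine lt_of_not_ge fun h => ?_
    have h1 := ((hτ n ω 0).1 h).trans (cappedIntegral_le_self _ _ _)
    have h2 : (Iic (0 : ℝ≥0)) = {0} := by ext; simp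
    rw [h2, setLIntegral_measure_zero _ _ (prod_timeMeasure_singleton ν 0)] at h1
    simp at h1
  refine ⟨?_, τ, ⟨⟨hτs, ?_⟩, ?_⟩, fun n => ?_⟩
  · filter_upwards [hfin] with ω hω
    have h1 := measurable_section_of_predictable hK ω
    have h2 := measurable_section_of_predictable hKr ω
    have h3 := isCadlag_setIntegral (fun t =>
      (hM.poisson_C.isConfiguration ω).integrableOn h1.coe_nnreal_real t)
    have h4 := isCadlag_setIntegral (μ := ν.prod timeMeasure) (fun t =>
      (⟨h2.coe_nnreal_real.aestronglyMeasurable, by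
        rw [hasFiniteIntegral_iff_enorm]
        simpa [enorm_eq_nnnorm] using hω t⟩ :
        IntegrableOn (fun x => ((K * rateBefore lam C D) (ω, x) : ℝ)) (univ ×ˢ Iic t) _))
    simp_rw [integral_coe_nnreal h1] at h3
    simp_rw [integral_coe_nnreal h2] at h4
    exact h3.sub h4
  · filter_upwards [hfin] with ω hω
    refine tendsto_withTop_of_forall fun t => ?_
    obtain ⟨n₀, hn₀⟩ := ENNReal.exists_nat_gt (hω t).ne
    filter_upwards [eventually_ge_atTop n₀] with n hn h
    have h1 := ((hτ n ω t).1 h).trans (cappedIntegral_le_self _ _ _)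
    refine absurd h1 (not_le.2 (hn₀.trans_le ?_))
    exact_mod_cast hn.trans (Nat.le_succ n)
  -- Monotonicity in `n` holds only where the running integral is finite: only then is reaching the
  -- lower level visible in its capped integral.
  · filter_upwards [hfin] with ω hω n n' hnn
    change τ n ω ≤ τ n' ω
    rcases eq_or_ne (τ n' ω) ⊤ with htop | htop
    · rw [htop]
      exact le_top
    · obtain ⟨t, ht⟩ := WithTop.ne_top_iff_exists.1 htop
      have h1 := ((hτ n' ω t).1 ht.ge).trans (cappedIntegral_le_self _ _ _)
      rw [← ht, hτ n ω t]
      refine le_cappedIntegral hH (hω t).ne (le_trans ?_ h1)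
      exact_mod_cast Nat.succ_le_succ hnn
  -- Stopping at `τ n` is the same as multiplying `K` by the predictable indicator of `s ≤ τ n`,
  -- which reduces the claim to the martingale case.
  · set S : Set (Ω × (E × ℝ≥0)) := {p | (p.2.2 : WithTop ℝ≥0) ≤ τ n p.1} with hS
    have hSm : MeasurableSet[predictableMarked E ℱ] S := measurableSet_le_stoppingTime (hτs n)
    have key : ∀ (ω : Ω) (t : ℝ≥0), ∃ T : ℝ≥0, T ≤ t ∧ (min (t : WithTop ℝ≥0) (τ n ω)).untopA = T ∧
        (T : WithTop ℝ≥0) ≤ τ n ω ∧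
        (∫⁻ x in univ ×ˢ Iic t, (S.indicator K (ω, x) : ℝ≥0) ∂(C ω) =
          ∫⁻ x in univ ×ˢ Iic T, K (ω, x) ∂(C ω)) ∧
        ∫⁻ x in univ ×ˢ Iic t, (S.indicator K (ω, x) * rateBefore lam C D (ω, x) : ℝ≥0)
          ∂(ν.prod timeMeasure) = ∫⁻ x in univ ×ˢ Iic T, H (ω, x) ∂(ν.prod timeMeasure) := by
      intro ω t
      obtain ⟨T, hT, h1, h2, h3⟩ := exists_inter_eq_Iic (S := E) t (τ n ω)
      have hSω : MeasurableSet {x : E × ℝ≥0 | (x.2 : WithTop ℝ≥0) ≤ τ n ω} :=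
        measurable_prodMk_left (predictableMarked_le _ hSm)
      refine ⟨T, hT, h1, h2, ?_, ?_⟩
      · rw [← h3, ← setLIntegral_indicator hSω]
        refine lintegral_congr fun x => ?_
        by_cases hx : (ω, x) ∈ S
        · rw [indicator_of_mem hx, indicator_of_mem (by exact hx)]
        · rw [indicator_of_notMem hx, indicator_of_notMem (by exact hx), ENNReal.coe_zero]
      · rw [← h3, ← setLIntegral_indicator hSω]
        refine lintegral_congr fun x => ?_
        by_cases hx : (ω, x) ∈ S
        · rw [indicator_of_mem hx, indicator_of_mem (by exact hx)]
        · rw [indicator_of_notMem hx, indicator_of_notMem (by exact hx), zero_mul, ENNReal.coe_zero]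
    have hmart := hM.martingale_compensated hP (hK.indicator hSm)
      (fun p => (indicator_le_self _ _ _).trans (hK1 p)) (fun t => by
        -- If the integral up to `T` exceeded `n + 1`, the level would be reached at some `s < T`,
        -- so that `τ n ω ≤ s < T ≤ τ n ω`.
        have hb : ∀ᵐ ω ∂P, ∫⁻ x in univ ×ˢ Iic t,
            (S.indicator K (ω, x) * rateBefore lam C D (ω, x) : ℝ≥0) ∂(ν.prod timeMeasure) ≤
              ((n + 1 : ℕ) : ℝ≥0∞) := by
          filter_upwards [hfin] with ω hω
          obtain ⟨T, -, -, hTτ, -, h⟩ := key ω t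
          rw [h]
          by_contra hlt
          obtain ⟨T', hT', he⟩ := exists_Iic_eq_lintegral_le (m := ν.prod timeMeasure)
            (V := fun x => H (ω, x)) (prod_timeMeasure_singleton ν 0)
            (prod_timeMeasure_singleton ν) T ((n + 1 : ℕ) : ℝ≥0∞)
          have hTT : T' < T := by
            refine lt_of_le_of_ne hT' fun h' => hlt ?_
            have h1 : T ∈ Iic T' := h'.ge
            rw [← he] at h1
            exact h1.2
          obtain ⟨s, hs1, hs2⟩ := exists_between hTT
          have h2 : ((n + 1 : ℕ) : ℝ≥0∞) ≤ ∫⁻ x in univ ×ˢ Iic s, H (ω, x) ∂(ν.prod timeMeasure) := by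
            by_contra h'
            have h1 : s ∈ Iic T' := by
              rw [← he]
              exact ⟨hs2.le, (not_le.1 h').le⟩
            exact absurd h1 (not_le.2 hs1)
          have h3 := (hτ n ω s).2 (le_cappedIntegral hH (hω s).ne h2)
          exact absurd (WithTop.coe_le_coe.1 (hTτ.trans h3)) (not_le.2 hs2)
        refine ((lintegral_mono_ae hb).trans_lt ?_).ne
        rw [lintegral_const, measure_univ, mul_one]
        exact ENNReal.natCast_lt_top _)
    convert hmart using 1
    funext t ω
    obtain ⟨T, -, h1, -, h2, h3⟩ := key ω t
    rw [h2, h3, stoppedProcess, h1, indicator_of_mem (by exact hτ0 n ω)]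

theorem isLocalMartingale_count (hM : IsClusterModel Q ℱ ν γ lam N C I D LN LC)
    (hP : HasLocalDensity ℱ P Q fun t ω => LN t ω * LC t ω) {A : Set E} (hA : MeasurableSet A)
    (hfin : ∀ᵐ ω ∂P, ∀ t : ℝ≥0, ∫⁻ x in A ×ˢ Iic t,
      (lam x.1 x.2 (D x.2 ω) (history (C ω) x.2) : ℝ≥0∞) ∂(ν.prod timeMeasure) < ∞) :
    IsLocalMartingale (fun t ω => (C ω (A ×ˢ Iic t)).toReal - ∫ x in A ×ˢ Iic t,
      (lam x.1 x.2 (D x.2 ω) (history (C ω) x.2) : ℝ) ∂(ν.prod timeMeasure)) ℱ P := by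
  have hAp : MeasurableSet[predictableMarked E ℱ] {p : Ω × (E × ℝ≥0) | p.2.1 ∈ A} :=
    measurable_mark_predictable hA
  have hAm : MeasurableSet {x : E × ℝ≥0 | x.1 ∈ A} := measurable_fst hA
  have hset : ∀ t : ℝ≥0, (A ×ˢ Iic t : Set (E × ℝ≥0)) = {x | x.1 ∈ A} ∩ univ ×ˢ Iic t := by
    intro t
    ext x
    simp
  set K : Ω × (E × ℝ≥0) → ℝ≥0 := {p | p.2.1 ∈ A}.indicator fun _ => 1 with hKdef
  have hK : Measurable[predictableMarked E ℱ] K :=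
    Measurable.indicator (@measurable_const _ _ _ (_) _) hAp
  have hK1 : ∀ p, K p ≤ 1 := fun p => indicator_le_self' (fun _ _ => zero_le) p
  have hKC : ∀ ω t, ∫⁻ x in univ ×ˢ Iic t, K (ω, x) ∂(C ω) = C ω (A ×ˢ Iic t) := by
    intro ω t
    rw [hset, ← setLIntegral_one, ← setLIntegral_indicator hAm]
    refine lintegral_congr fun x => ?_
    by_cases hx : x.1 ∈ A
    · rw [hKdef, indicator_of_mem (by exact hx), indicator_of_mem (by exact hx), ENNReal.coe_one]
    · rw [hKdef, indicator_of_notMem (by exact hx), indicator_of_notMem (by exact hx),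
        ENNReal.coe_zero]
  have hKm : ∀ ω t, ∫⁻ x in univ ×ˢ Iic t, (K (ω, x) * rateBefore lam C D (ω, x) : ℝ≥0)
      ∂(ν.prod timeMeasure) = ∫⁻ x in A ×ˢ Iic t,
        (lam x.1 x.2 (D x.2 ω) (history (C ω) x.2) : ℝ≥0∞) ∂(ν.prod timeMeasure) := by
    intro ω t
    rw [hset, ← setLIntegral_indicator hAm]
    refine lintegral_congr_ae (ae_restrict_of_ae ?_)
    filter_upwards [hM.ae_rateBefore_eq ω] with x h
    by_cases hx : x.1 ∈ A
    · rw [hKdef, indicator_of_mem (by exact hx), indicator_of_mem (by exact hx), one_mul, h]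
    · rw [hKdef, indicator_of_notMem (by exact hx), indicator_of_notMem (by exact hx), zero_mul,
        ENNReal.coe_zero]
  have hr : ∀ ω t, ∫ x in A ×ˢ Iic t, (lam x.1 x.2 (D x.2 ω) (history (C ω) x.2) : ℝ)
      ∂(ν.prod timeMeasure) = (∫⁻ x in A ×ˢ Iic t,
        (lam x.1 x.2 (D x.2 ω) (history (C ω) x.2) : ℝ≥0∞) ∂(ν.prod timeMeasure)).toReal := by
    intro ω t
    have h := ae_restrict_of_ae (s := A ×ˢ Iic t) (hM.ae_rateBefore_eq ω)
    have h1 := integral_coe_nnreal (c := (ν.prod timeMeasure).restrict (A ×ˢ Iic t))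
      (measurable_section_of_predictable hM.measurable_rateBefore ω)
    rw [integral_congr_ae (h.mono fun x hx => congrArg NNReal.toReal hx),
      lintegral_congr_ae (h.mono fun x hx => congrArg ENNReal.ofNNReal hx)] at h1
    exact h1
  have h := hM.isLocalMartingale_compensated hP hK hK1 (by
    filter_upwards [hfin] with ω hω t
    rw [hKm]
    exact hω t)
  simp_rw [hKC, hKm, ← hr] at h
  exact h

end IsClusterModel

end ClusterModel

end

/-! ### The main theorem -/

theorem theoremA1 {E Ω : Type*} [MeasurableSpace E] {mΩ : MeasurableSpace Ω}
    (Q : Measure Ω) [IsProbabilityMeasure Q] (ℱ : Filtration ℝ≥0 mΩ)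
    (ν : Measure E) [IsFiniteMeasure ν]
    (γ : E → ℝ≥0 → ℝ≥0) (hγ : Measurable fun x : E × ℝ≥0 => γ x.1 x.2)
    (lam : E → ℝ≥0 → Bool → Measure (E × ℝ≥0) → ℝ≥0)
    (hlam : Measurable fun x : E × ℝ≥0 × Bool × Measure (E × ℝ≥0) =>
      lam x.1 x.2.1 x.2.2.1 x.2.2.2)
    -- `N` and `C` are independent Poisson random measures with mean measure `ν(du) ds`
    (N C : Ω → Measure (E × ℝ≥0))
    (hN : ClusterModel.IsPoissonRandomMeasure N (ν.prod ClusterModel.timeMeasure) Q)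
    (hC : ClusterModel.IsPoissonRandomMeasure C (ν.prod ClusterModel.timeMeasure) Q)
    (hNC : IndepFun N C Q)
    -- the coins, and the cluster indicator `D`
    (p : ℝ) (I : ℕ+ → Ω → Bool) (hI : ∀ k, Measurable (I k))
    (hIp : ∀ k, Q.real {ω | I k ω = true} = p) (hIindep : iIndepFun I Q)
    (D : ℝ≥0 → Ω → Bool) (hDcadlag : ∀ ω, ClusterModel.IsCadlag (fun t => D t ω))
    (hDI : IndepFun (fun ω => (D 0 ω, fun k => I k ω)) (fun ω => (N ω, C ω)) Q)
    (hD : ∀ f : Bool × Measure (E × ℝ≥0) → ℝ, Measurable f →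
      ∀ᵐ ω ∂Q, ClusterModel.SolvesIndicatorEquation (C ω) (fun k => I k ω) (fun t => D t ω) f)
    -- compatibility with the filtration
    (hNℱ : ClusterModel.IsCompatible ℱ N Q) (hCℱ : ClusterModel.IsCompatible ℱ C Q)
    (hDℱ : ∀ t, Measurable[ℱ t] (D t))
    -- the exponential martingales
    (LN LC : ℝ≥0 → Ω → ℝ)
    (hLN : ClusterModel.SolvesExponentialEquation Q ν N (fun _ u s => γ u s) LN)
    (hLC : ClusterModel.SolvesExponentialEquation Q ν C
      (fun ω u s => lam u s (Function.leftLim (fun r => D r ω) s)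
        (ClusterModel.historyBefore (C ω) s)) LC)
    (hLNmart : Martingale LN ℱ Q) (hLCmart : Martingale LC ℱ Q) :
    Martingale (fun t ω => LN t ω * LC t ω) ℱ Q ∧
    (∀ t, ∀ᵐ ω ∂Q, 0 ≤ LN t ω * LC t ω) ∧
    ∀ P : Measure Ω, ClusterModel.HasLocalDensity ℱ P Q (fun t ω => LN t ω * LC t ω) →
      IsProbabilityMeasure P ∧
      (∀ A : Set E, MeasurableSet A →
        (∀ᵐ ω ∂P, ∀ t : ℝ≥0, ∫⁻ x in A ×ˢ Iic t,
          (lam x.1 x.2 (D x.2 ω) (ClusterModel.history (C ω) x.2) : ℝ≥0∞)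
            ∂(ν.prod ClusterModel.timeMeasure) < ∞) →
        ClusterModel.IsLocalMartingale
          (fun t ω => (C ω (A ×ˢ Iic t)).toReal - ∫ x in A ×ˢ Iic t,
            (lam x.1 x.2 (D x.2 ω) (ClusterModel.history (C ω) x.2) : ℝ) ∂(ν.prod ClusterModel.timeMeasure))
          ℱ P) ∧
      IndepFun N C P ∧
      ClusterModel.IsPoissonRandomMeasure N
        ((ν.prod ClusterModel.timeMeasure).withDensity fun x => (γ x.1 x.2 : ℝ≥0∞)) P := by
  have hM : ClusterModel.IsClusterModel Q ℱ ν γ lam N C I D LN LC :=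
    ⟨hγ, hlam, hN, hC, hNC, hI, hDcadlag, hDI, hD, hNℱ, hCℱ, hDℱ, hLN, hLC, hLNmart, hLCmart⟩
  refine ⟨hM.martingale_mul, fun t => ?_, fun P hP => ⟨hM.isProbabilityMeasure hP,
    fun A hA hfin => hM.isLocalMartingale_count hP hA hfin, hM.indepFun hP,
    hM.isPoissonRandomMeasure hP⟩⟩
  filter_upwards [hM.ae_nonneg] with ω hω using mul_nonneg (hω t).1 (hω t).2
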